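/- **Notation.** We work on $\mathbb R^3$; $\|\cdot\|_r$ is the norm of $L^r(\mathbb R^3)$, $\omega=(-\Delta)^{1/2}$, $\delta(r)=\tfrac32-\tfrac3r$ (so $\delta(\infty)=\tfrac32$), and $F$ is the unitary Fourier transform, $Fu(\xi)=(2\pi)^{-3/2}\int e^{-ix\cdot\xi}u(x)\,dx$. Let $H^{k,s}=\{u:\ (1+x^2)^{s/2}(1-\Delta)^{k/2}u\in L^2\}$, $H^k=H^{k,0}$, and for an integer $k\ge 0$ let $W^k_1=\{u:\ \partial^\alpha u\in L^1 \text{ for all } |\alpha|\le k\}$. **Approximate solution.** Let $u_+\in L^2$ and $w_+=Fu_+$. For $t>0$ put $$u_a(t,x)=e^{ix^2/2t}\,(it)^{-3/2}\,\big(e^{-i\varphi(t)}w_+\big)(x/t),\qquad \varphi(t)=(\ln t)\,\widetilde A_1,$$ $$\widetilde A_1=-\int_1^\infty d\nu\,\nu^{-3}\,\omega^{-1}\sin(\omega(\nu-1))\,\big(|w_+|^2(\cdot/\nu)\big).$$ Let $A_+\in L^2$, let $\dot A_+$ be a tempered distribution with $\omega^{-1}\dot A_+\in L^2$, and put $A_a=A_0+A_1$,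 where $$A_0(t)=\cos(\omega t)A_++\omega^{-1}\sin(\omega t)\dot A_+,\qquad A_1(t)=\int_t^\infty dt'\,\omega^{-1}\sin(\omega(t-t'))\,|u_a(t')|^2 .$$ Let $R_1=i\partial_tu_a+\tfrac12\Delta u_a-A_au_a$. Derivatives are taken in the sense of distributions on $\mathbb R^3$, for each time. For an integer $k\ge0$ consider the condition $$(\ast)_k\qquad A_+,\ \omega^{-1}\dot A_+\in H^k,\qquad \nabla^2A_+,\ \nabla\dot A_+\in W^k_1 .$$ **Proposition 3.1.** The constants $a$, $r_1$, $c$ below may depend on $u_+,A_+,\dot A_+$, but not on $t$ or $r$. (1) Let $u_+\in H^{0,2}$ and let $(A_+,\dot A_+)$ satisfy $(\ast)_0$. Then $R_1(t)$ is a function for every $t>0$, $\|Fu_+\|_r<\infty$ for $2\le r\le\infty$, and for some constants $a$, $r_1$ and all $t\ge1$, $$\|u_a(t)\|_r\le t^{-\delta(r)}\|Fu_+\|_r\quad(2\le r\le\infty),\qquad \|A_a(t)\|_\infty\le a\,t^{-1},\qquad \|R_1(t)\|_2\le r_1\,t^{-3/2}.$$ (2) Let $u_+\in H^{0,3}\cap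 H^{1,2}$ and let $(A_+,\dot A_+)$ satisfy $(\ast)_1$. Then the conclusions of (1) hold, and in addition, for some constants $c$, $a$, $r_1$ and all $t\ge1$, $$\|\nabla u_a(t)\|_r\le c\,t^{-\delta(r)}\quad(2\le r\le\infty),\qquad \|\nabla A_a(t)\|_\infty\le a\,t^{-1},\qquad \|\nabla R_1(t)\|_2\le r_1\,t^{-3/2}.$$ (3) Let $u_+\in H^{1,3}\cap H^{2,2}$ and let $(A_+,\dot A_+)$ satisfy $(\ast)_1$. Then the conclusions of (1) and (2) hold, and in addition, for some constants $c$, $a$, $r_1$ and all $t\ge1$, $$\|\partial_tu_a(t)\|_r\le c\,t^{-\delta(r)}\quad(2\le r\le\infty),\qquad \|\partial_tA_a(t)\|_\infty\le a\,t^{-1},\qquad \|\partial_tR_1(t)\|_2\le r_1\,t^{-3/2}.$$ -/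

import Mathlib

open MeasureTheory FourierTransform TemperedDistribution
open scoped ENNReal SchwartzMap LineDeriv Laplacian ContDiff Topology

noncomputable section

/-- Physical space `ℝ³` with its Euclidean norm. -/
abbrev E3 : Type := EuclideanSpace ℝ (Fin 3)

/-- `L²(ℝ³; ℂ)`. -/
abbrev L2C : Type := Lp ℂ 2 (volume : Measure E3)

/-- The `i`-th unit vector of `ℝ³`. -/
def basisVec (i : Fin 3) : E3 := EuclideanSpace.single i 1

/-! ### Function spaces

Mathlib's Fourier transform is `𝓕 f ξ = ∫ exp (-2π i x·ξ) f x dx`, so the operator `-Δ` has the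
symbol `‖2πξ‖²` and `ω = (-Δ)^{1/2}` has the symbol `2π‖ξ‖`. -/

/-- `u ∈ H^{k,s}`, that is `(1 + x²)^{s/2} (1 - Δ)^{k/2} u ∈ L²`. -/
def MemWeightedSobolev (k s : ℝ) (u : 𝓢'(E3, ℂ)) : Prop :=
  ∃ g : L2C,
    smulLeftCLM ℂ (fun x : E3 => (((1 + ‖x‖ ^ 2) ^ (s / 2) : ℝ) : ℂ))
      (fourierMultiplierCLM ℂ
        (fun ξ : E3 => (((1 + ‖(2 * Real.pi) • ξ‖ ^ 2) ^ (k / 2) : ℝ) : ℂ)) u) = (g : 𝓢'(E3, ℂ))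

/-- `u ∈ W_r^k`: all the distributional derivatives of order at most `k` are in `L^r`. -/
def MemSobolevW (k : ℕ) (r : ℝ≥0∞) [Fact (1 ≤ r)] (u : 𝓢'(E3, ℂ)) : Prop :=
  ∀ n : ℕ, n ≤ k → ∀ i : Fin n → Fin 3,
    ∃ g : Lp ℂ r (volume : Measure E3), ∂^{fun j => basisVec (i j)} u = (g : 𝓢'(E3, ℂ))

/-- `b ∈ L²` and `ω b = B`, that is, `b = ω⁻¹ B ∈ L²`. -/
def IsOmegaInv (B : 𝓢'(E3, ℂ)) (b : L2C) : Prop :=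
  ∀ ψ : 𝓢(E3, ℂ),
    (𝓕 B) ψ = ∫ ξ : E3, ψ ξ * (((2 * Real.pi * ‖ξ‖ : ℝ) : ℂ) * (𝓕 b : L2C) ξ)

/-- The regularity conditions `A₊, ω⁻¹ Ȧ₊ ∈ H^k` and `∇² A₊, ∇ Ȧ₊ ∈ W_1^k` on the data of the wave
equation; `b` stands for `ω⁻¹ Ȧ₊`. -/
def WaveDataCondition (k : ℕ) (Ap : L2C) (Adot : 𝓢'(E3, ℂ)) (b : L2C) : Prop :=
  MemWeightedSobolev k 0 (Ap : 𝓢'(E3, ℂ)) ∧ MemWeightedSobolev k 0 (b : 𝓢'(E3, ℂ)) ∧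
  (∀ i j : Fin 3, MemSobolevW k 1 (∂_{basisVec i} (∂_{basisVec j} (Ap : 𝓢'(E3, ℂ))))) ∧
  (∀ i : Fin 3, MemSobolevW k 1 (∂_{basisVec i} Adot))

/-! ### The asymptotic functions -/

/-- The unitary Fourier transform `F u (ξ) = (2π)^{-3/2} ∫ exp (-i x·ξ) u(x) dx` of `u ∈ L²`. -/
def unitaryFourier (u : L2C) : E3 → ℂ := fun ξ =>
  (((2 * Real.pi) ^ (-(3 / 2) : ℝ) : ℝ) : ℂ) * (𝓕 u : L2C) ((2 * Real.pi)⁻¹ • ξ)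

/-- The dilation `(D₀(t) f)(x) = f(x / t)`. -/
def dilation {V : Type*} (t : ℝ) (f : E3 → V) : E3 → V := fun x => f (t⁻¹ • x)

/-- `ω⁻¹ sin (ω s) g` for an integrable real function `g` whose Fourier transform is integrable.
The symbol `sin (s |ξ|) / |ξ|` is written as `s * sinc (s |ξ|)`. The operator maps real functions to
real functions: taking the real part only makes this visible in the type. -/
def sinOverOmega (s : ℝ) (g : E3 → ℝ) : E3 → ℝ := fun x =>
  (𝓕⁻ (fun ξ : E3 =>
    ((s * Real.sinc (s * (2 * Real.pi * ‖ξ‖)) : ℝ) : ℂ) * 𝓕 (fun y : E3 => (g y : ℂ)) ξ) x).re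

/-- `Ã₁ = - ∫_1^∞ dν ν⁻³ ω⁻¹ sin (ω (ν - 1)) D₀(ν) |w|²`. -/
def tildeA1 (w : E3 → ℂ) : E3 → ℝ := fun x =>
  -∫ ν in Set.Ioi (1 : ℝ), ν ^ (-3 : ℝ) *
    sinOverOmega (ν - 1) (dilation ν (fun y => ‖w y‖ ^ 2)) x

/-- The phase `φ(t) = (ln t) Ã₁`. -/
def phase (w : E3 → ℂ) (t : ℝ) : E3 → ℝ := fun x => Real.log t * tildeA1 w x

/-- `u_a(t) = M(t) D(t) exp (-i φ(t)) w`, where `M(t) = exp (i x² / 2t)` and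
`D(t) = (it)^{-3/2} D₀(t)`. -/
def uApprox (w : E3 → ℂ) (t : ℝ) : E3 → ℂ := fun x =>
  Complex.exp (Complex.I * ((‖x‖ ^ 2 / (2 * t) : ℝ) : ℂ)) *
    ((Complex.I * (t : ℂ)) ^ (-(3 / 2) : ℂ) *
      dilation t (fun y => Complex.exp (-(Complex.I * (phase w t y : ℂ))) * w y) x)

/-- `A₁(t) = ∫_t^∞ dt' ω⁻¹ sin (ω (t - t')) |u_a(t')|²`. -/
def A1 (w : E3 → ℂ) (t : ℝ) : E3 → ℝ := fun x =>
  ∫ t' in Set.Ioi t, sinOverOmega (t - t') (fun y => ‖uApprox w t' y‖ ^ 2) x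

theorem memLp_top_cos (t : ℝ) :
    MemLp (fun ξ : E3 => ((Real.cos (t * (2 * Real.pi * ‖ξ‖)) : ℝ) : ℂ)) ∞ volume := by
  refine memLp_top_of_bound (by fun_prop) 1 (Filter.Eventually.of_forall fun ξ => ?_)
  rw [Complex.norm_real]
  exact Real.abs_cos_le_one _

theorem memLp_top_sin (t : ℝ) :
    MemLp (fun ξ : E3 => ((Real.sin (t * (2 * Real.pi * ‖ξ‖)) : ℝ) : ℂ)) ∞ volume := by
  refine memLp_top_of_bound (by fun_prop) 1 (Filter.Eventually.of_forall fun ξ => ?_)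
  rw [Complex.norm_real]
  exact Real.abs_sin_le_one _

/-- `A₀(t) = cos (ωt) A₊ + sin (ωt) b`, the solution of the free wave equation with initial data
`(A₊, Ȧ₊)`, where `b = ω⁻¹ Ȧ₊`; hence `sin (ωt) b = ω⁻¹ sin (ωt) Ȧ₊`. -/
def A0 (Ap b : L2C) (t : ℝ) : L2C :=
  𝓕⁻ ((memLp_top_cos t).toLp _ • (𝓕 Ap : L2C) + (memLp_top_sin t).toLp _ • (𝓕 b : L2C) : L2C)

/-- `A_a(t) = A₀(t) + A₁(t)`. -/
def AApprox (w : E3 → ℂ) (Ap b : L2C) (t : ℝ) : E3 → ℂ := fun x =>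
  A0 Ap b t x + (A1 w t x : ℂ)

/-! ### Weak derivatives and the remainder -/

/-- Test functions on `ℝ³`. -/
def IsTest (ψ : E3 → ℝ) : Prop := ContDiff ℝ ∞ ψ ∧ HasCompactSupport ψ

/-- `G` is the distributional gradient of `f` on `ℝ³`. -/
def HasWeakGradient (f : E3 → ℂ) (G : E3 → EuclideanSpace ℂ (Fin 3)) : Prop :=
  LocallyIntegrable f ∧ LocallyIntegrable G ∧
  ∀ ψ : E3 → ℝ, IsTest ψ → ∀ i : Fin 3,
    ∫ x, ((fderiv ℝ ψ x (basisVec i) : ℝ) : ℂ) * f x = -∫ x, (ψ x : ℂ) * G x i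

/-- `g` is the time derivative at time `t` of `s ↦ f s`, in the sense of distributions on `ℝ³`. -/
def HasTimeDerivAt (f : ℝ → E3 → ℂ) (g : E3 → ℂ) (t : ℝ) : Prop :=
  (∀ᶠ s in 𝓝 t, LocallyIntegrable (f s)) ∧ LocallyIntegrable g ∧
  ∀ ψ : E3 → ℝ, IsTest ψ →
    HasDerivAt (fun s => ∫ x, (ψ x : ℂ) * f s x) (∫ x, (ψ x : ℂ) * g x) t

/-- `R = i ∂ₜ u + (1/2) Δ u - A u` for all times `t > 0`, in the sense of distributions on `ℝ³`.
The terms `∂ₜ u(t)` and `Δ u(t)` need not be functions separately. -/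
def IsRemainder (u A R : ℝ → E3 → ℂ) : Prop :=
  ∀ t : ℝ, 0 < t →
    LocallyIntegrable (u t) ∧ LocallyIntegrable (fun x => A t x * u t x) ∧
    LocallyIntegrable (R t) ∧
    ∀ ψ : E3 → ℝ, IsTest ψ → ∃ d : ℂ,
      HasDerivAt (fun s => ∫ x, (ψ x : ℂ) * u s x) d t ∧
      ∫ x, (ψ x : ℂ) * R t x =
        Complex.I * d + (1 / 2) * (∫ x, ((Δ ψ x : ℝ) : ℂ) * u t x)
          - ∫ x, (ψ x : ℂ) * (A t x * u t x)

/-! ### The estimates -/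

/-- `δ(r) = 3/2 - 3/r`, with `δ(∞) = 3/2`. -/
def deltaExp (r : ℝ≥0∞) : ℝ := 3 / 2 - 3 * (r⁻¹).toReal

/-- `‖u(t)‖_r ≤ t^{-δ(r)} ‖w‖_r < ∞` for `2 ≤ r ≤ ∞`, `‖A(t)‖_∞ ≤ a t⁻¹`, `‖R(t)‖_2 ≤ r₁ t^{-3/2}`,
for all `t ≥ 1`. -/
def BasicEstimates (w : E3 → ℂ) (u A R : ℝ → E3 → ℂ) : Prop :=
  (∀ r : ℝ≥0∞, 2 ≤ r → MemLp w r volume ∧ ∀ t : ℝ, 1 ≤ t →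
    eLpNorm (u t) r volume ≤ ENNReal.ofReal (t ^ (-deltaExp r)) * eLpNorm w r volume) ∧
  (∃ a : ℝ, ∀ t : ℝ, 1 ≤ t → eLpNorm (A t) ∞ volume ≤ ENNReal.ofReal (a * t ^ (-1 : ℝ))) ∧
  (∃ r₁ : ℝ, ∀ t : ℝ, 1 ≤ t →
    eLpNorm (R t) 2 volume ≤ ENNReal.ofReal (r₁ * t ^ (-(3 / 2) : ℝ)))

/-- `‖∇u(t)‖_r ≤ c t^{-δ(r)}` for `2 ≤ r ≤ ∞`, `‖∇A(t)‖_∞ ≤ a t⁻¹`, `‖∇R(t)‖_2 ≤ r₁ t^{-3/2}`,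
for all `t ≥ 1`, with distributional gradients. -/
def GradientEstimates (u A R : ℝ → E3 → ℂ) : Prop :=
  (∃ c : ℝ, ∀ t : ℝ, 1 ≤ t → ∃ G, HasWeakGradient (u t) G ∧ ∀ r : ℝ≥0∞, 2 ≤ r →
    eLpNorm G r volume ≤ ENNReal.ofReal (c * t ^ (-deltaExp r))) ∧
  (∃ a : ℝ, ∀ t : ℝ, 1 ≤ t → ∃ G, HasWeakGradient (A t) G ∧
    eLpNorm G ∞ volume ≤ ENNReal.ofReal (a * t ^ (-1 : ℝ))) ∧
  (∃ r₁ : ℝ, ∀ t : ℝ, 1 ≤ t → ∃ G, HasWeakGradient (R t) G ∧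
    eLpNorm G 2 volume ≤ ENNReal.ofReal (r₁ * t ^ (-(3 / 2) : ℝ)))

/-- `‖∂ₜu(t)‖_r ≤ c t^{-δ(r)}` for `2 ≤ r ≤ ∞`, `‖∂ₜA(t)‖_∞ ≤ a t⁻¹`, `‖∂ₜR(t)‖_2 ≤ r₁ t^{-3/2}`,
for all `t ≥ 1`, with distributional time derivatives. -/
def TimeDerivEstimates (u A R : ℝ → E3 → ℂ) : Prop :=
  (∃ c : ℝ, ∀ t : ℝ, 1 ≤ t → ∃ g, HasTimeDerivAt u g t ∧ ∀ r : ℝ≥0∞, 2 ≤ r →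
    eLpNorm g r volume ≤ ENNReal.ofReal (c * t ^ (-deltaExp r))) ∧
  (∃ a : ℝ, ∀ t : ℝ, 1 ≤ t → ∃ g, HasTimeDerivAt A g t ∧
    eLpNorm g ∞ volume ≤ ENNReal.ofReal (a * t ^ (-1 : ℝ))) ∧
  (∃ r₁ : ℝ, ∀ t : ℝ, 1 ≤ t → ∃ g, HasTimeDerivAt R g t ∧
    eLpNorm g 2 volume ≤ ENNReal.ofReal (r₁ * t ^ (-(3 / 2) : ℝ)))

end

/-!
The proof exploits the exact scaling of the ansatz. Write `w = F u₊` and `P = Ã₁`, so that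
`u_a(t)` is the dilate by `t` of `exp (-i (ln t) P) w`, multiplied by `(it)^(-3/2) exp (i x²/2t)`;
for general `P` and `w` this is `ansatz P t w`. The potential that `u_a` generates is
self-similar, `A₁(t, x) = t⁻¹ P(x / t)` (`A1_eq`). Hence the derivative of the phase `(ln t) P`,
which is `t⁻¹ P`, cancels `A₁ u_a`, and the modulation `exp (i x²/2t)` cancels the transport
terms. What is left (`I_mul_timeAmp_add_half_sum`, `isRemainder_remainder`) is
`R₁ = (2t²)⁻¹ ansatz P t (exp (i (ln t) P) Δ (exp (-i (ln t) P) w)) - A₀ u_a`.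

The amplitude in the first term is a polynomial of degree two in `ln t`, whose coefficients
`lapAmp` lie in `L²` as soon as `w ∈ H²`, `∇P` is bounded and `∂_j² P ∈ L²`. Since `ansatz P t` is
isometric on `L²`, this term is `O (t⁻² (1 + ln t)²)`, which is better than `O (t^(-3/2))`. In the
second term `A₀` is bounded in `L²` by energy conservation and `‖u_a‖_∞ = O (t^(-3/2))`.
The bounds on `u_a` itself hold by scaling, and those on `A_a` follow from the boundedness of `P`
and from the dispersive decay of `A₀`.

A derivative acting on `ansatz P t w` gives again an ansatz, with a new amplitude: `gradAmp` for
`∂_j` and `timeAmp` for `∂_t`. The former contains `y_j w`, the latter `|y|² w` and `y·∇w`, and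
this is where the weights on `w`, that is, the regularity of `u₊`, enter. With these
amplitudes the estimates of the derivatives of `u_a` and `R₁` repeat the ones above.

Two analytic inputs remain.

* *The phase.* The Fourier transform of `|w|²` is an autocorrelation of the weighted `L²` function
  `F⁻¹w`, hence is weighted `L²` and continuous (`intensitySpectrum_fourier_normSq`).
  The Fourier transform of `P` is an average of dilations of it (`phaseSymbol`); the factor `ω⁻¹`
  gains one power of `|ξ|` there, which puts `∇P` in the same class (`IntensitySpectrum.phaseBounds`). The
  quantity `y·∇P`, which occurs in `∂_t`, is bounded because by self-similarity it is a time
  derivative of `A₁` (`exists_abs_tildeA1_add_fderiv_le`).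

* *The free wave.* If `ΔA₊` and `∇Ȧ₊` are integrable, then `‖A₀(t)‖_∞ = O (t⁻¹)`
  (`dispersive_estimate`). On the Fourier side, `cos (ωt)` and `sin (ωt)` are written as limits of
  the products of `ω²`, respectively `t ω∇`, with the transforms of explicit radial kernels that are
  supported outside the ball of radius `t`, are bounded by a multiple of `t⁻¹`, respectively `t⁻²`,
  and decay exponentially. The estimate follows from Young's inequality for these kernels, by
  passing to the limit in `L²`.

All derivatives are distributional. Weak partial derivatives (`HasWeakPartial`) are handled through
test functions. The time derivative of the ansatz (`hasTimeDerivAt_ansatz`) is computed after the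
change of variables `x = t y`, which moves the dependence on `t` onto the test function and the
smooth factor, and the time derivative of `A₀ u_a` comes from a product rule for a curve that is
differentiable in `L²` (`HasContDerivs.hasTimeDerivAt_mul`). Since `u_a` depends only on the class of
`F u₊` up to null sets (`uApprox_congr`), a continuous representative may be used throughout.
-/

noncomputable section

/-! ### Weak partial derivatives -/

/-- `g` is the weak partial derivative of `f` in the `i`-th coordinate direction: both are locally
integrable, and they satisfy the integration by parts formula against real test functions. -/
structure HasWeakPartial (i : Fin 3) (f g : E3 → ℂ) : Prop where
  left : LocallyIntegrable f
  right : LocallyIntegrable g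
  eq : ∀ ψ : E3 → ℝ, IsTest ψ →
    ∫ x, ((fderiv ℝ ψ x (basisVec i) : ℝ) : ℂ) * f x = -∫ x, (ψ x : ℂ) * g x

theorem MeasureTheory.LocallyIntegrable.integrable_mul_of_hasCompactSupport {f Ψ : E3 → ℂ}
    (hf : LocallyIntegrable f) (hΨ : Continuous Ψ) (hc : HasCompactSupport Ψ) :
    Integrable (fun x => Ψ x * f x) := by
  simpa [smul_eq_mul] using hf.integrable_smul_left_of_hasCompactSupport hΨ hc

theorem MeasureTheory.LocallyIntegrable.integrable_ofReal_mul_of_hasCompactSupport {f : E3 → ℂ}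
    {ψ : E3 → ℝ} (hf : LocallyIntegrable f) (hψ : Continuous ψ) (hc : HasCompactSupport ψ) :
    Integrable (fun x => (ψ x : ℂ) * f x) :=
  hf.integrable_mul_of_hasCompactSupport (Ψ := fun x => (ψ x : ℂ)) (by fun_prop)
    (hc.comp_left (g := ((↑) : ℝ → ℂ)) rfl)

/-- A shrinking sequence of bump functions used for mollification. -/
def mollifier (n : ℕ) : ContDiffBump (0 : E3) where
  rIn := 1 / (2 * ((n : ℝ) + 1))
  rOut := 1 / ((n : ℝ) + 1)
  rIn_pos := by positivity
  rIn_lt_rOut := by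
    apply one_div_lt_one_div_of_lt <;> nlinarith [(Nat.cast_nonneg n : (0 : ℝ) ≤ n)]

theorem mollifier_rOut_le (n : ℕ) : (mollifier n).rOut ≤ 1 := by
  change 1 / ((n : ℝ) + 1) ≤ 1
  rw [div_le_one (by positivity)]; simp

theorem tendsto_mollifier_rOut :
    Filter.Tendsto (fun n => (mollifier n).rOut) Filter.atTop (𝓝 0) :=
  tendsto_one_div_add_atTop_nhds_zero_nat

/-- The mollification of a continuous compactly supported function converges to it when tested
against a locally integrable function. -/
theorem tendsto_integral_mollifier {f : E3 → ℂ} (hf : LocallyIntegrable f) {θ : E3 → ℝ}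
    (hθ : Continuous θ) (hc : HasCompactSupport θ) :
    Filter.Tendsto (fun n => ∫ x, ((MeasureTheory.convolution ((mollifier n).normed volume) θ
      (ContinuousLinearMap.lsmul ℝ ℝ) volume x : ℝ) : ℂ) * f x) Filter.atTop
      (𝓝 (∫ x, (θ x : ℂ) * f x)) := by
  obtain ⟨C, hC⟩ := hc.exists_bound_of_continuous hθ
  set K := Metric.cthickening 1 (tsupport θ) with hK
  have hKc : IsCompact K := hc.isCompact.cthickening
  have hbound : ∀ n x, |MeasureTheory.convolution ((mollifier n).normed volume) θ
      (ContinuousLinearMap.lsmul ℝ ℝ) volume x| ≤ K.indicator (fun _ => 3 * C) x := by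
    intro n x
    by_cases hx : x ∈ K
    · rw [Set.indicator_of_mem hx]
      have h1 := (mollifier n).dist_normed_convolution_le (μ := volume) (g := θ) (x₀ := x)
        (ε := 2 * C) hθ.aestronglyMeasurable (fun y _ => by
          rw [Real.dist_eq]
          have h2 := hC y; have h3 := hC x
          rw [Real.norm_eq_abs] at h2 h3
          linarith [abs_sub (θ y) (θ x)])
      rw [Real.dist_eq] at h1
      have h3 := hC x
      rw [Real.norm_eq_abs] at h3
      have := abs_sub_abs_le_abs_sub (MeasureTheory.convolution ((mollifier n).normed volume) θ
        (ContinuousLinearMap.lsmul ℝ ℝ) volume x) (θ x)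
      linarith
    · rw [Set.indicator_of_notMem hx]
      have h1 := (mollifier n).normed_convolution_eq_right (μ := volume) (g := θ) (x₀ := x)
        (fun y hy => by
          have hz : ∀ z ∈ Metric.ball x (mollifier n).rOut, θ z = 0 := by
            intro z hz
            by_contra hne
            apply hx
            refine Metric.mem_cthickening_of_dist_le x z 1 _ (subset_tsupport θ hne) ?_
            rw [dist_comm]
            exact (Metric.mem_ball.1 hz).le.trans (mollifier_rOut_le n)
          rw [hz y hy, hz x (Metric.mem_ball_self (mollifier n).rOut_pos)])
      rw [h1]
      have : θ x = 0 := by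
        by_contra hne
        exact hx (Metric.self_subset_cthickening _ (subset_tsupport θ hne))
      simp [this]
  refine tendsto_integral_of_dominated_convergence
    (fun x => K.indicator (fun x => 3 * C * ‖f x‖) x) ?_ ?_ ?_ ?_
  · intro n
    refine AEStronglyMeasurable.mul ?_ hf.aestronglyMeasurable
    refine Continuous.aestronglyMeasurable ?_
    refine Complex.continuous_ofReal.comp ?_
    exact hc.continuous_convolution_right _ (mollifier n).continuous_normed.locallyIntegrable hθ
  · rw [integrable_indicator_iff hKc.measurableSet]
    exact ((hf.integrableOn_isCompact hKc).norm.const_mul _)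
  · intro n
    refine Filter.Eventually.of_forall fun x => ?_
    rw [norm_mul, Complex.norm_real, Real.norm_eq_abs]
    have := hbound n x
    by_cases hx : x ∈ K
    · rw [Set.indicator_of_mem hx] at this ⊢
      gcongr
    · rw [Set.indicator_of_notMem hx] at this ⊢
      have h0 := le_antisymm this (abs_nonneg _)
      rw [h0]; simp
  · refine Filter.Eventually.of_forall fun x => ?_
    refine Filter.Tendsto.mul_const _ ?_
    refine (Complex.continuous_ofReal.tendsto _).comp ?_
    exact ContDiffBump.convolution_tendsto_right_of_continuous tendsto_mollifier_rOut hθ x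

namespace HasWeakPartial

variable {i : Fin 3} {f g f' g' : E3 → ℂ}

/-- Integration by parts against real `C¹` functions of compact support, by mollification. -/
theorem eq_of_contDiff_one_real (h : HasWeakPartial i f g) {ψ : E3 → ℝ} (hψ : ContDiff ℝ 1 ψ)
    (hc : HasCompactSupport ψ) :
    ∫ x, ((fderiv ℝ ψ x (basisVec i) : ℝ) : ℂ) * f x = -∫ x, (ψ x : ℂ) * g x := by
  have hc' : HasCompactSupport (fun x => fderiv ℝ ψ x (basisVec i)) :=
    hc.fderiv_apply (𝕜 := ℝ) (basisVec i)
  have hcont' : Continuous (fun x => fderiv ℝ ψ x (basisVec i)) :=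
    (hψ.continuous_fderiv one_ne_zero).clm_apply continuous_const
  have h1 := tendsto_integral_mollifier h.left hcont' hc'
  have h2 := (tendsto_integral_mollifier h.right hψ.continuous hc).neg
  refine tendsto_nhds_unique h1 (h2.congr fun n => ?_)
  have hloc : LocallyIntegrable ((mollifier n).normed volume) :=
    (mollifier n).continuous_normed.locallyIntegrable
  have htest : IsTest (MeasureTheory.convolution ((mollifier n).normed volume) ψ
      (ContinuousLinearMap.lsmul ℝ ℝ) volume) :=
    ⟨(mollifier n).hasCompactSupport_normed.contDiff_convolution_left _
      (mollifier n).contDiff_normed hψ.continuous.locallyIntegrable,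
      (mollifier n).hasCompactSupport_normed.convolution _ hc⟩
  rw [← h.eq _ htest]
  refine integral_congr_ae (Filter.Eventually.of_forall fun x => ?_)
  have hd := hc.hasFDerivAt_convolution_right (ContinuousLinearMap.lsmul ℝ ℝ) hloc hψ x
  simp only
  rw [hd.fderiv]
  congr 2
  rw [convolution_precompR_apply _ hloc (hc.fderiv (𝕜 := ℝ)) (hψ.continuous_fderiv one_ne_zero)]

/-- Integration by parts against complex `C¹` functions of compact support. -/
theorem eq_of_contDiff_one (h : HasWeakPartial i f g) {Ψ : E3 → ℂ} (hΨ : ContDiff ℝ 1 Ψ)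
    (hc : HasCompactSupport Ψ) :
    ∫ x, fderiv ℝ Ψ x (basisVec i) * f x = -∫ x, Ψ x * g x := by
  have hre : ContDiff ℝ 1 (fun x => (Ψ x).re) := Complex.reCLM.contDiff.comp hΨ
  have him : ContDiff ℝ 1 (fun x => (Ψ x).im) := Complex.imCLM.contDiff.comp hΨ
  have hcre : HasCompactSupport (fun x => (Ψ x).re) := hc.comp_left (g := Complex.re) rfl
  have hcim : HasCompactSupport (fun x => (Ψ x).im) := hc.comp_left (g := Complex.im) rfl
  have e1 := h.eq_of_contDiff_one_real hre hcre
  have e2 := h.eq_of_contDiff_one_real him hcim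
  have hdre : ∀ x, fderiv ℝ (fun x => (Ψ x).re) x (basisVec i)
      = (fderiv ℝ Ψ x (basisVec i)).re := fun x => by
    have := (Complex.reCLM.hasFDerivAt.comp x
      (hΨ.differentiable one_ne_zero x).hasFDerivAt).fderiv
    change fderiv ℝ (Complex.reCLM ∘ Ψ) x _ = _
    rw [this]; rfl
  have hdim : ∀ x, fderiv ℝ (fun x => (Ψ x).im) x (basisVec i)
      = (fderiv ℝ Ψ x (basisVec i)).im := fun x => by
    have := (Complex.imCLM.hasFDerivAt.comp x
      (hΨ.differentiable one_ne_zero x).hasFDerivAt).fderiv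
    change fderiv ℝ (Complex.imCLM ∘ Ψ) x _ = _
    rw [this]; rfl
  have hd : Continuous (fun x => fderiv ℝ Ψ x (basisVec i)) :=
    (hΨ.continuous_fderiv one_ne_zero).clm_apply continuous_const
  have hcd : HasCompactSupport (fun x => fderiv ℝ Ψ x (basisVec i)) :=
    hc.fderiv_apply (𝕜 := ℝ) (basisVec i)
  simp only [hdre, hdim] at e1 e2
  have split : ∀ {Θ k : E3 → ℂ}, Continuous Θ → HasCompactSupport Θ → LocallyIntegrable k →
      ∫ x, Θ x * k x = (∫ x, ((Θ x).re : ℂ) * k x) + Complex.I * ∫ x, ((Θ x).im : ℂ) * k x := by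
    intro Θ k hΘ hΘc hk
    rw [← integral_const_mul, ← integral_add]
    · refine integral_congr_ae (Filter.Eventually.of_forall fun x => ?_)
      simp only
      conv_lhs => rw [← Complex.re_add_im (Θ x)]
      ring
    · exact hk.integrable_ofReal_mul_of_hasCompactSupport (by fun_prop)
        (hΘc.comp_left (g := Complex.re) rfl)
    · exact (hk.integrable_ofReal_mul_of_hasCompactSupport (by fun_prop)
        (hΘc.comp_left (g := Complex.im) rfl)).const_mul _
  rw [split hd hcd h.left, split hΨ.continuous hc h.right, e1, e2]
  ring

theorem congr (h : HasWeakPartial i f g) (hf : f =ᵐ[volume] f') (hg : g =ᵐ[volume] g') :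
    HasWeakPartial i f' g' where
  left := h.left.congr hf
  right := h.right.congr hg
  eq ψ hψ := by
    rw [← integral_congr_ae (hf.mono fun x hx => by simp only [hx] :
        (fun x => ((fderiv ℝ ψ x (basisVec i) : ℝ) : ℂ) * f x) =ᵐ[volume] fun x =>
          ((fderiv ℝ ψ x (basisVec i) : ℝ) : ℂ) * f' x),
      ← integral_congr_ae (hg.mono fun x hx => by simp only [hx] :
        (fun x => (ψ x : ℂ) * g x) =ᵐ[volume] fun x => (ψ x : ℂ) * g' x)]
    exact h.eq ψ hψ

theorem _root_.IsTest.continuous_fderiv_apply {ψ : E3 → ℝ} (hψ : IsTest ψ) (v : E3) :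
    Continuous (fun x => fderiv ℝ ψ x v) :=
  (hψ.1.continuous_fderiv (by simp)).clm_apply continuous_const

theorem _root_.IsTest.hasCompactSupport_fderiv_apply {ψ : E3 → ℝ} (hψ : IsTest ψ) (v : E3) :
    HasCompactSupport (fun x => fderiv ℝ ψ x v) :=
  hψ.2.fderiv_apply (𝕜 := ℝ) v

theorem add (h : HasWeakPartial i f g) (h' : HasWeakPartial i f' g') :
    HasWeakPartial i (fun x => f x + f' x) (fun x => g x + g' x) where
  left := h.left.add h'.left
  right := h.right.add h'.right
  eq ψ hψ := by
    have c1 := hψ.continuous_fderiv_apply (basisVec i)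
    have c2 := hψ.hasCompactSupport_fderiv_apply (basisVec i)
    simp only [mul_add]
    rw [integral_add (h.left.integrable_ofReal_mul_of_hasCompactSupport c1 c2)
      (h'.left.integrable_ofReal_mul_of_hasCompactSupport c1 c2),
      integral_add (h.right.integrable_ofReal_mul_of_hasCompactSupport hψ.1.continuous hψ.2)
      (h'.right.integrable_ofReal_mul_of_hasCompactSupport hψ.1.continuous hψ.2),
      h.eq ψ hψ, h'.eq ψ hψ]
    ring

theorem const_mul (h : HasWeakPartial i f g) (c : ℂ) :
    HasWeakPartial i (fun x => c * f x) (fun x => c * g x) where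
  left := h.left.smul c
  right := h.right.smul c
  eq ψ hψ := by
    simp only [mul_left_comm _ c]
    rw [integral_const_mul, integral_const_mul, h.eq ψ hψ]
    ring

theorem zero : HasWeakPartial i (fun _ => 0) (fun _ => 0) where
  left := locallyIntegrable_zero
  right := locallyIntegrable_zero
  eq ψ hψ := by simp

theorem sum {ι : Type*} (s : Finset ι) {F G : ι → E3 → ℂ}
    (h : ∀ k ∈ s, HasWeakPartial i (F k) (G k)) :
    HasWeakPartial i (fun x => ∑ k ∈ s, F k x) (fun x => ∑ k ∈ s, G k x) := by
  classical
  induction s using Finset.induction_on with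
  | empty => simpa using zero
  | insert a s ha ih =>
    simp only [Finset.sum_insert ha]
    exact (h a (Finset.mem_insert_self a s)).add
      (ih fun k hk => h k (Finset.mem_insert_of_mem hk))

/-- Product rule for a `C¹` function and a weakly differentiable function. -/
theorem contDiff_mul {Φ : E3 → ℂ} (hΦ : ContDiff ℝ 1 Φ) (h : HasWeakPartial i f g) :
    HasWeakPartial i (fun x => Φ x * f x)
      (fun x => Φ x * g x + fderiv ℝ Φ x (basisVec i) * f x) := by
  have hd : Continuous (fun x => fderiv ℝ Φ x (basisVec i)) :=
    (hΦ.continuous_fderiv one_ne_zero).clm_apply continuous_const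
  have l1 : LocallyIntegrable (fun x => Φ x * f x) := by
    simpa [smul_eq_mul] using h.left.continuous_smul hΦ.continuous
  have l2 : LocallyIntegrable (fun x => Φ x * g x) := by
    simpa [smul_eq_mul] using h.right.continuous_smul hΦ.continuous
  have l3 : LocallyIntegrable (fun x => fderiv ℝ Φ x (basisVec i) * f x) := by
    simpa [smul_eq_mul] using h.left.continuous_smul hd
  refine ⟨l1, l2.add l3, fun ψ hψ => ?_⟩
  have hψ1 : ContDiff ℝ 1 (fun x => (ψ x : ℂ)) :=
    Complex.ofRealCLM.contDiff.comp (hψ.1.of_le (by exact_mod_cast le_top))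
  have hψc : HasCompactSupport (fun x => (ψ x : ℂ)) := hψ.2.comp_left (g := ((↑) : ℝ → ℂ)) rfl
  have key := h.eq_of_contDiff_one (hψ1.mul hΦ) (hψc.mul_right)
  have c1 := hψ.continuous_fderiv_apply (basisVec i)
  have c2 := hψ.hasCompactSupport_fderiv_apply (basisVec i)
  have hfd : ∀ x, fderiv ℝ (fun x => (ψ x : ℂ) * Φ x) x (basisVec i) =
      ((fderiv ℝ ψ x (basisVec i) : ℝ) : ℂ) * Φ x + ψ x * fderiv ℝ Φ x (basisVec i) := by
    intro x
    rw [fderiv_fun_mul (hψ1.differentiable one_ne_zero x) (hΦ.differentiable one_ne_zero x)]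
    have : fderiv ℝ (fun x => (ψ x : ℂ)) x (basisVec i)
        = ((fderiv ℝ ψ x (basisVec i) : ℝ) : ℂ) := by
      have := (Complex.ofRealCLM.hasFDerivAt.comp x
        (hψ.1.differentiable (by simp) x).hasFDerivAt).fderiv
      change fderiv ℝ (Complex.ofRealCLM ∘ ψ) x _ = _
      rw [this]; rfl
    simp only [add_apply, smul_apply, smul_eq_mul, this]
    ring
  have i1 := l1.integrable_ofReal_mul_of_hasCompactSupport c1 c2
  have i2 := l2.integrable_ofReal_mul_of_hasCompactSupport hψ.1.continuous hψ.2
  have i3 := l3.integrable_ofReal_mul_of_hasCompactSupport hψ.1.continuous hψ.2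
  have e1 : ∫ x, fderiv ℝ (fun x => (ψ x : ℂ) * Φ x) x (basisVec i) * f x =
      (∫ x, ((fderiv ℝ ψ x (basisVec i) : ℝ) : ℂ) * (Φ x * f x)) +
      ∫ x, (ψ x : ℂ) * (fderiv ℝ Φ x (basisVec i) * f x) := by
    rw [← integral_add i1 i3]
    refine integral_congr_ae (Filter.Eventually.of_forall fun x => ?_)
    simp only [hfd]; ring
  rw [e1] at key
  simp only [mul_add]
  rw [integral_add i2 i3]
  simp only [mul_assoc] at key
  linear_combination key

theorem of_contDiff {Φ : E3 → ℂ} (hΦ : ContDiff ℝ 1 Φ) :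
    HasWeakPartial i Φ (fun x => fderiv ℝ Φ x (basisVec i)) := by
  have h1 : HasWeakPartial i (fun _ => 1) (fun _ => 0) := by
    refine ⟨continuous_const.locallyIntegrable, locallyIntegrable_zero, fun ψ hψ => ?_⟩
    have := integral_mul_fderiv_eq_neg_fderiv_mul_of_integrable (μ := (volume : Measure E3))
      (f := fun _ => (1 : ℝ)) (g := ψ) (v := basisVec i) (by simp) (by
        simpa using (hψ.continuous_fderiv_apply (basisVec i)).integrable_of_hasCompactSupport
          (hψ.hasCompactSupport_fderiv_apply (basisVec i)))
      (by simpa using hψ.1.continuous.integrable_of_hasCompactSupport hψ.2)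
      (fun x _ => by fun_prop) (fun x _ => hψ.1.differentiable (by simp) x)
    simp only [one_mul, fderiv_const_apply, zero_apply, zero_mul,
      integral_zero, neg_zero] at this
    simp only [mul_one, mul_zero, integral_zero, neg_zero]
    rw [integral_complex_ofReal, this]; rfl
  have := h1.contDiff_mul hΦ
  simpa using this

/-- Weak derivatives are unique. -/
theorem unique (h : HasWeakPartial i f g) (h' : HasWeakPartial i f g') : g =ᵐ[volume] g' := by
  refine ae_eq_of_integral_contDiff_smul_eq h.right h'.right fun ψ hψ hc => ?_
  have e1 := h.eq ψ ⟨hψ, hc⟩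
  rw [h'.eq ψ ⟨hψ, hc⟩] at e1
  simpa [Complex.real_smul] using (neg_injective e1).symm

theorem _root_.MeasureTheory.LocallyIntegrable.dilation {k : E3 → ℂ} (hk : LocallyIntegrable k)
    {t : ℝ} (ht : 0 < t) : LocallyIntegrable (dilation t k) := by
  rw [MeasureTheory.locallyIntegrable_iff] at hk ⊢
  intro K hK
  have h1 := hk _ (hK.image (f := fun x => t⁻¹ • x) (by fun_prop))
  have h2 : Integrable (((fun x => t⁻¹ • x) '' K).indicator k) := by
    rw [integrable_indicator_iff]
    · exact h1
    · exact (hK.image (f := fun x => t⁻¹ • x) (by fun_prop)).measurableSet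
  have h3 := h2.comp_smul (inv_ne_zero ht.ne')
  rw [← integrable_indicator_iff hK.measurableSet]
  refine h3.congr (Filter.Eventually.of_forall fun x => ?_)
  by_cases hx : x ∈ K
  · simp only [Set.indicator_of_mem hx]
    rw [Set.indicator_of_mem (Set.mem_image_of_mem _ hx)]; rfl
  · simp only [Set.indicator_of_notMem hx]
    rw [Set.indicator_of_notMem]
    rintro ⟨y, hy, hxy⟩
    exact hx (smul_right_injective _ (inv_ne_zero ht.ne') hxy ▸ hy)

theorem comp_smul (h : HasWeakPartial i f g) {t : ℝ} (ht : 0 < t) :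
    HasWeakPartial i (dilation t f) (fun x => (t⁻¹ : ℂ) * dilation t g x) := by
  refine ⟨h.left.dilation ht, (h.right.dilation ht).smul ((t : ℂ)⁻¹),
    fun ψ hψ => ?_⟩
  -- test the original relation against the dilated function `y ↦ ψ (t y)`
  have hψt : IsTest (fun y => ψ (t • y)) :=
    ⟨hψ.1.comp (contDiff_const_smul t), hψ.2.comp_homeomorph (Homeomorph.smulOfNeZero t ht.ne')⟩
  have key := h.eq _ hψt
  have hfd : ∀ y, fderiv ℝ (fun y => ψ (t • y)) y (basisVec i) =
      t * fderiv ℝ ψ (t • y) (basisVec i) := fun y => by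
    rw [fderiv_comp_smul]; simp
  have cv : ∀ F : E3 → ℂ, ∫ x, F x = ((t ^ 3 : ℝ) : ℂ) * ∫ y, F (t • y) := by
    intro F
    rw [Measure.integral_comp_smul_of_nonneg volume F t (hR := ht.le), finrank_euclideanSpace_fin,
      Complex.real_smul, ← mul_assoc, ← Complex.ofReal_mul, mul_inv_cancel₀ (by positivity),
      Complex.ofReal_one, one_mul]
  rw [cv, cv (fun x => (ψ x : ℂ) * _)]
  have ht0 : (t : ℂ) ≠ 0 := by exact_mod_cast ht.ne'
  simp only [dilation, smul_smul, inv_mul_cancel₀ ht.ne', one_smul]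
  simp only [hfd, Complex.ofReal_mul, mul_assoc] at key
  rw [integral_const_mul] at key
  simp only [mul_left_comm _ ((t : ℂ)⁻¹)]
  rw [integral_const_mul]
  push_cast
  field_simp
  linear_combination key

end HasWeakPartial

theorem hasWeakGradient_of_hasWeakPartial {f : E3 → ℂ} {G : Fin 3 → E3 → ℂ}
    (h : ∀ i, HasWeakPartial i f (G i)) :
    HasWeakGradient f (fun x => WithLp.toLp 2 fun i => G i x) := by
  refine ⟨(h 0).left, ?_, fun ψ hψ i => (h i).eq ψ hψ⟩
  have : (fun x => (WithLp.toLp 2 fun i => G i x : EuclideanSpace ℂ (Fin 3))) =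
      fun x => ∑ i, G i x • EuclideanSpace.single i (1 : ℂ) := by
    funext x
    ext j
    simp [Finset.sum_apply, Pi.single_apply]
  rw [this]
  intro x
  choose s hs hsi using fun i => (h i).right x
  refine ⟨⋂ i, s i, Filter.iInter_mem.2 hs, ?_⟩
  refine integrable_finsetSum _ fun i _ => ?_
  exact ((hsi i).mono_set (Set.iInter_subset s i)).smul_const _

/-! ### Inverse Fourier transforms and weak derivatives -/

/-- `f` is the inverse Fourier transform of `a` in the sense of tempered distributions. Both are
functions, possibly defined up to null sets; no integrability is built in. -/
def IsFourierInv (a f : E3 → ℂ) : Prop :=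
  ∀ ψ : 𝓢(E3, ℂ), ∫ x, ψ x * f x = ∫ ξ, (𝓕⁻ ψ) ξ * a ξ

/-- The symbol `2πi ξ_i` of the partial derivative `∂_i`. -/
def partialSymbol (i : Fin 3) (ξ : E3) : ℂ := 2 * Real.pi * Complex.I * (ξ i : ℂ)

theorem inner_basisVec (ξ : E3) (i : Fin 3) : inner ℝ ξ (basisVec i) = ξ i := by
  simp [basisVec, EuclideanSpace.inner_single_right]

theorem norm_partialSymbol_le (i : Fin 3) (ξ : E3) : ‖partialSymbol i ξ‖ ≤ 2 * Real.pi * ‖ξ‖ := by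
  have h : |ξ i| ≤ ‖ξ‖ := by simpa using PiLp.norm_apply_le ξ i
  simp only [partialSymbol, norm_mul, Complex.norm_real, Complex.norm_I, Real.norm_eq_abs,
    abs_of_pos Real.pi_pos, mul_one]
  norm_num
  exact mul_le_mul_of_nonneg_left h (by positivity)

theorem continuous_partialSymbol (i : Fin 3) : Continuous (partialSymbol i) := by
  unfold partialSymbol; fun_prop

/-- Self-adjointness of the inverse Fourier transform on integrable functions. -/
theorem integral_fourierInv_mul_eq_flip {k a : E3 → ℂ} (hk : Integrable k) (ha : Integrable a) :
    ∫ x, k x * (𝓕⁻ a) x = ∫ ξ, (𝓕⁻ k) ξ * a ξ := by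
  have h := VectorFourier.integral_fourierIntegral_smul_eq_flip (μ := (volume : Measure E3))
    (ν := (volume : Measure E3)) (L := -innerₗ E3) Real.continuous_fourierChar
    (by simp only [LinearMap.neg_apply, innerₗ_apply_apply]; fun_prop) hk ha
  simp only [smul_eq_mul] at h
  have e1 : ∀ (k : E3 → ℂ) (x : E3),
      VectorFourier.fourierIntegral Real.fourierChar volume (-innerₗ E3) k x = (𝓕⁻ k) x := by
    intro k x
    rw [Real.fourierInv_eq, VectorFourier.fourierIntegral]
    simp [innerₗ_apply_apply]
  have e2 : (-innerₗ E3 : E3 →ₗ[ℝ] E3 →ₗ[ℝ] ℝ).flip = -innerₗ E3 := by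
    ext x y; simp [innerₗ_apply_apply, real_inner_comm]
  rw [e2] at h
  simp only [e1] at h
  exact h.symm

theorem integral_fourier_mul_eq_flip {k a : E3 → ℂ} (hk : Integrable k) (ha : Integrable a) :
    ∫ x, k x * (𝓕 a) x = ∫ ξ, (𝓕 k) ξ * a ξ := by
  have h := VectorFourier.integral_fourierIntegral_smul_eq_flip (μ := (volume : Measure E3))
    (ν := (volume : Measure E3)) (L := innerₗ E3) Real.continuous_fourierChar
    (by simp only [innerₗ_apply_apply]; fun_prop) hk ha
  rw [flip_innerₗ] at h
  exact h.symm

theorem isFourierInv_of_integrable {a : E3 → ℂ} (ha : Integrable a) : IsFourierInv a (𝓕⁻ a) := by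
  intro ψ
  rw [SchwartzMap.fourierInv_coe]
  exact integral_fourierInv_mul_eq_flip ψ.integrable ha

theorem isFourierInv_fourierInv_Lp (a : L2C) : IsFourierInv a (𝓕⁻ a : L2C) := by
  intro ψ
  have h := congrArg (fun T : 𝓢'(E3, ℂ) => T ψ) (Lp.fourierInv_toTemperedDistribution_eq a)
  simp only [TemperedDistribution.fourierInv_apply, Lp.toTemperedDistribution_apply,
    smul_eq_mul] at h
  exact h.symm

theorem isFourierInv_Lp (f : L2C) : IsFourierInv (𝓕 f : L2C) f := by
  simpa using isFourierInv_fourierInv_Lp (𝓕 f : L2C)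

theorem integral_mul_congr_ae {f f' g g' : E3 → ℂ} (hf : f =ᵐ[volume] f')
    (hg : g =ᵐ[volume] g') : ∫ x, f x * g x = ∫ x, f' x * g' x :=
  integral_congr_ae (by filter_upwards [hf, hg] with x h1 h2; rw [h1, h2])

namespace IsFourierInv

variable {a a' f f' g : E3 → ℂ} {i : Fin 3}

theorem congr (h : IsFourierInv a f) (ha : a =ᵐ[volume] a') (hf : f =ᵐ[volume] f') :
    IsFourierInv a' f' := by
  intro ψ
  rw [← integral_mul_congr_ae (Filter.EventuallyEq.refl _ ψ) hf,
    ← integral_mul_congr_ae (Filter.EventuallyEq.refl _ (𝓕⁻ ψ : 𝓢(E3, ℂ))) ha]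
  exact h ψ

/-- Real test functions are Schwartz functions. -/
def _root_.IsTest.toSchwartz {ψ : E3 → ℝ} (hψ : IsTest ψ) : 𝓢(E3, ℂ) :=
  HasCompactSupport.toSchwartzMap (f := fun x => (ψ x : ℂ))
    (hψ.2.comp_left (g := ((↑) : ℝ → ℂ)) rfl) (Complex.ofRealCLM.contDiff.comp hψ.1)

@[simp]
theorem _root_.IsTest.toSchwartz_apply {ψ : E3 → ℝ} (hψ : IsTest ψ) (x : E3) :
    hψ.toSchwartz x = ψ x := rfl

/-- The inverse Fourier transform of a function is unique up to null sets. -/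
theorem unique (h : IsFourierInv a f) (h' : IsFourierInv a g) (hf : LocallyIntegrable f)
    (hg : LocallyIntegrable g) : f =ᵐ[volume] g := by
  refine ae_eq_of_integral_contDiff_smul_eq hf hg fun ψ hψ hc => ?_
  have hψ' : IsTest ψ := ⟨hψ, hc⟩
  have e1 := h hψ'.toSchwartz
  rw [← h' hψ'.toSchwartz] at e1
  simpa [Complex.real_smul] using e1

/-- A function is determined up to null sets by its inverse Fourier transform. -/
theorem unique_left (h : IsFourierInv a f) (h' : IsFourierInv a' f) (hf : LocallyIntegrable a)
    (hg : LocallyIntegrable a') : a =ᵐ[volume] a' := by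
  refine ae_eq_of_integral_contDiff_smul_eq hf hg fun ψ hψ hc => ?_
  have hψ' : IsTest ψ := ⟨hψ, hc⟩
  have e1 := h (𝓕 hψ'.toSchwartz)
  rw [h' (𝓕 hψ'.toSchwartz)] at e1
  simpa [Complex.real_smul] using e1.symm

theorem _root_.SchwartzMap.partialSymbol_mul_fourierInv (ψ : 𝓢(E3, ℂ)) (i : Fin 3) (ξ : E3) :
    (𝓕⁻ (∂_{basisVec i} ψ)) ξ = -(partialSymbol i ξ * (𝓕⁻ ψ) ξ) := by
  rw [SchwartzMap.fourierInv_lineDerivOp_eq]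
  have : (inner ℝ · (basisVec i) : E3 → ℝ).HasTemperateGrowth := by fun_prop
  rw [_root_.smul_apply, SchwartzMap.smulLeftCLM_apply_apply this, inner_basisVec]
  simp only [partialSymbol, smul_eq_mul, Complex.real_smul]
  ring

/-- The weak derivative is computed by multiplication with `2πi ξ_i` on the Fourier side. -/
theorem hasWeakPartial (h : IsFourierInv a f)
    (h' : IsFourierInv (fun ξ => partialSymbol i ξ * a ξ) g)
    (hf : LocallyIntegrable f) (hg : LocallyIntegrable g) : HasWeakPartial i f g := by
  refine ⟨hf, hg, fun ψ hψ => ?_⟩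
  have e1 := h (∂_{basisVec i} hψ.toSchwartz)
  have e2 := h' hψ.toSchwartz
  simp only [SchwartzMap.partialSymbol_mul_fourierInv] at e1
  have e3 : ∀ x, (∂_{basisVec i} hψ.toSchwartz) x = ((fderiv ℝ ψ x (basisVec i) : ℝ) : ℂ) := by
    intro x
    rw [SchwartzMap.lineDerivOp_apply_eq_fderiv]
    have := (Complex.ofRealCLM.hasFDerivAt.comp x
        (hψ.1.differentiable (by simp) x).hasFDerivAt).fderiv
    change fderiv ℝ (Complex.ofRealCLM ∘ ψ) x _ = _
    rw [this]; rfl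
  simp only [e3] at e1
  simp only [IsTest.toSchwartz_apply] at e2
  rw [e1, e2, ← integral_neg]
  refine integral_congr_ae (Filter.Eventually.of_forall fun x => ?_)
  simp only; ring

end IsFourierInv

theorem exists_isFourierInv {a : E3 → ℂ} (ha : MemLp a 2 volume) :
    ∃ f, MemLp f 2 volume ∧ IsFourierInv a f :=
  ⟨(𝓕⁻ (ha.toLp a) : L2C), Lp.memLp _,
    (isFourierInv_fourierInv_Lp (ha.toLp a)).congr ha.coeFn_toLp Filter.EventuallyEq.rfl⟩

theorem memLp_two_locallyIntegrable {f : E3 → ℂ} (hf : MemLp f 2 volume) : LocallyIntegrable f :=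
  hf.locallyIntegrable (by norm_num)

theorem continuous_fourierInv {a : E3 → ℂ} (ha : Integrable a) : Continuous (𝓕⁻ a) := by
  rw [Real.fourierInv_eq_fourier_comp_neg]
  exact VectorFourier.fourierIntegral_continuous Real.continuous_fourierChar
    (by exact continuous_inner) ha.comp_neg

theorem norm_fourierInv_le (a : E3 → ℂ) (x : E3) : ‖(𝓕⁻ a) x‖ ≤ ∫ ξ, ‖a ξ‖ := by
  rw [Real.fourierInv_eq]
  refine (norm_integral_le_integral_norm _).trans (le_of_eq ?_)
  simp

theorem memLp_fourierInv {a : E3 → ℂ} (ha : Integrable a) (ha2 : MemLp a 2 volume) :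
    MemLp (𝓕⁻ a) 2 volume := by
  obtain ⟨f, hf, hfa⟩ := exists_isFourierInv ha2
  exact hf.ae_eq (hfa.unique (isFourierInv_of_integrable ha) (memLp_two_locallyIntegrable hf)
    (continuous_fourierInv ha).locallyIntegrable)

/-- If `a` and `|ξ| a` are integrable, the inverse Fourier transform of `a` is `C¹`. -/
theorem contDiff_fourierInv {a : E3 → ℂ} (ha : Integrable a)
    (ha' : Integrable (fun ξ => (‖ξ‖ : ℂ) * a ξ)) : ContDiff ℝ 1 (𝓕⁻ a) := by
  have : (𝓕⁻ a : E3 → ℂ) = fun x => 𝓕 a (-x) := by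
    funext x; exact Real.fourierInv_eq_fourier_neg a x
  rw [this]
  refine ContDiff.comp (g := 𝓕 a) ?_ contDiff_neg
  refine Real.contDiff_fourier (N := 1) fun n hn => ?_
  have hn' : n ≤ 1 := by exact_mod_cast hn
  interval_cases n
  · simpa using ha.norm
  · simpa using ha'.norm

theorem integrable_partialSymbol_mul {a : E3 → ℂ} (ha : Integrable a)
    (ha' : Integrable (fun ξ => (‖ξ‖ : ℂ) * a ξ)) (i : Fin 3) :
    Integrable (fun ξ => partialSymbol i ξ * a ξ) := by
  refine (ha'.const_mul (2 * Real.pi)).mono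
    ((continuous_partialSymbol i).aestronglyMeasurable.mul ha.1)
    (Filter.Eventually.of_forall fun ξ => ?_)
  simp only [norm_mul, Complex.norm_real, norm_norm]
  have := mul_le_mul_of_nonneg_right (norm_partialSymbol_le i ξ) (norm_nonneg (a ξ))
  simp only [Real.norm_eq_abs, abs_of_pos Real.pi_pos]
  norm_num
  linarith

theorem fderiv_fourierInv {a : E3 → ℂ} (ha : Integrable a)
    (ha' : Integrable (fun ξ => (‖ξ‖ : ℂ) * a ξ)) (i : Fin 3) (x : E3) :
    fderiv ℝ (𝓕⁻ a) x (basisVec i) = (𝓕⁻ (fun ξ => partialSymbol i ξ * a ξ)) x := by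
  have hi := integrable_partialSymbol_mul ha ha' i
  have hc := continuous_fourierInv hi
  have h1 : HasWeakPartial i (𝓕⁻ a) (𝓕⁻ (fun ξ => partialSymbol i ξ * a ξ)) :=
    (isFourierInv_of_integrable ha).hasWeakPartial (isFourierInv_of_integrable hi)
      (continuous_fourierInv ha).locallyIntegrable hc.locallyIntegrable
  have hcd := contDiff_fourierInv ha ha'
  have h2 := HasWeakPartial.of_contDiff (i := i) hcd
  have hc2 : Continuous (fun x => fderiv ℝ (𝓕⁻ a) x (basisVec i)) :=
    (hcd.continuous_fderiv one_ne_zero).clm_apply continuous_const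
  exact congrFun (Continuous.ae_eq_iff_eq volume hc2 hc |>.1 (h2.unique h1)) x

/-- Bilinear Parseval identity for an integrable and square integrable function `k` and a square
integrable function `a`. -/
theorem integral_mul_eq_integral_fourierInv_mul {k a w : E3 → ℂ} (hk : Integrable k)
    (hk2 : MemLp k 2 volume) (ha : MemLp a 2 volume) (hw : MemLp w 2 volume)
    (haw : IsFourierInv a w) : ∫ x, k x * w x = ∫ ξ, (𝓕⁻ k) ξ * a ξ := by
  have hflip : ∀ K A : L2C, ∫ x, K x * (𝓕⁻ A : L2C) x = ∫ ξ, (𝓕⁻ K : L2C) ξ * A ξ := by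
    intro K A
    have hpair : ∀ F G : L2C, ((ContinuousLinearMap.mul ℂ ℂ).lpPairing volume 2 2) F G =
        ∫ x, F x * G x := fun F G => by
      rw [ContinuousLinearMap.lpPairing_eq_integral]; rfl
    simp only [← hpair]
    refine DenseRange.induction_on (p := fun K : L2C =>
      ((ContinuousLinearMap.mul ℂ ℂ).lpPairing volume 2 2) K (𝓕⁻ A : L2C) =
      ((ContinuousLinearMap.mul ℂ ℂ).lpPairing volume 2 2) (𝓕⁻ K : L2C) A)
      (SchwartzMap.denseRange_toLpCLM (p := 2) (F := ℂ) (E := E3)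
        (μ := volume) ENNReal.ofNat_ne_top) K ?_ ?_
    · apply isClosed_eq
      · exact (((ContinuousLinearMap.mul ℂ ℂ).lpPairing volume 2 2).flip (𝓕⁻ A : L2C)).continuous
      · exact (((ContinuousLinearMap.mul ℂ ℂ).lpPairing volume 2 2).flip A ∘L
          (fourierInvCLM ℂ L2C)).continuous
    · intro ψ
      have := isFourierInv_fourierInv_Lp A ψ
      rw [hpair, hpair, SchwartzMap.toLpCLM_apply, SchwartzMap.toLp_fourierInv_eq]
      exact (integral_mul_congr_ae (ψ.coeFn_toLp 2 volume) (Filter.EventuallyEq.refl _ _)).trans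
        (this.trans (integral_mul_congr_ae ((𝓕⁻ ψ).coeFn_toLp 2 volume)
          (Filter.EventuallyEq.refl _ _)).symm)
  have e := hflip (hk2.toLp k) (ha.toLp a)
  have h1 : (𝓕⁻ (ha.toLp a) : L2C) =ᵐ[volume] w :=
    ((isFourierInv_fourierInv_Lp (ha.toLp a)).congr ha.coeFn_toLp Filter.EventuallyEq.rfl).unique
      haw (memLp_two_locallyIntegrable (Lp.memLp _)) (memLp_two_locallyIntegrable hw)
  have h2 : (𝓕⁻ (hk2.toLp k) : L2C) =ᵐ[volume] 𝓕⁻ k :=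
    ((isFourierInv_fourierInv_Lp (hk2.toLp k)).congr hk2.coeFn_toLp
      Filter.EventuallyEq.rfl).unique (isFourierInv_of_integrable hk)
      (memLp_two_locallyIntegrable (Lp.memLp _)) (continuous_fourierInv hk).locallyIntegrable
  rwa [integral_mul_congr_ae hk2.coeFn_toLp h1, integral_mul_congr_ae h2 ha.coeFn_toLp] at e

/-- The character `x ↦ e^{2πi x·ξ}`. -/
def planeWave (ξ x : E3) : ℂ := Complex.exp (((2 * Real.pi * inner ℝ x ξ : ℝ) : ℂ) * Complex.I)

theorem norm_planeWave (ξ x : E3) : ‖planeWave ξ x‖ = 1 := Complex.norm_exp_ofReal_mul_I _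

theorem continuous_planeWave : Continuous (fun p : E3 × E3 => planeWave p.1 p.2) := by
  unfold planeWave; fun_prop

theorem fourierInv_eq_planeWave (k : E3 → ℂ) (ξ : E3) : (𝓕⁻ k) ξ = ∫ x, planeWave ξ x * k x := by
  rw [Real.fourierInv_eq']; rfl

theorem contDiff_planeWave (ξ : E3) : ContDiff ℝ 1 (planeWave ξ) := by
  unfold planeWave
  refine Complex.contDiff_exp.comp (ContDiff.mul ?_ contDiff_const)
  refine Complex.ofRealCLM.contDiff.comp ?_
  exact contDiff_const.mul (contDiff_id.inner ℝ contDiff_const)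

theorem fderiv_planeWave (ξ x : E3) (i : Fin 3) :
    fderiv ℝ (planeWave ξ) x (basisVec i) = partialSymbol i ξ * planeWave ξ x := by
  have h1 : HasFDerivAt (fun x : E3 => 2 * Real.pi * inner ℝ x ξ)
      ((2 * Real.pi) • innerSL ℝ ξ) x := by
    have := ((innerSL ℝ ξ).hasFDerivAt (x := x)).const_mul (2 * Real.pi)
    refine this.congr_of_eventuallyEq (Filter.Eventually.of_forall fun y => ?_)
    simp [real_inner_comm]
  have h2 := ((Complex.ofRealCLM.hasFDerivAt.comp x h1).mul_const Complex.I).cexp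
  have h3 : fderiv ℝ (planeWave ξ) x = _ := h2.fderiv
  rw [h3]
  simp [inner_basisVec, planeWave, partialSymbol]
  ring

/-- Product rule for a continuous weakly differentiable function `f` and an inverse
Fourier transform `w` with weak derivative in `L²`. Both derivatives may fail to be continuous; the
rule follows from the one for plane waves by superposition. -/
theorem HasWeakPartial.mul_fourierInv {i : Fin 3} {f f' a w' : E3 → ℂ}
    (h : HasWeakPartial i f f') (hfc : Continuous f) (ha : Integrable a)
    (ha' : MemLp (fun ξ => partialSymbol i ξ * a ξ) 2 volume)
    (hw' : MemLp w' 2 volume) (hw : IsFourierInv (fun ξ => partialSymbol i ξ * a ξ) w') :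
    HasWeakPartial i (fun x => f x * (𝓕⁻ a) x)
      (fun x => f' x * (𝓕⁻ a) x + f x * w' x) := by
  have hac := continuous_fourierInv ha
  have l2 : LocallyIntegrable (fun x => f' x * (𝓕⁻ a) x) := by
    simpa [smul_eq_mul, mul_comm] using h.right.continuous_smul hac
  have l3 : LocallyIntegrable (fun x => f x * w' x) := by
    simpa [smul_eq_mul] using (memLp_two_locallyIntegrable hw').continuous_smul hfc
  refine ⟨(hfc.mul hac).locallyIntegrable, l2.add l3, fun ψ hψ => ?_⟩
  have c1 := hψ.continuous_fderiv_apply (basisVec i)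
  have c2 := hψ.hasCompactSupport_fderiv_apply (basisVec i)
  set k₁ : E3 → ℂ := fun x => ((fderiv ℝ ψ x (basisVec i) : ℝ) : ℂ) * f x
  set k₂ : E3 → ℂ := fun x => (ψ x : ℂ) * f' x
  set k₃ : E3 → ℂ := fun x => (ψ x : ℂ) * f x
  have i1 : Integrable k₁ := h.left.integrable_ofReal_mul_of_hasCompactSupport c1 c2
  have i2 : Integrable k₂ := h.right.integrable_ofReal_mul_of_hasCompactSupport hψ.1.continuous hψ.2
  have i3 : Integrable k₃ := h.left.integrable_ofReal_mul_of_hasCompactSupport hψ.1.continuous hψ.2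
  have i3' : MemLp k₃ 2 volume := by
    have hc3 : Continuous k₃ := (Complex.continuous_ofReal.comp hψ.1.continuous).mul hfc
    have hs3 : HasCompactSupport k₃ :=
      HasCompactSupport.mul_right (hψ.2.comp_left (g := ((↑) : ℝ → ℂ)) rfl)
    exact hc3.memLp_of_hasCompactSupport hs3
  have hψ1 : ContDiff ℝ 1 (fun x => (ψ x : ℂ)) :=
    Complex.ofRealCLM.contDiff.comp (hψ.1.of_le (by exact_mod_cast le_top))
  have hψc : HasCompactSupport (fun x => (ψ x : ℂ)) := hψ.2.comp_left (g := ((↑) : ℝ → ℂ)) rfl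
  -- the relation for a single plane wave
  have hwave : ∀ ξ, (𝓕⁻ k₁) ξ = -(𝓕⁻ k₂) ξ - (𝓕⁻ k₃) ξ * (partialSymbol i ξ) := by
    intro ξ
    have key := h.eq_of_contDiff_one (hψ1.mul (contDiff_planeWave ξ)) hψc.mul_right
    have hfd : ∀ x, fderiv ℝ (fun x => (ψ x : ℂ) * planeWave ξ x) x (basisVec i) =
        ((fderiv ℝ ψ x (basisVec i) : ℝ) : ℂ) * planeWave ξ x
          + ψ x * (partialSymbol i ξ * planeWave ξ x) := by
      intro x
      rw [fderiv_fun_mul (hψ1.differentiable one_ne_zero x)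
        ((contDiff_planeWave ξ).differentiable one_ne_zero x)]
      have : fderiv ℝ (fun x => (ψ x : ℂ)) x (basisVec i)
          = ((fderiv ℝ ψ x (basisVec i) : ℝ) : ℂ) := by
        have := (Complex.ofRealCLM.hasFDerivAt.comp x
          (hψ.1.differentiable (by simp) x).hasFDerivAt).fderiv
        change fderiv ℝ (Complex.ofRealCLM ∘ ψ) x _ = _
        rw [this]; rfl
      simp only [add_apply, smul_apply, smul_eq_mul, this, fderiv_planeWave]
      ring
    have pw : ∀ {k : E3 → ℂ}, Integrable k → Integrable (fun x => planeWave ξ x * k x) := by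
      intro k hk
      refine hk.bdd_mul (c := 1) ?_ (Filter.Eventually.of_forall fun x => (norm_planeWave ξ x).le)
      exact (contDiff_planeWave ξ).continuous.aestronglyMeasurable
    have e1 : ∫ x, fderiv ℝ (fun x => (ψ x : ℂ) * planeWave ξ x) x (basisVec i) * f x =
        (𝓕⁻ k₁) ξ + (𝓕⁻ k₃) ξ * partialSymbol i ξ := by
      rw [fourierInv_eq_planeWave, fourierInv_eq_planeWave, ← integral_mul_const, ← integral_add
        (pw i1) ((pw i3).mul_const _)]
      refine integral_congr_ae (Filter.Eventually.of_forall fun x => ?_)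
      simp only [hfd, k₁, k₃]; ring
    have e2 : ∫ x, (ψ x : ℂ) * planeWave ξ x * f' x = (𝓕⁻ k₂) ξ := by
      rw [fourierInv_eq_planeWave]
      refine integral_congr_ae (Filter.Eventually.of_forall fun x => ?_)
      simp only [k₂]; ring
    rw [e1, e2] at key
    linear_combination key
  have e1 : ∫ x, ((fderiv ℝ ψ x (basisVec i) : ℝ) : ℂ) * (f x * (𝓕⁻ a) x) =
      ∫ ξ, (𝓕⁻ k₁) ξ * a ξ := by
    rw [← integral_fourierInv_mul_eq_flip i1 ha]
    simp only [k₁, mul_assoc]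
  have e2 : ∫ x, (ψ x : ℂ) * (f' x * (𝓕⁻ a) x) = ∫ ξ, (𝓕⁻ k₂) ξ * a ξ := by
    rw [← integral_fourierInv_mul_eq_flip i2 ha]
    simp only [k₂, mul_assoc]
  have e3 : ∫ x, (ψ x : ℂ) * (f x * w' x) = ∫ ξ, (𝓕⁻ k₃) ξ * (partialSymbol i ξ * a ξ) := by
    rw [← integral_mul_eq_integral_fourierInv_mul i3 i3' ha' hw' hw]
    simp only [k₃, mul_assoc]
  have bddmul : ∀ {k : E3 → ℂ}, Integrable k → Integrable (fun ξ => (𝓕⁻ k) ξ * a ξ) := by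
    intro k hk
    exact ha.bdd_mul (continuous_fourierInv hk).aestronglyMeasurable
      (Filter.Eventually.of_forall (norm_fourierInv_le k))
  have j1 := bddmul i1
  have j2 := bddmul i2
  have j3 : Integrable (fun ξ => (𝓕⁻ k₃) ξ * (partialSymbol i ξ * a ξ)) :=
    (memLp_fourierInv i3 i3').integrable_mul ha'
  simp only [mul_add]
  rw [integral_add (l2.integrable_ofReal_mul_of_hasCompactSupport hψ.1.continuous hψ.2)
    (l3.integrable_ofReal_mul_of_hasCompactSupport hψ.1.continuous hψ.2), e1, e2, e3,
    ← integral_add j2 j3, ← integral_neg]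
  refine integral_congr_ae (Filter.Eventually.of_forall fun ξ => ?_)
  simp only [hwave]; ring

/-- A square integrable weak derivative of a square integrable function is a weak derivative against
all Schwartz functions, by cutting off. -/
theorem HasWeakPartial.eq_schwartz {i : Fin 3} {f g : E3 → ℂ} (h : HasWeakPartial i f g)
    (hf : MemLp f 2 volume) (hg : MemLp g 2 volume) (φ : 𝓢(E3, ℂ)) :
    ∫ x, (∂_{basisVec i} φ) x * f x = -∫ x, φ x * g x := by
  set χ : ContDiffBump (0 : E3) := ⟨1, 2, by norm_num, by norm_num⟩ with hχ
  have hχs : ContDiff ℝ 1 (χ : E3 → ℝ) := χ.contDiff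
  have hχd : Continuous (fun x => fderiv ℝ χ x (basisVec i)) :=
    (hχs.continuous_fderiv one_ne_zero).clm_apply continuous_const
  obtain ⟨C, hC⟩ := (χ.hasCompactSupport.fderiv_apply (𝕜 := ℝ) (basisVec i)
    ).exists_bound_of_continuous hχd
  set s : ℕ → ℝ := fun n => 1 / ((n : ℝ) + 1) with hs
  have hs0 : ∀ n, 0 < s n := fun n => by positivity
  have hs1 : ∀ n, s n ≤ 1 := fun n => by
    rw [hs]; simp only; rw [div_le_one (by positivity)]; simp
  have hst : Filter.Tendsto s Filter.atTop (𝓝 0) := tendsto_one_div_add_atTop_nhds_zero_nat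
  have hfi : Integrable (fun x => ‖(∂_{basisVec i} φ) x‖ * ‖f x‖ + C * (‖φ x‖ * ‖f x‖)) := by
    have h1 : Integrable (fun x => ‖(∂_{basisVec i} φ) x‖ * ‖f x‖) :=
      ((∂_{basisVec i} φ).memLp 2 volume).norm.integrable_mul hf.norm
    have h2 : Integrable (fun x => ‖φ x‖ * ‖f x‖) := (φ.memLp 2 volume).norm.integrable_mul hf.norm
    exact h1.add (h2.const_mul C)
  have hgi : Integrable (fun x => ‖φ x‖ * ‖g x‖) := (φ.memLp 2 volume).norm.integrable_mul hg.norm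
  have hφ : ContDiff ℝ 1 φ := φ.smooth 1
  have hcut : ∀ n, ContDiff ℝ 1 (fun x => ((χ (s n • x) : ℝ) : ℂ)) := fun n =>
    Complex.ofRealCLM.contDiff.comp (hχs.comp (contDiff_const_smul (s n)))
  have hcutc : ∀ n, HasCompactSupport (fun x => ((χ (s n • x) : ℝ) : ℂ)) := fun n =>
    (χ.hasCompactSupport.comp_homeomorph (Homeomorph.smulOfNeZero (s n) (hs0 n).ne')).comp_left
      (g := ((↑) : ℝ → ℂ)) rfl
  have hd : ∀ n x, fderiv ℝ (fun x => ((χ (s n • x) : ℝ) : ℂ) * φ x) x (basisVec i) =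
      ((χ (s n • x) : ℝ) : ℂ) * (∂_{basisVec i} φ) x +
        ((s n * fderiv ℝ χ (s n • x) (basisVec i) : ℝ) : ℂ) * φ x := by
    intro n x
    rw [fderiv_fun_mul ((hcut n).differentiable one_ne_zero x) (hφ.differentiable one_ne_zero x)]
    have : fderiv ℝ (fun x => ((χ (s n • x) : ℝ) : ℂ)) x (basisVec i)
        = ((s n * fderiv ℝ χ (s n • x) (basisVec i) : ℝ) : ℂ) := by
      have h1 : DifferentiableAt ℝ (fun x => χ (s n • x)) x :=
        (hχs.comp (contDiff_const_smul (s n))).differentiable one_ne_zero x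
      have := (Complex.ofRealCLM.hasFDerivAt.comp x h1.hasFDerivAt).fderiv
      change fderiv ℝ (Complex.ofRealCLM ∘ (fun x => χ (s n • x))) x _ = _
      rw [this, fderiv_comp_smul]; simp
    simp only [add_apply, smul_apply, smul_eq_mul, this,
      SchwartzMap.lineDerivOp_apply_eq_fderiv]
    ring
  have key := fun n => h.eq_of_contDiff_one ((hcut n).mul hφ) (hcutc n).mul_right
  simp only [hd] at key
  have hlim : ∀ x : E3, Filter.Tendsto (fun n => ((χ (s n • x) : ℝ) : ℂ)) Filter.atTop (𝓝 1) := by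
    intro x
    have h1 : Filter.Tendsto (fun n => s n • x) Filter.atTop (𝓝 ((0 : ℝ) • x)) :=
      hst.smul_const x
    rw [zero_smul] at h1
    have h2 := (Complex.continuous_ofReal.comp χ.continuous).continuousAt.tendsto.comp h1
    have h3 : χ (0 : E3) = 1 := χ.one_of_mem_closedBall (Metric.mem_closedBall_self χ.rIn_pos.le)
    have h4 : (Complex.ofReal ∘ χ) (0 : E3) = 1 := by simp [h3]
    rwa [h4] at h2
  have hχ1 : ∀ n x, ‖((χ (s n • x) : ℝ) : ℂ)‖ ≤ 1 := fun n x => by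
    rw [Complex.norm_real, Real.norm_eq_abs, abs_of_nonneg χ.nonneg]; exact χ.le_one
  have T1 : Filter.Tendsto (fun n => ∫ x, (((χ (s n • x) : ℝ) : ℂ) * (∂_{basisVec i} φ) x +
        ((s n * fderiv ℝ χ (s n • x) (basisVec i) : ℝ) : ℂ) * φ x) * f x) Filter.atTop
        (𝓝 (∫ x, (∂_{basisVec i} φ) x * f x)) := by
    refine tendsto_integral_of_dominated_convergence _ (fun n => ?_) hfi (fun n => ?_) ?_
    · refine AEStronglyMeasurable.mul (Continuous.aestronglyMeasurable ?_) hf.1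
      refine ((hcut n).continuous.mul (∂_{basisVec i} φ).continuous).add (Continuous.mul ?_
        φ.continuous)
      exact Complex.continuous_ofReal.comp (continuous_const.mul
        (hχd.comp (continuous_const_smul (s n))))
    · refine Filter.Eventually.of_forall fun x => ?_
      rw [norm_mul]
      have b1 : ‖((χ (s n • x) : ℝ) : ℂ) * (∂_{basisVec i} φ) x‖ ≤ ‖(∂_{basisVec i} φ) x‖ := by
        rw [norm_mul]; exact mul_le_of_le_one_left (norm_nonneg _) (hχ1 n x)
      have b2 : ‖((s n * fderiv ℝ χ (s n • x) (basisVec i) : ℝ) : ℂ) * φ x‖ ≤ C * ‖φ x‖ := by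
        rw [norm_mul, Complex.norm_real, norm_mul]
        refine mul_le_mul_of_nonneg_right ?_ (norm_nonneg _)
        rw [Real.norm_eq_abs, abs_of_pos (hs0 n)]
        exact (mul_le_of_le_one_left (norm_nonneg _) (hs1 n)).trans (hC _)
      have := mul_le_mul_of_nonneg_right ((norm_add_le _ _).trans (add_le_add b1 b2))
        (norm_nonneg (f x))
      linarith
    · refine Filter.Eventually.of_forall fun x => ?_
      refine Filter.Tendsto.mul_const _ ?_
      have t2 : Filter.Tendsto (fun n => ((s n * fderiv ℝ χ (s n • x) (basisVec i) : ℝ) : ℂ))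
          Filter.atTop (𝓝 0) := by
        rw [tendsto_zero_iff_norm_tendsto_zero]
        refine squeeze_zero (fun n => norm_nonneg _) (g := fun n => s n * C) (fun n => ?_)
          (by simpa using hst.mul_const C)
        rw [Complex.norm_real, norm_mul, Real.norm_eq_abs, abs_of_pos (hs0 n)]
        exact mul_le_mul_of_nonneg_left (hC _) (hs0 n).le
      simpa using ((hlim x).mul_const ((∂_{basisVec i} φ) x)).add (t2.mul_const (φ x))
  have T2 : Filter.Tendsto (fun n => ∫ x, (((χ (s n • x) : ℝ) : ℂ) * φ x) * g x) Filter.atTop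
        (𝓝 (∫ x, φ x * g x)) := by
    refine tendsto_integral_of_dominated_convergence _ (fun n => ?_) hgi (fun n => ?_) ?_
    · exact ((hcut n).continuous.mul φ.continuous).aestronglyMeasurable.mul hg.1
    · refine Filter.Eventually.of_forall fun x => ?_
      rw [norm_mul, norm_mul, mul_assoc]
      exact mul_le_of_le_one_left (by positivity) (hχ1 n x)
    · refine Filter.Eventually.of_forall fun x => ?_
      refine Filter.Tendsto.mul_const _ ?_
      simpa using (hlim x).mul_const (φ x)
  exact tendsto_nhds_unique T1 (T2.neg.congr fun n => (key n).symm)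

/-- On the Fourier side, a weak derivative in `L²` is multiplication by `2πi ξ_i`. -/
theorem HasWeakPartial.fourier_eq {i : Fin 3} {a b f g : E3 → ℂ} (h : HasWeakPartial i f g)
    (hf : MemLp f 2 volume) (hg : MemLp g 2 volume) (haf : IsFourierInv a f)
    (hbg : IsFourierInv b g) (ha : MemLp a 2 volume) (hb : MemLp b 2 volume) :
    b =ᵐ[volume] fun ξ => partialSymbol i ξ * a ξ := by
  have hl : LocallyIntegrable (fun ξ => partialSymbol i ξ * a ξ) := by
    simpa [smul_eq_mul] using
      (memLp_two_locallyIntegrable ha).continuous_smul (continuous_partialSymbol i)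
  refine hbg.unique_left ?_ (memLp_two_locallyIntegrable hb) hl
  intro φ
  have e := h.eq_schwartz hf hg φ
  have e1 := haf (∂_{basisVec i} φ)
  simp only [SchwartzMap.partialSymbol_mul_fourierInv] at e1
  rw [e1, eq_comm, neg_eq_iff_eq_neg, ← integral_neg] at e
  rw [e]
  refine integral_congr_ae (Filter.Eventually.of_forall fun x => ?_)
  simp only; ring

/-! ### Integration in spherical coordinates -/

/-- The surface measure of the unit sphere of `ℝ³`. -/
abbrev sphereMeasure : Measure (Metric.sphere (0 : E3) 1) := (volume : Measure E3).toSphere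

theorem integral_polar {F : E3 → ℂ} (hF : Integrable F) :
    ∫ x, F x = ∫ r in Set.Ioi (0 : ℝ),
      ((r ^ 2 : ℝ) : ℂ) * ∫ θ : Metric.sphere (0 : E3) 1, F (r • (θ : E3)) ∂sphereMeasure := by
  have hmp := (volume : Measure E3).measurePreserving_homeomorphUnitSphereProd
  rw [finrank_euclideanSpace_fin] at hmp
  set g : Metric.sphere (0 : E3) 1 × Set.Ioi (0 : ℝ) → ℂ := fun p => F (p.2.1 • (p.1 : E3)) with hg
  have hcomp : ∀ x : ({(0)}ᶜ : Set E3), g (homeomorphUnitSphereProd E3 x) = F x := by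
    intro x
    have h0 : ‖(x : E3)‖ ≠ 0 := norm_ne_zero_iff.2 x.2
    simp only [hg, homeomorphUnitSphereProd_apply_snd_coe, homeomorphUnitSphereProd_apply_fst_coe]
    rw [smul_smul, mul_inv_cancel₀ h0, one_smul]
  have hint : Integrable g (sphereMeasure.prod (Measure.volumeIoiPow 2)) := by
    rw [← hmp.integrable_comp_emb (Homeomorph.measurableEmbedding _)]
    have : (g ∘ homeomorphUnitSphereProd E3) = F ∘ ((↑) : ({(0)}ᶜ : Set E3) → E3) := by
      funext x; exact hcomp x
    rw [this, ← integrableOn_iff_comap_subtypeVal (measurableSet_singleton _).compl]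
    exact hF.integrableOn
  calc ∫ x, F x = ∫ x : ({(0)}ᶜ : Set E3), F x ∂(volume.comap (Subtype.val : ({(0)}ᶜ : Set E3) → E3)) := by
        rw [integral_subtype_comap (measurableSet_singleton _).compl F,
          restrict_compl_singleton]
    _ = ∫ x, g (homeomorphUnitSphereProd E3 x) ∂(volume.comap (Subtype.val : ({(0)}ᶜ : Set E3) → E3)) := by simp only [hcomp]
    _ = ∫ p, g p ∂(sphereMeasure.prod (Measure.volumeIoiPow 2)) :=
        hmp.integral_comp (Homeomorph.measurableEmbedding _) g
    _ = ∫ r : Set.Ioi (0 : ℝ), ∫ θ, g (θ, r) ∂sphereMeasure ∂(Measure.volumeIoiPow 2) :=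
        integral_prod_symm g hint
    _ = _ := by
        rw [Measure.volumeIoiPow]
        simp only [ENNReal.ofReal]
        rw [integral_withDensity_eq_integral_smul (by fun_prop)]
        rw [← integral_subtype_comap measurableSet_Ioi (fun r : ℝ => ((r ^ 2 : ℝ) : ℂ) *
          ∫ θ : Metric.sphere (0 : E3) 1, F (r • (θ : E3)) ∂sphereMeasure)]
        refine integral_congr_ae (Filter.Eventually.of_forall fun r => ?_)
        simp only [hg, NNReal.smul_def, Complex.real_smul]
        rw [Real.coe_toNNReal _ (by positivity)]

/-- Integration over a ball by slices orthogonal to the first coordinate axis. -/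
theorem integral_ball_slices {h : ℝ → ℂ} (hh : Continuous h) {K : ℝ} (hK : 0 < K) :
    ∫ x in Metric.ball (0 : E3) K, h (x 0) =
      ∫ s in (-K)..K, ((Real.pi * (K ^ 2 - s ^ 2) : ℝ) : ℂ) * h s := by
  have hint : Integrable ((Metric.ball (0 : E3) K).indicator fun x => h (x 0)) := by
    rw [integrable_indicator_iff measurableSet_ball]
    have hc : Continuous (fun x : E3 => h (x 0)) := by fun_prop
    exact (hc.locallyIntegrable.integrableOn_isCompact (isCompact_closedBall 0 K)).mono_set
      Metric.ball_subset_closedBall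
  have hmem : ∀ (s : ℝ) (y : Fin 2 → ℝ),
      (WithLp.toLp 2 ((MeasurableEquiv.piFinSuccAbove (fun _ => ℝ) 0).symm (s, y)) : E3) ∈
        Metric.ball (0 : E3) K ↔ (WithLp.toLp 2 y : EuclideanSpace ℝ (Fin 2)) ∈
        Metric.ball (0 : EuclideanSpace ℝ (Fin 2)) (Real.sqrt (K ^ 2 - s ^ 2)) := by
    intro s y
    rw [mem_ball_zero_iff, mem_ball_zero_iff, EuclideanSpace.norm_eq, EuclideanSpace.norm_eq,
      Real.sqrt_lt' hK]
    simp only [Fin.sum_univ_succ (n := 2), MeasurableEquiv.piFinSuccAbove_symm_apply,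
      Fin.insertNthEquiv_apply, Fin.insertNth_zero', Fin.cons_zero, Fin.cons_succ,
      Real.norm_eq_abs, sq_abs]
    rw [Real.sqrt_lt_sqrt_iff (by positivity), lt_sub_iff_add_lt']
  have e1 : ∫ x in Metric.ball (0 : E3) K, h (x 0) =
      ∫ p : ℝ × (Fin 2 → ℝ), (Metric.ball (0 : E3) K).indicator (fun x => h (x 0))
        (WithLp.toLp 2 ((MeasurableEquiv.piFinSuccAbove (fun _ => ℝ) 0).symm p)) := by
    rw [← integral_indicator measurableSet_ball,
      ← (PiLp.volume_preserving_toLp (Fin 3)).integral_comp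
        (MeasurableEquiv.toLp 2 (Fin 3 → ℝ)).measurableEmbedding,
      ← (volume_preserving_piFinSuccAbove (fun _ : Fin 3 => ℝ) 0).symm.integral_comp
        (MeasurableEquiv.measurableEmbedding _)]
  have hint2 : Integrable (fun p : ℝ × (Fin 2 → ℝ) => (Metric.ball (0 : E3) K).indicator
      (fun x => h (x 0))
        (WithLp.toLp 2 ((MeasurableEquiv.piFinSuccAbove (fun _ => ℝ) 0).symm p))) := by
    have h1 := ((PiLp.volume_preserving_toLp (Fin 3)).integrable_comp_emb
        (MeasurableEquiv.toLp 2 (Fin 3 → ℝ)).measurableEmbedding).2 hint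
    exact ((volume_preserving_piFinSuccAbove (fun _ : Fin 3 => ℝ) 0).symm.integrable_comp_emb
        (MeasurableEquiv.measurableEmbedding _)).2 h1
  rw [e1, Measure.volume_eq_prod, integral_prod _ (by rwa [← Measure.volume_eq_prod])]
  have e2 : ∀ s : ℝ, ∫ y : Fin 2 → ℝ, (Metric.ball (0 : E3) K).indicator (fun x => h (x 0))
      (WithLp.toLp 2 ((MeasurableEquiv.piFinSuccAbove (fun _ => ℝ) 0).symm (s, y))) =
      (Set.Ioc (-K) K).indicator (fun s => ((Real.pi * (K ^ 2 - s ^ 2) : ℝ) : ℂ) * h s) s := by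
    intro s
    have e3 : ∀ y : Fin 2 → ℝ, (Metric.ball (0 : E3) K).indicator (fun x => h (x 0))
      (WithLp.toLp 2 ((MeasurableEquiv.piFinSuccAbove (fun _ => ℝ) 0).symm (s, y))) =
      (Metric.ball (0 : EuclideanSpace ℝ (Fin 2)) (Real.sqrt (K ^ 2 - s ^ 2))).indicator
        (fun _ => h s) (WithLp.toLp 2 y) := by
      intro y
      classical
      rw [Set.indicator_apply, Set.indicator_apply]
      simp only [hmem]
      congr 1
    simp only [e3]
    rw [(PiLp.volume_preserving_toLp (Fin 2)).integral_comp
        (MeasurableEquiv.toLp 2 (Fin 2 → ℝ)).measurableEmbedding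
        ((Metric.ball (0 : EuclideanSpace ℝ (Fin 2)) (Real.sqrt (K ^ 2 - s ^ 2))).indicator
        (fun _ => h s)), integral_indicator measurableSet_ball, setIntegral_const,
      Measure.real, EuclideanSpace.volume_ball_fin_two]
    rw [Complex.real_smul]
    by_cases hs : s ∈ Set.Ioc (-K) K
    · have : 0 ≤ K ^ 2 - s ^ 2 := by nlinarith [hs.1, hs.2]
      rw [Set.indicator_of_mem hs, ← ENNReal.ofReal_pow (Real.sqrt_nonneg _), Real.sq_sqrt this]
      simp [ENNReal.toReal_mul, ENNReal.toReal_ofReal this, mul_comm, Real.pi_pos.le]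
    · rw [Set.indicator_of_notMem hs]
      have : K ^ 2 - s ^ 2 ≤ 0 := by
        simp only [Set.mem_Ioc, not_and_or, not_lt, not_le] at hs
        rcases hs with hs | hs <;> nlinarith
      rw [Real.sqrt_eq_zero_of_nonpos this]
      simp
  simp only [e2]
  rw [integral_indicator measurableSet_Ioc, intervalIntegral.integral_of_le (by linarith)]

/-- A linear isometry of `ℝ³` taking the unit vector `e` to the first basis vector. -/
theorem exists_isometry_basisVec {e : E3} (he : ‖e‖ = 1) :
    ∃ R : E3 ≃ₗᵢ[ℝ] E3, ∀ x, inner ℝ x e = (R x) 0 := by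
  have h0 : ‖e‖ = ‖basisVec 0‖ := by rw [he]; simp [basisVec]
  refine ⟨(Submodule.reflection (ℝ ∙ (e - basisVec 0))ᗮ), fun x => ?_⟩
  have h1 : Submodule.reflection (ℝ ∙ (e - basisVec 0))ᗮ e = basisVec 0 :=
    Submodule.reflection_sub h0
  have h2 := (Submodule.reflection (ℝ ∙ (e - basisVec 0))ᗮ).inner_map_map x e
  rw [h1, inner_basisVec] at h2
  exact h2.symm

/-- Archimedes' theorem: the projection of the surface measure of the sphere to a diameter is
uniform. It is obtained by differentiating integrals over balls with respect to the radius. -/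
theorem integral_sphere_inner {h : ℝ → ℂ} (hh : Continuous h) {e : E3} (he : ‖e‖ = 1) :
    ∫ θ : Metric.sphere (0 : E3) 1, h (inner ℝ (θ : E3) e) ∂sphereMeasure =
      2 * Real.pi * ∫ s in (-1)..1, h s := by
  obtain ⟨R, hR⟩ := exists_isometry_basisVec he
  set I : ℝ → ℂ := fun r => ∫ θ : Metric.sphere (0 : E3) 1, h (r * inner ℝ (θ : E3) e)
    ∂sphereMeasure with hI
  have hIc : Continuous I := by
    refine continuous_parametric_integral_of_continuous (X := ℝ) (μ := sphereMeasure)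
      (s := Set.univ) (f := fun r (θ : Metric.sphere (0 : E3) 1) =>
        h (r * inner ℝ (θ : E3) e)) ?_ isCompact_univ |>.congr fun r => ?_
    · fun_prop
    · simp [hI]
  -- the integral over the ball of radius `K`, computed in two ways
  have key : ∀ K : ℝ, 0 < K → ∫ r in (0 : ℝ)..K, ((r ^ 2 : ℝ) : ℂ) * I r =
      ∫ s in (-K)..K, ((Real.pi * (K ^ 2 - s ^ 2) : ℝ) : ℂ) * h s := by
    intro K hK
    rw [← integral_ball_slices hh hK]
    have e1 : ∫ x in Metric.ball (0 : E3) K, h (x 0) =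
        ∫ x in Metric.ball (0 : E3) K, h (inner ℝ x e) := by
      rw [← integral_indicator measurableSet_ball, ← integral_indicator measurableSet_ball,
        ← R.measurePreserving.integral_comp R.toHomeomorph.measurableEmbedding]
      refine integral_congr_ae (Filter.Eventually.of_forall fun x => ?_)
      classical
      simp only [Set.indicator_apply, mem_ball_zero_iff, LinearIsometryEquiv.norm_map, hR]
    have hint : Integrable ((Metric.ball (0 : E3) K).indicator fun x => h (inner ℝ x e)) := by
      rw [integrable_indicator_iff measurableSet_ball]
      have hc : Continuous (fun x : E3 => h (inner ℝ x e)) := by fun_prop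
      exact (hc.locallyIntegrable.integrableOn_isCompact (isCompact_closedBall 0 K)).mono_set
        Metric.ball_subset_closedBall
    rw [e1, ← integral_indicator measurableSet_ball, integral_polar hint,
      intervalIntegral.integral_of_le hK.le, integral_Ioc_eq_integral_Ioo,
      ← integral_indicator measurableSet_Ioo, ← integral_indicator measurableSet_Ioi]
    refine integral_congr_ae (Filter.Eventually.of_forall fun r => ?_)
    classical
    simp only [Set.indicator_apply, Set.mem_Ioo, Set.mem_Ioi, mem_ball_zero_iff]
    by_cases hr : 0 < r
    · have hn : ∀ θ : Metric.sphere (0 : E3) 1, ‖r • (θ : E3)‖ = r := fun θ => by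
        rw [norm_smul, norm_eq_of_mem_sphere, mul_one, Real.norm_eq_abs, abs_of_pos hr]
      by_cases hrK : r < K
      · simp [hr, hrK, hn, hI, inner_smul_left]
      · simp [hr, hrK, hn]
    · simp [hr]
  have hcont2 : Continuous (fun s : ℝ => ((s ^ 2 : ℝ) : ℂ) * h s) := by fun_prop
  have hexp : ∀ K : ℝ, 0 < K → ∫ r in (0 : ℝ)..K, ((r ^ 2 : ℝ) : ℂ) * I r =
      Real.pi * ((K : ℂ) ^ 2 * (∫ s in (-K)..K, h s)
        - ∫ s in (-K)..K, ((s ^ 2 : ℝ) : ℂ) * h s) := by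
    intro K hK
    rw [key K hK, ← intervalIntegral.integral_const_mul, ← intervalIntegral.integral_sub
      ((by fun_prop : Continuous _).intervalIntegrable _ _) (hcont2.intervalIntegrable _ _),
      ← intervalIntegral.integral_const_mul]
    refine intervalIntegral.integral_congr fun s _ => ?_
    push_cast; ring
  have hsym : ∀ {k : ℝ → ℂ}, Continuous k →
      HasDerivAt (fun K : ℝ => ∫ s in (-K)..K, k s) (k 1 + k (-1)) 1 := by
    intro k hk
    have h1 : HasDerivAt (fun K : ℝ => ∫ s in (0 : ℝ)..K, k s) (k 1) 1 :=
      intervalIntegral.integral_hasDerivAt_right (hk.intervalIntegrable _ _)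
        (hk.stronglyMeasurableAtFilter _ _) hk.continuousAt
    have h2 : HasDerivAt (fun K : ℝ => ∫ s in (0 : ℝ)..K, k s) (k (-1)) (-1) :=
      intervalIntegral.integral_hasDerivAt_right (hk.intervalIntegrable _ _)
        (hk.stronglyMeasurableAtFilter _ _) hk.continuousAt
    have h3 := HasDerivAt.scomp (1 : ℝ) h2 (hasDerivAt_neg (1 : ℝ))
    have h4 := h1.sub h3
    refine (h4.congr_deriv (by simp)).congr_of_eventuallyEq (Filter.Eventually.of_forall fun K => ?_)
    simp only [Pi.sub_apply, Function.comp_apply]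
    rw [intervalIntegral.integral_interval_sub_left (hk.intervalIntegrable _ _)
      (hk.intervalIntegrable _ _)]
  have d1 : HasDerivAt (fun K : ℝ => ∫ r in (0 : ℝ)..K, ((r ^ 2 : ℝ) : ℂ) * I r) (I 1) 1 := by
    have hc : Continuous (fun r : ℝ => ((r ^ 2 : ℝ) : ℂ) * I r) := by fun_prop
    have := intervalIntegral.integral_hasDerivAt_right (a := 0) (b := 1)
      (hc.intervalIntegrable _ _) (hc.stronglyMeasurableAtFilter _ _) hc.continuousAt
    simpa using this
  have d2 : HasDerivAt (fun K : ℝ => (Real.pi : ℂ) * ((K : ℂ) ^ 2 * (∫ s in (-K)..K, h s)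
        - ∫ s in (-K)..K, ((s ^ 2 : ℝ) : ℂ) * h s))
      ((Real.pi : ℂ) * (2 * (∫ s in (-1)..(1 : ℝ), h s))) 1 := by
    have hK : HasDerivAt (fun K : ℝ => (K : ℂ) ^ 2) 2 1 := by
      have := ((hasDerivAt_id (1 : ℝ)).ofReal_comp).fun_pow 2
      simpa using this
    have := ((hK.mul (hsym hh)).sub (hsym hcont2)).const_mul (Real.pi : ℂ)
    refine this.congr_deriv ?_
    simp
  have heq : (fun K : ℝ => ∫ r in (0 : ℝ)..K, ((r ^ 2 : ℝ) : ℂ) * I r) =ᶠ[𝓝 1]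
      (fun K : ℝ => (Real.pi : ℂ) * ((K : ℂ) ^ 2 * (∫ s in (-K)..K, h s)
        - ∫ s in (-K)..K, ((s ^ 2 : ℝ) : ℂ) * h s)) := by
    filter_upwards [lt_mem_nhds (one_pos : (0 : ℝ) < 1)] with K hK using hexp K hK
  have := d1.unique (d2.congr_of_eventuallyEq heq)
  simp only [hI, one_mul] at this
  rw [this]; ring

/-- Integrals of functions of the norm and of one coordinate, in spherical coordinates. -/
theorem integral_norm_inner {F : E3 → ℂ} (hF : Integrable F) {e : E3} (he : ‖e‖ = 1)
    {H : ℝ → ℝ → ℂ} (hH : ∀ r, Continuous (H r)) (hFH : ∀ x, F x = H ‖x‖ (inner ℝ x e)) :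
    ∫ x, F x = ∫ r in Set.Ioi (0 : ℝ),
      ((r ^ 2 : ℝ) : ℂ) * (2 * Real.pi * ∫ s in (-1)..1, H r (r * s)) := by
  rw [integral_polar hF]
  refine setIntegral_congr_fun measurableSet_Ioi fun r hr => ?_
  have hr' : 0 < r := hr
  congr 1
  rw [← integral_sphere_inner (h := fun s => H r (r * s)) ((hH r).comp (by fun_prop)) he]
  refine integral_congr_ae (Filter.Eventually.of_forall fun θ => ?_)
  change F (r • (θ : E3)) = H r (r * inner ℝ (θ : E3) e)
  rw [hFH, norm_smul, norm_eq_of_mem_sphere, mul_one, Real.norm_eq_abs, abs_of_pos hr',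
    inner_smul_left]
  simp

/-! ### Regularised wave kernels and their Fourier transforms -/

/-- Radial profile of the regularised kernel of `cos (ωt) (-Δ)⁻¹`, up to the factor `4π`. -/
def waveProfile (t ε r : ℝ) : ℝ := if t < r then Real.exp (-ε * r) / r else 0

/-- Radial profile of the regularised kernel of `∇ sin (ωt) ω⁻³`, up to a constant factor. -/
def waveProfileGrad (t ε r : ℝ) : ℝ :=
  if t < r then (ε / r + 1 / r ^ 2) * Real.exp (-ε * r) else 0

/-- The regularised kernel with profile `waveProfile`. -/
def waveKernel (t ε : ℝ) (x : E3) : ℂ := (waveProfile t ε ‖x‖ : ℝ)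

/-- The regularised vector kernel with radial profile `waveProfileGrad`. -/
def waveKernelGrad (t ε : ℝ) (j : Fin 3) (x : E3) : ℂ :=
  ((waveProfileGrad t ε ‖x‖ * (x j / ‖x‖) : ℝ) : ℂ)

theorem measurable_waveProfile (t ε : ℝ) : Measurable (waveProfile t ε) := by
  unfold waveProfile
  exact Measurable.ite measurableSet_Ioi (by fun_prop) measurable_const

theorem measurable_waveProfileGrad (t ε : ℝ) : Measurable (waveProfileGrad t ε) := by
  unfold waveProfileGrad
  exact Measurable.ite measurableSet_Ioi (by fun_prop) measurable_const

theorem waveProfile_bounds {t ε r : ℝ} (ht : 0 < t) :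
    |waveProfile t ε r| ≤ t⁻¹ * Real.exp (-ε * r) := by
  unfold waveProfile
  split_ifs with h
  · have hr : 0 < r := ht.trans h
    rw [abs_of_pos (by positivity), div_eq_inv_mul]
    gcongr
  · rw [abs_zero]; positivity

theorem waveProfileGrad_bounds {t ε r : ℝ} (ht : 0 < t) (hε : 0 < ε) :
    |waveProfileGrad t ε r| ≤ t⁻¹ * (ε + t⁻¹) * Real.exp (-ε * r) := by
  unfold waveProfileGrad
  split_ifs with h
  · have hr : 0 < r := ht.trans h
    rw [abs_of_pos (by positivity)]
    have e : t⁻¹ * (ε + t⁻¹) = ε / t + 1 / t ^ 2 := by field_simp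
    rw [e]
    gcongr
  · rw [abs_zero]; positivity

theorem integrable_exp_neg_mul_norm {ε : ℝ} (hε : 0 < ε) :
    Integrable (fun x : E3 => Real.exp (-ε * ‖x‖)) := by
  rw [integrable_fun_norm_addHaar volume (f := fun r => Real.exp (-ε * r)),
    finrank_euclideanSpace_fin]
  have := integrableOn_rpow_mul_exp_neg_mul_rpow (p := 1) (s := 2) (b := ε) (by norm_num)
    (by norm_num) hε
  simpa using this

theorem integrable_waveKernel {t ε : ℝ} (ht : 0 < t) (hε : 0 < ε) :
    Integrable (waveKernel t ε) := by
  refine ((integrable_exp_neg_mul_norm hε).const_mul t⁻¹).mono' ?_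
    (Filter.Eventually.of_forall fun x => ?_)
  · exact (Complex.measurable_ofReal.comp
      ((measurable_waveProfile t ε).comp measurable_norm)).aestronglyMeasurable
  · rw [waveKernel, Complex.norm_real]; exact waveProfile_bounds ht

theorem abs_coord_div_norm_le (x : E3) (j : Fin 3) : |x j / ‖x‖| ≤ 1 := by
  rw [abs_div, abs_norm]
  exact div_le_one_of_le₀ (by simpa using PiLp.norm_apply_le x j) (norm_nonneg x)

theorem norm_waveKernelGrad_le {t ε : ℝ} (ht : 0 < t) (hε : 0 < ε) (j : Fin 3) (x : E3) :
    ‖waveKernelGrad t ε j x‖ ≤ t⁻¹ * (ε + t⁻¹) * Real.exp (-ε * ‖x‖) := by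
  rw [waveKernelGrad, Complex.norm_real, norm_mul]
  exact (mul_le_of_le_one_right (norm_nonneg _) (abs_coord_div_norm_le x j)).trans
    (waveProfileGrad_bounds ht hε)

theorem integrable_waveKernelGrad {t ε : ℝ} (ht : 0 < t) (hε : 0 < ε) (j : Fin 3) :
    Integrable (waveKernelGrad t ε j) := by
  refine ((integrable_exp_neg_mul_norm hε).const_mul (t⁻¹ * (ε + t⁻¹))).mono' ?_
    (Filter.Eventually.of_forall fun x => ?_)
  · unfold waveKernelGrad
    refine (Complex.measurable_ofReal.comp (Measurable.mul
      ((measurable_waveProfileGrad t ε).comp measurable_norm) ?_)).aestronglyMeasurable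
    fun_prop
  · exact norm_waveKernelGrad_le ht hε j x

/-- An antiderivative of `e^{-εr} sin (br)` that vanishes at infinity. -/
theorem hasDerivAt_exp_mul_sin {ε b : ℝ} (hε : 0 < ε) (r : ℝ) :
    HasDerivAt (fun r => -(Real.exp (-ε * r) * (ε * Real.sin (b * r) + b * Real.cos (b * r))
      / (ε ^ 2 + b ^ 2))) (Real.exp (-ε * r) * Real.sin (b * r)) r := by
  have h0 : ε ^ 2 + b ^ 2 ≠ 0 := by positivity
  have h1 : HasDerivAt (fun r : ℝ => Real.exp (-ε * r)) (Real.exp (-ε * r) * -ε) r := by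
    simpa using ((hasDerivAt_id r).const_mul (-ε)).exp
  have hb : HasDerivAt (fun r : ℝ => b * r) b r := by simpa using (hasDerivAt_id r).const_mul b
  have h2 := ((h1.mul ((hb.sin.const_mul ε).add (hb.cos.const_mul b))).div_const
    (ε ^ 2 + b ^ 2)).neg
  refine h2.congr_deriv ?_
  simp only [Pi.add_apply]
  field_simp
  ring

theorem tendsto_exp_neg_mul_bounded {ε C : ℝ} (hε : 0 < ε) {k : ℝ → ℝ} (hk : ∀ r, |k r| ≤ C) :
    Filter.Tendsto (fun r => Real.exp (-ε * r) * k r) Filter.atTop (𝓝 0) := by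
  have h1 : Filter.Tendsto (fun r => Real.exp (-ε * r)) Filter.atTop (𝓝 0) := by
    refine Real.tendsto_exp_atBot.comp ?_
    exact (Filter.tendsto_id.const_mul_atTop_of_neg (by linarith : -ε < 0))
  refine squeeze_zero_norm (a := fun r => Real.exp (-ε * r) * C) (fun r => ?_)
    (by simpa using h1.mul_const C)
  rw [norm_mul, Real.norm_eq_abs, Real.norm_eq_abs, abs_of_pos (Real.exp_pos _)]
  exact mul_le_mul_of_nonneg_left (hk r) (Real.exp_pos _).le

theorem abs_sin_cos_combination_le (ε b x : ℝ) : |ε * Real.sin x + b * Real.cos x| ≤ |ε| + |b| := by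
  refine (abs_add_le _ _).trans ?_
  rw [abs_mul, abs_mul]
  exact add_le_add (mul_le_of_le_one_right (abs_nonneg _) (Real.abs_sin_le_one _))
    (mul_le_of_le_one_right (abs_nonneg _) (Real.abs_cos_le_one _))

theorem tendsto_antiderivative {ε b : ℝ} (hε : 0 < ε) :
    Filter.Tendsto (fun r => -(Real.exp (-ε * r) * (ε * Real.sin (b * r) + b * Real.cos (b * r))
      / (ε ^ 2 + b ^ 2))) Filter.atTop (𝓝 0) := by
  have := ((tendsto_exp_neg_mul_bounded hε
    (k := fun r => ε * Real.sin (b * r) + b * Real.cos (b * r))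
    (fun r => abs_sin_cos_combination_le ε b (b * r))).div_const (ε ^ 2 + b ^ 2)).neg
  simpa using this

theorem integral_exp_mul_sin {ε b : ℝ} (hε : 0 < ε) (t : ℝ) :
    ∫ r in Set.Ioi t, Real.exp (-ε * r) * Real.sin (b * r) =
      Real.exp (-ε * t) * (ε * Real.sin (b * t) + b * Real.cos (b * t)) / (ε ^ 2 + b ^ 2) := by
  have hint : IntegrableOn (fun r => Real.exp (-ε * r) * Real.sin (b * r)) (Set.Ioi t) := by
    refine (exp_neg_integrableOn_Ioi t hε).mono' (by fun_prop)
      (Filter.Eventually.of_forall fun r => ?_)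
    rw [norm_mul, Real.norm_eq_abs, abs_of_pos (Real.exp_pos _)]
    exact mul_le_of_le_one_right (Real.exp_pos _).le (Real.abs_sin_le_one _)
  rw [integral_Ioi_of_hasDerivAt_of_tendsto' (fun r _ => hasDerivAt_exp_mul_sin hε r) hint
    (tendsto_antiderivative hε)]
  ring

theorem integral_cexp_sym {c : ℝ} (hc : c ≠ 0) :
    ∫ s in (-1 : ℝ)..1, Complex.exp (((-(c * s) : ℝ) : ℂ) * Complex.I) =
      ((2 * Real.sin c / c : ℝ) : ℂ) := by
  have hc' : (-(c : ℂ) * Complex.I) ≠ 0 := by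
    simp [hc]
  have h1 : ∀ s : ℝ, Complex.exp (((-(c * s) : ℝ) : ℂ) * Complex.I) =
      Complex.exp ((-(c : ℂ) * Complex.I) * s) := fun s => by
    congr 1; push_cast; ring
  simp only [h1]
  rw [integral_exp_mul_complex hc']
  have hcc : (c : ℂ) ≠ 0 := by exact_mod_cast hc
  push_cast
  rw [Complex.sin]
  have e1 : -(c : ℂ) * Complex.I * 1 = -(c : ℂ) * Complex.I := by ring
  have e2 : -(c : ℂ) * Complex.I * -1 = (c : ℂ) * Complex.I := by ring
  rw [e1, e2]
  field_simp
  linear_combination (Complex.exp (-((c : ℂ) * Complex.I)) - Complex.exp ((c : ℂ) * Complex.I)) *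
    (-Complex.I_sq)

theorem integral_mul_cexp_sym {c : ℝ} (hc : c ≠ 0) :
    ∫ s in (-1 : ℝ)..1, (s : ℂ) * Complex.exp (((-(c * s) : ℝ) : ℂ) * Complex.I) =
      2 * Complex.I * (((c * Real.cos c - Real.sin c) / c ^ 2 : ℝ) : ℂ) := by
  have hcc : (c : ℂ) ≠ 0 := by exact_mod_cast hc
  have hd : ∀ s : ℝ, HasDerivAt (fun s : ℝ => Complex.exp (((-(c * s) : ℝ) : ℂ) * Complex.I) *
      (Complex.I * s / c + 1 / (c : ℂ) ^ 2))
      ((s : ℂ) * Complex.exp (((-(c * s) : ℝ) : ℂ) * Complex.I)) s := by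
    intro s
    have h1 : HasDerivAt (fun s : ℝ => ((-(c * s) : ℝ) : ℂ) * Complex.I) (((-c : ℝ) : ℂ) * Complex.I)
        s := by
      have : HasDerivAt (fun s : ℝ => -(c * s)) (-c) s := by
        simpa using ((hasDerivAt_id s).const_mul c).fun_neg
      exact this.ofReal_comp.mul_const _
    have h2 : HasDerivAt (fun s : ℝ => Complex.I * (s : ℂ) / c + 1 / (c : ℂ) ^ 2)
        (Complex.I * 1 / c) s :=
      (((hasDerivAt_id s).ofReal_comp.const_mul Complex.I).div_const _).add_const _
    refine (h1.cexp.mul h2).congr_deriv ?_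
    push_cast
    field_simp
    linear_combination (-(c : ℂ) * s) * Complex.I_sq
  rw [intervalIntegral.integral_eq_sub_of_hasDerivAt (fun s _ => hd s)
    (Continuous.intervalIntegrable (by fun_prop) _ _)]
  push_cast
  rw [Complex.sin, Complex.cos]
  have e1 : -((c : ℂ) * 1) * Complex.I = -(c : ℂ) * Complex.I := by ring
  have e2 : -((c : ℂ) * -1) * Complex.I = (c : ℂ) * Complex.I := by ring
  rw [e1, e2]
  field_simp
  linear_combination (Complex.exp (-((c : ℂ) * Complex.I)) - Complex.exp ((c : ℂ) * Complex.I)) *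
    Complex.I_sq

theorem norm_pos_unit {ξ : E3} (hξ : ξ ≠ 0) : ‖(‖ξ‖⁻¹ • ξ : E3)‖ = 1 := by
  rw [norm_smul, norm_inv, norm_norm, inv_mul_cancel₀ (norm_ne_zero_iff.2 hξ)]

theorem inner_eq_norm_mul_inner_unit {ξ : E3} (hξ : ξ ≠ 0) (x : E3) :
    inner ℝ x ξ = ‖ξ‖ * inner ℝ x (‖ξ‖⁻¹ • ξ) := by
  rw [inner_smul_right, ← mul_assoc, mul_inv_cancel₀ (norm_ne_zero_iff.2 hξ), one_mul]

theorem fourier_waveKernel {t ε : ℝ} (ht : 0 < t) (hε : 0 < ε) {ξ : E3} (hξ : ξ ≠ 0) :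
    𝓕 (waveKernel t ε) ξ = ((4 * Real.pi / (2 * Real.pi * ‖ξ‖) *
      (Real.exp (-ε * t) * (ε * Real.sin (2 * Real.pi * ‖ξ‖ * t)
        + 2 * Real.pi * ‖ξ‖ * Real.cos (2 * Real.pi * ‖ξ‖ * t)) /
          (ε ^ 2 + (2 * Real.pi * ‖ξ‖) ^ 2)) : ℝ) : ℂ) := by
  have hn : 0 < ‖ξ‖ := norm_pos_iff.2 hξ
  set b := 2 * Real.pi * ‖ξ‖ with hb
  have hb0 : 0 < b := by positivity
  rw [Real.fourier_eq']
  have hint : Integrable (fun v => Complex.exp (((-2 * Real.pi * inner ℝ v ξ : ℝ) : ℂ) * Complex.I) •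
      waveKernel t ε v) := by
    refine (integrable_waveKernel ht hε).bdd_mul (c := 1) ?_ (Filter.Eventually.of_forall fun v =>
      (Complex.norm_exp_ofReal_mul_I _).le)
    exact Continuous.aestronglyMeasurable (by fun_prop)
  rw [integral_norm_inner hint (norm_pos_unit hξ)
    (H := fun r s => Complex.exp (((-(b * s) : ℝ) : ℂ) * Complex.I) * (waveProfile t ε r : ℝ))
    (fun r => by fun_prop) (fun x => by
      rw [smul_eq_mul, waveKernel, inner_eq_norm_mul_inner_unit hξ x, hb]
      congr 4; ring)]
  have hinner : ∀ r ∈ Set.Ioi (0 : ℝ), ((r ^ 2 : ℝ) : ℂ) * (2 * Real.pi * ∫ s in (-1 : ℝ)..1,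
      Complex.exp (((-(b * (r * s)) : ℝ) : ℂ) * Complex.I) * (waveProfile t ε r : ℝ)) =
      (((Set.Ioi t).indicator (fun r => 4 * Real.pi / b * (Real.exp (-ε * r) * Real.sin (b * r))) r
        : ℝ) : ℂ) := by
    intro r hr
    have hr0 : 0 < r := hr
    rw [intervalIntegral.integral_mul_const]
    have e1 : ∀ s : ℝ, -(b * (r * s)) = -((b * r) * s) := fun s => by ring
    simp only [e1]
    rw [integral_cexp_sym (by positivity)]
    by_cases h : t < r
    · rw [Set.indicator_of_mem (show r ∈ Set.Ioi t from h), waveProfile, if_pos h]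
      norm_cast
      field_simp
      ring
    · rw [Set.indicator_of_notMem (show r ∉ Set.Ioi t from h), waveProfile, if_neg h]
      simp
  rw [setIntegral_congr_fun measurableSet_Ioi hinner, integral_complex_ofReal,
    setIntegral_indicator measurableSet_Ioi,
    Set.inter_eq_self_of_subset_right (Set.Ioi_subset_Ioi ht.le), integral_const_mul,
    integral_exp_mul_sin hε]

theorem hasDerivAt_sin_div {b r : ℝ} (hb : b ≠ 0) (hr : r ≠ 0) :
    HasDerivAt (fun r => Real.sin (b * r) / (b * r))
      ((b * r * Real.cos (b * r) - Real.sin (b * r)) / (b * r ^ 2)) r := by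
  have h : HasDerivAt (fun r : ℝ => b * r) b r := by simpa using (hasDerivAt_id r).const_mul b
  refine (h.sin.div h (mul_ne_zero hb hr)).congr_deriv ?_
  field_simp

/-- The symbol of the second regularised kernel, up to elementary factors. -/
def waveSymbolGrad (t ε b : ℝ) : ℝ :=
  (ε * t + 1) * Real.exp (-ε * t) * (Real.sin (b * t) / (b * t)) -
    ε ^ 2 / b * (Real.exp (-ε * t) * (ε * Real.sin (b * t) + b * Real.cos (b * t))
      / (ε ^ 2 + b ^ 2))

theorem hasDerivAt_waveSymbolGrad {ε b r : ℝ} (hε : 0 < ε) (hb : 0 < b) (hr : 0 < r) :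
    HasDerivAt (fun r => waveSymbolGrad r ε b) ((ε * r + 1) * Real.exp (-ε * r) *
      ((b * r * Real.cos (b * r) - Real.sin (b * r)) / (b * r ^ 2))) r := by
  have h1 : HasDerivAt (fun r : ℝ => Real.exp (-ε * r)) (Real.exp (-ε * r) * -ε) r := by
    simpa using ((hasDerivAt_id r).const_mul (-ε)).exp
  have h2 : HasDerivAt (fun r : ℝ => ε * r + 1) ε r := by
    simpa using ((hasDerivAt_id r).const_mul ε).add_const 1
  have h3 := ((h2.mul h1).mul (hasDerivAt_sin_div hb.ne' hr.ne')).add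
    ((hasDerivAt_exp_mul_sin (b := b) hε r).const_mul (ε ^ 2 / b))
  refine (h3.congr_of_eventuallyEq (Filter.Eventually.of_forall fun s => ?_)).congr_deriv ?_
  · simp only [waveSymbolGrad, Pi.add_apply, Pi.mul_apply]; ring
  · simp only [Pi.mul_apply]
    field_simp
    ring

theorem tendsto_waveSymbolGrad {ε b : ℝ} (hε : 0 < ε) (hb : 0 < b) :
    Filter.Tendsto (fun r => waveSymbolGrad r ε b) Filter.atTop (𝓝 0) := by
  have h1 : Filter.Tendsto (fun r => Real.exp (-ε * r) * Real.sin (b * r)) Filter.atTop (𝓝 0) :=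
    tendsto_exp_neg_mul_bounded hε fun r => Real.abs_sin_le_one _
  have h2 : Filter.Tendsto (fun r : ℝ => ε / b + 1 / b * r⁻¹) Filter.atTop (𝓝 (ε / b + 1 / b * 0)) :=
    (tendsto_inv_atTop_zero.const_mul _).const_add _
  have h3 := (h2.mul h1).add ((tendsto_antiderivative (b := b) hε).const_mul (ε ^ 2 / b))
  rw [mul_zero, mul_zero, add_zero] at h3
  refine h3.congr' ?_
  filter_upwards [Filter.eventually_gt_atTop 0] with r hr
  simp only [waveSymbolGrad]
  field_simp
  ring

/-- Only this combination of the transforms is needed. In spherical coordinates the angular integral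
yields the derivative of `sin (br) / (br)`, and the radial integrand is then the derivative of
`waveSymbolGrad` in its first argument. -/
theorem sum_coord_mul_fourier_waveKernelGrad {t ε : ℝ} (ht : 0 < t) (hε : 0 < ε) {ξ : E3}
    (hξ : ξ ≠ 0) :
    ∑ j, (ξ j : ℂ) * 𝓕 (waveKernelGrad t ε j) ξ =
      -2 * Complex.I * (waveSymbolGrad t ε (2 * Real.pi * ‖ξ‖) : ℝ) := by
  have hn : 0 < ‖ξ‖ := norm_pos_iff.2 hξ
  set b := 2 * Real.pi * ‖ξ‖ with hb
  have hb0 : 0 < b := by positivity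
  have hterm : ∀ j, Integrable (fun v => Complex.exp (((-2 * Real.pi * inner ℝ v ξ : ℝ) : ℂ) *
      Complex.I) • waveKernelGrad t ε j v) := by
    intro j
    refine (integrable_waveKernelGrad ht hε j).bdd_mul (c := 1) ?_
      (Filter.Eventually.of_forall fun v => (Complex.norm_exp_ofReal_mul_I _).le)
    exact Continuous.aestronglyMeasurable (by fun_prop)
  simp only [Real.fourier_eq']
  simp only [← integral_const_mul]
  rw [← integral_finsetSum _ fun j _ => (hterm j).const_mul _]
  have hint := integrable_finsetSum Finset.univ fun j _ => (hterm j).const_mul (ξ j : ℂ)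
  have hinn : ∀ x : E3, inner ℝ x ξ = ∑ j, ξ j * x j := fun x => by
    simp [PiLp.inner_apply]
  rw [integral_norm_inner hint (norm_pos_unit hξ)
    (H := fun r s => ((‖ξ‖ * (waveProfileGrad t ε r / r) : ℝ) : ℂ) *
      ((s : ℂ) * Complex.exp (((-(b * s) : ℝ) : ℂ) * Complex.I)))
    (fun r => by fun_prop) (fun x => by
      simp only [smul_eq_mul, waveKernelGrad]
      have e1 : ∀ j, (ξ j : ℂ) * (Complex.exp (((-2 * Real.pi * inner ℝ x ξ : ℝ) : ℂ) * Complex.I) *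
          ((waveProfileGrad t ε ‖x‖ * (x j / ‖x‖) : ℝ) : ℂ)) =
          (Complex.exp (((-2 * Real.pi * inner ℝ x ξ : ℝ) : ℂ) * Complex.I) *
          ((waveProfileGrad t ε ‖x‖ / ‖x‖ : ℝ) : ℂ)) * ((ξ j * x j : ℝ) : ℂ) := fun j => by
        push_cast; ring
      simp only [e1]
      rw [← Finset.mul_sum, ← Complex.ofReal_sum, ← hinn, inner_eq_norm_mul_inner_unit hξ x]
      have e2 : -2 * Real.pi * (‖ξ‖ * inner ℝ x (‖ξ‖⁻¹ • ξ)) = -(b * inner ℝ x (‖ξ‖⁻¹ • ξ)) := by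
        rw [hb]; ring
      rw [e2]
      push_cast; ring)]
  have hinner : ∀ r ∈ Set.Ioi (0 : ℝ), ((r ^ 2 : ℝ) : ℂ) * (2 * Real.pi * ∫ s in (-1 : ℝ)..1,
      ((‖ξ‖ * (waveProfileGrad t ε r / r) : ℝ) : ℂ) * (((r * s : ℝ) : ℂ) *
        Complex.exp (((-(b * (r * s)) : ℝ) : ℂ) * Complex.I))) =
      2 * Complex.I * (((Set.Ioi t).indicator (fun r => (ε * r + 1) * Real.exp (-ε * r) *
      ((b * r * Real.cos (b * r) - Real.sin (b * r)) / (b * r ^ 2))) r : ℝ) : ℂ) := by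
    intro r hr
    have hr0 : 0 < r := hr
    have e1 : ∀ s : ℝ, ((r * s : ℝ) : ℂ) * Complex.exp (((-(b * (r * s)) : ℝ) : ℂ) * Complex.I) =
      (r : ℂ) * ((s : ℂ) * Complex.exp (((-((b * r) * s) : ℝ) : ℂ) * Complex.I)) := fun s => by
        rw [← mul_assoc b]; push_cast; ring
    simp only [e1]
    rw [intervalIntegral.integral_const_mul, intervalIntegral.integral_const_mul,
      integral_mul_cexp_sym (by positivity)]
    have e2 : ∀ p q v w z : ℝ, (p : ℂ) * (2 * Real.pi * ((v : ℂ) * ((w : ℂ) *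
        (2 * Complex.I * (z : ℂ))))) = 2 * Complex.I * ((2 * Real.pi * p * v * w * z : ℝ) : ℂ) :=
      fun p q v w z => by push_cast; ring
    rw [e2 _ 0]
    congr 2
    by_cases h : t < r
    · rw [Set.indicator_of_mem (show r ∈ Set.Ioi t from h), waveProfileGrad, if_pos h]
      have : ‖ξ‖ = b / (2 * Real.pi) := by rw [hb]; field_simp
      rw [this]
      field_simp
    · rw [Set.indicator_of_notMem (show r ∉ Set.Ioi t from h), waveProfileGrad, if_neg h]
      simp
  rw [setIntegral_congr_fun measurableSet_Ioi hinner, integral_const_mul, integral_complex_ofReal,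
    setIntegral_indicator measurableSet_Ioi,
    Set.inter_eq_self_of_subset_right (Set.Ioi_subset_Ioi ht.le)]
  have hfi : IntegrableOn (fun r => (ε * r + 1) * Real.exp (-ε * r) *
      ((b * r * Real.cos (b * r) - Real.sin (b * r)) / (b * r ^ 2))) (Set.Ioi t) := by
    have hi1 : IntegrableOn (fun r => (ε + 1 / t) * (1 + 1 / (b * t)) * Real.exp (-ε * r))
        (Set.Ioi t) := (exp_neg_integrableOn_Ioi t hε).const_mul _
    refine hi1.mono' (Measurable.aestronglyMeasurable (by fun_prop)) ?_
    filter_upwards [ae_restrict_mem measurableSet_Ioi] with r hr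
    have hr0 : 0 < r := ht.trans hr
    have hrt : t ≤ r := le_of_lt hr
    have e : (ε * r + 1) * Real.exp (-ε * r) *
      ((b * r * Real.cos (b * r) - Real.sin (b * r)) / (b * r ^ 2)) =
      (ε + 1 / r) * (Real.cos (b * r) - 1 / (b * r) * Real.sin (b * r)) * Real.exp (-ε * r) := by
      field_simp
    rw [e, norm_mul, norm_mul, Real.norm_eq_abs, Real.norm_eq_abs, Real.norm_eq_abs,
      abs_of_pos (Real.exp_pos _), abs_of_pos (by positivity : 0 < ε + 1 / r)]
    refine mul_le_mul_of_nonneg_right ?_ (Real.exp_pos _).le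
    refine mul_le_mul (by gcongr) ?_ (abs_nonneg _) (by positivity)
    refine (abs_sub _ _).trans (add_le_add (Real.abs_cos_le_one _) ?_)
    rw [abs_mul, abs_of_pos (by positivity : 0 < 1 / (b * r))]
    refine (mul_le_of_le_one_right (by positivity) (Real.abs_sin_le_one _)).trans ?_
    gcongr
  rw [integral_Ioi_of_hasDerivAt_of_tendsto'
    (fun r hr => hasDerivAt_waveSymbolGrad hε hb0 (ht.trans_le hr)) hfi
    (tendsto_waveSymbolGrad hε hb0)]
  push_cast; ring

/-! ### The dispersive estimate for the wave equation -/

/-- The dominated convergence theorem in `L²`, along a countably generated filter. -/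
theorem tendsto_eLpNorm_two_of_dominated {ι : Type*} {l : Filter ι} [l.IsCountablyGenerated]
    {F : ι → E3 → ℂ} {f : E3 → ℂ} {bound : E3 → ℝ}
    (hF : ∀ᶠ n in l, AEStronglyMeasurable (F n) volume) (hf : AEStronglyMeasurable f volume)
    (hb : MemLp bound 2 volume) (hle : ∀ᶠ n in l, ∀ᵐ x, ‖F n x - f x‖ ≤ bound x)
    (hlim : ∀ᵐ x, Filter.Tendsto (fun n => F n x) l (𝓝 (f x))) :
    Filter.Tendsto (fun n => eLpNorm (F n - f) 2 volume) l (𝓝 0) := by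
  simp only [eLpNorm_eq_lintegral_rpow_enorm_toReal two_ne_zero ENNReal.ofNat_ne_top,
    ENNReal.toReal_ofNat]
  have h : Filter.Tendsto (fun n => ∫⁻ x, ‖(F n - f) x‖ₑ ^ (2 : ℝ)) l
      (𝓝 (∫⁻ _ : E3, (0 : ℝ≥0∞))) := by
    refine tendsto_lintegral_filter_of_dominated_convergence' (fun x => ‖bound x‖ₑ ^ (2 : ℝ)) ?_ ?_
      ?_ ?_
    · filter_upwards [hF] with n hn
      exact (hn.sub hf).enorm.pow_const _
    · filter_upwards [hle] with n hn
      filter_upwards [hn] with x hx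
      refine ENNReal.rpow_le_rpow ?_ (by norm_num)
      rw [Pi.sub_apply, enorm_le_iff_norm_le]
      exact hx.trans (Real.le_norm_self _)
    · have := (eLpNorm_lt_top_iff_lintegral_rpow_enorm_lt_top two_ne_zero
        ENNReal.ofNat_ne_top).1 hb.2
      simpa using this.ne
    · filter_upwards [hlim] with x hx
      have h1 : Filter.Tendsto (fun n => ‖F n x - f x‖ₑ) l (𝓝 0) := by
        have := (hx.sub_const (f x)).enorm
        simpa using this
      have h2 := (ENNReal.continuous_rpow_const (y := (2 : ℝ))).tendsto 0 |>.comp h1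
      simpa [Function.comp_def] using h2
  rw [lintegral_zero] at h
  have h2 := (ENNReal.continuous_rpow_const (y := (1 / 2 : ℝ))).tendsto 0 |>.comp h
  simpa [Function.comp_def] using h2

theorem isFourierInv_fourier {k : E3 → ℂ} (hk : Integrable k) : IsFourierInv (𝓕 k) k := by
  intro ψ
  have h : 𝓕 (⇑(𝓕⁻ ψ : 𝓢(E3, ℂ))) = ψ := by
    rw [← SchwartzMap.fourier_coe, fourier_fourierInv_eq]
  rw [integral_fourier_mul_eq_flip (𝓕⁻ ψ : 𝓢(E3, ℂ)).integrable hk, h]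

theorem convolution_integrable_and_bound {N g : E3 → ℂ} (hN : Integrable N) (hg : Integrable g)
    {C : ℝ} (hC : ∀ x, ‖N x‖ ≤ C) :
    ∃ k : E3 → ℂ, Integrable k ∧ (∀ ξ, 𝓕 k ξ = 𝓕 N ξ * 𝓕 g ξ) ∧ ∀ x, ‖k x‖ ≤ C * ∫ y, ‖g y‖ := by
  refine ⟨convolution N g (ContinuousLinearMap.mul ℂ ℂ) volume, hN.integrable_convolution _ hg,
    fun ξ => Real.fourier_mul_convolution_eq hN hg ξ, fun x => ?_⟩
  have h := norm_integral_le_of_norm_le (f := fun y => N y * g (x - y))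
    (g := fun y => C * ‖g (x - y)‖) ((hg.comp_sub_left x).norm.const_mul C)
    (Filter.Eventually.of_forall fun y => by
      rw [norm_mul]; exact mul_le_mul_of_nonneg_right (hC y) (norm_nonneg _))
  rw [integral_const_mul, integral_sub_left_eq_self (fun y => ‖g y‖) volume x] at h
  exact h

/-- The symbol that regularises `cos (bt)`. -/
def regCos (t ε b : ℝ) : ℝ :=
  b * (Real.exp (-ε * t) * (ε * Real.sin (b * t) + b * Real.cos (b * t)) / (ε ^ 2 + b ^ 2))

/-- The symbol that regularises `sin (bt)`. -/
def regSin (t ε b : ℝ) : ℝ := t * b * waveSymbolGrad t ε b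

theorem abs_exp_mul_combination_le {t ε : ℝ} (ht : 0 < t) (hε : 0 < ε) {b c : ℝ} (hb : 0 ≤ b)
    (hc : 0 ≤ c) (hcb : c * (ε + b) ≤ 2 * (ε ^ 2 + b ^ 2)) :
    |c * (Real.exp (-ε * t) * (ε * Real.sin (b * t) + b * Real.cos (b * t)) / (ε ^ 2 + b ^ 2))| ≤
      2 := by
  have h0 : 0 < ε ^ 2 + b ^ 2 := by positivity
  have he : Real.exp (-ε * t) ≤ 1 := Real.exp_le_one_iff.2 (by nlinarith)
  rw [abs_mul, abs_div, abs_mul, abs_of_nonneg hc, abs_of_pos h0, abs_of_pos (Real.exp_pos _),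
    ← mul_div_assoc, div_le_iff₀ h0]
  refine le_trans ?_ hcb
  refine mul_le_mul_of_nonneg_left ?_ hc
  refine (mul_le_of_le_one_left (abs_nonneg _) he).trans ?_
  have := abs_sin_cos_combination_le ε b (b * t)
  rwa [abs_of_pos hε, abs_of_nonneg hb] at this

theorem abs_regCos_le {t ε b : ℝ} (ht : 0 < t) (hε : 0 < ε) (hb : 0 ≤ b) : |regCos t ε b| ≤ 2 :=
  abs_exp_mul_combination_le ht hε hb hb (by nlinarith [sq_nonneg (ε - b), sq_nonneg ε])

theorem regSin_eq {t ε b : ℝ} (ht : 0 < t) (hb : 0 < b) :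
    regSin t ε b = (ε * t + 1) * Real.exp (-ε * t) * Real.sin (b * t) - t * ε * (ε *
      (Real.exp (-ε * t) * (ε * Real.sin (b * t) + b * Real.cos (b * t)) / (ε ^ 2 + b ^ 2))) := by
  unfold regSin waveSymbolGrad
  field_simp

theorem abs_regSin_le {t ε b : ℝ} (ht : 0 < t) (hε : 0 < ε) (hε1 : ε ≤ 1) (hb : 0 < b) :
    |regSin t ε b| ≤ 1 + 3 * t := by
  rw [regSin_eq ht hb]
  have h1 := abs_exp_mul_combination_le ht hε hb.le hε.le
    (by nlinarith [sq_nonneg (ε - b), sq_nonneg b])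
  have he : Real.exp (-ε * t) ≤ 1 := Real.exp_le_one_iff.2 (by nlinarith)
  refine (abs_sub _ _).trans ?_
  have h2 : |(ε * t + 1) * Real.exp (-ε * t) * Real.sin (b * t)| ≤ t + 1 := by
    rw [abs_mul]
    refine (mul_le_of_le_one_right (abs_nonneg _) (Real.abs_sin_le_one _)).trans ?_
    rw [abs_mul, abs_of_pos (Real.exp_pos _), abs_of_pos (by positivity)]
    refine (mul_le_of_le_one_right (by positivity) he).trans ?_
    nlinarith
  have h3 : ∀ z : ℝ, |z| ≤ 2 → |t * ε * z| ≤ 2 * t := fun z hz => by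
    rw [abs_mul, abs_of_pos (by positivity)]
    have : t * ε ≤ t := by nlinarith
    nlinarith [abs_nonneg z]
  have := h3 _ h1
  linarith

theorem tendsto_regCos (t : ℝ) {b : ℝ} (hb : 0 < b) :
    Filter.Tendsto (fun ε => regCos t ε b) (𝓝 0) (𝓝 (Real.cos (t * b))) := by
  have h : ContinuousAt (fun ε => regCos t ε b) 0 := by
    unfold regCos
    exact ContinuousAt.mul continuousAt_const
      (ContinuousAt.div (by fun_prop) (by fun_prop) (by positivity))
  have e : regCos t 0 b = Real.cos (t * b) := by
    unfold regCos; field_simp; simp; ring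
  rw [← e]; exact h

theorem tendsto_regSin {t b : ℝ} (ht : 0 < t) (hb : 0 < b) :
    Filter.Tendsto (fun ε => regSin t ε b) (𝓝 0) (𝓝 (Real.sin (t * b))) := by
  simp only [regSin_eq ht hb]
  have h : ContinuousAt (fun ε => (ε * t + 1) * Real.exp (-ε * t) * Real.sin (b * t) - t * ε * (ε *
      (Real.exp (-ε * t) * (ε * Real.sin (b * t) + b * Real.cos (b * t)) / (ε ^ 2 + b ^ 2)))) 0 :=
    ContinuousAt.sub (by fun_prop) (ContinuousAt.mul (by fun_prop) (ContinuousAt.mul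
      (by fun_prop) (ContinuousAt.div (by fun_prop) (by fun_prop) (by positivity))))
  have h2 := h.tendsto
  simpa [mul_comm b t] using h2

theorem measurable_regCos (t ε : ℝ) : Measurable (regCos t ε) := by
  unfold regCos; fun_prop

theorem measurable_regSin (t ε : ℝ) : Measurable (regSin t ε) := by
  unfold regSin waveSymbolGrad; fun_prop

theorem memLp_bounded_mul {X m : E3 → ℂ} (hX : MemLp X 2 volume) (hm : AEStronglyMeasurable m volume)
    {C : ℝ} (hC : ∀ᵐ x, ‖m x‖ ≤ C) : MemLp (fun x => m x * X x) 2 volume := by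
  refine MemLp.of_le_mul (c := C) hX (hm.mul hX.1) ?_
  filter_upwards [hC] with x hx
  rw [norm_mul]
  exact mul_le_mul_of_nonneg_right hx (norm_nonneg _)

theorem ae_ne_zero : ∀ᵐ x : E3, x ≠ 0 := by
  simp [ae_iff, measure_singleton]

/-- The function with Fourier transform `m X + n Y`, where `m` and `n` regularise `cos (ωt)` and
`sin (ωt)`, is a sum of convolutions of bounded kernels with integrable functions. -/
theorem regularised_wave_bound {t ε : ℝ} (ht : 0 < t) (hε : 0 < ε) (hεt : ε ≤ t⁻¹) {X Y g : E3 → ℂ}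
    {gg : Fin 3 → E3 → ℂ} (hg : Integrable g) (hgg : ∀ j, Integrable (gg j))
    (h1 : ∀ᵐ ξ : E3, (((2 * Real.pi * ‖ξ‖) ^ 2 : ℝ) : ℂ) * X ξ = 𝓕 g ξ)
    (h2 : ∀ j, ∀ᵐ ξ : E3, ((‖ξ‖ * ξ j : ℝ) : ℂ) * Y ξ = 𝓕 (gg j) ξ) :
    ∃ k : E3 → ℂ, Integrable k ∧
      IsFourierInv (fun ξ => ((regCos t ε (2 * Real.pi * ‖ξ‖) : ℝ) : ℂ) * X ξ +
        ((regSin t ε (2 * Real.pi * ‖ξ‖) : ℝ) : ℂ) * Y ξ) k ∧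
      ∀ x, ‖k x‖ ≤ t⁻¹ * ((∫ y, ‖g y‖) + 2 * Real.pi * ∑ j, ∫ y, ‖gg j y‖) := by
  have hexp : ∀ x : E3, Real.exp (-ε * ‖x‖) ≤ 1 := fun x =>
    Real.exp_le_one_iff.2 (by nlinarith [norm_nonneg x])
  obtain ⟨k0, hk0, hk0F, hk0b⟩ := convolution_integrable_and_bound (integrable_waveKernel ht hε) hg
    (C := t⁻¹) (fun x => by
      rw [waveKernel, Complex.norm_real]
      exact (waveProfile_bounds ht).trans (mul_le_of_le_one_right (by positivity) (hexp x)))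
  have hG : ∀ j, ∃ k : E3 → ℂ, Integrable k ∧
      (∀ ξ, 𝓕 k ξ = 𝓕 (waveKernelGrad t ε j) ξ * 𝓕 (gg j) ξ) ∧
      ∀ x, ‖k x‖ ≤ t⁻¹ * (t⁻¹ + t⁻¹) * ∫ y, ‖gg j y‖ := fun j =>
    convolution_integrable_and_bound (integrable_waveKernelGrad ht hε j) (hgg j) (fun x => by
      refine (norm_waveKernelGrad_le ht hε j x).trans ?_
      refine (mul_le_of_le_one_right (by positivity) (hexp x)).trans ?_
      gcongr)
  choose k hk hkF hkb using hG
  have hc1 : ‖(((4 * Real.pi)⁻¹ : ℝ) : ℂ)‖ ≤ 1 := by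
    rw [Complex.norm_real, Real.norm_of_nonneg (by positivity)]
    exact inv_le_one_of_one_le₀ (by linarith [Real.pi_gt_three])
  have hc2 : ‖Complex.I * ((Real.pi * t : ℝ) : ℂ)‖ = Real.pi * t := by
    rw [norm_mul, Complex.norm_I, one_mul, Complex.norm_real, Real.norm_of_nonneg (by positivity)]
  set K : E3 → ℂ := (((4 * Real.pi)⁻¹ : ℝ) : ℂ) • k0 +
    (Complex.I * ((Real.pi * t : ℝ) : ℂ)) • ∑ j, k j with hK
  have hKi : Integrable K := (hk0.smul _).add ((integrable_finsetSum' _ fun j _ => hk j).smul _)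
  refine ⟨K, hKi, (isFourierInv_fourier hKi).congr ?_ (ae_eq_refl _), fun x => ?_⟩
  · have hFK : ∀ ξ, 𝓕 K ξ = (((4 * Real.pi)⁻¹ : ℝ) : ℂ) * 𝓕 k0 ξ +
        Complex.I * ((Real.pi * t : ℝ) : ℂ) * ∑ j, 𝓕 (k j) ξ := by
      intro ξ
      simp only [Real.fourier_eq, hK, Pi.add_apply, Pi.smul_apply, Finset.sum_apply, smul_add,
        Finset.smul_sum]
      have hi : ∀ {f : E3 → ℂ}, Integrable f →
          Integrable fun v => Real.fourierChar (-inner ℝ v ξ) • f v := fun hf => by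
        have := (Real.fourierIntegral_convergent_iff (μ := volume) ξ).2 hf
        simpa using this
      have e1 : ∀ (c z : ℂ) (v : E3), Real.fourierChar (-inner ℝ v ξ) • c • z =
          c * (Real.fourierChar (-inner ℝ v ξ) • z) := fun c z v => by
        simp only [smul_eq_mul, Circle.smul_def]; ring
      simp only [e1]
      rw [integral_add ((hi hk0).const_mul _)
        (integrable_finsetSum _ fun j _ => (hi (hk j)).const_mul _), integral_const_mul,
        integral_finsetSum _ fun j _ => (hi (hk j)).const_mul _]
      simp only [integral_const_mul, Finset.mul_sum]
    filter_upwards [h1, ae_all_iff.2 h2, ae_ne_zero] with ξ h1 h2 hξ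
    have hb : 0 < 2 * Real.pi * ‖ξ‖ := by positivity
    rw [hFK, hk0F, ← h1, fourier_waveKernel ht hε hξ]
    simp only [hkF, ← h2]
    have e : ∑ j, 𝓕 (waveKernelGrad t ε j) ξ * (((‖ξ‖ * ξ j : ℝ) : ℂ) * Y ξ) =
        ‖ξ‖ * Y ξ * ∑ j, (ξ j : ℂ) * 𝓕 (waveKernelGrad t ε j) ξ := by
      rw [Finset.mul_sum]
      refine Finset.sum_congr rfl fun j _ => ?_
      push_cast; ring
    rw [e, sum_coord_mul_fourier_waveKernelGrad ht hε hξ, regCos, regSin]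
    congr 1
    · rw [← mul_assoc, ← mul_assoc, ← Complex.ofReal_mul, ← Complex.ofReal_mul]
      congr 2
      field_simp
    · push_cast
      linear_combination (-2 * Real.pi * t * ‖ξ‖ * Y ξ *
        (waveSymbolGrad t ε (2 * Real.pi * ‖ξ‖) : ℝ)) * Complex.I_sq
  · have e : K x = (((4 * Real.pi)⁻¹ : ℝ) : ℂ) * k0 x +
        (Complex.I * ((Real.pi * t : ℝ) : ℂ)) * ∑ j, k j x := by
      simp [hK, Finset.sum_apply]
    rw [e]
    refine (norm_add_le _ _).trans ?_
    rw [norm_mul, norm_mul, hc2, mul_add]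
    refine add_le_add ((mul_le_of_le_one_left (norm_nonneg _) hc1).trans (hk0b x)) ?_
    have hs : ‖∑ j, k j x‖ ≤ t⁻¹ * (t⁻¹ + t⁻¹) * ∑ j, ∫ y, ‖gg j y‖ := by
      refine (norm_sum_le _ _).trans ?_
      rw [Finset.mul_sum]
      exact Finset.sum_le_sum fun j _ => hkb j x
    refine (mul_le_mul_of_nonneg_left hs (by positivity)).trans (le_of_eq ?_)
    field_simp
    ring

/-- The dispersive estimate: a solution of the wave equation, with data whose second order
derivatives (suitably arranged) are integrable, decays like `t⁻¹` in the uniform norm. -/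
theorem dispersive_estimate {t : ℝ} (ht : 0 < t) {X Y g B : E3 → ℂ} {gg : Fin 3 → E3 → ℂ}
    (hX : MemLp X 2 volume) (hY : MemLp Y 2 volume) (hg : Integrable g)
    (hgg : ∀ j, Integrable (gg j))
    (h1 : ∀ᵐ ξ : E3, (((2 * Real.pi * ‖ξ‖) ^ 2 : ℝ) : ℂ) * X ξ = 𝓕 g ξ)
    (h2 : ∀ j, ∀ᵐ ξ : E3, ((‖ξ‖ * ξ j : ℝ) : ℂ) * Y ξ = 𝓕 (gg j) ξ) (hB : LocallyIntegrable B)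
    (h : IsFourierInv (fun ξ => ((Real.cos (t * (2 * Real.pi * ‖ξ‖)) : ℝ) : ℂ) * X ξ +
        ((Real.sin (t * (2 * Real.pi * ‖ξ‖)) : ℝ) : ℂ) * Y ξ) B) :
    eLpNorm B ∞ volume ≤
      ENNReal.ofReal (t⁻¹ * ((∫ y, ‖g y‖) + 2 * Real.pi * ∑ j, ∫ y, ‖gg j y‖)) := by
  set C := t⁻¹ * ((∫ y, ‖g y‖) + 2 * Real.pi * ∑ j, ∫ y, ‖gg j y‖) with hCdef
  have hC0 : 0 ≤ C := by positivity
  -- regularisation parameters that tend to `0` and stay below `1` and `t⁻¹`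
  set e : ℕ → ℝ := fun n => min 1 t⁻¹ * (1 / ((n : ℝ) + 1)) with he
  have hm : 0 < min 1 t⁻¹ := lt_min one_pos (by positivity)
  have he0 : ∀ n, 0 < e n := fun n => by positivity
  have hle : ∀ n, e n ≤ min 1 t⁻¹ := fun n => mul_le_of_le_one_right hm.le (by
    rw [div_le_one (by positivity)]; linarith [Nat.cast_nonneg (α := ℝ) n])
  have hlim : Filter.Tendsto e Filter.atTop (𝓝 0) := by
    have := tendsto_one_div_add_atTop_nhds_zero_nat (𝕜 := ℝ) |>.const_mul (min 1 t⁻¹)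
    simpa [he] using this
  have hmeas : Measurable fun ξ : E3 => 2 * Real.pi * ‖ξ‖ := by fun_prop
  have hsym : ∀ {m : ℝ → ℝ}, Measurable m →
      AEStronglyMeasurable (fun ξ : E3 => ((m (2 * Real.pi * ‖ξ‖) : ℝ) : ℂ)) volume := fun hm =>
    (Complex.measurable_ofReal.comp (hm.comp hmeas)).aestronglyMeasurable
  set a : ℕ → E3 → ℂ := fun n ξ => ((regCos t (e n) (2 * Real.pi * ‖ξ‖) : ℝ) : ℂ) * X ξ +
        ((regSin t (e n) (2 * Real.pi * ‖ξ‖) : ℝ) : ℂ) * Y ξ with ha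
  set a0 : E3 → ℂ := fun ξ => ((Real.cos (t * (2 * Real.pi * ‖ξ‖)) : ℝ) : ℂ) * X ξ +
        ((Real.sin (t * (2 * Real.pi * ‖ξ‖)) : ℝ) : ℂ) * Y ξ with ha0
  have hcb : ∀ n, ∀ᵐ ξ : E3, ‖((regCos t (e n) (2 * Real.pi * ‖ξ‖) : ℝ) : ℂ)‖ ≤ 2 := fun n =>
    Filter.Eventually.of_forall fun ξ => by
      rw [Complex.norm_real]; exact abs_regCos_le ht (he0 n) (by positivity)
  have hsb : ∀ n, ∀ᵐ ξ : E3, ‖((regSin t (e n) (2 * Real.pi * ‖ξ‖) : ℝ) : ℂ)‖ ≤ 1 + 3 * t :=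
    fun n => by
      filter_upwards [ae_ne_zero] with ξ hξ
      rw [Complex.norm_real]
      exact abs_regSin_le ht (he0 n) ((hle n).trans (min_le_left _ _)) (by positivity)
  have haL : ∀ n, MemLp (a n) 2 volume := fun n =>
    (memLp_bounded_mul hX (hsym (measurable_regCos t _)) (hcb n)).add
      (memLp_bounded_mul hY (hsym (measurable_regSin t _)) (hsb n))
  have ha0L : MemLp a0 2 volume :=
    (memLp_bounded_mul hX (hsym (m := fun b => Real.cos (t * b)) (by fun_prop)) (C := 1)
      (Filter.Eventually.of_forall fun ξ => by
        rw [Complex.norm_real]; exact Real.abs_cos_le_one _)).add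
    (memLp_bounded_mul hY (hsym (m := fun b => Real.sin (t * b)) (by fun_prop)) (C := 1)
      (Filter.Eventually.of_forall fun ξ => by
        rw [Complex.norm_real]; exact Real.abs_sin_le_one _))
  have hconv : Filter.Tendsto (fun n => eLpNorm (a n - a0) 2 volume) Filter.atTop (𝓝 0) := by
    refine tendsto_eLpNorm_two_of_dominated (bound := fun ξ => 3 * ‖X ξ‖ + (2 + 3 * t) * ‖Y ξ‖)
      (Filter.Eventually.of_forall fun n => (haL n).1) ha0L.1
      ((hX.norm.const_mul 3).add (hY.norm.const_mul (2 + 3 * t)))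
      (Filter.Eventually.of_forall fun n => ?_) ?_
    · filter_upwards [hcb n, hsb n] with ξ h1 h2
      have e1 : a n ξ - a0 ξ = (((regCos t (e n) (2 * Real.pi * ‖ξ‖) : ℝ) : ℂ) -
          ((Real.cos (t * (2 * Real.pi * ‖ξ‖)) : ℝ) : ℂ)) * X ξ +
          (((regSin t (e n) (2 * Real.pi * ‖ξ‖) : ℝ) : ℂ) -
          ((Real.sin (t * (2 * Real.pi * ‖ξ‖)) : ℝ) : ℂ)) * Y ξ := by
        simp only [ha, ha0]; ring
      rw [e1]
      refine (norm_add_le _ _).trans ?_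
      rw [norm_mul, norm_mul]
      have h3 : ‖((Real.cos (t * (2 * Real.pi * ‖ξ‖)) : ℝ) : ℂ)‖ ≤ 1 := by
        rw [Complex.norm_real]; exact Real.abs_cos_le_one _
      have h4 : ‖((Real.sin (t * (2 * Real.pi * ‖ξ‖)) : ℝ) : ℂ)‖ ≤ 1 := by
        rw [Complex.norm_real]; exact Real.abs_sin_le_one _
      refine add_le_add (mul_le_mul_of_nonneg_right ?_ (norm_nonneg _))
        (mul_le_mul_of_nonneg_right ?_ (norm_nonneg _))
      · exact (norm_sub_le _ _).trans (by linarith)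
      · exact (norm_sub_le _ _).trans (by linarith)
    · filter_upwards [ae_ne_zero] with ξ hξ
      have hb : 0 < 2 * Real.pi * ‖ξ‖ := by positivity
      refine Filter.Tendsto.add (Filter.Tendsto.mul_const _ ?_) (Filter.Tendsto.mul_const _ ?_)
      · exact (Complex.continuous_ofReal.tendsto _).comp ((tendsto_regCos t hb).comp hlim)
      · exact (Complex.continuous_ofReal.tendsto _).comp ((tendsto_regSin ht hb).comp hlim)
  have hLp := (Lp.tendsto_Lp_iff_tendsto_eLpNorm'' a haL a0 ha0L).2 hconv
  have hF : Filter.Tendsto (fun n => (𝓕⁻ ((haL n).toLp (a n)) : L2C)) Filter.atTop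
      (𝓝 (𝓕⁻ (ha0L.toLp a0) : L2C)) :=
    ((Lp.fourierTransformₗᵢ E3 ℂ).symm.continuous.tendsto _).comp hLp
  have hbound : ∀ n, eLpNorm (𝓕⁻ ((haL n).toLp (a n)) : L2C) ∞ volume ≤ ENNReal.ofReal C := by
    intro n
    obtain ⟨k, hk, hkF, hkb⟩ := regularised_wave_bound ht (he0 n)
      ((hle n).trans (min_le_right _ _)) hg hgg h1 h2
    have h3 := (isFourierInv_fourierInv_Lp ((haL n).toLp (a n))).congr (haL n).coeFn_toLp
      (ae_eq_refl _)
    have h4 := h3.unique hkF (memLp_two_locallyIntegrable (Lp.memLp _)) hk.locallyIntegrable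
    rw [eLpNorm_congr_ae h4]
    exact eLpNormEssSup_le_of_ae_bound (Filter.Eventually.of_forall hkb)
  -- the uniform bound passes to the limit in `L²`, since that limit is also one in measure
  have h5 := eLpNorm_le_of_tendstoInMeasure (Filter.Eventually.of_forall hbound)
    (tendstoInMeasure_of_tendsto_Lp hF) (fun n => (Lp.memLp _).1)
  have h6 := ((isFourierInv_fourierInv_Lp (ha0L.toLp a0)).congr ha0L.coeFn_toLp
      (ae_eq_refl _)).unique h (memLp_two_locallyIntegrable (Lp.memLp _)) hB
  rwa [eLpNorm_congr_ae h6] at h5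

/-! ### Weighted `L²` spaces -/

/-- `(1 + |x|)ⁿ b ∈ L²`. -/
def MemWeightedL2 (n : ℕ) (b : E3 → ℂ) : Prop :=
  MemLp (fun x => (((1 + ‖x‖) ^ n : ℝ) : ℂ) * b x) 2 volume

theorem memLp_two_one_add_norm_inv_sq :
    MemLp (fun x : E3 => (((1 + ‖x‖) ^ 2)⁻¹ : ℝ)) 2 volume := by
  have hc : Continuous fun x : E3 => (((1 + ‖x‖) ^ 2)⁻¹ : ℝ) :=
    Continuous.inv₀ (by fun_prop) (fun x => by positivity)
  refine (memLp_two_iff_integrable_sq hc.aestronglyMeasurable).2 ?_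
  have h := integrable_one_add_norm (E := E3) (μ := volume) (r := 4)
    (by rw [finrank_euclideanSpace_fin]; norm_num)
  refine h.congr (Filter.Eventually.of_forall fun x => ?_)
  have h0 : 0 < 1 + ‖x‖ := by positivity
  simp only
  rw [Real.rpow_neg h0.le]
  norm_cast
  rw [inv_pow, ← pow_mul]

namespace MemWeightedL2

variable {n : ℕ} {b : E3 → ℂ}

theorem aestronglyMeasurable (hb : MemWeightedL2 n b) : AEStronglyMeasurable b volume := by
  have h : AEStronglyMeasurable (fun x : E3 => ((((1 + ‖x‖) ^ n)⁻¹ : ℝ) : ℂ)) volume := by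
    refine Continuous.aestronglyMeasurable (Complex.continuous_ofReal.comp
      (Continuous.inv₀ (by fun_prop) (fun x => by positivity)))
  refine (h.mul hb.1).congr (Filter.Eventually.of_forall fun x => ?_)
  have h0 : (1 + ‖x‖) ^ n ≠ 0 := by positivity
  simp only [Pi.mul_apply]
  rw [← mul_assoc, ← Complex.ofReal_mul, inv_mul_cancel₀ h0, Complex.ofReal_one, one_mul]

theorem mul_memLp (hb : MemWeightedL2 n b) {m : E3 → ℂ} (hm : AEStronglyMeasurable m volume) (C : ℝ)
    (hC : ∀ x, ‖m x‖ ≤ C * (1 + ‖x‖) ^ n) : MemLp (fun x => m x * b x) 2 volume := by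
  refine MemLp.of_le_mul (c := C) hb (hm.mul hb.aestronglyMeasurable)
    (Filter.Eventually.of_forall fun x => ?_)
  rw [norm_mul, norm_mul, Complex.norm_real, Real.norm_of_nonneg (by positivity), ← mul_assoc]
  exact mul_le_mul_of_nonneg_right (hC x) (norm_nonneg _)

theorem mul_integrable (hb : MemWeightedL2 n b) {m : E3 → ℂ} (hm : AEStronglyMeasurable m volume)
    (C : ℝ) {k : ℕ} (hk : k + 2 ≤ n) (hC : ∀ x, ‖m x‖ ≤ C * (1 + ‖x‖) ^ k) :
    Integrable (fun x => m x * b x) := by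
  have h := (memLp_two_one_add_norm_inv_sq.const_mul C).integrable_mul hb.norm
  refine h.mono' (hm.mul hb.aestronglyMeasurable) (Filter.Eventually.of_forall fun x => ?_)
  simp only [Pi.mul_apply]
  rw [norm_mul, norm_mul, Complex.norm_real, Real.norm_of_nonneg (by positivity), ← mul_assoc]
  refine mul_le_mul_of_nonneg_right ((hC x).trans ?_) (norm_nonneg _)
  have hC0 : 0 ≤ C := by
    have := (norm_nonneg _).trans (hC 0)
    simpa using this
  rw [mul_assoc]
  refine mul_le_mul_of_nonneg_left ?_ hC0
  rw [inv_mul_eq_div, le_div_iff₀ (by positivity), ← pow_add]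
  exact pow_le_pow_right₀ (by linarith [norm_nonneg x]) hk

theorem memLp (hb : MemWeightedL2 n b) : MemLp b 2 volume := by
  have := hb.mul_memLp (m := fun _ => 1) aestronglyMeasurable_const 1 (fun x => by
    rw [norm_one, one_mul]; exact one_le_pow₀ (by linarith [norm_nonneg x]))
  simpa using this

theorem integrable (hb : MemWeightedL2 n b) (hn : 2 ≤ n) : Integrable b := by
  have := hb.mul_integrable (m := fun _ => 1) (k := 0) aestronglyMeasurable_const 1 (by omega)
    (fun x => by simp)
  simpa using this

theorem reflect (hb : MemWeightedL2 n b) : MemWeightedL2 n (fun ξ => starRingEnd ℂ (b (-ξ))) := by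
  have h1 := hb.comp_measurePreserving (Measure.measurePreserving_neg volume)
  have h2 : MemLp (fun x => starRingEnd ℂ ((((1 + ‖-x‖) ^ n : ℝ) : ℂ) * b (-x))) 2 volume := by
    exact h1.star
  refine h2.ae_eq (Filter.Eventually.of_forall fun x => ?_)
  simp only [map_mul, Complex.conj_ofReal, norm_neg]

end MemWeightedL2

theorem memLp_two_of_lintegral_sq {f : E3 → ℂ} (hf : AEStronglyMeasurable f volume)
    (h : ∫⁻ x, ‖f x‖ₑ ^ 2 < ⊤) : MemLp f 2 volume := by
  refine ⟨hf, (eLpNorm_lt_top_iff_lintegral_rpow_enorm_lt_top two_ne_zero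
    ENNReal.ofNat_ne_top).2 ?_⟩
  simpa using h

theorem lintegral_sq_lt_top {f : E3 → ℂ} (hf : MemLp f 2 volume) : ∫⁻ x, ‖f x‖ₑ ^ 2 < ⊤ := by
  have := (eLpNorm_lt_top_iff_lintegral_rpow_enorm_lt_top two_ne_zero
        ENNReal.ofNat_ne_top).1 hf.2
  simpa using this

/-- The Cauchy–Schwarz inequality with respect to the measure with density `f`. -/
theorem lintegral_mul_sq_le {α : Type*} [MeasurableSpace α] {μ : Measure α} {f g : α → ℝ≥0∞}
    (hf : AEMeasurable f μ) (hg : AEMeasurable g μ) :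
    (∫⁻ x, f x * g x ∂μ) ^ 2 ≤ (∫⁻ x, f x ∂μ) * ∫⁻ x, f x * g x ^ 2 ∂μ := by
  have h := ENNReal.lintegral_mul_le_Lp_mul_Lq μ Real.HolderConjugate.two_two
    (hf.pow_const (1 / 2 : ℝ)) ((hf.pow_const (1 / 2 : ℝ)).mul hg)
  have e1 : ∀ x, f x ^ (1 / 2 : ℝ) * (f x ^ (1 / 2 : ℝ) * g x) = f x * g x := fun x => by
    rw [← mul_assoc, ← ENNReal.rpow_add_of_nonneg _ _ (by norm_num) (by norm_num)]
    norm_num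
  have e2 : ∀ x, (f x ^ (1 / 2 : ℝ)) ^ (2 : ℝ) = f x := fun x => by
    rw [← ENNReal.rpow_mul]; norm_num
  simp only [Pi.mul_apply, e1, ENNReal.mul_rpow_of_nonneg _ _ (zero_le_two : (0 : ℝ) ≤ 2), e2,
    ENNReal.rpow_two] at h
  refine (pow_le_pow_left' h 2).trans (le_of_eq ?_)
  rw [mul_pow]
  have e3 : ∀ z : ℝ≥0∞, (z ^ (1 / 2 : ℝ)) ^ 2 = z := fun z => by
    rw [← ENNReal.rpow_two, ← ENNReal.rpow_mul]; norm_num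
  rw [e3, e3]

/-- Young's inequality `L¹ * L² ⊆ L²`. -/
theorem lintegral_convolution_sq_le {f g : E3 → ℝ≥0∞} (hf : Measurable f) (hg : Measurable g) :
    ∫⁻ x, (∫⁻ y, f y * g (x - y)) ^ 2 ≤ (∫⁻ y, f y) ^ 2 * ∫⁻ y, g y ^ 2 := by
  calc ∫⁻ x, (∫⁻ y, f y * g (x - y)) ^ 2
      ≤ ∫⁻ x, (∫⁻ y, f y) * ∫⁻ y, f y * g (x - y) ^ 2 :=
        lintegral_mono fun x => lintegral_mul_sq_le hf.aemeasurable (by fun_prop)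
    _ = (∫⁻ y, f y) * ∫⁻ y, ∫⁻ x, f y * g (x - y) ^ 2 := by
        rw [lintegral_const_mul _ (Measurable.lintegral_prod_right' (f := fun p : E3 × E3 =>
          f p.2 * g (p.1 - p.2) ^ 2) (by fun_prop)), lintegral_lintegral_swap (by fun_prop)]
    _ = (∫⁻ y, f y) ^ 2 * ∫⁻ y, g y ^ 2 := by
        have : ∀ y, ∫⁻ x, f y * g (x - y) ^ 2 = f y * ∫⁻ x, g x ^ 2 := fun y => by
          rw [lintegral_const_mul _ (by fun_prop),
            lintegral_sub_right_eq_self (fun x => g x ^ 2) y]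
        simp only [this]
        rw [lintegral_mul_const _ hf, sq, mul_assoc]

/-- Weighted estimates for a convolution, in `L¹` and in `L²`. -/
theorem convolution_weighted {n k : ℕ} (hk : k + 2 ≤ n) {b c : E3 → ℂ} (hb : MemWeightedL2 n b)
    (hc : MemWeightedL2 n c) :
    Integrable (fun x => (((1 + ‖x‖) ^ k : ℝ) : ℂ) *
      convolution b c (ContinuousLinearMap.mul ℂ ℂ) volume x) ∧
    MemWeightedL2 n (convolution b c (ContinuousLinearMap.mul ℂ ℂ) volume) := by
  have hwm : ∀ m : ℕ, Continuous fun x : E3 => (((1 + ‖x‖) ^ m : ℝ) : ℂ) := fun m => by fun_prop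
  have hwn : ∀ (m : ℕ) (x : E3), ‖(((1 + ‖x‖) ^ m : ℝ) : ℂ)‖ₑ = ENNReal.ofReal ((1 + ‖x‖) ^ m) :=
    fun m x => by
      rw [← ofReal_norm, Complex.norm_real, Real.norm_of_nonneg (by positivity)]
  -- it suffices to treat Borel measurable functions
  obtain ⟨b', hb'm, hbb'⟩ := hb.aestronglyMeasurable
  obtain ⟨c', hc'm, hcc'⟩ := hc.aestronglyMeasurable
  rw [convolution_congr _ hbb' hcc']
  have hb' : MemWeightedL2 n b' := MemLp.ae_eq (by
    filter_upwards [hbb'] with x hx; rw [hx]) hb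
  have hc' : MemWeightedL2 n c' := MemLp.ae_eq (by
    filter_upwards [hcc'] with x hx; rw [hx]) hc
  have hconv : AEStronglyMeasurable (convolution b' c' (ContinuousLinearMap.mul ℂ ℂ) volume)
      volume :=
    ((hb'.integrable (by omega)).integrable_convolution _ (hc'.integrable (by omega))).1
  have hpt : ∀ x, ‖convolution b' c' (ContinuousLinearMap.mul ℂ ℂ) volume x‖ₑ ≤
      ∫⁻ y, ‖b' y‖ₑ * ‖c' (x - y)‖ₑ := fun x => by
    refine (enorm_integral_le_lintegral_enorm _).trans (lintegral_mono fun y => ?_)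
    simp [enorm_mul]
  have htri : ∀ x y : E3, 1 + ‖x‖ ≤ (1 + ‖y‖) * (1 + ‖x - y‖) := fun x y => by
    have := norm_add_le y (x - y)
    rw [add_sub_cancel] at this
    nlinarith [norm_nonneg y, norm_nonneg (x - y)]
  have hbe : Measurable fun y => ‖b' y‖ₑ := hb'm.measurable.enorm
  have hce : Measurable fun y => ‖c' y‖ₑ := hc'm.measurable.enorm
  have hb1 : ∀ {b : E3 → ℂ} {m : ℕ}, MemWeightedL2 n b → m + 2 ≤ n →
      ∫⁻ x, ENNReal.ofReal ((1 + ‖x‖) ^ m) * ‖b x‖ₑ < ⊤ := fun {b m} hb hm => by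
    have := (hb.mul_integrable (m := fun x => (((1 + ‖x‖) ^ m : ℝ) : ℂ)) (k := m)
      (hwm m).aestronglyMeasurable 1 hm (fun x => by
        rw [Complex.norm_real, Real.norm_of_nonneg (by positivity), one_mul])).2
    simpa only [HasFiniteIntegral, enorm_mul, hwn] using this
  have hb2 : ∀ {b : E3 → ℂ}, MemWeightedL2 n b →
      ∫⁻ x, (ENNReal.ofReal ((1 + ‖x‖) ^ n) * ‖b x‖ₑ) ^ 2 < ⊤ := fun {b} hb => by
    have := lintegral_sq_lt_top hb
    simpa only [enorm_mul, hwn] using this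
  constructor
  · refine ⟨(hwm k).aestronglyMeasurable.mul hconv, ?_⟩
    rw [HasFiniteIntegral]
    simp only [enorm_mul, hwn]
    calc ∫⁻ x, ENNReal.ofReal ((1 + ‖x‖) ^ k) *
          ‖convolution b' c' (ContinuousLinearMap.mul ℂ ℂ) volume x‖ₑ
        ≤ ∫⁻ x, ∫⁻ y, (ENNReal.ofReal ((1 + ‖y‖) ^ k) * ‖b' y‖ₑ) *
          (ENNReal.ofReal ((1 + ‖x - y‖) ^ k) * ‖c' (x - y)‖ₑ) := by
          refine lintegral_mono fun x => ?_
          refine (mul_le_mul_right (hpt x) _).trans ?_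
          rw [← lintegral_const_mul _ (by fun_prop)]
          refine lintegral_mono fun y => ?_
          have : ENNReal.ofReal ((1 + ‖x‖) ^ k) ≤
              ENNReal.ofReal ((1 + ‖y‖) ^ k) * ENNReal.ofReal ((1 + ‖x - y‖) ^ k) := by
            rw [← ENNReal.ofReal_mul (by positivity), ← mul_pow]
            exact ENNReal.ofReal_le_ofReal (pow_le_pow_left₀ (by positivity) (htri x y) k)
          refine (mul_le_mul_left this _).trans (le_of_eq ?_)
          ring
      _ = (∫⁻ y, ENNReal.ofReal ((1 + ‖y‖) ^ k) * ‖b' y‖ₑ) *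
          ∫⁻ x, ENNReal.ofReal ((1 + ‖x‖) ^ k) * ‖c' x‖ₑ := by
          rw [lintegral_lintegral_swap (by fun_prop), ← lintegral_mul_const _ (by fun_prop)]
          refine lintegral_congr fun y => ?_
          rw [lintegral_const_mul _ (by fun_prop), lintegral_sub_right_eq_self
            (fun x => ENNReal.ofReal ((1 + ‖x‖) ^ k) * ‖c' x‖ₑ) y]
      _ < ⊤ := ENNReal.mul_lt_top (hb1 hb' hk) (hb1 hc' hk)
  · refine memLp_two_of_lintegral_sq ((hwm n).aestronglyMeasurable.mul hconv) ?_
    simp only [enorm_mul, hwn]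
    set B := fun y : E3 => ENNReal.ofReal ((1 + ‖y‖) ^ n) * ‖b' y‖ₑ with hB
    set Cc := fun y : E3 => ENNReal.ofReal ((1 + ‖y‖) ^ n) * ‖c' y‖ₑ with hCc
    have hBm : Measurable B := by fun_prop
    have hCm : Measurable Cc := by fun_prop
    have hmain : ∀ x, (ENNReal.ofReal ((1 + ‖x‖) ^ n) *
        ‖convolution b' c' (ContinuousLinearMap.mul ℂ ℂ) volume x‖ₑ) ^ 2 ≤
        2 * ENNReal.ofReal (2 ^ n) ^ 2 * (∫⁻ y, ‖b' y‖ₑ * Cc (x - y)) ^ 2 +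
        2 * ENNReal.ofReal (2 ^ n) ^ 2 * (∫⁻ y, ‖c' y‖ₑ * B (x - y)) ^ 2 := by
      intro x
      have h1 : ENNReal.ofReal ((1 + ‖x‖) ^ n) *
          ‖convolution b' c' (ContinuousLinearMap.mul ℂ ℂ) volume x‖ₑ ≤
          ENNReal.ofReal (2 ^ n) * ((∫⁻ y, ‖b' y‖ₑ * Cc (x - y)) +
            ∫⁻ y, ‖c' y‖ₑ * B (x - y)) := by
        have e : ∫⁻ y, ‖c' y‖ₑ * B (x - y) = ∫⁻ y, ‖c' (x - y)‖ₑ * B y := by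
          rw [← lintegral_sub_left_eq_self (fun y => ‖c' (x - y)‖ₑ * B y) x]
          simp
        rw [e, ← lintegral_add_left (by fun_prop), ← lintegral_const_mul _ (by fun_prop)]
        refine (mul_le_mul_right (hpt x) _).trans ?_
        rw [← lintegral_const_mul _ (by fun_prop)]
        refine lintegral_mono fun y => ?_
        have h2 : (1 + ‖x‖) ^ n ≤ 2 ^ n * ((1 + ‖y‖) ^ n + (1 + ‖x - y‖) ^ n) := by
          have h3 : 1 + ‖x‖ ≤ 2 * max (1 + ‖y‖) (1 + ‖x - y‖) := by
            have := norm_add_le y (x - y)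
            rw [add_sub_cancel] at this
            have h4 := le_max_left (1 + ‖y‖) (1 + ‖x - y‖)
            have h5 := le_max_right (1 + ‖y‖) (1 + ‖x - y‖)
            linarith [norm_nonneg y]
          refine (pow_le_pow_left₀ (by positivity) h3 n).trans ?_
          rw [mul_pow]
          refine mul_le_mul_of_nonneg_left ?_ (by positivity)
          rcases max_cases (1 + ‖y‖) (1 + ‖x - y‖) with h | h <;> rw [h.1]
          · linarith [show 0 ≤ (1 + ‖x - y‖) ^ n by positivity]
          · linarith [show 0 ≤ (1 + ‖y‖) ^ n by positivity]
        have h3 := ENNReal.ofReal_le_ofReal h2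
        rw [ENNReal.ofReal_mul (by positivity), ENNReal.ofReal_add (by positivity)
          (by positivity)] at h3
        refine (mul_le_mul_left h3 _).trans (le_of_eq ?_)
        simp only [hB, hCc]; ring
      refine (pow_le_pow_left' h1 2).trans ?_
      rw [mul_pow, mul_comm 2, mul_assoc, mul_assoc, ← mul_add]
      refine mul_le_mul_right ?_ _
      rw [← mul_add]
      have := ENNReal.rpow_add_le_mul_rpow_add_rpow (∫⁻ y, ‖b' y‖ₑ * Cc (x - y))
        (∫⁻ y, ‖c' y‖ₑ * B (x - y)) (p := 2) (by norm_num)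
      norm_num at this
      exact this
    refine (lintegral_mono hmain).trans_lt ?_
    have hm1 : Measurable fun x => ∫⁻ y, ‖b' y‖ₑ * Cc (x - y) :=
      Measurable.lintegral_prod_right' (f := fun p : E3 × E3 => ‖b' p.2‖ₑ * Cc (p.1 - p.2))
        (by fun_prop)
    have hm2 : Measurable fun x => ∫⁻ y, ‖c' y‖ₑ * B (x - y) :=
      Measurable.lintegral_prod_right' (f := fun p : E3 × E3 => ‖c' p.2‖ₑ * B (p.1 - p.2))
        (by fun_prop)
    rw [lintegral_add_left (by fun_prop), lintegral_const_mul _ (by fun_prop),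
      lintegral_const_mul _ (by fun_prop)]
    have hfin : (2 * ENNReal.ofReal (2 ^ n) ^ 2 : ℝ≥0∞) < ⊤ :=
      ENNReal.mul_lt_top (by simp) (ENNReal.pow_lt_top ENNReal.ofReal_lt_top)
    have hI : ∀ {b : E3 → ℂ}, MemWeightedL2 n b → (∫⁻ y, ‖b y‖ₑ) ^ 2 < ⊤ := fun hb =>
      ENNReal.pow_lt_top (hb.integrable (by omega)).2
    exact ENNReal.add_lt_top.2
      ⟨ENNReal.mul_lt_top hfin ((lintegral_convolution_sq_le hbe hCm).trans_lt
        (ENNReal.mul_lt_top (hI hb') (hb2 hc'))),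
      ENNReal.mul_lt_top hfin ((lintegral_convolution_sq_le hce hBm).trans_lt
        (ENNReal.mul_lt_top (hI hc') (hb2 hb')))⟩

/-! ### The Fourier transform of the intensity -/

theorem fourierInv_conj_reflect (b : E3 → ℂ) (x : E3) :
    (𝓕⁻ (fun ξ => starRingEnd ℂ (b (-ξ)))) x = starRingEnd ℂ ((𝓕⁻ b) x) := by
  rw [fourierInv_eq_planeWave, fourierInv_eq_planeWave, ← integral_conj,
    ← integral_neg_eq_self]
  refine integral_congr_ae (Filter.Eventually.of_forall fun ξ => ?_)
  simp only [planeWave, neg_neg, inner_neg_left, map_mul, ← Complex.exp_conj, Complex.conj_I,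
    Complex.conj_ofReal]
  congr 2
  push_cast; ring

/-- `F(|w|²)` is the autocorrelation of `b` when `w` is the inverse Fourier transform of `b`. -/
theorem fourier_normSq_ae {n : ℕ} (hn : 2 ≤ n) {b : E3 → ℂ} (hb : MemWeightedL2 n b) :
    𝓕 (fun x => ((‖(𝓕⁻ b) x‖ ^ 2 : ℝ) : ℂ)) =ᵐ[volume]
      convolution b (fun ξ => starRingEnd ℂ (b (-ξ))) (ContinuousLinearMap.mul ℂ ℂ) volume := by
  have hbi := hb.integrable hn
  have hci := hb.reflect.integrable hn
  have hk := hbi.integrable_convolution (ContinuousLinearMap.mul ℂ ℂ) hci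
  have e : 𝓕⁻ (convolution b (fun ξ => starRingEnd ℂ (b (-ξ))) (ContinuousLinearMap.mul ℂ ℂ)
      volume) = fun x => ((‖(𝓕⁻ b) x‖ ^ 2 : ℝ) : ℂ) := by
    ext x
    rw [Real.fourierInv_eq_fourier_neg, Real.fourier_mul_convolution_eq hbi hci,
      ← Real.fourierInv_eq_fourier_neg, ← Real.fourierInv_eq_fourier_neg,
      fourierInv_conj_reflect, Complex.mul_conj, Complex.normSq_eq_norm_sq]
  have hw := memLp_fourierInv hbi hb.memLp
  have hg : Integrable (fun x => ((‖(𝓕⁻ b) x‖ ^ 2 : ℝ) : ℂ)) :=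
    ((memLp_two_iff_integrable_sq_norm hw.1).1 hw).ofReal
  have h1 := isFourierInv_of_integrable hk
  rw [e] at h1
  refine (isFourierInv_fourier hg).unique_left h1 ?_ hk.locallyIntegrable
  have hc : Continuous (𝓕 (fun x => ((‖(𝓕⁻ b) x‖ ^ 2 : ℝ) : ℂ))) := by
    have := (continuous_fourierInv hg).comp continuous_neg
    refine this.congr fun x => ?_
    simp [Function.comp, Real.fourierInv_eq_fourier_neg]
  exact hc.locallyIntegrable

/-- The properties of the Fourier transform `h` of the intensity `|w|²` that control the phase. -/
structure IntensitySpectrum (n : ℕ) (h : E3 → ℂ) : Prop where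
  continuous : Continuous h
  integrable : ∀ k, k + 2 ≤ n → Integrable fun η => ((‖η‖ ^ k : ℝ) : ℂ) * h η
  integrable_inv : Integrable fun η => ((‖η‖⁻¹ : ℝ) : ℂ) * h η
  memLp : ∀ k, k ≤ n → MemLp (fun η => ((‖η‖ ^ k : ℝ) : ℂ) * h η) 2 volume
  conj_neg : ∀ η, h (-η) = starRingEnd ℂ (h η)

theorem integrable_inv_norm_mul_exp :
    Integrable (fun x : E3 => ‖x‖⁻¹ * Real.exp (-‖x‖)) := by
  rw [integrable_fun_norm_addHaar volume (f := fun r => r⁻¹ * Real.exp (-r)),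
    finrank_euclideanSpace_fin]
  have := integrableOn_rpow_mul_exp_neg_mul_rpow (p := 1) (s := 1) (b := 1) (by norm_num)
    (by norm_num) one_pos
  refine (integrableOn_congr_fun (fun r hr => ?_) measurableSet_Ioi).1 this
  have hr0 : (r : ℝ) ≠ 0 := (ne_of_gt hr)
  simp only [Real.rpow_one, smul_eq_mul, neg_mul, one_mul]
  field_simp

/-- For `w = F⁻¹ b` the Fourier transform of `|w|²` is an autocorrelation of `b`, and inherits the
weights of `b`. -/
theorem intensitySpectrum_fourier_normSq {n : ℕ} (hn : 2 ≤ n) {b : E3 → ℂ}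
    (hb : MemWeightedL2 n b) :
    IntensitySpectrum n (𝓕 (fun x => ((‖(𝓕⁻ b) x‖ ^ 2 : ℝ) : ℂ))) := by
  have hw := memLp_fourierInv (hb.integrable hn) hb.memLp
  set g : E3 → ℂ := fun x => ((‖(𝓕⁻ b) x‖ ^ 2 : ℝ) : ℂ) with hgdef
  have hg : Integrable g := ((memLp_two_iff_integrable_sq_norm hw.1).1 hw).ofReal
  have hc : Continuous (𝓕 g) := by
    have := (continuous_fourierInv hg).comp continuous_neg
    refine this.congr fun x => ?_
    simp [Function.comp, Real.fourierInv_eq_fourier_neg]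
  have hae := fourier_normSq_ae hn hb
  rw [← hgdef] at hae
  have hbd : ∀ x, ‖𝓕 g x‖ ≤ ∫ y, ‖g y‖ := fun x => by
    have := norm_fourierInv_le g (-x)
    rwa [Real.fourierInv_eq_fourier_neg, neg_neg] at this
  have hpow : ∀ (k : ℕ) (x : E3), ‖((‖x‖ ^ k : ℝ) : ℂ)‖ ≤ (1 + ‖x‖) ^ k := fun k x => by
    rw [Complex.norm_real, Real.norm_of_nonneg (by positivity)]
    exact pow_le_pow_left₀ (norm_nonneg x) (by linarith) k
  have hI : ∀ k, k + 2 ≤ n → Integrable fun η => ((‖η‖ ^ k : ℝ) : ℂ) * 𝓕 g η := fun k hk => by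
    have h1 := (convolution_weighted hk hb hb.reflect).1
    refine h1.mono (Continuous.aestronglyMeasurable (by fun_prop)) ?_
    filter_upwards [hae] with x hx
    rw [norm_mul, norm_mul, ← hx]
    refine mul_le_mul_of_nonneg_right ((hpow k x).trans (le_of_eq ?_)) (norm_nonneg _)
    rw [Complex.norm_real, Real.norm_of_nonneg (by positivity)]
  refine ⟨hc, hI, ?_, fun k hk => ?_, fun η => ?_⟩
  · have h0 : Integrable (𝓕 g) := by simpa using hI 0 (by omega)
    have h1 : Integrable fun η : E3 => ‖𝓕 g η‖ + (∫ y, ‖g y‖) * Real.exp 1 *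
        (‖η‖⁻¹ * Real.exp (-‖η‖)) := h0.norm.add (integrable_inv_norm_mul_exp.const_mul _)
    refine h1.mono' ?_ (Filter.Eventually.of_forall fun η => ?_)
    · exact (Measurable.aestronglyMeasurable (by fun_prop)).mul hc.aestronglyMeasurable
    · rw [norm_mul, Complex.norm_real, Real.norm_of_nonneg (by positivity)]
      have hg0 : 0 ≤ ∫ y, ‖g y‖ := by positivity
      -- near the origin the boundedness of `h` is used, elsewhere its integrability
      rcases le_total 1 ‖η‖ with h | h
      · have : ‖η‖⁻¹ ≤ 1 := inv_le_one_of_one_le₀ h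
        have h2 : 0 ≤ (∫ y, ‖g y‖) * Real.exp 1 * (‖η‖⁻¹ * Real.exp (-‖η‖)) := by positivity
        nlinarith [norm_nonneg (𝓕 g η)]
      · have h2 : 1 ≤ Real.exp 1 * Real.exp (-‖η‖) := by
          rw [← Real.exp_add]; exact Real.one_le_exp (by linarith)
        have h3 : ‖η‖⁻¹ * ‖𝓕 g η‖ ≤ ‖η‖⁻¹ * (∫ y, ‖g y‖) :=
          mul_le_mul_of_nonneg_left (hbd η) (by positivity)
        have h4 : ‖η‖⁻¹ * (∫ y, ‖g y‖) * 1 ≤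
            ‖η‖⁻¹ * (∫ y, ‖g y‖) * (Real.exp 1 * Real.exp (-‖η‖)) :=
          mul_le_mul_of_nonneg_left h2 (by positivity)
        calc _ ≤ ‖η‖⁻¹ * (∫ y, ‖g y‖) * (Real.exp 1 * Real.exp (-‖η‖)) := by linarith
          _ ≤ _ := by nlinarith [norm_nonneg (𝓕 g η)]
  · have h2 := (convolution_weighted (k := 0) (by omega) hb hb.reflect).2.mul_memLp
      (m := fun x => ((‖x‖ ^ k : ℝ) : ℂ)) (Continuous.aestronglyMeasurable (by fun_prop)) 1
      (fun x => by
        rw [one_mul]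
        exact (hpow k x).trans (pow_le_pow_right₀ (by linarith [norm_nonneg x]) hk))
    refine h2.ae_eq ?_
    filter_upwards [hae] with x hx
    rw [hx]
  · have h1 := fourierInv_conj_reflect g η
    have e : (fun ξ => starRingEnd ℂ (g (-ξ))) = fun ξ => g (-ξ) := by
      ext ξ; simp [hgdef]
    rw [e] at h1
    rw [← Real.fourierInv_eq_fourier_neg, ← neg_neg η, ← Real.fourierInv_eq_fourier_neg,
      neg_neg]
    have h2 := fourierInv_conj_reflect g (-η)
    rw [e] at h2
    rw [← h2, fourierInv_eq_planeWave, fourierInv_eq_planeWave, ← integral_neg_eq_self]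
    refine integral_congr_ae (Filter.Eventually.of_forall fun ξ => ?_)
    simp [planeWave]

/-! ### Averages over dilations -/

theorem lintegral_comp_smul_pos {F : E3 → ℝ≥0∞} (hF : Measurable F) {ν : ℝ} (hν : 0 < ν) :
    ∫⁻ ξ, F (ν • ξ) = ENNReal.ofReal ((ν ^ 3)⁻¹) * ∫⁻ ξ, F ξ := by
  have h := Measure.map_addHaar_smul (volume : Measure E3) hν.ne'
  rw [finrank_euclideanSpace_fin, abs_of_pos (by positivity)] at h
  have h2 := congrArg (fun μ => ∫⁻ ξ, F ξ ∂μ) h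
  simp only [lintegral_smul_measure, smul_eq_mul] at h2
  rw [← h2, lintegral_map hF (measurable_const_smul ν)]

theorem integral_comp_smul_pos (F : E3 → ℂ) {ν : ℝ} (hν : 0 < ν) :
    ∫ ξ, F (ν • ξ) = (((ν ^ 3)⁻¹ : ℝ) : ℂ) * ∫ ξ, F ξ := by
  rw [Measure.integral_comp_smul, finrank_euclideanSpace_fin, abs_of_pos (by positivity)]
  rfl

theorem lintegral_dilation_average {F : E3 → ℝ≥0∞} (hF : Measurable F) {ρ : ℝ → ℝ≥0∞}
    (hρ : Measurable ρ) {s : Set ℝ} (hs : MeasurableSet s) (hs0 : s ⊆ Set.Ioi 0) :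
    ∫⁻ ξ, ∫⁻ ν in s, ρ ν * F (ν • ξ) =
      (∫⁻ ν in s, ρ ν * ENNReal.ofReal ((ν ^ 3)⁻¹)) * ∫⁻ ξ, F ξ := by
  have hm : Measurable fun p : E3 × ℝ => ρ p.2 * F (p.2 • p.1) := by fun_prop
  rw [lintegral_lintegral_swap hm.aemeasurable, ← lintegral_mul_const _ (by fun_prop)]
  refine setLIntegral_congr_fun hs fun ν hν => ?_
  have hν0 : 0 < ν := hs0 hν
  rw [lintegral_const_mul _ (by fun_prop), lintegral_comp_smul_pos hF hν0, mul_assoc]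

theorem lintegral_Ioi_rpow_lt_top {a c : ℝ} (ha : a < -1) (hc : 0 < c) :
    ∫⁻ ν in Set.Ioi c, ENNReal.ofReal (ν ^ a) < ⊤ := by
  have h := (integrableOn_Ioi_rpow_of_lt ha hc).2
  rw [HasFiniteIntegral] at h
  refine lt_of_le_of_lt (lintegral_mono_ae ?_) h
  filter_upwards [ae_restrict_mem measurableSet_Ioi] with ν hν
  have : 0 ≤ ν ^ a := Real.rpow_nonneg (hc.trans hν).le _
  rw [← ofReal_norm, Real.norm_of_nonneg this]

/-- The average over dilations is bounded on `L²`, by Cauchy–Schwarz with the weight `ν^{3/2}`. -/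
theorem lintegral_dilation_average_sq {F : E3 → ℝ≥0∞} (hF : Measurable F)
    (h : ∫⁻ ξ, F ξ ^ 2 < ⊤) : ∫⁻ ξ, (∫⁻ ν in Set.Ioi (1 : ℝ), F (ν • ξ)) ^ 2 < ⊤ := by
  set C := ∫⁻ ν in Set.Ioi (1 : ℝ), ENNReal.ofReal (ν ^ (-(3 / 2) : ℝ)) with hC
  have hCt : C < ⊤ := lintegral_Ioi_rpow_lt_top (by norm_num) one_pos
  have h1 : ∀ ξ, (∫⁻ ν in Set.Ioi (1 : ℝ), F (ν • ξ)) ^ 2 ≤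
      C * ∫⁻ ν in Set.Ioi (1 : ℝ), ENNReal.ofReal (ν ^ (3 / 2 : ℝ)) * F (ν • ξ) ^ 2 := by
    intro ξ
    have h2 := lintegral_mul_sq_le (μ := volume.restrict (Set.Ioi (1 : ℝ)))
      (f := fun ν => ENNReal.ofReal (ν ^ (-(3 / 2) : ℝ)))
      (g := fun ν => ENNReal.ofReal (ν ^ (3 / 2 : ℝ)) * F (ν • ξ)) (by fun_prop) (by fun_prop)
    have e : ∀ ν ∈ Set.Ioi (1 : ℝ), ENNReal.ofReal (ν ^ (-(3 / 2) : ℝ)) *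
        ENNReal.ofReal (ν ^ (3 / 2 : ℝ)) = 1 := fun ν hν => by
      have h0 : (0 : ℝ) < ν := one_pos.trans hν
      rw [← ENNReal.ofReal_mul (by positivity), ← Real.rpow_add h0]
      norm_num
    rw [setLIntegral_congr_fun measurableSet_Ioi (g := fun ν => F (ν • ξ)) (fun ν hν => by
        simp only; rw [← mul_assoc, e ν hν, one_mul]),
      setLIntegral_congr_fun (f := fun ν => ENNReal.ofReal (ν ^ (-(3 / 2) : ℝ)) *
        (ENNReal.ofReal (ν ^ (3 / 2 : ℝ)) * F (ν • ξ)) ^ 2) measurableSet_Ioi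
        (g := fun ν => ENNReal.ofReal (ν ^ (3 / 2 : ℝ)) * F (ν • ξ) ^ 2) (fun ν hν => by
        simp only; rw [mul_pow, sq (ENNReal.ofReal _), ← mul_assoc, ← mul_assoc, e ν hν, one_mul])]
      at h2
    exact h2
  refine (lintegral_mono h1).trans_lt ?_
  have hm : Measurable fun ξ => ∫⁻ ν in Set.Ioi (1 : ℝ), ENNReal.ofReal (ν ^ (3 / 2 : ℝ)) *
      F (ν • ξ) ^ 2 := Measurable.lintegral_prod_right'
      (f := fun p : E3 × ℝ => ENNReal.ofReal (p.2 ^ (3 / 2 : ℝ)) * F (p.2 • p.1) ^ 2) (by fun_prop)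
  rw [lintegral_const_mul _ hm, lintegral_dilation_average (F := fun η => F η ^ 2) (by fun_prop)
    (by fun_prop) measurableSet_Ioi (Set.Ioi_subset_Ioi zero_le_one)]
  refine ENNReal.mul_lt_top hCt (ENNReal.mul_lt_top ?_ h)
  refine lt_of_le_of_lt (le_of_eq ?_) hCt
  refine setLIntegral_congr_fun measurableSet_Ioi fun ν hν => ?_
  have h0 : (0 : ℝ) < ν := one_pos.trans hν
  rw [← ENNReal.ofReal_mul (by positivity)]
  congr 1
  rw [← Real.rpow_natCast, ← Real.rpow_neg h0.le, ← Real.rpow_add h0]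
  norm_num

/-! ### The symbol of the phase -/

/-- `sin (σc) / c`, the symbol of `ω⁻¹ sin (ωσ)` at frequency `c`. -/
def sinSymbol (σ c : ℝ) : ℝ := σ * Real.sinc (σ * c)

theorem continuous_sinSymbol : Continuous fun p : ℝ × ℝ => sinSymbol p.1 p.2 := by
  unfold sinSymbol
  exact continuous_fst.mul (Real.continuous_sinc.comp (by fun_prop))

theorem sinSymbol_mul_self (σ c : ℝ) : sinSymbol σ c * c = Real.sin (σ * c) := by
  unfold sinSymbol
  by_cases h : σ * c = 0
  · rw [h, Real.sinc_zero, Real.sin_zero, mul_one, h]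
  · rw [Real.sinc_of_ne_zero h]
    have := mul_ne_zero_iff.1 h
    field_simp [this.1, this.2]

theorem sinSymbol_neg (σ c : ℝ) : sinSymbol (-σ) c = -sinSymbol σ c := by
  unfold sinSymbol; rw [neg_mul, neg_mul, Real.sinc_neg]

theorem sinSymbol_zero (c : ℝ) : sinSymbol 0 c = 0 := by simp [sinSymbol]

theorem abs_sinSymbol_mul_norm_le (σ : ℝ) (ξ : E3) :
    |sinSymbol σ (2 * Real.pi * ‖ξ‖)| * ‖ξ‖ ≤ 1 := by
  have h := sinSymbol_mul_self σ (2 * Real.pi * ‖ξ‖)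
  have h1 : |sinSymbol σ (2 * Real.pi * ‖ξ‖)| * (2 * Real.pi * ‖ξ‖) ≤ 1 := by
    have := Real.abs_sin_le_one (σ * (2 * Real.pi * ‖ξ‖))
    rw [← h, abs_mul] at this
    rwa [abs_of_nonneg (by positivity : 0 ≤ 2 * Real.pi * ‖ξ‖)] at this
  have : |sinSymbol σ (2 * Real.pi * ‖ξ‖)| * ‖ξ‖ ≤
      |sinSymbol σ (2 * Real.pi * ‖ξ‖)| * (2 * Real.pi * ‖ξ‖) := by
    refine mul_le_mul_of_nonneg_left ?_ (abs_nonneg _)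
    nlinarith [Real.pi_gt_three, norm_nonneg ξ]
  linarith

theorem abs_sinSymbol_sub_le (σ σ' c : ℝ) : |sinSymbol σ c - sinSymbol σ' c| ≤ |σ - σ'| := by
  by_cases hc : c = 0
  · simp [sinSymbol, hc]
  have h : ∀ σ, sinSymbol σ c = Real.sin (σ * c) / c := fun σ => by
    rw [← sinSymbol_mul_self]; field_simp
  rw [h, h, ← sub_div, abs_div, div_le_iff₀ (abs_pos.2 hc), ← abs_mul, sub_mul]
  have := Convex.norm_image_sub_le_of_norm_deriv_le (f := Real.sin) (C := 1) (s := Set.univ)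
    (x := σ' * c) (y := σ * c) (fun x _ => Real.differentiableAt_sin)
    (fun x _ => by rw [Real.deriv_sin]; exact Real.abs_cos_le_one x) convex_univ trivial trivial
  simpa using this

/-- The Fourier transform of `Ã₁`, in terms of the Fourier transform `h` of `|w|²`. -/
def phaseSymbol (h : E3 → ℂ) (ξ : E3) : ℂ :=
  -∫ ν in Set.Ioi (1 : ℝ), ((sinSymbol (ν - 1) (2 * Real.pi * ‖ξ‖) : ℝ) : ℂ) * h (ν • ξ)

namespace IntensitySpectrum

variable {n : ℕ} {h : E3 → ℂ}

theorem continuous_kernel (H : IntensitySpectrum n h) {f : ℝ → ℝ} (hf : Continuous f) :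
    Continuous fun p : E3 × ℝ =>
      ((sinSymbol (f p.2) (2 * Real.pi * ‖p.1‖) : ℝ) : ℂ) * h (p.2 • p.1) := by
  have h1 := H.continuous
  have h2 := continuous_sinSymbol.comp
    (f := fun p : E3 × ℝ => (f p.2, 2 * Real.pi * ‖p.1‖)) (by fun_prop)
  exact (Complex.continuous_ofReal.comp h2).mul (h1.comp (by fun_prop))

theorem stronglyMeasurable_phaseSymbol (H : IntensitySpectrum n h) :
    StronglyMeasurable (phaseSymbol h) :=
  ((H.continuous_kernel (f := fun ν => ν - 1)
    (by fun_prop)).stronglyMeasurable.integral_prod_right'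
    (ν := volume.restrict (Set.Ioi (1 : ℝ)))).neg

theorem enorm_phaseSymbol_le (ξ : E3) : ‖phaseSymbol h ξ‖ₑ ≤ ∫⁻ ν in Set.Ioi (1 : ℝ),
    ‖((sinSymbol (ν - 1) (2 * Real.pi * ‖ξ‖) : ℝ) : ℂ) * h (ν • ξ)‖ₑ := by
  rw [phaseSymbol, enorm_neg]
  exact enorm_integral_le_lintegral_enorm _

theorem lintegral_kernel_le (h : E3 → ℂ) (f : ℝ → ℝ) :
    ∀ᵐ ξ : E3, ∀ ν : ℝ, 0 < ν →
      ‖((sinSymbol (f ν) (2 * Real.pi * ‖ξ‖) : ℝ) : ℂ) * h (ν • ξ)‖ₑ ≤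
      ENNReal.ofReal ν * ‖((‖ν • ξ‖⁻¹ : ℝ) : ℂ) * h (ν • ξ)‖ₑ := by
  filter_upwards [ae_ne_zero] with ξ hξ ν hν
  have h1 := abs_sinSymbol_mul_norm_le (f ν) ξ
  have hp : 0 < ‖ξ‖ := norm_pos_iff.2 hξ
  rw [← ofReal_norm, ← ofReal_norm, ← ENNReal.ofReal_mul hν.le]
  refine ENNReal.ofReal_le_ofReal ?_
  rw [norm_mul, norm_mul, Complex.norm_real, Complex.norm_real, Real.norm_eq_abs, ← mul_assoc]
  refine mul_le_mul_of_nonneg_right ?_ (norm_nonneg _)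
  rw [Real.norm_of_nonneg (by positivity), norm_smul, Real.norm_of_nonneg hν.le, mul_inv,
    ← mul_assoc, mul_inv_cancel₀ hν.ne', one_mul, ← one_div, le_div_iff₀ hp]
  exact h1

theorem measurable_inv (H : IntensitySpectrum n h) :
    Measurable fun η : E3 => ‖((‖η‖⁻¹ : ℝ) : ℂ) * h η‖ₑ := by
  have := H.continuous.measurable
  fun_prop

/-- The bound `ω⁻¹` of the symbol costs a factor `ν`; the dilation gains `ν⁻³`, which leaves the
integrable power `ν⁻²`. -/
theorem integrable_kernel (H : IntensitySpectrum n h) {f : ℝ → ℝ} (hf : Continuous f) {c : ℝ}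
    (hc : 0 < c) :
    Integrable (fun p : E3 × ℝ =>
      ((sinSymbol (f p.2) (2 * Real.pi * ‖p.1‖) : ℝ) : ℂ) * h (p.2 • p.1))
      ((volume : Measure E3).prod (volume.restrict (Set.Ioi c))) := by
  refine ⟨(H.continuous_kernel hf).aestronglyMeasurable, ?_⟩
  rw [HasFiniteIntegral, lintegral_prod _ (H.continuous_kernel hf).enorm.measurable.aemeasurable]
  calc _ ≤ ∫⁻ ξ : E3, ∫⁻ ν in Set.Ioi c, ENNReal.ofReal ν *
          ‖((‖ν • ξ‖⁻¹ : ℝ) : ℂ) * h (ν • ξ)‖ₑ := by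
        refine lintegral_mono_ae ?_
        filter_upwards [lintegral_kernel_le h f] with ξ hξ
        exact setLIntegral_mono' measurableSet_Ioi fun ν hν => hξ ν (hc.trans hν)
    _ = _ := lintegral_dilation_average (F := fun η => ‖((‖η‖⁻¹ : ℝ) : ℂ) * h η‖ₑ)
        H.measurable_inv (by fun_prop) measurableSet_Ioi (Set.Ioi_subset_Ioi hc.le)
    _ < ⊤ := by
        refine ENNReal.mul_lt_top ?_ H.integrable_inv.2
        refine lt_of_le_of_lt (le_of_eq ?_)
          (lintegral_Ioi_rpow_lt_top (a := -2) (by norm_num) hc)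
        refine setLIntegral_congr_fun measurableSet_Ioi fun ν hν => ?_
        have h0 : (0 : ℝ) < ν := hc.trans hν
        rw [← ENNReal.ofReal_mul h0.le, Real.rpow_neg h0.le]
        norm_cast
        congr 1
        field_simp

theorem integrable_phaseSymbol (H : IntensitySpectrum n h) : Integrable (phaseSymbol h) :=
  (H.integrable_kernel (f := fun ν => ν - 1) (by fun_prop) one_pos).integral_prod_left.neg

/-- The symbol `ω⁻¹ sin` absorbs one power of `‖ξ‖`. -/
theorem pow_mul_phaseSymbol_le (k : ℕ) (ξ : E3) :
    ‖((‖ξ‖ ^ (k + 1) : ℝ) : ℂ) * phaseSymbol h ξ‖ₑ ≤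
      ∫⁻ ν in Set.Ioi (1 : ℝ), ‖((‖ν • ξ‖ ^ k : ℝ) : ℂ) * h (ν • ξ)‖ₑ := by
  rw [enorm_mul]
  refine (mul_le_mul_right (enorm_phaseSymbol_le ξ) _).trans ?_
  rw [← lintegral_const_mul' _ _ (by simp)]
  refine setLIntegral_mono' measurableSet_Ioi fun ν hν => ?_
  have hν1 : (1 : ℝ) ≤ ν := le_of_lt hν
  rw [← enorm_mul, ← ofReal_norm, ← ofReal_norm]
  refine ENNReal.ofReal_le_ofReal ?_
  rw [norm_mul, norm_mul, norm_mul, ← mul_assoc]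
  refine mul_le_mul_of_nonneg_right ?_ (norm_nonneg _)
  rw [Complex.norm_real, Complex.norm_real, Complex.norm_real, norm_pow, norm_pow, norm_norm,
    norm_norm, Real.norm_eq_abs, norm_smul, Real.norm_of_nonneg (by positivity : (0 : ℝ) ≤ ν),
    mul_pow, pow_succ, mul_assoc, mul_comm ‖ξ‖]
  have h1 := abs_sinSymbol_mul_norm_le (ν - 1) ξ
  have h2 : 1 ≤ ν ^ k := one_le_pow₀ hν1
  calc _ ≤ ‖ξ‖ ^ k * 1 := mul_le_mul_of_nonneg_left h1 (by positivity)
    _ = 1 * ‖ξ‖ ^ k := by ring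
    _ ≤ _ := mul_le_mul_of_nonneg_right h2 (by positivity)

theorem measurable_pow (H : IntensitySpectrum n h) (k : ℕ) :
    Measurable fun η : E3 => ‖((‖η‖ ^ k : ℝ) : ℂ) * h η‖ₑ := by
  have := H.continuous.measurable
  fun_prop

theorem integrable_pow_mul_phaseSymbol (H : IntensitySpectrum n h) {k : ℕ} (hk : k + 2 ≤ n) :
    Integrable fun ξ => ((‖ξ‖ ^ (k + 1) : ℝ) : ℂ) * phaseSymbol h ξ := by
  refine ⟨(Continuous.aestronglyMeasurable (by fun_prop)).mul
    H.stronglyMeasurable_phaseSymbol.aestronglyMeasurable, ?_⟩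
  refine (lintegral_mono fun ξ => pow_mul_phaseSymbol_le k ξ).trans_lt ?_
  have := lintegral_dilation_average (H.measurable_pow k) (ρ := fun _ => 1) measurable_const
    measurableSet_Ioi (Set.Ioi_subset_Ioi (zero_le_one : (0 : ℝ) ≤ 1))
  simp only [one_mul] at this
  rw [this]
  refine ENNReal.mul_lt_top ?_ (H.integrable k hk).2
  refine lt_of_le_of_lt (le_of_eq ?_)
    (lintegral_Ioi_rpow_lt_top (a := -3) (by norm_num) one_pos)
  refine setLIntegral_congr_fun measurableSet_Ioi fun ν hν => ?_
  have h0 : (0 : ℝ) < ν := one_pos.trans hν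
  rw [Real.rpow_neg h0.le]
  norm_cast

theorem memLp_pow_mul_phaseSymbol (H : IntensitySpectrum n h) {k : ℕ} (hk : k ≤ n) :
    MemLp (fun ξ => ((‖ξ‖ ^ (k + 1) : ℝ) : ℂ) * phaseSymbol h ξ) 2 volume := by
  refine memLp_two_of_lintegral_sq ((Continuous.aestronglyMeasurable (by fun_prop)).mul
    H.stronglyMeasurable_phaseSymbol.aestronglyMeasurable) ?_
  refine (lintegral_mono fun ξ => pow_le_pow_left' (pow_mul_phaseSymbol_le k ξ) 2).trans_lt ?_
  exact lintegral_dilation_average_sq (H.measurable_pow k) (lintegral_sq_lt_top (H.memLp k hk))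

theorem phaseSymbol_conj (H : IntensitySpectrum n h) (ξ : E3) :
    starRingEnd ℂ (phaseSymbol h (-ξ)) = phaseSymbol h ξ := by
  simp only [phaseSymbol, map_neg, ← integral_conj, map_mul, Complex.conj_ofReal, norm_neg,
    smul_neg, H.conj_neg, Complex.conj_conj]

theorem fourierInv_phaseSymbol_real (H : IntensitySpectrum n h) (x : E3) :
    (((𝓕⁻ (phaseSymbol h)) x).re : ℂ) = (𝓕⁻ (phaseSymbol h)) x := by
  rw [← Complex.conj_eq_iff_re, ← fourierInv_conj_reflect]
  simp only [H.phaseSymbol_conj]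

end IntensitySpectrum

/-! ### The potentials generated by the asymptotic wave function -/

/-- The Fourier transform of `|w|²`. -/
def intensityFourier (w : E3 → ℂ) : E3 → ℂ := 𝓕 (fun y => ((‖w y‖ ^ 2 : ℝ) : ℂ))

/-- `ω⁻¹ sin (ωσ) g_τ` where `g_τ` is the function with Fourier transform `h (τ ·)`. -/
def waveIntegral (h : E3 → ℂ) (σ τ : ℝ) (x : E3) : ℂ :=
  (𝓕⁻ (fun ξ : E3 => ((sinSymbol σ (2 * Real.pi * ‖ξ‖) : ℝ) : ℂ) * h (τ • ξ))) x

theorem fourier_dilation (G : E3 → ℂ) {τ : ℝ} (hτ : 0 < τ) (ξ : E3) :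
    𝓕 (dilation τ G) ξ = ((τ ^ 3 : ℝ) : ℂ) * 𝓕 G (τ • ξ) := by
  rw [Real.fourier_eq, Real.fourier_eq]
  have h := integral_comp_smul_pos (fun v => Real.fourierChar (-inner ℝ v (τ • ξ)) • G v)
    (inv_pos.2 hτ)
  rw [inv_pow, inv_inv] at h
  rw [← h]
  refine integral_congr_ae (Filter.Eventually.of_forall fun v => ?_)
  simp only [dilation, inner_smul_left, inner_smul_right, conj_trivial]
  rw [← mul_assoc, mul_inv_cancel₀ hτ.ne', one_mul]

theorem fourierInv_const_mul (c : ℂ) (k : E3 → ℂ) (x : E3) :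
    (𝓕⁻ (fun ξ => c * k ξ)) x = c * (𝓕⁻ k) x := by
  rw [fourierInv_eq_planeWave, fourierInv_eq_planeWave, ← integral_const_mul]
  refine integral_congr_ae (Filter.Eventually.of_forall fun v => ?_)
  simp only; ring

theorem sinOverOmega_dilation (w : E3 → ℂ) (s : ℝ) {τ : ℝ} (hτ : 0 < τ) (c : ℝ) (x : E3) :
    sinOverOmega s (fun y => c * dilation τ (fun y => ‖w y‖ ^ 2) y) x =
      c * τ ^ 3 * (waveIntegral (intensityFourier w) s τ x).re := by
  unfold sinOverOmega waveIntegral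
  have e : (fun ξ : E3 => ((s * Real.sinc (s * (2 * Real.pi * ‖ξ‖)) : ℝ) : ℂ) *
      𝓕 (fun y : E3 => ((c * dilation τ (fun y => ‖w y‖ ^ 2) y : ℝ) : ℂ)) ξ) =
      fun ξ => ((c * τ ^ 3 : ℝ) : ℂ) * (((sinSymbol s (2 * Real.pi * ‖ξ‖) : ℝ) : ℂ) *
        intensityFourier w (τ • ξ)) := by
    ext ξ
    have h1 : 𝓕 (fun y : E3 => ((c * dilation τ (fun y => ‖w y‖ ^ 2) y : ℝ) : ℂ)) ξ =
        c * 𝓕 (dilation τ fun y => ((‖w y‖ ^ 2 : ℝ) : ℂ)) ξ := by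
      rw [Real.fourier_eq, Real.fourier_eq, ← integral_const_mul]
      refine integral_congr_ae (Filter.Eventually.of_forall fun v => ?_)
      simp only [dilation, Circle.smul_def, smul_eq_mul]
      push_cast; ring
    rw [h1, fourier_dilation _ hτ, sinSymbol, intensityFourier]
    push_cast; ring
  rw [e, fourierInv_const_mul, Complex.re_ofReal_mul]

theorem norm_I_mul_cpow {t : ℝ} (ht : 0 < t) :
    ‖(Complex.I * (t : ℂ)) ^ (-(3 / 2) : ℂ)‖ = t ^ (-(3 / 2) : ℝ) := by
  have e : (-(3 / 2) : ℂ) = ((-(3 / 2) : ℝ) : ℂ) := by push_cast; ring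
  have h0 : Complex.I * (t : ℂ) ≠ 0 :=
    mul_ne_zero Complex.I_ne_zero (Complex.ofReal_ne_zero.2 ht.ne')
  rw [e, Complex.norm_cpow_of_ne_zero h0, Complex.ofReal_re, Complex.ofReal_im, mul_zero,
    Real.exp_zero, div_one, norm_mul, Complex.norm_I, one_mul, Complex.norm_real,
    Real.norm_of_nonneg ht.le]

theorem norm_exp_I_mul (s : ℝ) : ‖Complex.exp (Complex.I * (s : ℂ))‖ = 1 := by
  rw [mul_comm, Complex.norm_exp_ofReal_mul_I]

theorem norm_exp_neg_I_mul (s : ℝ) : ‖Complex.exp (-(Complex.I * (s : ℂ)))‖ = 1 := by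
  rw [← mul_neg, ← Complex.ofReal_neg, norm_exp_I_mul]

theorem norm_uApprox (w : E3 → ℂ) {t : ℝ} (ht : 0 < t) (x : E3) :
    ‖uApprox w t x‖ = t ^ (-(3 / 2) : ℝ) * ‖w (t⁻¹ • x)‖ := by
  simp only [uApprox, dilation, norm_mul, norm_exp_I_mul, norm_exp_neg_I_mul, one_mul,
    norm_I_mul_cpow ht]

theorem normSq_uApprox (w : E3 → ℂ) {t : ℝ} (ht : 0 < t) (x : E3) :
    ‖uApprox w t x‖ ^ 2 = (t ^ 3)⁻¹ * dilation t (fun y => ‖w y‖ ^ 2) x := by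
  rw [norm_uApprox w ht, mul_pow, dilation]
  congr 1
  rw [← Real.rpow_natCast, ← Real.rpow_mul ht.le, ← Real.rpow_natCast, ← Real.rpow_neg ht.le]
  norm_num

theorem A1_eq_integral (w : E3 → ℂ) {t : ℝ} (ht : 0 < t) (x : E3) :
    A1 w t x = ∫ τ in Set.Ioi t, (waveIntegral (intensityFourier w) (t - τ) τ x).re := by
  refine setIntegral_congr_fun measurableSet_Ioi fun τ hτ => ?_
  have h0 : 0 < τ := ht.trans hτ
  simp only [normSq_uApprox w h0]
  rw [sinOverOmega_dilation w _ h0, inv_mul_cancel₀ (by positivity), one_mul]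

theorem tildeA1_eq_integral (w : E3 → ℂ) (x : E3) :
    tildeA1 w x =
      -∫ ν in Set.Ioi (1 : ℝ), (waveIntegral (intensityFourier w) (ν - 1) ν x).re := by
  unfold tildeA1
  congr 1
  refine setIntegral_congr_fun measurableSet_Ioi fun ν hν => ?_
  have h0 : (0 : ℝ) < ν := one_pos.trans hν
  have h := sinOverOmega_dilation w (ν - 1) h0 1 x
  simp only [one_mul] at h
  rw [show (dilation ν fun y => ‖w y‖ ^ 2) = fun y => dilation ν (fun y => ‖w y‖ ^ 2) y from rfl, h,
    ← mul_assoc, Real.rpow_neg h0.le]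
  norm_cast
  rw [inv_mul_cancel₀ (by positivity), one_mul]

theorem waveIntegral_neg (h : E3 → ℂ) (σ τ : ℝ) (x : E3) :
    waveIntegral h (-σ) τ x = -waveIntegral h σ τ x := by
  have h1 := fourierInv_const_mul (-1)
    (fun ξ : E3 => ((sinSymbol σ (2 * Real.pi * ‖ξ‖) : ℝ) : ℂ) * h (τ • ξ)) x
  rw [neg_one_mul] at h1
  unfold waveIntegral
  rw [← h1]
  simp only [sinSymbol_neg, Complex.ofReal_neg, neg_mul, one_mul]

theorem waveIntegral_scale (h : E3 → ℂ) (σ τ : ℝ) {t : ℝ} (ht : 0 < t) (x : E3) :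
    waveIntegral h (t * σ) (t * τ) x = (((t ^ 2)⁻¹ : ℝ) : ℂ) * waveIntegral h σ τ (t⁻¹ • x) := by
  unfold waveIntegral
  rw [fourierInv_eq_planeWave, fourierInv_eq_planeWave]
  have h1 := integral_comp_smul_pos (fun ξ : E3 => planeWave (t⁻¹ • x) ξ *
    (((sinSymbol σ (2 * Real.pi * ‖ξ‖) : ℝ) : ℂ) * h (τ • ξ))) ht
  have e : (((t ^ 2)⁻¹ : ℝ) : ℂ) = t * (((t ^ 3)⁻¹ : ℝ) : ℂ) := by
    rw [← Complex.ofReal_mul]; congr 1; field_simp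
  rw [e, mul_assoc, ← h1, ← integral_const_mul]
  refine integral_congr_ae (Filter.Eventually.of_forall fun ξ => ?_)
  have e1 : planeWave (t⁻¹ • x) (t • ξ) = planeWave x ξ := by
    simp only [planeWave, inner_smul_left, inner_smul_right, conj_trivial]
    rw [← mul_assoc t⁻¹, inv_mul_cancel₀ ht.ne', one_mul]
  have e2 : sinSymbol (t * σ) (2 * Real.pi * ‖ξ‖) = t * sinSymbol σ (2 * Real.pi * ‖t • ξ‖) := by
    unfold sinSymbol
    rw [norm_smul, Real.norm_of_nonneg ht.le, mul_assoc]
    congr 3; ring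
  simp only [e1, e2, smul_smul, mul_comm τ t]
  push_cast; ring

/-- The exact self-similarity of `A₁`. -/
theorem A1_eq (w : E3 → ℂ) {t : ℝ} (ht : 0 < t) (x : E3) :
    A1 w t x = t⁻¹ * tildeA1 w (t⁻¹ • x) := by
  rw [A1_eq_integral w ht, tildeA1_eq_integral]
  have h := integral_comp_mul_left_Ioi
    (fun τ => (waveIntegral (intensityFourier w) (t - τ) τ x).re) 1 ht
  rw [mul_one] at h
  have e : ∀ ν : ℝ, (waveIntegral (intensityFourier w) (t - t * ν) (t * ν) x).re =
      -(t ^ 2)⁻¹ * (waveIntegral (intensityFourier w) (ν - 1) ν (t⁻¹ • x)).re := fun ν => by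
    rw [show t - t * ν = t * -(ν - 1) by ring, waveIntegral_scale _ _ _ ht, waveIntegral_neg,
      Complex.re_ofReal_mul, Complex.neg_re]
    ring
  simp only [e, integral_const_mul, smul_eq_mul] at h
  have h2 : ∫ τ in Set.Ioi t, (waveIntegral (intensityFourier w) (t - τ) τ x).re =
      t * (t⁻¹ * ∫ τ in Set.Ioi t, (waveIntegral (intensityFourier w) (t - τ) τ x).re) := by
    rw [← mul_assoc, mul_inv_cancel₀ ht.ne', one_mul]
  rw [h2, ← h]
  field_simp

namespace IntensitySpectrum

variable {n : ℕ} {h : E3 → ℂ}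

theorem integrable_planeWave_kernel (H : IntensitySpectrum n h) {f : ℝ → ℝ} (hf : Continuous f)
    {c : ℝ} (hc : 0 < c) (x : E3) :
    Integrable (fun p : E3 × ℝ => planeWave x p.1 *
      (((sinSymbol (f p.2) (2 * Real.pi * ‖p.1‖) : ℝ) : ℂ) * h (p.2 • p.1)))
      ((volume : Measure E3).prod (volume.restrict (Set.Ioi c))) := by
  refine (H.integrable_kernel hf hc).mono ?_ (Filter.Eventually.of_forall fun p => ?_)
  · refine Continuous.aestronglyMeasurable (Continuous.mul ?_ (H.continuous_kernel hf))
    exact continuous_planeWave.comp (by fun_prop : Continuous fun p : E3 × ℝ => (x, p.1))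
  · rw [norm_mul, norm_planeWave, one_mul]

theorem integrableOn_waveIntegral (H : IntensitySpectrum n h) {f : ℝ → ℝ} (hf : Continuous f)
    {c : ℝ} (hc : 0 < c) (x : E3) :
    IntegrableOn (fun τ => waveIntegral h (f τ) τ x) (Set.Ioi c) := by
  have := (H.integrable_planeWave_kernel hf hc x).integral_prod_right
  simpa only [waveIntegral, fourierInv_eq_planeWave, IntegrableOn] using this

theorem norm_waveIntegral_sub_le (H : IntensitySpectrum n h) (hn : 2 ≤ n) (σ σ' : ℝ) {τ : ℝ}
    (hτ : 0 < τ) (x : E3) :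
    ‖waveIntegral h σ τ x - waveIntegral h σ' τ x‖ ≤ |σ - σ'| * (τ ^ 3)⁻¹ * ∫ η, ‖h η‖ := by
  have hI : Integrable h := by simpa using H.integrable 0 (by omega)
  have hIτ : Integrable fun ξ : E3 => h (τ • ξ) := hI.comp_smul hτ.ne'
  have hker : ∀ σ, Integrable fun ξ : E3 => planeWave x ξ *
      (((sinSymbol σ (2 * Real.pi * ‖ξ‖) : ℝ) : ℂ) * h (τ • ξ)) := fun σ => by
    refine (hIτ.norm.const_mul |σ|).mono' ?_ (Filter.Eventually.of_forall fun ξ => ?_)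
    · refine Continuous.aestronglyMeasurable (Continuous.mul ?_ (Continuous.mul ?_ ?_))
      · exact continuous_planeWave.comp (by fun_prop : Continuous fun ξ : E3 => (x, ξ))
      · exact Complex.continuous_ofReal.comp (continuous_sinSymbol.comp
          (by fun_prop : Continuous fun ξ : E3 => (σ, 2 * Real.pi * ‖ξ‖)))
      · exact H.continuous.comp (by fun_prop)
    · rw [norm_mul, norm_planeWave, one_mul, norm_mul, Complex.norm_real, Real.norm_eq_abs]
      refine mul_le_mul_of_nonneg_right ?_ (norm_nonneg _)
      have := abs_sinSymbol_sub_le σ 0 (2 * Real.pi * ‖ξ‖)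
      rwa [sinSymbol_zero, sub_zero, sub_zero] at this
  unfold waveIntegral
  rw [fourierInv_eq_planeWave, fourierInv_eq_planeWave, ← integral_sub (hker σ) (hker σ')]
  refine (norm_integral_le_of_norm_le (hIτ.norm.const_mul |σ - σ'|)
    (Filter.Eventually.of_forall fun ξ => ?_)).trans (le_of_eq ?_)
  · rw [← mul_sub, ← sub_mul, norm_mul, norm_planeWave, one_mul, norm_mul, ← Complex.ofReal_sub,
      Complex.norm_real, Real.norm_eq_abs]
    exact mul_le_mul_of_nonneg_right (abs_sinSymbol_sub_le _ _ _) (norm_nonneg _)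
  · rw [integral_const_mul, Measure.integral_comp_smul volume (fun η => ‖h η‖),
      finrank_euclideanSpace_fin, abs_of_pos (by positivity : 0 < (τ ^ 3)⁻¹), smul_eq_mul, mul_assoc]

end IntensitySpectrum

theorem ofReal_tildeA1 {n : ℕ} {w : E3 → ℂ} (H : IntensitySpectrum n (intensityFourier w)) (x : E3) :
    (tildeA1 w x : ℂ) = (𝓕⁻ (phaseSymbol (intensityFourier w))) x := by
  rw [← H.fourierInv_phaseSymbol_real]
  congr 1
  set h := intensityFourier w
  have hf : Continuous fun ν : ℝ => ν - 1 := by fun_prop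
  have e1 : ∫ ν in Set.Ioi (1 : ℝ), (waveIntegral h (ν - 1) ν x).re =
      (∫ ν in Set.Ioi (1 : ℝ), waveIntegral h (ν - 1) ν x).re :=
    integral_re (H.integrableOn_waveIntegral hf one_pos x)
  rw [tildeA1_eq_integral, e1, ← Complex.neg_re]
  congr 1
  simp only [waveIntegral, fourierInv_eq_planeWave]
  rw [← integral_integral_swap (f := fun (ξ : E3) (ν : ℝ) => planeWave x ξ *
    (((sinSymbol (ν - 1) (2 * Real.pi * ‖ξ‖) : ℝ) : ℂ) * h (ν • ξ)))
    (H.integrable_planeWave_kernel hf one_pos x), ← integral_neg]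
  refine integral_congr_ae (Filter.Eventually.of_forall fun ξ => ?_)
  simp only [phaseSymbol, mul_neg, ← integral_const_mul]

theorem contDiff_tildeA1 {n : ℕ} {w : E3 → ℂ} (H : IntensitySpectrum n (intensityFourier w))
    (hn : 2 ≤ n) : ContDiff ℝ 1 (tildeA1 w) := by
  have h1 := contDiff_fourierInv H.integrable_phaseSymbol (by
    simpa using H.integrable_pow_mul_phaseSymbol (k := 0) (by omega))
  have h2 : ContDiff ℝ 1 fun x => ((𝓕⁻ (phaseSymbol (intensityFourier w))) x).re :=
    Complex.reCLM.contDiff.comp h1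
  simpa only [← ofReal_tildeA1 H, Complex.ofReal_re] using h2

/-- The derivative of `Ã₁` along the dilations, `y·∇Ã₁`, is bounded, although no bound on the whole
of `|y| ∇Ã₁` is available: by self-similarity it is a time derivative of `A₁`, where `∂ₜ` removes
the factor `ω⁻¹`. -/
theorem exists_abs_tildeA1_add_fderiv_le {n : ℕ} {w : E3 → ℂ}
    (H : IntensitySpectrum n (intensityFourier w)) (hn : 2 ≤ n) :
    ∃ C : ℝ, ∀ y, |tildeA1 w y + fderiv ℝ (tildeA1 w) y y| ≤ C := by
  set h := intensityFourier w with hh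
  set I := ∫ τ in Set.Ioi (1 / 2 : ℝ), τ ^ (-3 : ℝ) with hI
  have hIi : IntegrableOn (fun τ : ℝ => τ ^ (-3 : ℝ)) (Set.Ioi (1 / 2)) :=
    integrableOn_Ioi_rpow_of_lt (by norm_num) (by norm_num)
  have hI0 : 0 ≤ I := setIntegral_nonneg measurableSet_Ioi fun τ hτ => by
    have : (0 : ℝ) < τ := lt_trans (by norm_num) hτ
    positivity
  refine ⟨I * ∫ η, ‖h η‖, fun y => ?_⟩
  -- truncating `r - τ` at `0` keeps the domain of integration fixed while `φ r = A₁(r, y)` near `1`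
  set φ : ℝ → ℝ := fun r => ∫ τ in Set.Ioi (1 / 2 : ℝ), (waveIntegral h (min (r - τ) 0) τ y).re
    with hφ
  have hcont : ∀ r : ℝ, Continuous fun τ : ℝ => min (r - τ) 0 := fun r => by fun_prop
  have hint : ∀ r : ℝ, IntegrableOn (fun τ => (waveIntegral h (min (r - τ) 0) τ y).re)
      (Set.Ioi (1 / 2)) := fun r =>
    (H.integrableOn_waveIntegral (hcont r) (by norm_num) y).re
  have hLip : ∀ r r', |φ r - φ r'| ≤ (I * ∫ η, ‖h η‖) * |r - r'| := by
    intro r r'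
    rw [hφ, ← integral_sub (hint r) (hint r')]
    have hb := norm_integral_le_of_norm_le
      (f := fun τ => (waveIntegral h (min (r - τ) 0) τ y).re -
        (waveIntegral h (min (r' - τ) 0) τ y).re)
      (g := fun τ => |r - r'| * τ ^ (-3 : ℝ) * ∫ η, ‖h η‖) (μ := volume.restrict (Set.Ioi (1 / 2)))
      ((hIi.const_mul _).mul_const _) (by
        filter_upwards [ae_restrict_mem measurableSet_Ioi] with τ hτ
        have h0 : (0 : ℝ) < τ := lt_trans (by norm_num) hτ
        rw [← Complex.sub_re]
        refine (Complex.abs_re_le_norm _).trans ?_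
        refine (H.norm_waveIntegral_sub_le hn _ _ h0 y).trans ?_
        rw [Real.rpow_neg h0.le]
        norm_cast
        refine mul_le_mul_of_nonneg_right (mul_le_mul_of_nonneg_right ?_ (by positivity))
          (by positivity)
        refine (abs_min_sub_min_le_max _ _ _ _).trans ?_
        simp)
    rw [integral_mul_const, integral_const_mul] at hb
    refine (le_of_eq ?_).trans (hb.trans (le_of_eq ?_))
    · rfl
    · rw [← hI]; ring
  have hφA : ∀ r : ℝ, 1 / 2 < r → φ r = r⁻¹ * tildeA1 w (r⁻¹ • y) := by
    intro r hr
    have hr0 : 0 < r := lt_trans (by norm_num) hr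
    rw [← A1_eq w hr0, A1_eq_integral w hr0, hφ]
    simp only
    rw [setIntegral_eq_of_subset_of_forall_sdiff_eq_zero (f := fun τ =>
      (waveIntegral h (min (r - τ) 0) τ y).re) (s := Set.Ioi r) (t := Set.Ioi (1 / 2)) measurableSet_Ioi
      (Set.Ioi_subset_Ioi hr.le) (fun τ hτ => ?_)]
    · refine setIntegral_congr_fun measurableSet_Ioi fun τ hτ => ?_
      have : r - τ ≤ 0 := by linarith [Set.mem_Ioi.1 hτ]
      simp only [min_eq_left this]
      rfl
    · have : 0 ≤ r - τ := by linarith [not_lt.1 (Set.mem_Ioi.not.1 hτ.2)]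
      rw [min_eq_right this]
      simp [waveIntegral, sinSymbol_zero, fourierInv_eq_planeWave]
  have hd : HasDerivAt φ (-(tildeA1 w y + fderiv ℝ (tildeA1 w) y y)) 1 := by
    have h1 : HasDerivAt (fun r : ℝ => r⁻¹) (-1) 1 := by
      simpa using hasDerivAt_inv (one_ne_zero : (1 : ℝ) ≠ 0)
    have hdiff : HasFDerivAt (tildeA1 w) (fderiv ℝ (tildeA1 w) ((1 : ℝ)⁻¹ • y)) ((1 : ℝ)⁻¹ • y) :=
      ((contDiff_tildeA1 H hn).differentiable (by norm_num)).differentiableAt.hasFDerivAt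
    have h2 := hdiff.comp_hasDerivAt (1 : ℝ) (h1.smul_const y)
    have h3 := h1.mul h2
    refine (h3.congr_of_eventuallyEq ?_).congr_deriv ?_
    · filter_upwards [Ioi_mem_nhds (by norm_num : (1 / 2 : ℝ) < 1)] with r hr
      exact hφA r hr
    · simp
      ring
  have := hd.le_of_lip' (C := I * ∫ η, ‖h η‖) (by positivity)
    (Filter.Eventually.of_forall fun r => by
      simpa [Real.norm_eq_abs] using hLip r 1)
  rwa [norm_neg, Real.norm_eq_abs] at this

/-! ### Regularity of the data on the Fourier side -/

/-- The Fourier transform of the tempered distribution `T` is the function `a`. -/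
def HasSpectrum (T : 𝓢'(E3, ℂ)) (a : E3 → ℂ) : Prop :=
  ∀ ψ : 𝓢(E3, ℂ), T ψ = ∫ ξ, (𝓕⁻ ψ : 𝓢(E3, ℂ)) ξ * a ξ

theorem toTemperedDistribution_eq_integral {r : ℝ≥0∞} [Fact (1 ≤ r)]
    (f : Lp ℂ r (volume : Measure E3)) (ψ : 𝓢(E3, ℂ)) :
    (f : 𝓢'(E3, ℂ)) ψ = ∫ x, ψ x * f x := by
  simp only [Lp.toTemperedDistribution_apply, smul_eq_mul]

theorem hasSpectrum_Lp (f : L2C) : HasSpectrum (f : 𝓢'(E3, ℂ)) (𝓕 f : L2C) := fun ψ => by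
  rw [toTemperedDistribution_eq_integral, isFourierInv_Lp f ψ]

theorem HasSpectrum.lineDeriv {T : 𝓢'(E3, ℂ)} {a : E3 → ℂ} (h : HasSpectrum T a) (i : Fin 3) :
    HasSpectrum (∂_{basisVec i} T) (fun ξ => partialSymbol i ξ * a ξ) := fun ψ => by
  rw [TemperedDistribution.lineDerivOp_apply_apply, map_neg, h, ← integral_neg]
  refine integral_congr_ae (Filter.Eventually.of_forall fun ξ => ?_)
  simp only [SchwartzMap.partialSymbol_mul_fourierInv]
  ring

theorem IsOmegaInv.hasSpectrum {B : 𝓢'(E3, ℂ)} {b : L2C} (h : IsOmegaInv B b) :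
    HasSpectrum B (fun ξ => ((2 * Real.pi * ‖ξ‖ : ℝ) : ℂ) * (𝓕 b : L2C) ξ) := fun ψ => by
  rw [← h (𝓕⁻ ψ : 𝓢(E3, ℂ)), TemperedDistribution.fourier_apply, fourier_fourierInv_eq]

theorem HasSpectrum.isFourierInv {T : 𝓢'(E3, ℂ)} {a : E3 → ℂ} (h : HasSpectrum T a) {r : ℝ≥0∞}
    [Fact (1 ≤ r)] {g : Lp ℂ r (volume : Measure E3)} (hg : T = (g : 𝓢'(E3, ℂ))) :
    IsFourierInv a g := fun ψ => by
  rw [← toTemperedDistribution_eq_integral, ← hg, h ψ]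

theorem hasTemperateGrowth_bracket (r : ℝ) :
    (fun x : E3 => (((1 + ‖x‖ ^ 2) ^ r : ℝ) : ℂ)).HasTemperateGrowth := by
  fun_prop

theorem continuous_bracket (r : ℝ) : Continuous fun x : E3 => (((1 + ‖x‖ ^ 2) ^ r : ℝ) : ℂ) :=
  Complex.continuous_ofReal.comp ((by fun_prop : Continuous fun x : E3 => 1 + ‖x‖ ^ 2).rpow_const
    fun x => Or.inl (by positivity))

theorem hasTemperateGrowth_scaled_bracket (r : ℝ) :
    (fun x : E3 => (((1 + ‖(2 * Real.pi) • x‖ ^ 2) ^ r : ℝ) : ℂ)).HasTemperateGrowth := by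
  have h := (hasTemperateGrowth_bracket r).comp
    (((2 * Real.pi) • ContinuousLinearMap.id ℝ E3).hasTemperateGrowth)
  exact h

/-- `MemWeightedSobolev` in terms of functions: `v = (1 - Δ)^{k/2} u` is a function. -/
theorem MemWeightedSobolev.exists_isFourierInv {k s : ℝ} {u : L2C}
    (h : MemWeightedSobolev k s (u : 𝓢'(E3, ℂ))) :
    ∃ v : E3 → ℂ, MemLp (fun x => (((1 + ‖x‖ ^ 2) ^ (s / 2) : ℝ) : ℂ) * v x) 2 volume ∧
      IsFourierInv (fun ξ => (((1 + ‖(2 * Real.pi) • ξ‖ ^ 2) ^ (k / 2) : ℝ) : ℂ) *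
        (𝓕 u : L2C) ξ) v := by
  obtain ⟨g, hg⟩ := h
  refine ⟨fun x => (((1 + ‖x‖ ^ 2) ^ (-(s / 2)) : ℝ) : ℂ) * g x, ?_, fun χ => ?_⟩
  · refine (Lp.memLp g).ae_eq (Filter.Eventually.of_forall fun x => ?_)
    simp only
    rw [← mul_assoc, ← Complex.ofReal_mul, ← Real.rpow_add (by positivity), add_neg_cancel,
      Real.rpow_zero, Complex.ofReal_one, one_mul]
  · have e := congrArg (fun T : 𝓢'(E3, ℂ) => T (SchwartzMap.smulLeftCLM ℂ
      (fun x : E3 => (((1 + ‖x‖ ^ 2) ^ (-(s / 2)) : ℝ) : ℂ)) χ)) hg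
    simp only [TemperedDistribution.smulLeftCLM_apply_apply,
      TemperedDistribution.fourierMultiplierCLM_apply_apply] at e
    rw [SchwartzMap.smulLeftCLM_smulLeftCLM_apply (hasTemperateGrowth_bracket _)
      (hasTemperateGrowth_bracket _)] at e
    have e1 : ((fun x : E3 => (((1 + ‖x‖ ^ 2) ^ (s / 2) : ℝ) : ℂ)) *
        fun x : E3 => (((1 + ‖x‖ ^ 2) ^ (-(s / 2)) : ℝ) : ℂ)) = fun _ => 1 := by
      ext x
      simp only [Pi.mul_apply]
      rw [← Complex.ofReal_mul, ← Real.rpow_add (by positivity), add_neg_cancel,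
        Real.rpow_zero, Complex.ofReal_one]
    rw [e1, SchwartzMap.smulLeftCLM_const, one_smul, ContinuousLinearMap.id_apply, hasSpectrum_Lp u,
      toTemperedDistribution_eq_integral, fourierInv_fourier_eq] at e
    simp only [SchwartzMap.smulLeftCLM_apply_apply (hasTemperateGrowth_bracket _),
      SchwartzMap.smulLeftCLM_apply_apply (hasTemperateGrowth_scaled_bracket _), smul_eq_mul] at e
    refine Eq.trans ?_ (e.symm.trans ?_)
    · refine integral_congr_ae (Filter.Eventually.of_forall fun x => ?_)
      simp only; ring
    · refine integral_congr_ae (Filter.Eventually.of_forall fun x => ?_)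
      simp only; ring

theorem one_add_le_two_mul_sqrt (r : ℝ) : 1 + r ≤ 2 * (1 + r ^ 2) ^ (1 / 2 : ℝ) := by
  rw [← Real.sqrt_eq_rpow]
  have h1 : 1 ≤ √(1 + r ^ 2) := Real.one_le_sqrt.2 (by nlinarith)
  have h2 : r ≤ √(1 + r ^ 2) := Real.le_sqrt_of_sq_le (by linarith)
  linarith

theorem MemLp.comp_smul_two {f : E3 → ℂ} (hf : MemLp f 2 volume) {c : ℝ} (hc : c ≠ 0) :
    MemLp (fun x => f (c • x)) 2 volume := by
  have hq : Measure.QuasiMeasurePreserving (fun x : E3 => c • x) volume volume := by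
    refine ⟨measurable_const_smul c, ?_⟩
    rw [Measure.map_addHaar_smul _ hc]
    exact Measure.smul_absolutelyContinuous
  have hm : AEStronglyMeasurable (fun x => f (c • x)) volume := hf.1.comp_quasiMeasurePreserving hq
  rw [memLp_two_iff_integrable_sq_norm hm]
  exact ((memLp_two_iff_integrable_sq_norm hf.1).1 hf).comp_smul hc

theorem ae_comp_smul {p : E3 → Prop} (h : ∀ᵐ x, p x) {c : ℝ} (hc : c ≠ 0) :
    ∀ᵐ x : E3, p (c • x) := by
  have hq : Measure.QuasiMeasurePreserving (fun x : E3 => c • x) volume volume := by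
    refine ⟨measurable_const_smul c, ?_⟩
    rw [Measure.map_addHaar_smul _ hc]
    exact Measure.smul_absolutelyContinuous
  exact hq.ae h

/-- If `u ∈ H^{k,n}` with `n ≥ 2`, then `(1 + |ξ|²)^{k/2} F u` is the inverse Fourier transform of an
integrable function `b` with `(1 + |x|)ⁿ b ∈ L²`. -/
theorem MemWeightedSobolev.exists_unitaryFourier {k : ℝ} {n : ℕ} (hn : 2 ≤ n) {u : L2C}
    (h : MemWeightedSobolev k n (u : 𝓢'(E3, ℂ))) :
    ∃ b : E3 → ℂ, MemWeightedL2 n b ∧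
      (fun ξ => (((1 + ‖ξ‖ ^ 2) ^ (k / 2) : ℝ) : ℂ) * unitaryFourier u ξ) =ᵐ[volume] 𝓕⁻ b := by
  obtain ⟨v, hv, hvF⟩ := h.exists_isFourierInv
  have hvm : AEStronglyMeasurable v volume := by
    have := (continuous_bracket (-((n : ℝ) / 2))).aestronglyMeasurable.mul hv.1
    refine this.congr (Filter.Eventually.of_forall fun x => ?_)
    simp only [Pi.mul_apply]
    rw [← mul_assoc, ← Complex.ofReal_mul, ← Real.rpow_add (by positivity), neg_add_cancel,
      Real.rpow_zero, Complex.ofReal_one, one_mul]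
  have hbound : ∀ x : E3, (1 + ‖x‖) ^ n ≤ 2 ^ n * (1 + ‖x‖ ^ 2) ^ ((n : ℝ) / 2) := fun x => by
    refine (pow_le_pow_left₀ (by positivity) (one_add_le_two_mul_sqrt ‖x‖) n).trans
      (le_of_eq ?_)
    rw [mul_pow, ← Real.rpow_natCast ((1 + ‖x‖ ^ 2) ^ (1 / 2 : ℝ)) n,
      ← Real.rpow_mul (by positivity)]
    congr 2; ring
  have hvW : MemWeightedL2 n v := by
    refine MemLp.of_le_mul (c := 2 ^ n) hv
      ((Continuous.aestronglyMeasurable (by fun_prop)).mul hvm)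
      (Filter.Eventually.of_forall fun x => ?_)
    rw [norm_mul, norm_mul, Complex.norm_real, Complex.norm_real,
      Real.norm_of_nonneg (by positivity), Real.norm_of_nonneg (by positivity), ← mul_assoc]
    exact mul_le_mul_of_nonneg_right (hbound x) (norm_nonneg _)
  have hvI := hvW.integrable hn
  have hF : 𝓕 v =ᵐ[volume] fun ξ => (((1 + ‖(2 * Real.pi) • ξ‖ ^ 2) ^ (k / 2) : ℝ) : ℂ) *
      (𝓕 u : L2C) ξ := by
    refine (isFourierInv_fourier hvI).unique_left hvF ?_ ?_
    · have := (continuous_fourierInv hvI).comp continuous_neg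
      refine Continuous.locallyIntegrable (this.congr fun x => ?_)
      simp [Function.comp, Real.fourierInv_eq_fourier_neg]
    · exact (memLp_two_locallyIntegrable (Lp.memLp _)).continuous_mul
        ((continuous_bracket (k / 2)).comp (by fun_prop))
  set τ : ℝ := (2 * Real.pi)⁻¹ with hτ
  have hτ0 : 0 < τ := by positivity
  set c : ℝ := (2 * Real.pi) ^ (-(3 / 2) : ℝ) with hc
  have hb : MemWeightedL2 n (fun y => v (-(2 * Real.pi) • y)) := by
    have h1 := MemLp.comp_smul_two hvW (c := -(2 * Real.pi)) (by
      simp [Real.pi_ne_zero])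
    refine MemLp.of_le h1 ((Continuous.aestronglyMeasurable (by fun_prop)).mul ?_)
      (Filter.Eventually.of_forall fun x => ?_)
    · exact (MemLp.comp_smul_two hvW.memLp (by simp [Real.pi_ne_zero])).1
    · rw [norm_mul, norm_mul, Complex.norm_real, Complex.norm_real,
        Real.norm_of_nonneg (by positivity), Real.norm_of_nonneg (by positivity)]
      refine mul_le_mul_of_nonneg_right (pow_le_pow_left₀ (by positivity) ?_ n) (norm_nonneg _)
      rw [norm_smul, norm_neg, Real.norm_of_nonneg (by positivity)]
      nlinarith [Real.pi_gt_three, norm_nonneg x]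
  refine ⟨fun y => ((c * (τ ^ 3)⁻¹ : ℝ) : ℂ) * v (-(2 * Real.pi) • y), ?_, ?_⟩
  · have := MemLp.const_mul hb (((c * (τ ^ 3)⁻¹ : ℝ) : ℂ))
    refine MemLp.ae_eq (Filter.Eventually.of_forall fun x => ?_) this
    simp only; ring
  · filter_upwards [ae_comp_smul hF hτ0.ne'] with ξ hξ
    rw [smul_smul, show 2 * Real.pi * τ = 1 by rw [hτ]; field_simp, one_smul] at hξ
    rw [unitaryFourier, ← hc, ← hτ, mul_left_comm, ← hξ, fourierInv_const_mul]
    have h1 := fourier_dilation v hτ0 ξ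
    have h2 : (𝓕⁻ (fun y => v (-(2 * Real.pi) • y))) ξ = 𝓕 (dilation τ v) ξ := by
      rw [fourierInv_eq_planeWave, Real.fourier_eq, ← integral_neg_eq_self]
      refine integral_congr_ae (Filter.Eventually.of_forall fun y => ?_)
      simp only [planeWave, dilation, smul_neg, neg_smul, neg_neg, hτ, inv_inv, Circle.smul_def,
        Real.fourierChar_apply, smul_eq_mul, inner_neg_right, real_inner_comm]
    have hτ3 : (τ : ℂ) ≠ 0 := by exact_mod_cast hτ0.ne'
    rw [h2, h1]
    push_cast
    field_simp

/-- If `u ∈ H^k` then `(1 + |2πξ|²)^{k/2} 𝓕u ∈ L²`. -/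
theorem MemWeightedSobolev.memLp_fourier {k : ℝ} {u : L2C}
    (h : MemWeightedSobolev k 0 (u : 𝓢'(E3, ℂ))) :
    MemLp (fun ξ => (((1 + ‖(2 * Real.pi) • ξ‖ ^ 2) ^ (k / 2) : ℝ) : ℂ) * (𝓕 u : L2C) ξ) 2
      volume := by
  obtain ⟨v, hv, hvF⟩ := h.exists_isFourierInv
  simp only [zero_div, Real.rpow_zero, Complex.ofReal_one, one_mul] at hv
  have h1 := (isFourierInv_Lp (hv.toLp v)).congr (ae_eq_refl _) hv.coeFn_toLp
  refine (Lp.memLp (𝓕 (hv.toLp v) : L2C)).ae_eq (h1.unique_left hvF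
    (memLp_two_locallyIntegrable (Lp.memLp _)) ?_)
  exact (memLp_two_locallyIntegrable (Lp.memLp _)).continuous_mul
        ((continuous_bracket (k / 2)).comp (by fun_prop))

theorem MemWeightedSobolev.memLp_norm_mul_fourier {u : L2C}
    (h : MemWeightedSobolev 1 0 (u : 𝓢'(E3, ℂ))) {m : E3 → ℂ} (hm : Continuous m)
    (hle : ∀ ξ, ‖m ξ‖ ≤ 2 * Real.pi * ‖ξ‖) :
    MemLp (fun ξ => m ξ * (𝓕 u : L2C) ξ) 2 volume := by
  refine MemLp.of_le h.memLp_fourier (hm.aestronglyMeasurable.mul (Lp.memLp _).1)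
    (Filter.Eventually.of_forall fun ξ => ?_)
  rw [norm_mul, norm_mul, Complex.norm_real, Real.norm_of_nonneg (by positivity)]
  refine mul_le_mul_of_nonneg_right ((hle ξ).trans ?_) (norm_nonneg _)
  rw [norm_smul, Real.norm_of_nonneg (by positivity), ← Real.sqrt_eq_rpow]
  exact Real.le_sqrt_of_sq_le (by linarith)

/-! ### The free wave -/

/-- The function `a` is the Fourier transform of an integrable function. -/
def IsFourierOfIntegrable (a : E3 → ℂ) : Prop :=
  ∃ g : E3 → ℂ, Integrable g ∧ a =ᵐ[volume] 𝓕 g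

namespace IsFourierOfIntegrable

theorem const_mul {a : E3 → ℂ} (h : IsFourierOfIntegrable a) (c : ℂ) :
    IsFourierOfIntegrable fun ξ => c * a ξ := by
  obtain ⟨g, hg, hga⟩ := h
  refine ⟨fun x => c * g x, hg.const_mul c, ?_⟩
  filter_upwards [hga] with ξ hξ
  rw [hξ, Real.fourier_eq, Real.fourier_eq, ← integral_const_mul]
  refine integral_congr_ae (Filter.Eventually.of_forall fun v => ?_)
  simp only [Circle.smul_def, smul_eq_mul]; ring

theorem add {a a' : E3 → ℂ} (h : IsFourierOfIntegrable a) (h' : IsFourierOfIntegrable a') :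
    IsFourierOfIntegrable fun ξ => a ξ + a' ξ := by
  obtain ⟨g, hg, hga⟩ := h
  obtain ⟨g', hg', hga'⟩ := h'
  refine ⟨fun x => g x + g' x, hg.add hg', ?_⟩
  have hi : ∀ {f : E3 → ℂ} (ξ : E3), Integrable f →
      Integrable fun v => Real.fourierChar (-inner ℝ v ξ) • f v := fun ξ hf => by
    have := (Real.fourierIntegral_convergent_iff (μ := volume) ξ).2 hf
    simpa using this
  filter_upwards [hga, hga'] with ξ hξ hξ'
  rw [hξ, hξ', Real.fourier_eq, Real.fourier_eq, Real.fourier_eq,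
    ← integral_add (hi ξ hg) (hi ξ hg')]
  simp only [smul_add]

theorem congr {a a' : E3 → ℂ} (h : IsFourierOfIntegrable a) (haa' : a =ᵐ[volume] a') :
    IsFourierOfIntegrable a' := by
  obtain ⟨g, hg, hga⟩ := h
  exact ⟨g, hg, haa'.symm.trans hga⟩

end IsFourierOfIntegrable

theorem HasSpectrum.isFourierOfIntegrable {T : 𝓢'(E3, ℂ)} {a : E3 → ℂ} (h : HasSpectrum T a)
    (ha : LocallyIntegrable a) {g : Lp ℂ 1 (volume : Measure E3)} (hg : T = (g : 𝓢'(E3, ℂ))) :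
    IsFourierOfIntegrable a := by
  have hgi := L1.integrable_coeFn g
  refine ⟨g, hgi, (h.isFourierInv hg).unique_left (isFourierInv_fourier hgi) ha ?_⟩
  have := (continuous_fourierInv hgi).comp continuous_neg
  refine Continuous.locallyIntegrable (this.congr fun x => ?_)
  simp [Function.comp, Real.fourierInv_eq_fourier_neg]

theorem MemSobolevW.isFourierOfIntegrable {k : ℕ} {T : 𝓢'(E3, ℂ)} (hT : MemSobolevW k 1 T)
    {a : E3 → ℂ} (h : HasSpectrum T a) (ha : LocallyIntegrable a) : IsFourierOfIntegrable a := by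
  obtain ⟨g, hg⟩ := hT 0 (Nat.zero_le k) Fin.elim0
  exact h.isFourierOfIntegrable ha hg

theorem MemSobolevW.isFourierOfIntegrable_partial {T : 𝓢'(E3, ℂ)} (hT : MemSobolevW 1 1 T)
    {a : E3 → ℂ} (h : HasSpectrum T a) (ha : LocallyIntegrable a) (i : Fin 3) :
    IsFourierOfIntegrable fun ξ => partialSymbol i ξ * a ξ := by
  obtain ⟨g, hg⟩ := hT 1 le_rfl fun _ => i
  exact (h.lineDeriv i).isFourierOfIntegrable (ha.continuous_mul (continuous_partialSymbol i)) hg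

theorem sum_partialSymbol_sq (ξ : E3) :
    ∑ i, partialSymbol i ξ * partialSymbol i ξ = -(((2 * Real.pi * ‖ξ‖) ^ 2 : ℝ) : ℂ) := by
  have h : ‖ξ‖ ^ 2 = ∑ i, ξ i ^ 2 := by
    rw [EuclideanSpace.norm_sq_eq]; simp
  rw [mul_pow, h, Fin.sum_univ_three, Fin.sum_univ_three]
  simp only [partialSymbol]
  push_cast
  linear_combination (4 * Real.pi ^ 2 * ((ξ 0 : ℂ) ^ 2 + (ξ 1 : ℂ) ^ 2 + (ξ 2 : ℂ) ^ 2)) *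
    Complex.I_sq

/-- The Fourier transform of `cos (ωt) f + sin (ωt) g`, where `f`, `g` have Fourier transforms `X`
and `Y`. -/
def waveSymbol (t : ℝ) (X Y : E3 → ℂ) (ξ : E3) : ℂ :=
  ((Real.cos (t * (2 * Real.pi * ‖ξ‖)) : ℝ) : ℂ) * X ξ +
    ((Real.sin (t * (2 * Real.pi * ‖ξ‖)) : ℝ) : ℂ) * Y ξ

theorem exists_dispersive_estimate {X Y : E3 → ℂ} (hX : MemLp X 2 volume) (hY : MemLp Y 2 volume)
    (h1 : ∀ i, IsFourierOfIntegrable fun ξ => partialSymbol i ξ * (partialSymbol i ξ * X ξ))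
    (h2 : ∀ j, IsFourierOfIntegrable fun ξ =>
      partialSymbol j ξ * (((2 * Real.pi * ‖ξ‖ : ℝ) : ℂ) * Y ξ)) :
    ∃ C : ℝ, 0 ≤ C ∧ ∀ t : ℝ, 0 < t → ∀ B : E3 → ℂ, LocallyIntegrable B →
      IsFourierInv (waveSymbol t X Y) B → eLpNorm B ∞ volume ≤ ENNReal.ofReal (C * t⁻¹) := by
  have h3 : IsFourierOfIntegrable fun ξ => (((2 * Real.pi * ‖ξ‖) ^ 2 : ℝ) : ℂ) * X ξ := by
    refine ((((h1 0).add (h1 1)).add (h1 2)).const_mul (-1)).congr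
      (Filter.Eventually.of_forall fun ξ => ?_)
    have := sum_partialSymbol_sq ξ
    rw [Fin.sum_univ_three] at this
    simp only
    linear_combination (-X ξ) * this
  have h4 : ∀ j, IsFourierOfIntegrable fun ξ => ((‖ξ‖ * ξ j : ℝ) : ℂ) * Y ξ := fun j => by
    refine ((h2 j).const_mul (((4 * Real.pi ^ 2 : ℝ) : ℂ) * Complex.I)⁻¹).congr
      (Filter.Eventually.of_forall fun ξ => ?_)
    have hp : (Real.pi : ℂ) ≠ 0 := by exact_mod_cast Real.pi_ne_zero
    simp only [partialSymbol]
    push_cast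
    field_simp [Complex.I_ne_zero]
    ring
  obtain ⟨g, hg, hgX⟩ := h3
  choose gg hgg hggY using h4
  refine ⟨(∫ y, ‖g y‖) + 2 * Real.pi * ∑ j, ∫ y, ‖gg j y‖, by positivity, fun t ht B hB h => ?_⟩
  rw [mul_comm]
  exact dispersive_estimate ht hX hY hg hgg hgX hggY hB h

theorem isFourierInv_A0 (Ap b : L2C) (t : ℝ) :
    IsFourierInv (waveSymbol t (𝓕 Ap : L2C) (𝓕 b : L2C)) (A0 Ap b t) := by
  refine (isFourierInv_fourierInv_Lp _).congr ?_ (ae_eq_refl _)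
  filter_upwards [Lp.coeFn_add ((memLp_top_cos t).toLp _ • (𝓕 Ap : L2C))
    ((memLp_top_sin t).toLp _ • (𝓕 b : L2C)), Lp.coeFn_lpSMul (r := 2) ((memLp_top_cos t).toLp _)
    (𝓕 Ap : L2C), Lp.coeFn_lpSMul (r := 2) ((memLp_top_sin t).toLp _) (𝓕 b : L2C),
    (memLp_top_cos t).coeFn_toLp, (memLp_top_sin t).coeFn_toLp] with ξ h1 h2 h3 h4 h5
  rw [h1, Pi.add_apply, h2, h3, Pi.smul_apply', Pi.smul_apply', h4, h5]
  rfl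

/-- The wave with the prescribed Fourier transforms `X`, `Y` of the data. -/
def waveOf {X Y : E3 → ℂ} (hX : MemLp X 2 volume) (hY : MemLp Y 2 volume) (t : ℝ) : L2C :=
  A0 (𝓕⁻ (hX.toLp X)) (𝓕⁻ (hY.toLp Y)) t

theorem isFourierInv_waveOf {X Y : E3 → ℂ} (hX : MemLp X 2 volume) (hY : MemLp Y 2 volume) (t : ℝ) :
    IsFourierInv (waveSymbol t X Y) (waveOf hX hY t) := by
  refine (isFourierInv_A0 _ _ t).congr ?_ (ae_eq_refl _)
  rw [fourier_fourierInv_eq, fourier_fourierInv_eq]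
  filter_upwards [hX.coeFn_toLp, hY.coeFn_toLp] with ξ h1 h2
  rw [waveSymbol, waveSymbol, h1, h2]

theorem norm_A0_le (Ap b : L2C) (t : ℝ) : ‖A0 Ap b t‖ ≤ ‖Ap‖ + ‖b‖ := by
  have h0 : ∀ a : L2C, ‖(𝓕⁻ a : L2C)‖ = ‖a‖ := fun a => (Lp.fourierTransformₗᵢ E3 ℂ).symm.norm_map a
  have h1 : ∀ a : L2C, ‖(𝓕 a : L2C)‖ = ‖a‖ := fun a => (Lp.fourierTransformₗᵢ E3 ℂ).norm_map a
  have h2 : ∀ {f : E3 → ℂ} (hf : MemLp f ∞ volume), (∀ x, ‖f x‖ ≤ 1) → ∀ a : L2C,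
      ‖(hf.toLp f • a : L2C)‖ ≤ ‖a‖ := fun {f} hf hb a => by
    refine Lp.norm_le_norm_of_ae_le ?_
    filter_upwards [Lp.coeFn_lpSMul (r := 2) (hf.toLp f) a, hf.coeFn_toLp] with x h1 h2
    rw [h1, Pi.smul_apply', h2, smul_eq_mul, norm_mul]
    exact mul_le_of_le_one_left (norm_nonneg _) (hb x)
  rw [A0, h0]
  refine (norm_add_le _ _).trans (add_le_add ?_ ?_)
  · refine (h2 (memLp_top_cos t) (fun x => ?_) _).trans (h1 _).le
    rw [Complex.norm_real]; exact Real.abs_cos_le_one _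
  · refine (h2 (memLp_top_sin t) (fun x => ?_) _).trans (h1 _).le
    rw [Complex.norm_real]; exact Real.abs_sin_le_one _

theorem eLpNorm_A0_le (Ap b : L2C) (t : ℝ) :
    eLpNorm (A0 Ap b t) 2 volume ≤ ENNReal.ofReal (‖Ap‖ + ‖b‖) := by
  rw [← ENNReal.ofReal_toReal (Lp.memLp (A0 Ap b t)).2.ne, ← Lp.norm_def]
  exact ENNReal.ofReal_le_ofReal (norm_A0_le Ap b t)

theorem norm_waveSymbol_le (t : ℝ) (X Y : E3 → ℂ) (ξ : E3) :
    ‖waveSymbol t X Y ξ‖ ≤ ‖X ξ‖ + ‖Y ξ‖ := by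
  refine (norm_add_le _ _).trans (add_le_add ?_ ?_)
  · rw [norm_mul, Complex.norm_real]
    exact mul_le_of_le_one_left (norm_nonneg _) (Real.abs_cos_le_one _)
  · rw [norm_mul, Complex.norm_real]
    exact mul_le_of_le_one_left (norm_nonneg _) (Real.abs_sin_le_one _)

theorem hasDerivAt_waveSymbol (t : ℝ) (X Y : E3 → ℂ) (ξ : E3) :
    HasDerivAt (fun s => waveSymbol s X Y ξ)
      (waveSymbol t (fun ξ => ((2 * Real.pi * ‖ξ‖ : ℝ) : ℂ) * Y ξ)
        (fun ξ => -(((2 * Real.pi * ‖ξ‖ : ℝ) : ℂ) * X ξ)) ξ) t := by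
  have h : HasDerivAt (fun s : ℝ => s * (2 * Real.pi * ‖ξ‖)) (2 * Real.pi * ‖ξ‖) t := by
    simpa using (hasDerivAt_id t).mul_const (2 * Real.pi * ‖ξ‖)
  refine ((h.cos.ofReal_comp.mul_const (X ξ)).add
    (h.sin.ofReal_comp.mul_const (Y ξ))).congr_deriv ?_
  simp only [waveSymbol]
  push_cast; ring

/-- The free wave is differentiable in time, with values in `L²`, when `ωA₊, ωb ∈ L²`. -/
theorem hasDerivAt_A0 {Ap b : L2C}
    (hX : MemLp (fun ξ => ((2 * Real.pi * ‖ξ‖ : ℝ) : ℂ) * (𝓕 b : L2C) ξ) 2 volume)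
    (hY : MemLp (fun ξ => -(((2 * Real.pi * ‖ξ‖ : ℝ) : ℂ) * (𝓕 Ap : L2C) ξ)) 2 volume) (t : ℝ) :
    HasDerivAt (A0 Ap b) (waveOf hX hY t) t := by
  set Z : ℝ → L2C := fun s => 𝓕 (A0 Ap b s) with hZ
  have hZc : ∀ s, Z s =ᵐ[volume] waveSymbol s (𝓕 Ap : L2C) (𝓕 b : L2C) := fun s =>
    (isFourierInv_Lp (A0 Ap b s)).unique_left (isFourierInv_A0 Ap b s)
      (memLp_two_locallyIntegrable (Lp.memLp _)) (memLp_two_locallyIntegrable (by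
        refine MemLp.of_le (g := fun ξ => ‖(𝓕 Ap : L2C) ξ‖ + ‖(𝓕 b : L2C) ξ‖)
          ((Lp.memLp _).norm.add (Lp.memLp _).norm) ?_ (Filter.Eventually.of_forall fun ξ => ?_)
        · exact ((memLp_top_cos s).1.mul (Lp.memLp _).1).add
            ((memLp_top_sin s).1.mul (Lp.memLp _).1)
        · exact (norm_waveSymbol_le _ _ _ _).trans (Real.le_norm_self _)))
  set D : L2C := 𝓕 (waveOf hX hY t) with hD
  have hDm : MemLp (waveSymbol t (fun ξ => ((2 * Real.pi * ‖ξ‖ : ℝ) : ℂ) * (𝓕 b : L2C) ξ)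
      (fun ξ => -(((2 * Real.pi * ‖ξ‖ : ℝ) : ℂ) * (𝓕 Ap : L2C) ξ))) 2 volume := by
    refine MemLp.of_le (hX.norm.add hY.norm) ?_ (Filter.Eventually.of_forall fun ξ => ?_)
    · exact ((memLp_top_cos t).1.mul hX.1).add ((memLp_top_sin t).1.mul hY.1)
    · exact (norm_waveSymbol_le _ _ _ _).trans (Real.le_norm_self _)
  have hDc : D =ᵐ[volume] _ := (isFourierInv_Lp (waveOf hX hY t)).unique_left
    (isFourierInv_waveOf hX hY t) (memLp_two_locallyIntegrable (Lp.memLp _))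
    (memLp_two_locallyIntegrable hDm)
  have hmain : HasDerivAt Z D t := by
    rw [hasDerivAt_iff_tendsto_slope, Lp.tendsto_Lp_iff_tendsto_eLpNorm']
    have hsl : ∀ s, (slope Z t s : L2C) =ᵐ[volume]
        fun ξ => slope (fun s => waveSymbol s (𝓕 Ap : L2C) (𝓕 b : L2C) ξ) t s := fun s => by
      rw [slope_def_module]
      filter_upwards [Lp.coeFn_smul (s - t)⁻¹ (Z s - Z t), Lp.coeFn_sub (Z s) (Z t), hZc s, hZc t]
        with ξ h1 h2 h3 h4
      rw [h1, Pi.smul_apply, h2, Pi.sub_apply, h3, h4, slope_def_module]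
    have hlim := tendsto_eLpNorm_two_of_dominated (l := 𝓝[≠] t)
      (F := fun s ξ => slope (fun s => waveSymbol s (𝓕 Ap : L2C) (𝓕 b : L2C) ξ) t s)
      (f := waveSymbol t (fun ξ => ((2 * Real.pi * ‖ξ‖ : ℝ) : ℂ) * (𝓕 b : L2C) ξ)
        (fun ξ => -(((2 * Real.pi * ‖ξ‖ : ℝ) : ℂ) * (𝓕 Ap : L2C) ξ)))
      (bound := fun ξ => 2 * (‖((2 * Real.pi * ‖ξ‖ : ℝ) : ℂ) * (𝓕 b : L2C) ξ‖ +
        ‖-(((2 * Real.pi * ‖ξ‖ : ℝ) : ℂ) * (𝓕 Ap : L2C) ξ)‖))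
      (Filter.Eventually.of_forall fun s => (Lp.memLp (slope Z t s)).1.congr (hsl s)) hDm.1
      ((hX.norm.add hY.norm).const_mul 2) ?_ ?_
    · refine hlim.congr fun s => eLpNorm_congr_ae ?_
      filter_upwards [hsl s, hDc] with ξ h1 h2
      rw [Pi.sub_apply, Pi.sub_apply, h1, h2]
    · filter_upwards [self_mem_nhdsWithin] with s hs
      refine Filter.Eventually.of_forall fun ξ => ?_
      have hle := Convex.norm_image_sub_le_of_norm_hasDerivWithin_le (s := Set.univ) (x := t)
        (y := s) (fun s _ => (hasDerivAt_waveSymbol s (𝓕 Ap : L2C) (𝓕 b : L2C) ξ).hasDerivWithinAt)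
        (fun s _ => norm_waveSymbol_le _ _ _ _) convex_univ trivial trivial
      rw [slope_def_module]
      refine (norm_sub_le _ _).trans ?_
      rw [two_mul (_ + _)]
      refine add_le_add ?_ (norm_waveSymbol_le _ _ _ _)
      have hst : 0 < ‖s - t‖ := norm_pos_iff.2 (sub_ne_zero.2 hs)
      rw [norm_smul, norm_inv, inv_mul_le_iff₀ hst, mul_comm]
      exact hle
    · exact Filter.Eventually.of_forall fun ξ =>
        hasDerivAt_iff_tendsto_slope.1 (hasDerivAt_waveSymbol t _ _ ξ)
  have h2 := ((fourierInvCLM ℂ L2C).restrictScalars ℝ).hasFDerivAt.comp_hasDerivAt t hmain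
  have e1 : (((fourierInvCLM ℂ L2C).restrictScalars ℝ) ∘ Z) = A0 Ap b := by
    funext s
    simp [hZ]
  have e2 : ((fourierInvCLM ℂ L2C).restrictScalars ℝ) D = waveOf hX hY t := by
    simp [hD]
  rw [e1] at h2
  exact h2.congr_deriv e2

/-- Decay of the free wave. -/
theorem WaveDataCondition.exists_A0_bound {k : ℕ} {Ap b : L2C} {Adot : 𝓢'(E3, ℂ)}
    (h : WaveDataCondition k Ap Adot b) (hω : IsOmegaInv Adot b) :
    ∃ C : ℝ, 0 ≤ C ∧ ∀ t : ℝ, 0 < t →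
      eLpNorm (A0 Ap b t) ∞ volume ≤ ENNReal.ofReal (C * t⁻¹) := by
  obtain ⟨-, -, h3, h4⟩ := h
  have hl : ∀ f : L2C, LocallyIntegrable (f : E3 → ℂ) := fun f =>
    memLp_two_locallyIntegrable (Lp.memLp f)
  have hfr : Continuous fun ξ : E3 => ((2 * Real.pi * ‖ξ‖ : ℝ) : ℂ) := by fun_prop
  obtain ⟨C, hC, hC'⟩ := exists_dispersive_estimate (Lp.memLp (𝓕 Ap : L2C)) (Lp.memLp (𝓕 b : L2C))
    (fun i => (h3 i i).isFourierOfIntegrable (((hasSpectrum_Lp Ap).lineDeriv i).lineDeriv i)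
      (((hl _).continuous_mul (continuous_partialSymbol i)).continuous_mul
        (continuous_partialSymbol i)))
    (fun j => (h4 j).isFourierOfIntegrable (hω.hasSpectrum.lineDeriv j)
      (((hl _).continuous_mul hfr).continuous_mul (continuous_partialSymbol j)))
  exact ⟨C, hC, fun t ht => hC' t ht _ (hl _) (isFourierInv_A0 Ap b t)⟩

/-- Decay of the gradient of the free wave. -/
theorem WaveDataCondition.exists_A0_partial {Ap b : L2C} {Adot : 𝓢'(E3, ℂ)}
    (h : WaveDataCondition 1 Ap Adot b) (hω : IsOmegaInv Adot b) (l : Fin 3) :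
    ∃ (B : ℝ → L2C) (C : ℝ), 0 ≤ C ∧ ∀ t : ℝ, HasWeakPartial l (A0 Ap b t) (B t) ∧
      eLpNorm (B t) 2 volume ≤ ENNReal.ofReal C ∧
      (0 < t → eLpNorm (B t) ∞ volume ≤ ENNReal.ofReal (C * t⁻¹)) := by
  obtain ⟨h1, h2, h3, h4⟩ := h
  rw [Nat.cast_one] at h1 h2
  have hl : ∀ f : L2C, LocallyIntegrable (f : E3 → ℂ) := fun f =>
    memLp_two_locallyIntegrable (Lp.memLp f)
  have hfr : Continuous fun ξ : E3 => ((2 * Real.pi * ‖ξ‖ : ℝ) : ℂ) := by fun_prop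
  have hX := h1.memLp_norm_mul_fourier (continuous_partialSymbol l) (norm_partialSymbol_le l)
  have hY := h2.memLp_norm_mul_fourier (continuous_partialSymbol l) (norm_partialSymbol_le l)
  obtain ⟨C, hC, hC'⟩ := exists_dispersive_estimate hX hY
    (fun i => ((h3 i i).isFourierOfIntegrable_partial (((hasSpectrum_Lp Ap).lineDeriv i).lineDeriv i)
      (((hl _).continuous_mul (continuous_partialSymbol i)).continuous_mul
        (continuous_partialSymbol i)) l).congr (Filter.Eventually.of_forall fun ξ => by
          simp only; ring))
    (fun j => ((h4 j).isFourierOfIntegrable_partial (hω.hasSpectrum.lineDeriv j)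
      (((hl _).continuous_mul hfr).continuous_mul (continuous_partialSymbol j)) l).congr
        (Filter.Eventually.of_forall fun ξ => by simp only; ring))
  refine ⟨waveOf hX hY, max C (‖(𝓕⁻ (hX.toLp _) : L2C)‖ + ‖(𝓕⁻ (hY.toLp _) : L2C)‖),
    hC.trans (le_max_left _ _), fun t => ⟨?_, ?_, fun ht => ?_⟩⟩
  · refine (isFourierInv_A0 Ap b t).hasWeakPartial ?_ (hl _) (hl _)
    refine (isFourierInv_waveOf hX hY t).congr (Filter.Eventually.of_forall fun ξ => ?_)
      (ae_eq_refl _)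
    simp only [waveSymbol]; ring
  · exact (eLpNorm_A0_le _ _ t).trans (ENNReal.ofReal_le_ofReal (le_max_right _ _))
  · refine (hC' t ht _ (hl _) (isFourierInv_waveOf hX hY t)).trans (ENNReal.ofReal_le_ofReal ?_)
    exact mul_le_mul_of_nonneg_right (le_max_left _ _) (by positivity)

/-- Decay of the time derivative of the free wave. -/
theorem WaveDataCondition.exists_A0_deriv {Ap b : L2C} {Adot : 𝓢'(E3, ℂ)}
    (h : WaveDataCondition 1 Ap Adot b) (hω : IsOmegaInv Adot b) :
    ∃ (B : ℝ → L2C) (C : ℝ), 0 ≤ C ∧ ∀ t : ℝ, HasDerivAt (A0 Ap b) (B t) t ∧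
      eLpNorm (B t) 2 volume ≤ ENNReal.ofReal C ∧
      (0 < t → eLpNorm (B t) ∞ volume ≤ ENNReal.ofReal (C * t⁻¹)) := by
  obtain ⟨h1, h2, h3, h4⟩ := h
  rw [Nat.cast_one] at h1 h2
  have hl : ∀ f : L2C, LocallyIntegrable (f : E3 → ℂ) := fun f =>
    memLp_two_locallyIntegrable (Lp.memLp f)
  have hfr : Continuous fun ξ : E3 => ((2 * Real.pi * ‖ξ‖ : ℝ) : ℂ) := by fun_prop
  have hfb : ∀ ξ : E3, ‖((2 * Real.pi * ‖ξ‖ : ℝ) : ℂ)‖ ≤ 2 * Real.pi * ‖ξ‖ := fun ξ => by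
    rw [Complex.norm_real, Real.norm_of_nonneg (by positivity)]
  have hX := h2.memLp_norm_mul_fourier hfr hfb
  have hY := (h1.memLp_norm_mul_fourier hfr hfb).neg
  have hc := continuous_partialSymbol
  have hsp := fun i : Fin 3 => ((hasSpectrum_Lp Ap).lineDeriv i).lineDeriv
  obtain ⟨C, hC, hC'⟩ := exists_dispersive_estimate hX hY
    (fun i => ((h4 i).isFourierOfIntegrable_partial (hω.hasSpectrum.lineDeriv i)
      (((hl _).continuous_mul hfr).continuous_mul (hc i)) i))
    (fun j => by
      have h5 := fun i : Fin 3 => (h3 i i).isFourierOfIntegrable_partial (hsp i i)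
        (((hl _).continuous_mul (hc i)).continuous_mul (hc i)) j
      refine (((h5 0).add (h5 1)).add (h5 2)).congr (Filter.Eventually.of_forall fun ξ => ?_)
      have := sum_partialSymbol_sq ξ
      rw [Fin.sum_univ_three] at this
      simp only [Pi.neg_apply]
      push_cast at this ⊢
      linear_combination (partialSymbol j ξ * (𝓕 Ap : L2C) ξ) * this)
  refine ⟨waveOf hX hY, max C (‖(𝓕⁻ (hX.toLp _) : L2C)‖ + ‖(𝓕⁻ (hY.toLp _) : L2C)‖),
    hC.trans (le_max_left _ _), fun t => ⟨hasDerivAt_A0 hX hY t, ?_, fun ht => ?_⟩⟩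
  · exact (eLpNorm_A0_le _ _ t).trans (ENNReal.ofReal_le_ofReal (le_max_right _ _))
  · refine (hC' t ht _ (hl _) (isFourierInv_waveOf hX hY t)).trans (ENNReal.ofReal_le_ofReal ?_)
    exact mul_le_mul_of_nonneg_right (le_max_left _ _) (by positivity)

/-! ### Weighted Sobolev spaces through weak derivatives -/

/-- `f` has weak partial derivatives up to order `m` in `L²`. -/
def MemH : ℕ → (E3 → ℂ) → Prop
  | 0, f => MemLp f 2 volume
  | m + 1, f => MemLp f 2 volume ∧ ∀ i, ∃ g, HasWeakPartial i f g ∧ MemH m g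

/-- `φ` is continuous and bounded, and so are its classical partial derivatives up to order `m`. -/
def BddDerivs : ℕ → (E3 → ℂ) → Prop
  | 0, φ => Continuous φ ∧ ∃ C : ℝ, ∀ x, ‖φ x‖ ≤ C
  | m + 1, φ => ContDiff ℝ 1 φ ∧ (∃ C : ℝ, ∀ x, ‖φ x‖ ≤ C) ∧
      ∀ i, BddDerivs m fun x => fderiv ℝ φ x (basisVec i)

theorem BddDerivs.of_succ : ∀ {m : ℕ} {φ : E3 → ℂ}, BddDerivs (m + 1) φ → BddDerivs m φ
  | 0, _, h => ⟨h.1.continuous, h.2.1⟩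
  | _ + 1, _, h => ⟨h.1, h.2.1, fun i => (h.2.2 i).of_succ⟩

namespace MemH

theorem memLp : ∀ {m : ℕ} {f : E3 → ℂ}, MemH m f → MemLp f 2 volume
  | 0, _, h => h
  | _ + 1, _, h => h.1

theorem of_succ : ∀ {m : ℕ} {f : E3 → ℂ}, MemH (m + 1) f → MemH m f
  | 0, _, h => h.1
  | _ + 1, _, h => ⟨h.1, fun i => by
      obtain ⟨g, hg, hg'⟩ := h.2 i
      exact ⟨g, hg, hg'.of_succ⟩⟩

theorem mono {m m' : ℕ} (hm : m ≤ m') {f : E3 → ℂ} (h : MemH m' f) : MemH m f := by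
  induction hm with
  | refl => exact h
  | step _ ih => exact ih h.of_succ

theorem congr {m : ℕ} {f f' : E3 → ℂ} (h : MemH m f) (hf : f =ᵐ[volume] f') : MemH m f' := by
  cases m with
  | zero => exact MemLp.ae_eq hf h
  | succ m => exact ⟨h.1.ae_eq hf, fun i => by
      obtain ⟨g, hg, hg'⟩ := h.2 i
      exact ⟨g, hg.congr hf (ae_eq_refl _), hg'⟩⟩

theorem add : ∀ {m : ℕ} {f f' : E3 → ℂ}, MemH m f → MemH m f' → MemH m fun x => f x + f' x
  | 0, _, _, h, h' => MemLp.add h h'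
  | _ + 1, _, _, h, h' => ⟨h.1.add h'.1, fun i => by
      obtain ⟨g, hg, hg2⟩ := h.2 i
      obtain ⟨g', hg', hg2'⟩ := h'.2 i
      exact ⟨_, hg.add hg', hg2.add hg2'⟩⟩

theorem partial_mem {m : ℕ} {f g : E3 → ℂ} (h : MemH (m + 1) f) {i : Fin 3}
    (hg : HasWeakPartial i f g) : MemH m g := by
  obtain ⟨g', hg', hg2⟩ := h.2 i
  exact hg2.congr (hg'.unique hg)

theorem bdd_mul : ∀ {m : ℕ} {φ f : E3 → ℂ}, BddDerivs m φ → MemH m f → MemH m fun x => φ x * f x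
  | 0, _, _, hφ, hf => by
      obtain ⟨hc, C, hC⟩ := hφ
      exact memLp_bounded_mul hf hc.aestronglyMeasurable (Filter.Eventually.of_forall hC)
  | m + 1, φ, f, hφ, hf => by
      have hφm := hφ.of_succ
      obtain ⟨hc, ⟨C, hC⟩, hd⟩ := hφ
      refine ⟨memLp_bounded_mul hf.1 hc.continuous.aestronglyMeasurable
        (Filter.Eventually.of_forall hC), fun i => ?_⟩
      obtain ⟨g, hg, hg2⟩ := hf.2 i
      exact ⟨_, hg.contDiff_mul hc, (bdd_mul hφm hg2).add (bdd_mul (hd i) hf.of_succ)⟩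

end MemH

namespace BddDerivs

theorem bound : ∀ {m : ℕ} {φ : E3 → ℂ}, BddDerivs m φ → ∃ C : ℝ, ∀ x, ‖φ x‖ ≤ C
  | 0, _, h => h.2
  | _ + 1, _, h => h.2.1

theorem continuous : ∀ {m : ℕ} {φ : E3 → ℂ}, BddDerivs m φ → Continuous φ
  | 0, _, h => h.1
  | _ + 1, _, h => h.1.continuous

theorem const (c : ℂ) : ∀ m, BddDerivs m fun _ => c
  | 0 => ⟨continuous_const, ‖c‖, fun _ => le_rfl⟩
  | m + 1 => ⟨contDiff_const, ⟨‖c‖, fun _ => le_rfl⟩, fun i => by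
      simpa using const 0 m⟩

theorem add : ∀ {m : ℕ} {φ χ : E3 → ℂ}, BddDerivs m φ → BddDerivs m χ →
    BddDerivs m fun x => φ x + χ x
  | 0, _, _, ⟨h1, C, hC⟩, ⟨h2, D, hD⟩ =>
      ⟨h1.add h2, C + D, fun x => (norm_add_le _ _).trans (add_le_add (hC x) (hD x))⟩
  | m + 1, φ, χ, ⟨h1, ⟨C, hC⟩, h1'⟩, ⟨h2, ⟨D, hD⟩, h2'⟩ =>
      ⟨h1.add h2, ⟨C + D, fun x => (norm_add_le _ _).trans (add_le_add (hC x) (hD x))⟩, fun i => by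
        have e : (fun x => fderiv ℝ (fun x => φ x + χ x) x (basisVec i)) =
            fun x => fderiv ℝ φ x (basisVec i) + fderiv ℝ χ x (basisVec i) := by
          ext x
          rw [fderiv_fun_add (h1.differentiable one_ne_zero x) (h2.differentiable one_ne_zero x)]
          rfl
        rw [e]
        exact (h1' i).add (h2' i)⟩

theorem mul : ∀ {m : ℕ} {φ χ : E3 → ℂ}, BddDerivs m φ → BddDerivs m χ →
    BddDerivs m fun x => φ x * χ x
  | 0, _, _, ⟨h1, C, hC⟩, ⟨h2, D, hD⟩ =>
      ⟨h1.mul h2, C * D, fun x => (norm_mul_le _ _).trans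
        (mul_le_mul (hC x) (hD x) (norm_nonneg _) ((norm_nonneg _).trans (hC x)))⟩
  | m + 1, φ, χ, H1, H2 => by
      have H1' := H1.of_succ
      have H2' := H2.of_succ
      obtain ⟨h1, ⟨C, hC⟩, h1'⟩ := H1
      obtain ⟨h2, ⟨D, hD⟩, h2'⟩ := H2
      refine ⟨h1.mul h2, ⟨C * D, fun x => (norm_mul_le _ _).trans
        (mul_le_mul (hC x) (hD x) (norm_nonneg _) ((norm_nonneg _).trans (hC x)))⟩, fun i => ?_⟩
      have e : (fun x => fderiv ℝ (fun x => φ x * χ x) x (basisVec i)) =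
          fun x => φ x * fderiv ℝ χ x (basisVec i) + χ x * fderiv ℝ φ x (basisVec i) := by
        ext x
        rw [fderiv_fun_mul (h1.differentiable one_ne_zero x) (h2.differentiable one_ne_zero x)]
        rfl
      rw [e]
      exact (H1'.mul (h2' i)).add (H2'.mul (h1' i))

theorem fourierInv_zero {a : E3 → ℂ} (ha : Integrable a) : BddDerivs 0 (𝓕⁻ a) :=
  ⟨continuous_fourierInv ha, _, norm_fourierInv_le a⟩

theorem fourierInv_one {a : E3 → ℂ} (ha : Integrable a)
    (ha' : Integrable (fun ξ => (‖ξ‖ : ℂ) * a ξ)) : BddDerivs 1 (𝓕⁻ a) :=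
  ⟨contDiff_fourierInv ha ha', ⟨_, norm_fourierInv_le a⟩, fun i => by
    simp only [fderiv_fourierInv ha ha']
    exact fourierInv_zero (integrable_partialSymbol_mul ha ha' i)⟩

end BddDerivs

/-- Multiplication by the coordinate `x_k`. -/
def coordMul (k : Fin 3) (f : E3 → ℂ) : E3 → ℂ := fun x => (x k : ℂ) * f x

theorem contDiff_coord (k : Fin 3) : ContDiff ℝ 1 fun x : E3 => (x k : ℂ) :=
  Complex.ofRealCLM.contDiff.comp (EuclideanSpace.proj k : E3 →L[ℝ] ℝ).contDiff

theorem fderiv_coord (k i : Fin 3) (x : E3) :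
    fderiv ℝ (fun x : E3 => (x k : ℂ)) x (basisVec i) = if i = k then 1 else 0 := by
  have h := (Complex.ofRealCLM.comp (EuclideanSpace.proj k : E3 →L[ℝ] ℝ)).hasFDerivAt (x := x)
  have e : (fun x : E3 => (x k : ℂ)) = Complex.ofRealCLM.comp (EuclideanSpace.proj k : E3 →L[ℝ] ℝ) :=
    rfl
  rw [e, h.fderiv]
  rcases eq_or_ne i k with rfl | h
  · simp [basisVec]
  · simp [basisVec, h, h.symm]

theorem HasWeakPartial.coordMul {i : Fin 3} {f g : E3 → ℂ} (h : HasWeakPartial i f g) (k : Fin 3) :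
    HasWeakPartial i (coordMul k f)
      (fun x => _root_.coordMul k g x + (if i = k then 1 else 0) * f x) := by
  have := h.contDiff_mul (contDiff_coord k)
  simp only [fderiv_coord] at this
  exact this

/-- `x^α f ∈ H^m` for all `|α| ≤ s`. -/
def MemHW : ℕ → ℕ → (E3 → ℂ) → Prop
  | 0, m, f => MemH m f
  | s + 1, m, f => MemHW s m f ∧ ∀ k, MemHW s m (coordMul k f)

namespace MemHW

theorem memH : ∀ {s m : ℕ} {f : E3 → ℂ}, MemHW s m f → MemH m f
  | 0, _, _, h => h
  | _ + 1, _, _, h => h.1.memH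

theorem of_succ_right : ∀ {s m : ℕ} {f : E3 → ℂ}, MemHW s (m + 1) f → MemHW s m f
  | 0, _, _, h => h.of_succ
  | _ + 1, _, _, h => ⟨h.1.of_succ_right, fun k => (h.2 k).of_succ_right⟩

theorem congr : ∀ {s m : ℕ} {f f' : E3 → ℂ}, MemHW s m f → f =ᵐ[volume] f' → MemHW s m f'
  | 0, _, _, _, h, hf => MemH.congr h hf
  | _ + 1, _, _, _, h, hf => ⟨h.1.congr hf, fun k => (h.2 k).congr (by
      filter_upwards [hf] with x hx
      rw [coordMul, coordMul, hx])⟩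

theorem add : ∀ {s m : ℕ} {f f' : E3 → ℂ}, MemHW s m f → MemHW s m f' →
    MemHW s m fun x => f x + f' x
  | 0, _, _, _, h, h' => MemH.add h h'
  | _ + 1, _, _, _, h, h' => ⟨h.1.add h'.1, fun k => by
      refine (congrArg (MemHW _ _) (funext fun x => ?_)).mpr ((h.2 k).add (h'.2 k))
      simp only [_root_.coordMul]; ring⟩

theorem bdd_mul {m : ℕ} {φ : E3 → ℂ} (hφ : BddDerivs m φ) : ∀ {s : ℕ} {f : E3 → ℂ},
    MemHW s m f → MemHW s m fun x => φ x * f x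
  | 0, _, h => MemH.bdd_mul hφ h
  | _ + 1, _, h => ⟨bdd_mul hφ h.1, fun k => by
      refine (congrArg (MemHW _ _) (funext fun x => ?_)).mpr (bdd_mul hφ (h.2 k))
      simp only [_root_.coordMul]; ring⟩

theorem const_mul {s m : ℕ} {f : E3 → ℂ} (h : MemHW s m f) (c : ℂ) :
    MemHW s m fun x => c * f x := bdd_mul (BddDerivs.const c m) h

theorem sum {ι : Type*} (S : Finset ι) {s m : ℕ} {f : ι → E3 → ℂ} (h : ∀ i ∈ S, MemHW s m (f i))
    (h0 : MemHW s m fun _ => 0) : MemHW s m fun x => ∑ i ∈ S, f i x := by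
  classical
  induction S using Finset.induction_on with
  | empty => simpa using h0
  | insert a S ha ih =>
    simp only [Finset.sum_insert ha]
    exact (h a (by simp)).add (ih fun i hi => h i (by simp [hi]))

theorem partial_mem : ∀ {s m : ℕ} {f g : E3 → ℂ} {i : Fin 3}, MemHW s (m + 1) f →
    HasWeakPartial i f g → MemHW s m g
  | 0, _, _, _, _, h, hg => MemH.partial_mem h hg
  | s + 1, m, f, g, i, h, hg => ⟨h.1.partial_mem hg, fun k => by
      have h1 := (h.2 k).partial_mem (hg.coordMul k)
      have h2 := h1.add ((h.1.of_succ_right).const_mul (-(if i = k then 1 else 0)))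
      refine h2.congr (Filter.Eventually.of_forall fun x => ?_)
      simp only
      ring⟩

end MemHW

/-! ### Removing the weight -/

/-- `(1 + |x|²)^{-1/2}`. -/
def bracketInv (x : E3) : ℂ := (((1 + ‖x‖ ^ 2) ^ (-(1 / 2) : ℝ) : ℝ) : ℂ)

theorem contDiff_bracketInv : ContDiff ℝ 1 bracketInv := by
  refine Complex.ofRealCLM.contDiff.comp (ContDiff.rpow_const_of_ne ?_ fun x => by positivity)
  exact contDiff_const.add (contDiff_norm_sq ℝ)

theorem fderiv_bracketInv (x : E3) (i : Fin 3) :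
    fderiv ℝ bracketInv x (basisVec i) =
      -(((x i : ℂ) * bracketInv x) * (bracketInv x * bracketInv x)) := by
  have h0 : (0 : ℝ) < 1 + ‖x‖ ^ 2 := by positivity
  have h1 : HasFDerivAt (fun x : E3 => 1 + ‖x‖ ^ 2) (2 • innerSL ℝ x) x := by
    simpa using ((hasStrictFDerivAt_norm_sq x).hasFDerivAt).const_add 1
  have h2 := h1.rpow_const (p := (-(1 / 2) : ℝ)) (Or.inl h0.ne')
  have h3 := (Complex.ofRealCLM.hasFDerivAt (x := (1 + ‖x‖ ^ 2) ^ (-(1 / 2) : ℝ))).comp x h2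
  have e : bracketInv = Complex.ofRealCLM ∘ fun x : E3 => (1 + ‖x‖ ^ 2) ^ (-(1 / 2) : ℝ) := rfl
  rw [e, h3.fderiv]
  have e2 : (1 + ‖x‖ ^ 2) ^ (-(1 / 2) - 1 : ℝ) = (1 + ‖x‖ ^ 2) ^ (-(1 / 2) : ℝ) *
      ((1 + ‖x‖ ^ 2) ^ (-(1 / 2) : ℝ) * (1 + ‖x‖ ^ 2) ^ (-(1 / 2) : ℝ)) := by
    rw [← Real.rpow_add h0, ← Real.rpow_add h0]; norm_num
  simp only [ContinuousLinearMap.comp_apply, _root_.smul_apply, innerSL_apply_apply,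
    inner_basisVec, e2, smul_eq_mul, Complex.ofRealCLM_apply, Function.comp_apply, nsmul_eq_mul]
  push_cast
  ring

theorem norm_bracketInv_le (x : E3) : ‖bracketInv x‖ ≤ 1 := by
  rw [bracketInv, Complex.norm_real, Real.norm_of_nonneg (by positivity)]
  exact Real.rpow_le_one_of_one_le_of_nonpos (by nlinarith [norm_nonneg x]) (by norm_num)

theorem norm_coordMul_bracketInv_le (k : Fin 3) (x : E3) : ‖coordMul k bracketInv x‖ ≤ 1 := by
  have h1 : |x k| ≤ ‖x‖ := by simpa using PiLp.norm_apply_le x k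
  have h2 : ‖x‖ ≤ (1 + ‖x‖ ^ 2) ^ (1 / 2 : ℝ) := by
    rw [← Real.sqrt_eq_rpow]; exact Real.le_sqrt_of_sq_le (by linarith)
  rw [coordMul, bracketInv, norm_mul, Complex.norm_real, Complex.norm_real,
    Real.norm_of_nonneg (by positivity : 0 ≤ (1 + ‖x‖ ^ 2) ^ (-(1 / 2) : ℝ)), Real.rpow_neg (by positivity),
    Real.norm_eq_abs, mul_inv_le_iff₀ (by positivity), one_mul]
  exact h1.trans h2

theorem bddDerivs_bracketInv : ∀ m, BddDerivs m bracketInv ∧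
    ∀ k, BddDerivs m (coordMul k bracketInv)
  | 0 => ⟨⟨contDiff_bracketInv.continuous, 1, norm_bracketInv_le⟩, fun k =>
      ⟨((contDiff_coord k).mul contDiff_bracketInv).continuous, 1,
        norm_coordMul_bracketInv_le k⟩⟩
  | m + 1 => by
      obtain ⟨h1, h2⟩ := bddDerivs_bracketInv m
      have hd : ∀ i, BddDerivs m fun x => fderiv ℝ bracketInv x (basisVec i) := fun i => by
        have h3 := (BddDerivs.const (-1) m).mul ((h2 i).mul (h1.mul h1))
        refine (congrArg (BddDerivs m) (funext fun x => ?_)).mpr h3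
        rw [fderiv_bracketInv, coordMul, neg_one_mul]
      refine ⟨⟨contDiff_bracketInv, ⟨1, norm_bracketInv_le⟩, hd⟩, fun k =>
        ⟨(contDiff_coord k).mul contDiff_bracketInv, ⟨1, norm_coordMul_bracketInv_le k⟩,
          fun i => ?_⟩⟩
      have h3 := ((BddDerivs.const (-1) m).mul ((h2 k).mul ((h2 i).mul h1))).add
        ((BddDerivs.const (if i = k then 1 else 0) m).mul h1)
      refine (congrArg (BddDerivs m) (funext fun x => ?_)).mpr h3
      have e : coordMul k bracketInv = fun x => (x k : ℂ) * bracketInv x := rfl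
      rw [e, fderiv_fun_mul ((contDiff_coord k).differentiable one_ne_zero x)
        (contDiff_bracketInv.differentiable one_ne_zero x)]
      simp only [_root_.add_apply, _root_.smul_apply, smul_eq_mul, fderiv_coord,
        fderiv_bracketInv, coordMul]
      ring

/-- Division by `(1 + |x|²)^{s/2}` gains `s` powers of `x`. -/
theorem MemH.memHW_bracketInv_pow {m : ℕ} : ∀ (s : ℕ) {f : E3 → ℂ}, MemH m f →
    MemHW s m fun x => bracketInv x ^ s * f x
  | 0, f, h => by simpa [MemHW] using h
  | s + 1, f, h => by
      obtain ⟨h1, h2⟩ := bddDerivs_bracketInv m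
      refine ⟨?_, fun k => ?_⟩
      · refine (congrArg (MemHW s m) (funext fun x => ?_)).mpr
          (memHW_bracketInv_pow s (MemH.bdd_mul h1 h))
        ring
      · refine (congrArg (MemHW s m) (funext fun x => ?_)).mpr
          (memHW_bracketInv_pow s (MemH.bdd_mul (h2 k) h))
        simp only [coordMul]; ring

/-- `x^α φ` has bounded derivatives up to order `m` for all `|α| ≤ s`. -/
def BddDerivsW : ℕ → ℕ → (E3 → ℂ) → Prop
  | 0, m, φ => BddDerivs m φ
  | s + 1, m, φ => BddDerivsW s m φ ∧ ∀ k, BddDerivsW s m (coordMul k φ)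

theorem BddDerivs.bddDerivsW_bracketInv_pow {m : ℕ} : ∀ (s : ℕ) {f : E3 → ℂ}, BddDerivs m f →
    BddDerivsW s m fun x => bracketInv x ^ s * f x
  | 0, f, h => by simpa [BddDerivsW] using h
  | s + 1, f, h => by
      obtain ⟨h1, h2⟩ := bddDerivs_bracketInv m
      refine ⟨?_, fun k => ?_⟩
      · refine (congrArg (BddDerivsW s m) (funext fun x => ?_)).mpr
          (bddDerivsW_bracketInv_pow s (h1.mul h))
        ring
      · refine (congrArg (BddDerivsW s m) (funext fun x => ?_)).mpr
          (bddDerivsW_bracketInv_pow s ((h2 k).mul h))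
        simp only [coordMul]; ring

/-! ### Weak derivatives and weights on the Fourier side -/

theorem MemWeightedL2.partialSymbol_mul {n : ℕ} {a : E3 → ℂ} (ha : MemWeightedL2 (n + 1) a)
    (i : Fin 3) : MemWeightedL2 n fun ξ => partialSymbol i ξ * a ξ := by
  have h := ha.mul_memLp (m := fun ξ => (((1 + ‖ξ‖) ^ n : ℝ) : ℂ) * partialSymbol i ξ)
    (((by fun_prop : Continuous fun ξ : E3 => (((1 + ‖ξ‖) ^ n : ℝ) : ℂ)).mul
      (continuous_partialSymbol i)).aestronglyMeasurable) (2 * Real.pi) (fun ξ => by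
    rw [norm_mul, Complex.norm_real, Real.norm_of_nonneg (by positivity), pow_succ]
    have h1 := norm_partialSymbol_le i ξ
    have h2 : 2 * Real.pi * ‖ξ‖ ≤ 2 * Real.pi * (1 + ‖ξ‖) := by
      have := Real.pi_pos; nlinarith
    calc _ ≤ (1 + ‖ξ‖) ^ n * (2 * Real.pi * (1 + ‖ξ‖)) :=
          mul_le_mul_of_nonneg_left (h1.trans h2) (by positivity)
      _ = _ := by ring)
  refine MemLp.ae_eq (Filter.Eventually.of_forall fun ξ => ?_) h
  simp only; ring

theorem MemWeightedL2.memH : ∀ {m : ℕ} {a f : E3 → ℂ}, MemWeightedL2 m a → IsFourierInv a f →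
    MemLp f 2 volume → MemH m f
  | 0, _, _, _, _, hf => hf
  | _ + 1, _, _, ha, h, hf => ⟨hf, fun i => by
      obtain ⟨g, hg, hgF⟩ := exists_isFourierInv (ha.partialSymbol_mul i).memLp
      exact ⟨g, h.hasWeakPartial hgF (memLp_two_locallyIntegrable hf)
        (memLp_two_locallyIntegrable hg), (ha.partialSymbol_mul i).memH hgF hg⟩⟩

theorem eq_sum_basisVec (y : E3) : y = ∑ i, y i • basisVec i := by
  ext j
  simp [basisVec, Finset.sum_apply, Pi.single_apply]

theorem norm_le_sum_partialSymbol (ξ : E3) : ‖ξ‖ ≤ ∑ i, ‖partialSymbol i ξ‖ := by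
  have h1 : ‖ξ‖ ≤ ∑ i, ‖ξ i‖ := by
    have h3 : ∀ i, ‖ξ i • basisVec i‖ = ‖ξ i‖ := fun i => by
      rw [norm_smul, basisVec, PiLp.norm_single, norm_one, mul_one]
    calc ‖ξ‖ = ‖∑ i, ξ i • basisVec i‖ := by rw [← eq_sum_basisVec]
      _ ≤ ∑ i, ‖ξ i • basisVec i‖ := norm_sum_le _ _
      _ = _ := by simp only [h3]
  refine h1.trans (Finset.sum_le_sum fun i _ => ?_)
  simp only [partialSymbol, norm_mul, Complex.norm_real, Complex.norm_I, mul_one,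
    Real.norm_eq_abs, abs_of_pos Real.pi_pos]
  norm_num
  nlinarith [Real.pi_gt_three, abs_nonneg (ξ i)]

theorem MemH.memWeightedL2 : ∀ {m : ℕ} {a f : E3 → ℂ}, MemH m f → IsFourierInv a f →
    MemLp a 2 volume → MemWeightedL2 m a
  | 0, _, _, _, _, ha => by simpa [MemWeightedL2] using ha
  | m + 1, a, f, hf, h, ha => by
      have h0 := hf.of_succ.memWeightedL2 h ha
      have hi : ∀ i, MemWeightedL2 m fun ξ => partialSymbol i ξ * a ξ := fun i => by
        obtain ⟨g, hg, hg2⟩ := hf.2 i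
        have hb := isFourierInv_Lp (hg2.memLp.toLp g) |>.congr (ae_eq_refl _)
          hg2.memLp.coeFn_toLp
        have he := hg.fourier_eq hf.memLp hg2.memLp h hb ha (Lp.memLp _)
        have h1 := hb.congr he (ae_eq_refl _)
        exact hg2.memWeightedL2 h1 ((Lp.memLp _).ae_eq he)
      have hs : MemLp (fun ξ => ‖(((1 + ‖ξ‖) ^ m : ℝ) : ℂ) * a ξ‖ +
          ∑ i, ‖(((1 + ‖ξ‖) ^ m : ℝ) : ℂ) * (partialSymbol i ξ * a ξ)‖) 2 volume :=
        h0.norm.add (memLp_finsetSum _ fun i _ => (hi i).norm)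
      refine MemLp.of_le hs ((Continuous.aestronglyMeasurable (by fun_prop)).mul ha.1)
        (Filter.Eventually.of_forall fun ξ => ?_)
      refine le_trans ?_ (Real.le_norm_self _)
      simp only [norm_mul, Complex.norm_real, norm_pow]
      rw [← Finset.mul_sum, ← Finset.sum_mul, ← mul_assoc, ← add_mul, pow_succ]
      refine mul_le_mul_of_nonneg_right ?_ (norm_nonneg _)
      have h1 : ‖1 + ‖ξ‖‖ = 1 + ‖ξ‖ := Real.norm_of_nonneg (by positivity)
      rw [h1]
      have h2 := norm_le_sum_partialSymbol ξ
      nlinarith [pow_pos (by positivity : 0 < 1 + ‖ξ‖) m]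

/-! ### Regularity of the asymptotic phase -/

/-- The partial derivative `∂_j P`, as a complex function. -/
def partialC (P : E3 → ℝ) (j : Fin 3) : E3 → ℂ := fun x => ((fderiv ℝ P x (basisVec j) : ℝ) : ℂ)

/-- The regularity of the phase function `P = Ã₁` that the estimates use; `PP j` stands for the
weak derivative `∂_j² P`, which is only square integrable. -/
structure PhaseBounds (m : ℕ) (P : E3 → ℝ) (PP : Fin 3 → E3 → ℂ) : Prop where
  contDiff : ContDiff ℝ 1 P
  bdd : ∃ C, ∀ x, |P x| ≤ C
  euler : ∃ C, ∀ x, |fderiv ℝ P x x| ≤ C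
  grad : ∀ j, BddDerivs m (partialC P j)
  memH : ∀ j, MemH 1 (PP j)
  mul : ∀ (j : Fin 3) {f f' : E3 → ℂ}, HasWeakPartial j f f' → Continuous f →
    HasWeakPartial j (fun x => f x * partialC P j x) (fun x => f' x * partialC P j x + f x * PP j x)

theorem IntensitySpectrum.memWeightedL2_partialSymbol_mul_phaseSymbol {n : ℕ} {h : E3 → ℂ}
    (H : IntensitySpectrum n h) (hn : 2 ≤ n) (j : Fin 3) :
    MemWeightedL2 2 fun ξ => partialSymbol j ξ * phaseSymbol h ξ := by
  have h0 := H.memLp_pow_mul_phaseSymbol (k := 0) (by omega)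
  have h1 := H.memLp_pow_mul_phaseSymbol (k := 1) (by omega)
  have h2 := H.memLp_pow_mul_phaseSymbol (k := 2) (by omega)
  refine MemLp.of_le_mul (c := 2 * Real.pi) ((h0.norm.add (h1.norm.const_mul 2)).add h2.norm)
    (((by fun_prop : Continuous fun ξ : E3 => (((1 + ‖ξ‖) ^ 2 : ℝ) : ℂ)).aestronglyMeasurable).mul
      ((continuous_partialSymbol j).aestronglyMeasurable.mul
        H.stronglyMeasurable_phaseSymbol.aestronglyMeasurable))
    (Filter.Eventually.of_forall fun ξ => ?_)
  have e : ‖‖(((‖ξ‖ ^ (0 + 1) : ℝ) : ℂ)) * phaseSymbol h ξ‖ +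
      2 * ‖(((‖ξ‖ ^ (1 + 1) : ℝ) : ℂ)) * phaseSymbol h ξ‖ +
      ‖(((‖ξ‖ ^ (2 + 1) : ℝ) : ℂ)) * phaseSymbol h ξ‖‖ =
      (1 + ‖ξ‖) ^ 2 * (‖ξ‖ * ‖phaseSymbol h ξ‖) := by
    rw [Real.norm_of_nonneg (by positivity)]
    simp only [norm_mul, Complex.norm_real, norm_pow, norm_norm]
    ring
  refine le_trans ?_ (mul_le_mul_of_nonneg_left e.ge (by positivity))
  simp only [norm_mul, Complex.norm_real]
  rw [Real.norm_of_nonneg (by positivity : 0 ≤ (1 + ‖ξ‖) ^ 2)]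
  calc _ ≤ (1 + ‖ξ‖) ^ 2 * (2 * Real.pi * ‖ξ‖ * ‖phaseSymbol h ξ‖) := by
        gcongr; exact norm_partialSymbol_le j ξ
    _ = _ := by ring

/-- The transform of `Ã₁` itself need not be square integrable near the origin; only the weights of
its gradient are used. -/
theorem IntensitySpectrum.phaseBounds {n m : ℕ} {w : E3 → ℂ}
    (H : IntensitySpectrum n (intensityFourier w)) (hm : m ≤ 1) (hmn : m + 2 ≤ n) :
    ∃ PP, PhaseBounds m (tildeA1 w) PP := by
  have hn : 2 ≤ n := by omega
  set a := phaseSymbol (intensityFourier w) with ha_def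
  have ha : Integrable a := H.integrable_phaseSymbol
  have ha1 : Integrable fun ξ => (‖ξ‖ : ℂ) * a ξ := by
    simpa using H.integrable_pow_mul_phaseSymbol (k := 0) (by omega)
  have hP : (fun x => (tildeA1 w x : ℂ)) = 𝓕⁻ a := funext fun x => ofReal_tildeA1 H x
  have hC : ContDiff ℝ 1 (tildeA1 w) := contDiff_tildeA1 H hn
  have hgrad : ∀ j, partialC (tildeA1 w) j = 𝓕⁻ fun ξ => partialSymbol j ξ * a ξ := fun j => by
    ext x
    rw [← fderiv_fourierInv ha ha1, ← hP]
    have := (Complex.ofRealCLM.hasFDerivAt (x := tildeA1 w x)).comp x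
      (hC.differentiable one_ne_zero x).hasFDerivAt
    have e : (fun x => (tildeA1 w x : ℂ)) = Complex.ofRealCLM ∘ tildeA1 w := rfl
    rw [e, this.fderiv]
    rfl
  have hI : ∀ j, Integrable fun ξ => partialSymbol j ξ * a ξ :=
    fun j => integrable_partialSymbol_mul ha ha1 j
  have hW : ∀ j, MemWeightedL2 2 fun ξ => partialSymbol j ξ * a ξ :=
    fun j => H.memWeightedL2_partialSymbol_mul_phaseSymbol hn j
  choose PP hPP2 hPPF using fun j => exists_isFourierInv ((hW j).partialSymbol_mul j).memLp
  obtain ⟨C, hCb⟩ : ∃ C, ∀ x, |tildeA1 w x| ≤ C := ⟨∫ ξ, ‖a ξ‖, fun x => by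
    have h1 := norm_fourierInv_le a x
    rwa [← hP, Complex.norm_real, Real.norm_eq_abs] at h1⟩
  obtain ⟨D, hD⟩ := exists_abs_tildeA1_add_fderiv_le H hn
  refine ⟨PP, hC, ⟨C, hCb⟩, ⟨D + C, fun x => ?_⟩, fun j => ?_, fun j => ?_, fun j f f' hf hfc => ?_⟩
  · have h1 := abs_sub (tildeA1 w x + fderiv ℝ (tildeA1 w) x x) (tildeA1 w x)
    rw [add_sub_cancel_left] at h1
    exact h1.trans (add_le_add (hD x) (hCb x))
  · rw [hgrad]
    obtain rfl | rfl : m = 0 ∨ m = 1 := by omega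
    · exact BddDerivs.fourierInv_zero (hI j)
    · refine BddDerivs.fourierInv_one (hI j) ?_
      have h2 := H.integrable_pow_mul_phaseSymbol (k := 1) (by omega)
      refine (h2.norm.const_mul (2 * Real.pi)).mono'
        ((by fun_prop : Continuous fun ξ : E3 => (‖ξ‖ : ℂ)).aestronglyMeasurable.mul
          (hI j).aestronglyMeasurable) (Filter.Eventually.of_forall fun ξ => ?_)
      simp only [norm_mul, Complex.norm_real, norm_pow, norm_norm]
      calc _ ≤ ‖ξ‖ * (2 * Real.pi * ‖ξ‖ * ‖a ξ‖) := by
            gcongr; exact norm_partialSymbol_le j ξ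
        _ = _ := by ring
  · exact (MemWeightedL2.memH (m := 1) ((hW j).partialSymbol_mul j) (hPPF j) (hPP2 j))
  · have h1 := HasWeakPartial.mul_fourierInv (i := j) hf hfc (hI j)
      ((hW j).partialSymbol_mul j).memLp (hPP2 j) (hPPF j)
    rwa [← hgrad] at h1

/-! ### Regularity of the asymptotic amplitude -/

/-- For `u ∈ H^{0,n}`, `F u` is represented by the inverse Fourier transform of a weighted `L²`
function, which is continuous. -/
theorem MemWeightedSobolev.exists_continuous_rep {u : L2C} {n : ℕ} (hn : 2 ≤ n)
    (h : MemWeightedSobolev 0 n (u : 𝓢'(E3, ℂ))) :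
    ∃ b, MemWeightedL2 n b ∧ unitaryFourier u =ᵐ[volume] 𝓕⁻ b := by
  obtain ⟨b, hb, hb'⟩ := h.exists_unitaryFourier hn
  exact ⟨b, hb, by simpa using hb'⟩

theorem MemWeightedL2.memH_fourierInv {n : ℕ} (hn : 2 ≤ n) {b : E3 → ℂ} (hb : MemWeightedL2 n b) :
    MemH n (𝓕⁻ b) :=
  hb.memH (isFourierInv_of_integrable (hb.integrable hn)) (memLp_fourierInv (hb.integrable hn) hb.memLp)

theorem MemWeightedL2.mono {n n' : ℕ} (hn : n ≤ n') {b : E3 → ℂ} (hb : MemWeightedL2 n' b) :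
    MemWeightedL2 n b := by
  refine MemLp.of_le hb ((Continuous.aestronglyMeasurable (by fun_prop)).mul
    hb.aestronglyMeasurable) (Filter.Eventually.of_forall fun ξ => ?_)
  simp only [norm_mul, Complex.norm_real, norm_pow]
  gcongr
  rw [Real.norm_of_nonneg (by positivity)]
  linarith [norm_nonneg ξ]

theorem MemWeightedL2.bddDerivs_fourierInv {n m : ℕ} (hm : m ≤ 1) (hmn : m + 2 ≤ n) {b : E3 → ℂ}
    (hb : MemWeightedL2 n b) : BddDerivs m (𝓕⁻ b) := by
  have hi := hb.integrable (by omega)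
  obtain rfl | rfl : m = 0 ∨ m = 1 := by omega
  · exact BddDerivs.fourierInv_zero hi
  · refine BddDerivs.fourierInv_one hi ?_
    have h3 : MemWeightedL2 (2 + 1) b := hb.mono (by omega)
    have h2 : MemWeightedL2 2 fun ξ => (‖ξ‖ : ℂ) * b ξ := by
      refine MemLp.of_le h3 ((Continuous.aestronglyMeasurable (by fun_prop)).mul
        ((Continuous.aestronglyMeasurable (by fun_prop)).mul hb.aestronglyMeasurable))
        (Filter.Eventually.of_forall fun ξ => ?_)
      simp only [norm_mul, Complex.norm_real, norm_pow, norm_norm, pow_succ _ 2, mul_assoc]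
      gcongr
      rw [Real.norm_of_nonneg (by positivity)]
      linarith [norm_nonneg ξ]
    exact h2.integrable le_rfl

theorem bracketInv_pow_mul (x : E3) (s : ℕ) :
    bracketInv x ^ s * (((1 + ‖x‖ ^ 2) ^ ((s : ℝ) / 2) : ℝ) : ℂ) = 1 := by
  have h0 : (0 : ℝ) < 1 + ‖x‖ ^ 2 := by positivity
  rw [bracketInv, ← Complex.ofReal_pow, ← Complex.ofReal_mul, ← Real.rpow_natCast,
    ← Real.rpow_mul h0.le, ← Real.rpow_add h0]
  norm_num
  ring_nf
  simp

/-- A representative of `F u` for `u ∈ H^{s,n}`: the weight `(1 + |ξ|²)^{s/2}` is divided out. -/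
theorem MemWeightedSobolev.exists_rep {u : L2C} {n s : ℕ} (hn : 2 ≤ n)
    (h : MemWeightedSobolev s n (u : 𝓢'(E3, ℂ))) :
    ∃ b, MemWeightedL2 n b ∧ unitaryFourier u =ᵐ[volume] fun x => bracketInv x ^ s * (𝓕⁻ b) x := by
  obtain ⟨b, hb, hb'⟩ := h.exists_unitaryFourier hn
  refine ⟨b, hb, hb'.mono fun x hx => ?_⟩
  change _ = bracketInv x ^ s * (𝓕⁻ b) x
  rw [← hx, ← mul_assoc, bracketInv_pow_mul, one_mul]

theorem continuous_bracketInv_pow_mul_fourierInv {n : ℕ} (hn : 2 ≤ n) {b : E3 → ℂ}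
    (hb : MemWeightedL2 n b) (s : ℕ) : Continuous fun x => bracketInv x ^ s * (𝓕⁻ b) x :=
  (contDiff_bracketInv.continuous.pow s).mul (continuous_fourierInv (hb.integrable hn))

theorem BddDerivsW.bddDerivs : ∀ {s m : ℕ} {φ : E3 → ℂ}, BddDerivsW s m φ → BddDerivs m φ
  | 0, _, _, h => h
  | _ + 1, _, _, h => h.1.bddDerivs

/-- The regularity of `F u` that the estimates without derivatives use. -/
theorem MemWeightedSobolev.exists_profile {u : L2C} (h : MemWeightedSobolev 0 2 (u : 𝓢'(E3, ℂ))) :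
    ∃ w, unitaryFourier u =ᵐ[volume] w ∧ IntensitySpectrum 2 (intensityFourier w) ∧
      BddDerivs 0 w ∧ MemH 2 w := by
  obtain ⟨b, hb, hb'⟩ := MemWeightedSobolev.exists_continuous_rep (n := 2) le_rfl (by exact_mod_cast h)
  exact ⟨𝓕⁻ b, hb', intensitySpectrum_fourier_normSq le_rfl hb,
    hb.bddDerivs_fourierInv (by omega) le_rfl, hb.memH_fourierInv le_rfl⟩

/-- The regularity of `F u` that the estimates of the gradients use. The two hypotheses provide two
expressions for `F u`; both are continuous, so they agree everywhere. -/
theorem MemWeightedSobolev.exists_gradient_profile {u : L2C}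
    (h : MemWeightedSobolev 0 3 (u : 𝓢'(E3, ℂ)))
    (h' : MemWeightedSobolev 1 2 (u : 𝓢'(E3, ℂ))) :
    ∃ w, unitaryFourier u =ᵐ[volume] w ∧ IntensitySpectrum 3 (intensityFourier w) ∧
      BddDerivs 1 w ∧ BddDerivsW 1 0 w ∧ MemH 3 w ∧ MemHW 1 2 w := by
  obtain ⟨b, hb, hbu⟩ := MemWeightedSobolev.exists_continuous_rep (n := 3) (by omega)
    (by exact_mod_cast h)
  obtain ⟨c, hc, hcu⟩ := MemWeightedSobolev.exists_rep (n := 2) (s := 1) le_rfl (by exact_mod_cast h')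
  have e : 𝓕⁻ b = fun x => bracketInv x ^ 1 * (𝓕⁻ c) x :=
    Continuous.ae_eq_iff_eq (volume : Measure E3) (continuous_fourierInv (hb.integrable (by omega)))
      (continuous_bracketInv_pow_mul_fourierInv le_rfl hc 1) |>.mp (hbu.symm.trans hcu)
  refine ⟨𝓕⁻ b, hbu, intensitySpectrum_fourier_normSq (by omega) hb,
    hb.bddDerivs_fourierInv le_rfl le_rfl, ?_, hb.memH_fourierInv (by omega), ?_⟩
  · rw [e]; exact (hc.bddDerivs_fourierInv (by omega) le_rfl).bddDerivsW_bracketInv_pow 1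
  · rw [e]; exact (hc.memH_fourierInv le_rfl).memHW_bracketInv_pow 1

/-- The regularity of `F u` that the estimates of the time derivatives use. -/
theorem MemWeightedSobolev.exists_timeDeriv_profile {u : L2C}
    (h : MemWeightedSobolev 1 3 (u : 𝓢'(E3, ℂ)))
    (h' : MemWeightedSobolev 2 2 (u : 𝓢'(E3, ℂ))) :
    ∃ w, unitaryFourier u =ᵐ[volume] w ∧ IntensitySpectrum 3 (intensityFourier w) ∧
      BddDerivsW 1 1 w ∧ BddDerivsW 2 0 w ∧ MemHW 1 3 w ∧ MemHW 2 2 w := by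
  obtain ⟨b, hb, hbu⟩ := MemWeightedSobolev.exists_rep (n := 3) (s := 1) (by omega)
    (by exact_mod_cast h)
  obtain ⟨c, hc, hcu⟩ := MemWeightedSobolev.exists_rep (n := 2) (s := 2) le_rfl
    (by exact_mod_cast h')
  have e : (fun x => bracketInv x ^ 1 * (𝓕⁻ b) x) = fun x => bracketInv x ^ 2 * (𝓕⁻ c) x :=
    Continuous.ae_eq_iff_eq (volume : Measure E3)
      (continuous_bracketInv_pow_mul_fourierInv (by omega) hb 1)
      (continuous_bracketInv_pow_mul_fourierInv le_rfl hc 2) |>.mp (hbu.symm.trans hcu)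
  have h13 : MemHW 1 3 fun x => bracketInv x ^ 1 * (𝓕⁻ b) x :=
    (hb.memH_fourierInv (by omega)).memHW_bracketInv_pow 1
  refine ⟨_, hbu, ?_, (hb.bddDerivs_fourierInv le_rfl le_rfl).bddDerivsW_bracketInv_pow 1, ?_,
    h13, ?_⟩
  · -- the amplitude lies in `H³`, so it is the inverse Fourier transform of a weighted `L²` function
    have h3 := h13.memH
    have hF := (isFourierInv_Lp (h3.memLp.toLp _)).congr (ae_eq_refl _) h3.memLp.coeFn_toLp
    have hd := h3.memWeightedL2 hF (Lp.memLp _)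
    have hdi := hd.integrable (by omega)
    have e2 := Continuous.ae_eq_iff_eq (volume : Measure E3)
      (continuous_bracketInv_pow_mul_fourierInv (by omega) hb 1) (continuous_fourierInv hdi) |>.mp
      (hF.unique (isFourierInv_of_integrable hdi) (memLp_two_locallyIntegrable h3.memLp)
        (continuous_fourierInv hdi).locallyIntegrable)
    rw [e2]
    exact intensitySpectrum_fourier_normSq (by omega) hd
  · rw [e]; exact (hc.bddDerivs_fourierInv (by omega) le_rfl).bddDerivsW_bracketInv_pow 2
  · rw [e]; exact (hc.memH_fourierInv le_rfl).memHW_bracketInv_pow 2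

/-! ### The ansatz with a general amplitude -/

/-- `M(t) D(t) exp (-i (ln t) P) Q`: the approximate solution is the case `P = Ã₁`, `Q = w`. -/
def ansatz (P : E3 → ℝ) (t : ℝ) (Q : E3 → ℂ) : E3 → ℂ := fun x =>
  Complex.exp (Complex.I * ((‖x‖ ^ 2 / (2 * t) : ℝ) : ℂ)) *
    ((Complex.I * (t : ℂ)) ^ (-(3 / 2) : ℂ) *
      dilation t (fun y => Complex.exp (-(Complex.I * ((Real.log t * P y : ℝ) : ℂ))) * Q y) x)

theorem uApprox_eq_ansatz (w : E3 → ℂ) : uApprox w = fun t => ansatz (tildeA1 w) t w := rfl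

/-- The factor of the ansatz that does not depend on the amplitude. -/
def carrier (P : E3 → ℝ) (t : ℝ) : E3 → ℂ := fun x =>
  Complex.exp (Complex.I * ((‖x‖ ^ 2 / (2 * t) : ℝ) : ℂ)) *
    ((Complex.I * (t : ℂ)) ^ (-(3 / 2) : ℂ) *
      Complex.exp (-(Complex.I * ((Real.log t * P (t⁻¹ • x) : ℝ) : ℂ))))

theorem ansatz_eq_carrier_mul (P : E3 → ℝ) (t : ℝ) (Q : E3 → ℂ) :
    ansatz P t Q = fun x => carrier P t x * dilation t Q x := by
  ext x; simp only [ansatz, carrier, dilation]; ring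

theorem norm_carrier {P : E3 → ℝ} {t : ℝ} (ht : 0 < t) (x : E3) :
    ‖carrier P t x‖ = t ^ (-(3 / 2) : ℝ) := by
  rw [carrier, norm_mul, norm_mul, norm_exp_I_mul, norm_exp_neg_I_mul, norm_I_mul_cpow ht]
  ring

theorem contDiff_carrier {P : E3 → ℝ} (hP : ContDiff ℝ 1 P) (t : ℝ) :
    ContDiff ℝ 1 (carrier P t) := by
  have h1 : ContDiff ℝ 1 fun x : E3 => ((‖x‖ ^ 2 / (2 * t) : ℝ) : ℂ) :=
    Complex.ofRealCLM.contDiff.comp ((contDiff_norm_sq ℝ).div_const _)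
  have h2 : ContDiff ℝ 1 fun x : E3 => ((Real.log t * P (t⁻¹ • x) : ℝ) : ℂ) :=
    Complex.ofRealCLM.contDiff.comp (contDiff_const.mul (hP.comp (contDiff_const_smul _)))
  exact (contDiff_const.mul h1).cexp.mul (contDiff_const.mul (contDiff_const.mul h2).neg.cexp)

theorem fderiv_carrier {P : E3 → ℝ} (hP : ContDiff ℝ 1 P) {t : ℝ} (ht : 0 < t) (i : Fin 3)
    (x : E3) : fderiv ℝ (carrier P t) x (basisVec i) = carrier P t x *
      (Complex.I * ((t⁻¹ • x) i : ℝ) -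
        (t⁻¹ : ℝ) * (Complex.I * (Real.log t * partialC P i (t⁻¹ • x)))) := by
  have h1 : HasFDerivAt (fun x : E3 => Complex.I * ((‖x‖ ^ 2 / (2 * t) : ℝ) : ℂ))
      (Complex.I • Complex.ofRealCLM.comp ((2 * t)⁻¹ • (2 • innerSL ℝ x))) x := by
    have h := ((hasStrictFDerivAt_norm_sq x).hasFDerivAt).mul_const ((2 * t)⁻¹)
    have := (Complex.ofRealCLM.hasFDerivAt (x := ‖x‖ ^ 2 * (2 * t)⁻¹)).comp x h
    exact this.const_mul Complex.I
  have h2 : HasFDerivAt (fun x : E3 => -(Complex.I * ((Real.log t * P (t⁻¹ • x) : ℝ) : ℂ)))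
      (-(Complex.I • Complex.ofRealCLM.comp (Real.log t •
        ((fderiv ℝ P (t⁻¹ • x)).comp (t⁻¹ • ContinuousLinearMap.id ℝ E3))))) x := by
    have h := (((hP.differentiable one_ne_zero (t⁻¹ • x)).hasFDerivAt).comp x
      ((hasFDerivAt_id x).const_smul t⁻¹)).const_mul (Real.log t)
    have := (Complex.ofRealCLM.hasFDerivAt (x := Real.log t * P (t⁻¹ • x))).comp x h
    exact (this.const_mul Complex.I).neg
  have h3 := h1.cexp.mul ((h2.cexp).const_mul ((Complex.I * (t : ℂ)) ^ (-(3 / 2) : ℂ)))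
  have e : fderiv ℝ (carrier P t) x = _ := h3.fderiv
  rw [e]
  simp only [carrier, _root_.add_apply, _root_.smul_apply, _root_.neg_apply, ContinuousLinearMap.comp_apply,
    innerSL_apply_apply, inner_basisVec, Complex.ofRealCLM_apply, smul_eq_mul, partialC,
    ContinuousLinearMap.id_apply, map_smul, nsmul_eq_mul, PiLp.smul_apply]
  have ht' : (t : ℂ) ≠ 0 := by exact_mod_cast ht.ne'
  push_cast
  field_simp
  ring

theorem _root_.MeasureTheory.LocallyIntegrable.ansatz {P : E3 → ℝ} (hP : ContDiff ℝ 1 P) {t : ℝ} (ht : 0 < t)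
    {Q : E3 → ℂ} (hQ : LocallyIntegrable Q) : LocallyIntegrable (ansatz P t Q) := by
  rw [ansatz_eq_carrier_mul]
  exact (hQ.dilation ht).continuous_mul (contDiff_carrier hP t).continuous

/-- The amplitude of `∂_i (ansatz P t Q)`, where `Q'` is `∂_i Q`. -/
def gradAmp (P : E3 → ℝ) (t : ℝ) (i : Fin 3) (Q Q' : E3 → ℂ) : E3 → ℂ := fun y =>
  Complex.I * coordMul i Q y +
    (t⁻¹ : ℝ) * (Q' y + -(Complex.I * Real.log t) * (partialC P i y * Q y))

theorem HasWeakPartial.ansatz {P : E3 → ℝ} (hP : ContDiff ℝ 1 P) {t : ℝ} (ht : 0 < t) {i : Fin 3}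
    {Q Q' : E3 → ℂ} (hQ : HasWeakPartial i Q Q') :
    HasWeakPartial i (ansatz P t Q) (ansatz P t (gradAmp P t i Q Q')) := by
  have h := (hQ.comp_smul ht).contDiff_mul (contDiff_carrier hP t)
  rw [ansatz_eq_carrier_mul, ansatz_eq_carrier_mul]
  refine h.congr (ae_eq_refl _) (Filter.Eventually.of_forall fun x => ?_)
  simp only [fderiv_carrier hP ht, dilation, gradAmp, _root_.coordMul]
  push_cast
  ring


/-- `y · ∇P`, as a complex function. -/
def eulerC (P : E3 → ℝ) : E3 → ℂ := fun y => ((fderiv ℝ P y y : ℝ) : ℂ)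

theorem eulerC_eq (P : E3 → ℝ) (y : E3) : eulerC P y = ∑ j, (y j : ℂ) * partialC P j y := by
  have h : fderiv ℝ P y y = ∑ j, y j * fderiv ℝ P y (basisVec j) :=
    (congrArg _ (eq_sum_basisVec y)).trans (by simp only [map_sum, map_smul, smul_eq_mul])
  simp only [eulerC, h, partialC]
  push_cast
  rfl

/-- The amplitude of `∂_t (ansatz P t Q)`, where `Q' j` is `∂_j Q`. -/
def timeAmp (P : E3 → ℝ) (t : ℝ) (Q : E3 → ℂ) (Q' : Fin 3 → E3 → ℂ) : E3 → ℂ := fun y =>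
  -(Complex.I / 2) * ∑ j, coordMul j (coordMul j Q) y + -(3 / 2 * (t⁻¹ : ℝ)) * Q y +
    -(Complex.I * (t⁻¹ : ℝ)) * ((P y : ℂ) * Q y) + -(t⁻¹ : ℝ) * ∑ j, coordMul j (Q' j) y +
    Complex.I * ((t⁻¹ * Real.log t : ℝ) : ℂ) * (eulerC P y * Q y)

/-- The coefficients of the powers of `-i ln t` in
`exp (i (ln t) P) Δ (exp (-i (ln t) P) w)`. -/
def lapAmp (P : E3 → ℝ) (PP : Fin 3 → E3 → ℂ) (w : E3 → ℂ) (w' w'' : Fin 3 → E3 → ℂ) :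
    Fin 3 → E3 → ℂ :=
  ![fun y => ∑ i, w'' i y, fun y => ∑ i, (w y * PP i y + 2 * (partialC P i y * w' i y)),
    fun y => ∑ i, partialC P i y * (partialC P i y * w y)]

/-- `exp (i (ln t) P) Δ (exp (-i (ln t) P) w)`. -/
def lapSum (P : E3 → ℝ) (PP : Fin 3 → E3 → ℂ) (w : E3 → ℂ) (w' w'' : Fin 3 → E3 → ℂ) (t : ℝ) :
    E3 → ℂ := fun y => ∑ k : Fin 3, (-(Complex.I * Real.log t)) ^ (k : ℕ) *
      lapAmp P PP w w' w'' k y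

/-- The weak derivative `∂_i` of `gradAmp P t i w (∂_i w)`. -/
def gradAmpDeriv (P : E3 → ℝ) (PP : Fin 3 → E3 → ℂ) (w : E3 → ℂ) (w' w'' : Fin 3 → E3 → ℂ) (t : ℝ)
    (i : Fin 3) : E3 → ℂ := fun y =>
  Complex.I * (coordMul i (w' i) y + w y) + (t⁻¹ : ℝ) * (w'' i y + -(Complex.I * Real.log t) *
    (w' i y * partialC P i y + w y * PP i y))

theorem PhaseBounds.hasWeakPartial_gradAmp {m : ℕ} {P : E3 → ℝ} {PP : Fin 3 → E3 → ℂ}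
    (hP : PhaseBounds m P PP) {w : E3 → ℂ} (hw : Continuous w) {w' w'' : Fin 3 → E3 → ℂ}
    (h1 : ∀ i, HasWeakPartial i w (w' i)) (h2 : ∀ i, HasWeakPartial i (w' i) (w'' i)) (t : ℝ)
    (i : Fin 3) :
    HasWeakPartial i (gradAmp P t i w (w' i)) (gradAmpDeriv P PP w w' w'' t i) := by
  have h := (((h1 i).coordMul i).const_mul Complex.I).add
    (((h2 i).add ((hP.mul i (h1 i) hw).const_mul (-(Complex.I * Real.log t)))).const_mul
      ((t⁻¹ : ℝ) : ℂ))
  refine h.congr (Filter.Eventually.of_forall fun y => ?_) (Filter.Eventually.of_forall fun y => ?_)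
  · simp only [gradAmp]; ring
  · simp only [gradAmpDeriv, if_true]; ring

/-- The cancellation behind the estimate of the remainder: of `i ∂_t u + (1/2) Δ u` only the
Laplacian of the amplitude and the phase term survive. -/
theorem I_mul_timeAmp_add_half_sum (P : E3 → ℝ) (PP : Fin 3 → E3 → ℂ) (w : E3 → ℂ)
    (w' w'' : Fin 3 → E3 → ℂ) {t : ℝ} (ht : 0 < t) (y : E3) :
    Complex.I * timeAmp P t w w' y + (1 / 2) * ∑ i, gradAmp P t i (gradAmp P t i w (w' i))
      (gradAmpDeriv P PP w w' w'' t i) y =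
    (((2 * t ^ 2)⁻¹ : ℝ) : ℂ) * lapSum P PP w w' w'' t y + ((t⁻¹ * P y : ℝ) : ℂ) * w y := by
  have ht' : (t : ℂ) ≠ 0 := by exact_mod_cast ht.ne'
  have hI : Complex.I * Complex.I = -1 := Complex.I_mul_I
  simp only [timeAmp, gradAmp, gradAmpDeriv, lapSum, lapAmp, eulerC_eq, coordMul,
    Fin.sum_univ_three, Matrix.cons_val_zero, Matrix.cons_val_one, Matrix.cons_val]
  push_cast
  generalize (Real.log t : ℂ) = L
  simp only [Fin.val_zero, Fin.val_one, Fin.val_two, pow_zero, pow_one, pow_two]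
  field_simp
  ring_nf
  simp only [Complex.I_sq]
  ring

/-! ### The time derivative of the ansatz -/

/-- Differentiation under the integral sign for a kernel `k s` supported in a fixed ball, against a
locally integrable function. -/
theorem hasDerivAt_integral_kernel_mul {k k' : ℝ → E3 → ℂ} {Q : E3 → ℂ} (hQ : LocallyIntegrable Q)
    {t ε ρ : ℝ} (hε : 0 < ε)
    (hk : ∀ s ∈ Set.Icc (t - ε) (t + ε), ∀ y, HasDerivAt (fun s => k s y) (k' s y) s)
    (hc : ∀ s ∈ Set.Icc (t - ε) (t + ε), Continuous (k s))
    (hc' : ContinuousOn (fun p : ℝ × E3 => k' p.1 p.2) (Set.Icc (t - ε) (t + ε) ×ˢ Set.univ))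
    (h0 : ∀ s ∈ Set.Icc (t - ε) (t + ε), ∀ y, ρ < ‖y‖ → k s y = 0)
    (h0' : ∀ s ∈ Set.Icc (t - ε) (t + ε), ∀ y, ρ < ‖y‖ → k' s y = 0) :
    HasDerivAt (fun s => ∫ y, k s y * Q y) (∫ y, k' t y * Q y) t := by
  have ht : t ∈ Set.Icc (t - ε) (t + ε) := ⟨by linarith, by linarith⟩
  have hnhds : Set.Icc (t - ε) (t + ε) ∈ 𝓝 t := Icc_mem_nhds (by linarith) (by linarith)
  obtain ⟨C, hC⟩ := (isCompact_Icc.prod (isCompact_closedBall (0 : E3) ρ)).exists_bound_of_continuousOn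
    (hc'.mono (Set.prod_mono_right (Set.subset_univ _)))
  have hcs : ∀ s ∈ Set.Icc (t - ε) (t + ε), HasCompactSupport (k s) := fun s hs =>
    HasCompactSupport.intro (isCompact_closedBall (0 : E3) ρ) fun y hy =>
      h0 s hs y (by simpa using hy)
  have hcont' : Continuous (k' t) :=
    (continuousOn_univ.mp (hc'.comp (f := fun y : E3 => (t, y)) (s := Set.univ)
      (by fun_prop) fun y _ => ⟨ht, trivial⟩))
  refine (hasDerivAt_integral_of_dominated_loc_of_deriv_le
    (F := fun s y => k s y * Q y) (F' := fun s y => k' s y * Q y)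
    (bound := (Metric.closedBall (0 : E3) ρ).indicator fun y => C * ‖Q y‖) hnhds ?_ ?_ ?_ ?_ ?_ ?_).2
  · filter_upwards [hnhds] with s hs
    exact (hc s hs).aestronglyMeasurable.mul hQ.aestronglyMeasurable
  · exact hQ.integrable_mul_of_hasCompactSupport (hc t ht) (hcs t ht)
  · exact hcont'.aestronglyMeasurable.mul hQ.aestronglyMeasurable
  · refine Filter.Eventually.of_forall fun y s hs => ?_
    by_cases hy : ‖y‖ ≤ ρ
    · rw [Set.indicator_of_mem (by simpa using hy), norm_mul]
      exact mul_le_mul_of_nonneg_right (hC (s, y) ⟨hs, by simpa using hy⟩) (norm_nonneg _)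
    · rw [Set.indicator_of_notMem (by simpa using hy), h0' s hs y (not_le.mp hy)]
      simp
  · rw [integrable_indicator_iff Metric.isClosed_closedBall.measurableSet]
    exact ((hQ.integrableOn_isCompact (isCompact_closedBall _ _)).norm).const_mul C
  · exact Filter.Eventually.of_forall fun y s hs => (hk s hs y).mul_const _

/-- The carrier at the rescaled point `s y`. -/
def scaledCarrier (P : E3 → ℝ) (s : ℝ) (y : E3) : ℂ :=
  Complex.exp (Complex.I * ((s * (‖y‖ ^ 2 / 2) : ℝ) : ℂ)) *
    ((Complex.I * (s : ℂ)) ^ (-(3 / 2) : ℂ) *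
      Complex.exp (-(Complex.I * ((Real.log s * P y : ℝ) : ℂ))))

theorem carrier_smul (P : E3 → ℝ) {s : ℝ} (hs : 0 < s) (y : E3) :
    carrier P s (s • y) = scaledCarrier P s y := by
  rw [carrier, scaledCarrier, inv_smul_smul₀ hs.ne', norm_smul, Real.norm_of_nonneg hs.le]
  have : (s * ‖y‖) ^ 2 / (2 * s) = s * (‖y‖ ^ 2 / 2) := by field_simp
  rw [this]

theorem I_mul_mem_slitPlane {s : ℝ} (hs : 0 < s) : Complex.I * (s : ℂ) ∈ Complex.slitPlane :=
  Or.inr (by simpa using hs.ne')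

theorem hasDerivAt_I_mul_cpow {s : ℝ} (hs : 0 < s) :
    HasDerivAt (fun s : ℝ => (Complex.I * (s : ℂ)) ^ (-(3 / 2) : ℂ))
      (-(3 / 2 * (s⁻¹ : ℝ)) * (Complex.I * (s : ℂ)) ^ (-(3 / 2) : ℂ)) s := by
  have h1 : HasDerivAt (fun z : ℂ => Complex.I * z) Complex.I (s : ℂ) := by
    simpa using (hasDerivAt_id (s : ℂ)).const_mul Complex.I
  have h2 := (h1.cpow_const (c := (-(3 / 2) : ℂ)) (I_mul_mem_slitPlane hs)).comp_ofReal
  have hs' : (s : ℂ) ≠ 0 := by exact_mod_cast hs.ne'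
  convert h2 using 1
  rw [Complex.cpow_sub _ _ (mul_ne_zero Complex.I_ne_zero hs'), Complex.cpow_one]
  push_cast
  field_simp

theorem hasDerivAt_scaledCarrier (P : E3 → ℝ) {s : ℝ} (hs : 0 < s) (y : E3) :
    HasDerivAt (fun s => scaledCarrier P s y) (scaledCarrier P s y *
      (Complex.I * ((‖y‖ ^ 2 / 2 : ℝ) : ℂ) - 3 / 2 * (s⁻¹ : ℝ) -
        Complex.I * ((s⁻¹ * P y : ℝ) : ℂ))) s := by
  have h1 : HasDerivAt (fun s : ℝ => Complex.I * ((s * (‖y‖ ^ 2 / 2) : ℝ) : ℂ))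
      (Complex.I * ((‖y‖ ^ 2 / 2 : ℝ) : ℂ)) s := by
    have := ((hasDerivAt_id s).mul_const (‖y‖ ^ 2 / 2)).ofReal_comp
    simpa using this.const_mul Complex.I
  have h2 : HasDerivAt (fun s : ℝ => -(Complex.I * ((Real.log s * P y : ℝ) : ℂ)))
      (-(Complex.I * ((s⁻¹ * P y : ℝ) : ℂ))) s :=
    ((((Real.hasDerivAt_log hs.ne').mul_const (P y)).ofReal_comp).const_mul Complex.I).neg
  have h3 := h1.cexp.mul ((hasDerivAt_I_mul_cpow hs).mul h2.cexp)
  refine h3.congr_deriv ?_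
  rw [scaledCarrier]
  simp only [Pi.mul_apply]
  ring

theorem continuousOn_scaledCarrier {P : E3 → ℝ} (hP : Continuous P) :
    ContinuousOn (fun p : ℝ × E3 => scaledCarrier P p.1 p.2) (Set.Ioi 0 ×ˢ Set.univ) := by
  have h1 : ContinuousOn (fun p : ℝ × E3 => (Complex.I * (p.1 : ℂ)) ^ (-(3 / 2) : ℂ))
      (Set.Ioi 0 ×ˢ Set.univ) :=
    ContinuousOn.cpow (by fun_prop) continuousOn_const fun p hp => I_mul_mem_slitPlane hp.1
  have h2 : ContinuousOn (fun p : ℝ × E3 => Real.log p.1) (Set.Ioi 0 ×ˢ Set.univ) :=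
    ContinuousOn.log (by fun_prop) fun p hp => (ne_of_gt hp.1)
  have h3 : ContinuousOn (fun p : ℝ × E3 => P p.2) (Set.Ioi 0 ×ˢ Set.univ) := by fun_prop
  unfold scaledCarrier
  refine ContinuousOn.mul (by fun_prop) (h1.mul ?_)
  exact (continuousOn_const.mul (Complex.continuous_ofReal.comp_continuousOn (h2.mul h3))).neg.cexp

theorem integral_mul_ansatz (P : E3 → ℝ) (Q : E3 → ℂ) (ψ : E3 → ℝ) {s : ℝ} (hs : 0 < s) :
    ∫ x, (ψ x : ℂ) * ansatz P s Q x =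
      ∫ y, (((s ^ 3 * ψ (s • y) : ℝ) : ℂ) * scaledCarrier P s y) * Q y := by
  have h := integral_comp_smul_pos (fun x => (ψ x : ℂ) * ansatz P s Q x) hs
  have hs' : ((s ^ 3 : ℝ) : ℂ) ≠ 0 := by exact_mod_cast (pow_pos hs 3).ne'
  have h2 : ∫ x, (ψ x : ℂ) * ansatz P s Q x =
      ((s ^ 3 : ℝ) : ℂ) * ∫ y, (ψ (s • y) : ℂ) * ansatz P s Q (s • y) := by
    rw [h, ← mul_assoc, Complex.ofReal_inv, mul_inv_cancel₀ hs', one_mul]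
  rw [h2, ← integral_const_mul]
  refine integral_congr_ae (Filter.Eventually.of_forall fun y => ?_)
  simp only [ansatz_eq_carrier_mul, carrier_smul P hs, dilation, inv_smul_smul₀ hs.ne']
  push_cast
  ring


theorem IsTest.exists_radius {ψ : E3 → ℝ} (hψ : IsTest ψ) :
    ∃ ρ : ℝ, ∀ x, ρ < ‖x‖ → ψ x = 0 ∧ fderiv ℝ ψ x = 0 := by
  obtain ⟨ρ, hρ⟩ := hψ.2.isCompact.isBounded.subset_closedBall (0 : E3)
  refine ⟨ρ, fun x hx => ?_⟩
  have hx' : x ∉ tsupport ψ := fun h => by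
    have := hρ h
    simp only [mem_closedBall_zero_iff] at this
    linarith
  exact ⟨image_eq_zero_of_notMem_tsupport hx', fderiv_of_notMem_tsupport ℝ hx'⟩

theorem hasDerivAt_integral_mul_ansatz {P : E3 → ℝ} (hP : Continuous P) {Q : E3 → ℂ}
    (hQ : LocallyIntegrable Q) {ψ : E3 → ℝ} (hψ : IsTest ψ) {t : ℝ} (ht : 0 < t) :
    HasDerivAt (fun s => ∫ x, (ψ x : ℂ) * ansatz P s Q x)
      (∫ y, (((3 * t ^ 2 * ψ (t • y) + t ^ 3 * fderiv ℝ ψ (t • y) y : ℝ) : ℂ) *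
        scaledCarrier P t y + ((t ^ 3 * ψ (t • y) : ℝ) : ℂ) * (scaledCarrier P t y *
        (Complex.I * ((‖y‖ ^ 2 / 2 : ℝ) : ℂ) - 3 / 2 * (t⁻¹ : ℝ) -
          Complex.I * ((t⁻¹ * P y : ℝ) : ℂ)))) * Q y) t := by
  obtain ⟨ρ, hρ⟩ := hψ.exists_radius
  have hpos : ∀ s ∈ Set.Icc (t - t / 2) (t + t / 2), 0 < s := fun s hs => by linarith [hs.1]
  have hfar : ∀ s ∈ Set.Icc (t - t / 2) (t + t / 2), ∀ y : E3, ρ / (t / 2) < ‖y‖ →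
      ρ < ‖s • y‖ := fun s hs y hy => by
    rw [norm_smul, Real.norm_of_nonneg (hpos s hs).le]
    rw [div_lt_iff₀ (by linarith)] at hy
    nlinarith [hs.1, norm_nonneg y]
  have hsub : Set.Icc (t - t / 2) (t + t / 2) ×ˢ (Set.univ : Set E3) ⊆
      Set.Ioi 0 ×ˢ Set.univ := Set.prod_mono_left fun s hs => hpos s hs
  have hE := (continuousOn_scaledCarrier hP).mono hsub
  have hψd : Continuous fun p : ℝ × E3 => fderiv ℝ ψ (p.1 • p.2) p.2 :=
    ((hψ.1.continuous_fderiv (by simp)).comp (by fun_prop)).clm_apply continuous_snd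
  have hψc : Continuous ψ := hψ.1.continuous
  have hinv : ContinuousOn (fun p : ℝ × E3 => p.1⁻¹) (Set.Icc (t - t / 2) (t + t / 2) ×ˢ Set.univ) :=
    ContinuousOn.inv₀ (by fun_prop) fun p hp => (hpos p.1 hp.1).ne'
  have h := hasDerivAt_integral_kernel_mul (t := t) (ε := t / 2) (ρ := ρ / (t / 2))
    (k := fun s y => ((s ^ 3 * ψ (s • y) : ℝ) : ℂ) * scaledCarrier P s y)
    (k' := fun s y => (((3 * s ^ 2 * ψ (s • y) + s ^ 3 * fderiv ℝ ψ (s • y) y : ℝ) : ℂ) *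
        scaledCarrier P s y + ((s ^ 3 * ψ (s • y) : ℝ) : ℂ) * (scaledCarrier P s y *
        (Complex.I * ((‖y‖ ^ 2 / 2 : ℝ) : ℂ) - 3 / 2 * (s⁻¹ : ℝ) -
          Complex.I * ((s⁻¹ * P y : ℝ) : ℂ))))) hQ (by linarith) ?_ ?_ ?_ ?_ ?_
  · refine h.congr_of_eventuallyEq ?_
    filter_upwards [lt_mem_nhds ht] with s hs
    exact integral_mul_ansatz P Q ψ hs
  · intro s hs y
    refine HasDerivAt.mul (HasDerivAt.ofReal_comp ?_) (hasDerivAt_scaledCarrier P (hpos s hs) y)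
    have h1 : HasDerivAt (fun s : ℝ => ψ (s • y)) (fderiv ℝ ψ (s • y) y) s := by
      have := ((hψ.1.differentiable (by simp) (s • y)).hasFDerivAt).comp_hasDerivAt s
        ((hasDerivAt_id s).smul_const y)
      exact this.congr_deriv (by simp)
    exact ((hasDerivAt_pow 3 s).mul h1).congr_deriv (by simp)
  · intro s hs
    have : Continuous fun y => scaledCarrier P s y :=
      continuousOn_univ.mp (hE.comp (f := fun y : E3 => (s, y)) (s := Set.univ) (by fun_prop)
        fun y _ => ⟨hs, trivial⟩)
    exact (Complex.continuous_ofReal.comp (by fun_prop)).mul this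
  · have h1 : ContinuousOn (fun p : ℝ × E3 => p.1⁻¹ * P p.2)
        (Set.Icc (t - t / 2) (t + t / 2) ×ˢ Set.univ) :=
      hinv.mul (by fun_prop)
    have h2 : Continuous fun p : ℝ × E3 =>
        ((3 * p.1 ^ 2 * ψ (p.1 • p.2) + p.1 ^ 3 * fderiv ℝ ψ (p.1 • p.2) p.2 : ℝ) : ℂ) := by
      fun_prop
    have h3 : Continuous fun p : ℝ × E3 => ((p.1 ^ 3 * ψ (p.1 • p.2) : ℝ) : ℂ) := by fun_prop
    refine (h2.continuousOn.mul hE).add (h3.continuousOn.mul (hE.mul (((by fun_prop :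
      Continuous fun p : ℝ × E3 => Complex.I * ((‖p.2‖ ^ 2 / 2 : ℝ) : ℂ)).continuousOn.sub
      (continuousOn_const.mul (Complex.continuous_ofReal.comp_continuousOn hinv))).sub
      (continuousOn_const.mul (Complex.continuous_ofReal.comp_continuousOn h1)))))
  · intro s hs y hy
    simp [(hρ _ (hfar s hs y hy)).1]
  · intro s hs y hy
    simp [(hρ _ (hfar s hs y hy)).1, (hρ _ (hfar s hs y hy)).2]

theorem contDiff_scaledCarrier {P : E3 → ℝ} (hP : ContDiff ℝ 1 P) {t : ℝ} (ht : 0 < t) :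
    ContDiff ℝ 1 (scaledCarrier P t) := by
  have : scaledCarrier P t = fun y => carrier P t (t • y) :=
    funext fun y => (carrier_smul P ht y).symm
  rw [this]
  exact (contDiff_carrier hP t).comp (contDiff_const_smul t)

theorem fderiv_scaledCarrier {P : E3 → ℝ} (hP : ContDiff ℝ 1 P) {t : ℝ} (ht : 0 < t) (i : Fin 3)
    (y : E3) : fderiv ℝ (scaledCarrier P t) y (basisVec i) = scaledCarrier P t y *
      (Complex.I * ((t * y i : ℝ) : ℂ) - Complex.I * (Real.log t * partialC P i y)) := by
  have e : scaledCarrier P t = fun y => carrier P t (t • y) :=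
    funext fun y => (carrier_smul P ht y).symm
  rw [e, fderiv_comp_smul, _root_.smul_apply, fderiv_carrier hP ht, inv_smul_smul₀ ht.ne']
  have ht' : (t : ℂ) ≠ 0 := by exact_mod_cast ht.ne'
  rw [Complex.real_smul]
  push_cast
  field_simp

theorem locallyIntegrable_timeAmp {P : E3 → ℝ} (hP : ContDiff ℝ 1 P) (t : ℝ) {Q : E3 → ℂ}
    {Q' : Fin 3 → E3 → ℂ} (hQ : LocallyIntegrable Q) (hQ' : ∀ j, LocallyIntegrable (Q' j)) :
    LocallyIntegrable (timeAmp P t Q Q') := by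
  have hc : ∀ (k : Fin 3) {f : E3 → ℂ}, LocallyIntegrable f → LocallyIntegrable (coordMul k f) :=
    fun k f hf => hf.continuous_mul (contDiff_coord k).continuous
  have hs : ∀ {f : Fin 3 → E3 → ℂ}, (∀ j, LocallyIntegrable (f j)) →
      LocallyIntegrable fun y => ∑ j, f j y := fun {f} hf => by
    simp only [Fin.sum_univ_three]
    exact ((hf 0).add (hf 1)).add (hf 2)
  have hcm : ∀ (c : ℂ) {f : E3 → ℂ}, LocallyIntegrable f → LocallyIntegrable fun y => c * f y :=
    fun c f hf => hf.smul c
  have hE : Continuous (eulerC P) := Complex.continuous_ofReal.comp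
    ((hP.continuous_fderiv one_ne_zero).clm_apply continuous_id)
  have hPc : Continuous fun y => (P y : ℂ) := Complex.continuous_ofReal.comp hP.continuous
  exact ((((hcm _ (hs fun j => hc j (hc j hQ))).add (hcm _ hQ)).add
    (hcm _ (hQ.continuous_mul hPc))).add (hcm _ (hs fun j => hc j (hQ' j)))).add
    (hcm _ (hQ.continuous_mul hE))

/-- The time derivative of the ansatz. After the change of variables `x = t y` only the kernel
depends on `t`, and the derivative that falls on the test function is integrated by parts. -/
theorem hasTimeDerivAt_ansatz {P : E3 → ℝ} (hP : ContDiff ℝ 1 P) {Q : E3 → ℂ}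
    {Q' : Fin 3 → E3 → ℂ} (hQ : ∀ j, HasWeakPartial j Q (Q' j)) {t : ℝ} (ht : 0 < t) :
    HasTimeDerivAt (fun s => ansatz P s Q) (ansatz P t (timeAmp P t Q Q')) t := by
  have hQl : LocallyIntegrable Q := (hQ 0).left
  have hT := locallyIntegrable_timeAmp hP t hQl fun j => (hQ j).right
  refine ⟨?_, hT.ansatz hP ht, fun ψ hψ => ?_⟩
  · filter_upwards [lt_mem_nhds ht] with s hs using hQl.ansatz hP hs
  refine (hasDerivAt_integral_mul_ansatz hP.continuous hQl hψ ht).congr_deriv ?_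
  rw [integral_mul_ansatz P _ ψ ht]
  set E := scaledCarrier P t with hE
  have hEc : ContDiff ℝ 1 E := contDiff_scaledCarrier hP ht
  set ψt : E3 → ℝ := fun y => ψ (t • y) with hψt
  have hψt' : IsTest ψt := ⟨hψ.1.comp (contDiff_const_smul t), hψ.2.comp_smul ht.ne'⟩
  have hfd : ∀ y v, fderiv ℝ ψt y v = t * fderiv ℝ ψ (t • y) v := fun y v => by
    rw [hψt, fderiv_comp_smul, _root_.smul_apply, smul_eq_mul]
  have hW : ∀ j, HasWeakPartial j (coordMul j fun y => E y * Q y) fun y =>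
      coordMul j (fun y => E y * Q' j y + fderiv ℝ E y (basisVec j) * Q y) y + E y * Q y :=
    fun j => by simpa using ((hQ j).contDiff_mul hEc).coordMul j
  -- the two parts of the derivative: the second one is integrated by parts
  have i1 : Integrable fun y => (ψt y : ℂ) * (((3 * t ^ 2 : ℝ) + (t ^ 3 : ℝ) *
      (Complex.I * ((‖y‖ ^ 2 / 2 : ℝ) : ℂ) - 3 / 2 * (t⁻¹ : ℝ) -
        Complex.I * ((t⁻¹ * P y : ℝ) : ℂ))) * E y * Q y) := by
    refine LocallyIntegrable.integrable_ofReal_mul_of_hasCompactSupport ?_ hψt'.1.continuous hψt'.2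
    refine hQl.continuous_mul ?_
    have h1 := hP.continuous
    have h2 := hEc.continuous
    fun_prop
  have i2 : ∀ j, Integrable fun y => ((fderiv ℝ ψt y (basisVec j) : ℝ) : ℂ) *
      coordMul j (fun y => E y * Q y) y := fun j =>
    (hW j).left.integrable_ofReal_mul_of_hasCompactSupport (hψt'.continuous_fderiv_apply _)
      (hψt'.hasCompactSupport_fderiv_apply _)
  have i3 : ∀ j, Integrable fun y => (ψt y : ℂ) * (coordMul j (fun y => E y * Q' j y +
      fderiv ℝ E y (basisVec j) * Q y) y + E y * Q y) := fun j =>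
    (hW j).right.integrable_ofReal_mul_of_hasCompactSupport hψt'.1.continuous hψt'.2
  have hsum : ∑ j, ∫ y, ((fderiv ℝ ψt y (basisVec j) : ℝ) : ℂ) * coordMul j (fun y => E y * Q y) y =
      -∑ j, ∫ y, (ψt y : ℂ) * (coordMul j (fun y => E y * Q' j y +
        fderiv ℝ E y (basisVec j) * Q y) y + E y * Q y) := by
    rw [← Finset.sum_neg_distrib]
    exact Finset.sum_congr rfl fun j _ => (hW j).eq ψt hψt'
  rw [← integral_finsetSum _ fun j _ => i2 j, ← integral_finsetSum _ fun j _ => i3 j] at hsum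
  have e1 : ∀ y, (((3 * t ^ 2 * ψ (t • y) + t ^ 3 * fderiv ℝ ψ (t • y) y : ℝ) : ℂ) * E y +
      ((t ^ 3 * ψ (t • y) : ℝ) : ℂ) * (E y * (Complex.I * ((‖y‖ ^ 2 / 2 : ℝ) : ℂ) -
        3 / 2 * (t⁻¹ : ℝ) - Complex.I * ((t⁻¹ * P y : ℝ) : ℂ)))) * Q y =
      (ψt y : ℂ) * (((3 * t ^ 2 : ℝ) + (t ^ 3 : ℝ) * (Complex.I * ((‖y‖ ^ 2 / 2 : ℝ) : ℂ) -
        3 / 2 * (t⁻¹ : ℝ) - Complex.I * ((t⁻¹ * P y : ℝ) : ℂ))) * E y * Q y) +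
      ((t ^ 2 : ℝ) : ℂ) * ∑ j, ((fderiv ℝ ψt y (basisVec j) : ℝ) : ℂ) *
        coordMul j (fun y => E y * Q y) y := fun y => by
    have h1 : fderiv ℝ ψ (t • y) y = ∑ j, y j * fderiv ℝ ψ (t • y) (basisVec j) :=
      (congrArg _ (eq_sum_basisVec y)).trans (by simp only [map_sum, map_smul, smul_eq_mul])
    simp only [h1, hfd, coordMul, Fin.sum_univ_three]
    simp only [hψt]
    push_cast
    ring
  have e2 : ∀ y, ((t ^ 3 * ψ (t • y) : ℝ) : ℂ) * E y * timeAmp P t Q Q' y =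
      (ψt y : ℂ) * (((3 * t ^ 2 : ℝ) + (t ^ 3 : ℝ) * (Complex.I * ((‖y‖ ^ 2 / 2 : ℝ) : ℂ) -
        3 / 2 * (t⁻¹ : ℝ) - Complex.I * ((t⁻¹ * P y : ℝ) : ℂ))) * E y * Q y) -
      ((t ^ 2 : ℝ) : ℂ) * ∑ j, (ψt y : ℂ) * (coordMul j (fun y => E y * Q' j y +
        fderiv ℝ E y (basisVec j) * Q y) y + E y * Q y) := fun y => by
    have h1 : ‖y‖ ^ 2 = y 0 ^ 2 + y 1 ^ 2 + y 2 ^ 2 := by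
      rw [EuclideanSpace.norm_sq_eq, Fin.sum_univ_three]; simp
    simp only [timeAmp, eulerC_eq, coordMul, Fin.sum_univ_three, hψt, hE,
      fderiv_scaledCarrier hP ht, h1]
    have ht' : (t : ℂ) ≠ 0 := by exact_mod_cast ht.ne'
    push_cast
    field_simp
    ring
  simp only [e1, e2]
  rw [integral_add i1 ((integrable_finsetSum _ fun j _ => i2 j).const_mul _),
    integral_sub i1 ((integrable_finsetSum _ fun j _ => i3 j).const_mul _),
    integral_const_mul, integral_const_mul, hsum]
  ring

/-! ### Lebesgue norms of the ansatz -/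

theorem eLpNorm_dilation {V : Type*} [NormedAddCommGroup V] (f : E3 → V) {r : ℝ≥0∞} {t : ℝ}
    (ht : 0 < t) : eLpNorm (dilation t f) r volume =
      ENNReal.ofReal (t ^ (3 * (r⁻¹).toReal)) * eLpNorm f r volume := by
  have h0 : t⁻¹ ≠ 0 := (inv_pos.mpr ht).ne'
  have he : MeasurableEmbedding fun x : E3 => t⁻¹ • x := measurableEmbedding_const_smul₀ h0
  have h1 := he.eLpNorm_map_measure (p := r) (μ := volume) (g := f)
  have h3 : |((t⁻¹) ^ Module.finrank ℝ E3)⁻¹| = t ^ 3 := by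
    rw [finrank_euclideanSpace, Fintype.card_fin, inv_pow, inv_inv, abs_of_pos (pow_pos ht 3)]
  rw [Measure.map_addHaar_smul volume h0, h3, eLpNorm_smul_measure_of_ne_zero
    (by simpa using pow_pos ht 3)] at h1
  have h2 : dilation t f = f ∘ fun x => t⁻¹ • x := rfl
  rw [h2, ← h1, smul_eq_mul, one_div, ENNReal.ofReal_rpow_of_pos (pow_pos ht 3),
    ← Real.rpow_natCast, ← Real.rpow_mul ht.le]
  norm_num

theorem AEStronglyMeasurable.dilation {f : E3 → ℂ} (hf : AEStronglyMeasurable f) {t : ℝ}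
    (ht : 0 < t) : AEStronglyMeasurable (dilation t f) :=
  ⟨fun x => hf.mk f (t⁻¹ • x), hf.stronglyMeasurable_mk.comp_measurable (by fun_prop),
    ae_comp_smul hf.ae_eq_mk (inv_pos.mpr ht).ne'⟩

theorem eLpNorm_ansatz (P : E3 → ℝ) (Q : E3 → ℂ) {r : ℝ≥0∞} {t : ℝ} (ht : 0 < t) :
    eLpNorm (ansatz P t Q) r volume =
      ENNReal.ofReal (t ^ (-deltaExp r)) * eLpNorm Q r volume := by
  have h1 : eLpNorm (ansatz P t Q) r volume =
      eLpNorm (((t ^ (-(3 / 2) : ℝ) : ℝ) : ℂ) • dilation t Q) r volume := by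
    refine eLpNorm_congr_norm_ae (Filter.Eventually.of_forall fun x => ?_)
    rw [ansatz_eq_carrier_mul, Pi.smul_apply, smul_eq_mul, norm_mul, norm_mul, norm_carrier ht,
      Complex.norm_real, Real.norm_of_nonneg (by positivity)]
  rw [h1, eLpNorm_const_smul, eLpNorm_dilation _ ht, ← mul_assoc, ← ofReal_norm,
    Complex.norm_real, Real.norm_of_nonneg (by positivity), ← ENNReal.ofReal_mul (by positivity),
    ← Real.rpow_add ht]
  congr 4
  rw [deltaExp]; ring

theorem AEStronglyMeasurable.ansatz {P : E3 → ℝ} (hP : ContDiff ℝ 1 P) {Q : E3 → ℂ}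
    (hQ : AEStronglyMeasurable Q) {t : ℝ} (ht : 0 < t) : AEStronglyMeasurable (ansatz P t Q) := by
  rw [ansatz_eq_carrier_mul]
  exact (contDiff_carrier hP t).continuous.aestronglyMeasurable.mul
    (AEStronglyMeasurable.dilation hQ ht)

/-- Interpolation between `L²` and `L^∞`. -/
theorem eLpNorm_le_max_two_top {f : E3 → ℂ} {r : ℝ≥0∞} (hr : 2 ≤ r) :
    eLpNorm f r volume ≤ max (eLpNorm f 2 volume) (eLpNorm f ⊤ volume) := by
  set K := max (eLpNorm f 2 volume) (eLpNorm f ⊤ volume) with hK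
  rcases eq_or_ne r ⊤ with rfl | hr'
  · exact le_max_right _ _
  have h2 : (2 : ℝ) ≤ r.toReal := by
    simpa using ENNReal.toReal_mono hr' hr
  have h0 : r ≠ 0 := by rintro rfl; simp at hr
  have hae : ∀ᵐ x, ‖f x‖ₑ ≤ K := by
    filter_upwards [ae_le_eLpNormEssSup (f := f) (μ := (volume : Measure E3))] with x hx
    exact hx.trans (by rw [← eLpNorm_exponent_top]; exact le_max_right _ _)
  have hsq : ∫⁻ x, ‖f x‖ₑ ^ (2 : ℝ) ≤ K ^ (2 : ℝ) := by
    have h := le_max_left (eLpNorm f 2 volume) (eLpNorm f ⊤ volume)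
    rw [← hK, eLpNorm_eq_lintegral_rpow_enorm_toReal (by norm_num) (by norm_num)] at h
    have h' := ENNReal.rpow_le_rpow h (by norm_num : (0 : ℝ) ≤ 2)
    rw [← ENNReal.rpow_mul] at h'
    simpa using h'
  rw [eLpNorm_eq_lintegral_rpow_enorm_toReal h0 hr']
  have hmain : ∫⁻ x, ‖f x‖ₑ ^ r.toReal ≤ K ^ r.toReal := by
    calc ∫⁻ x, ‖f x‖ₑ ^ r.toReal ≤ ∫⁻ x, K ^ (r.toReal - 2) * ‖f x‖ₑ ^ (2 : ℝ) := by
          refine lintegral_mono_ae (hae.mono fun x hx => ?_)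
          have e : r.toReal = (r.toReal - 2) + 2 := by ring
          conv_lhs => rw [e]
          rw [ENNReal.rpow_add_of_nonneg _ _ (by linarith) (by norm_num)]
          gcongr
      _ ≤ K ^ (r.toReal - 2) * K ^ (2 : ℝ) := by
          rcases eq_or_ne K ⊤ with hK' | hK'
          · have : K ^ (2 : ℝ) = ⊤ := by rw [hK']; simp
            rcases eq_or_lt_of_le h2 with h | h
            · simp only [← h, sub_self, ENNReal.rpow_zero, one_mul]; exact hsq
            · have h4 : K ^ (r.toReal - 2) = ⊤ := by
                rw [hK', ENNReal.top_rpow_of_pos (by linarith)]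
              rw [this, h4, ENNReal.top_mul_top]
              exact le_top
          · rw [lintegral_const_mul' _ _ (ENNReal.rpow_ne_top_of_nonneg (by linarith) hK')]
            gcongr
      _ = K ^ r.toReal := by
          rw [← ENNReal.rpow_add_of_nonneg _ _ (by linarith) (by norm_num)]
          congr 1; ring
  calc _ ≤ (K ^ r.toReal) ^ (1 / r.toReal) := by gcongr
    _ = K := by rw [← ENNReal.rpow_mul, mul_one_div_cancel (by linarith), ENNReal.rpow_one]

/-! ### Bounds that are uniform in time -/

/-- `‖F(t)‖_p ≤ C γ(t)` for `t ≥ 1`, with a finite constant `C`. -/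
def NormBound (p : ℝ≥0∞) (γ : ℝ → ℝ) (F : ℝ → E3 → ℂ) : Prop :=
  ∃ C : ℝ≥0∞, C ≠ ⊤ ∧ ∀ t : ℝ, 1 ≤ t → AEStronglyMeasurable (F t) ∧
    eLpNorm (F t) p volume ≤ C * ENNReal.ofReal (γ t)

namespace NormBound

variable {p : ℝ≥0∞} {γ γ' : ℝ → ℝ} {F G : ℝ → E3 → ℂ}

theorem congr (h : NormBound p γ F) (hFG : ∀ t, 1 ≤ t → F t =ᵐ[volume] G t) : NormBound p γ G := by
  obtain ⟨C, hC, h⟩ := h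
  exact ⟨C, hC, fun t ht => ⟨(h t ht).1.congr (hFG t ht),
    (eLpNorm_congr_ae (hFG t ht)).symm.le.trans (h t ht).2⟩⟩

theorem add (hp : 1 ≤ p) (hF : NormBound p γ F) (hG : NormBound p γ G) :
    NormBound p γ fun t x => F t x + G t x := by
  obtain ⟨C, hC, hF⟩ := hF
  obtain ⟨D, hD, hG⟩ := hG
  refine ⟨C + D, ENNReal.add_ne_top.mpr ⟨hC, hD⟩, fun t ht => ⟨(hF t ht).1.add (hG t ht).1, ?_⟩⟩
  rw [add_mul]
  exact (eLpNorm_add_le (hF t ht).1 (hG t ht).1 hp).trans (add_le_add (hF t ht).2 (hG t ht).2)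

theorem smul (hF : NormBound p γ F) {c : ℝ → ℂ} {K : ℝ}
    (hc : ∀ t, 1 ≤ t → ‖c t‖ * γ t ≤ K * γ' t) (hγ' : ∀ t, 1 ≤ t → 0 ≤ γ' t) :
    NormBound p γ' fun t x => c t * F t x := by
  obtain ⟨C, hC, hF⟩ := hF
  refine ⟨C * ENNReal.ofReal K, ENNReal.mul_ne_top hC ENNReal.ofReal_ne_top, fun t ht =>
    ⟨(hF t ht).1.const_mul _, ?_⟩⟩
  have h1 : eLpNorm (fun x => c t * F t x) p volume = ‖c t‖ₑ * eLpNorm (F t) p volume :=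
    eLpNorm_const_smul (c t) (F t) p volume
  rw [h1, ← ofReal_norm]
  calc _ ≤ ENNReal.ofReal ‖c t‖ * (C * ENNReal.ofReal (γ t)) := by gcongr; exact (hF t ht).2
    _ = C * ENNReal.ofReal (‖c t‖ * γ t) := by rw [ENNReal.ofReal_mul (norm_nonneg _)]; ring
    _ ≤ C * ENNReal.ofReal (K * γ' t) := mul_le_mul' le_rfl (ENNReal.ofReal_le_ofReal (hc t ht))
    _ = _ := by rw [ENNReal.ofReal_mul' (hγ' t ht)]; ring

theorem smul_bounded (hF : NormBound p γ F) (hγ : ∀ t, 1 ≤ t → 0 ≤ γ t) {c : ℝ → ℂ} {K : ℝ}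
    (hc : ∀ t, 1 ≤ t → ‖c t‖ ≤ K) : NormBound p γ fun t x => c t * F t x :=
  hF.smul (K := K) (fun t ht => mul_le_mul_of_nonneg_right (hc t ht) (hγ t ht)) hγ

theorem const {f : E3 → ℂ} (hf : MemLp f p volume) (hγ : ∀ t, 1 ≤ t → 1 ≤ γ t) :
    NormBound p γ fun _ => f :=
  ⟨eLpNorm f p volume, hf.2.ne, fun t ht => ⟨hf.1, le_mul_of_one_le_right' (by
    simpa using ENNReal.ofReal_le_ofReal (hγ t ht))⟩⟩

theorem sum {ι : Type*} (S : Finset ι) (hp : 1 ≤ p) {F : ι → ℝ → E3 → ℂ}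
    (h : ∀ i ∈ S, NormBound p γ (F i)) : NormBound p γ fun t x => ∑ i ∈ S, F i t x := by
  classical
  induction S using Finset.induction_on with
  | empty => exact ⟨0, by simp, fun t _ => ⟨by simpa using aestronglyMeasurable_const, by simp⟩⟩
  | insert a S ha ih =>
    simp only [Finset.sum_insert ha]
    exact (h a (by simp)).add hp (ih fun i hi => h i (by simp [hi]))

/-- Hölder's inequality with one factor in `L^∞`. -/
theorem mul {γ'' : ℝ → ℝ} (hF : NormBound ⊤ γ F) (hG : NormBound p γ' G)
    (hγ : ∀ t, 1 ≤ t → 0 ≤ γ t) (hle : ∀ t, 1 ≤ t → γ t * γ' t ≤ γ'' t) :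
    NormBound p γ'' fun t x => F t x * G t x := by
  obtain ⟨C, hC, hF⟩ := hF
  obtain ⟨D, hD, hG⟩ := hG
  refine ⟨C * D, ENNReal.mul_ne_top hC hD, fun t ht => ⟨(hF t ht).1.mul (hG t ht).1, ?_⟩⟩
  have h := eLpNorm_le_eLpNorm_top_mul_eLpNorm p (F t) (hG t ht).1 (fun a b => a * b) 1
    (Filter.Eventually.of_forall fun x => by simp)
  refine h.trans ?_
  rw [ENNReal.coe_one, one_mul]
  calc _ ≤ (C * ENNReal.ofReal (γ t)) * (D * ENNReal.ofReal (γ' t)) := by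
        gcongr
        · exact (hF t ht).2
        · exact (hG t ht).2
    _ = C * D * ENNReal.ofReal (γ t * γ' t) := by rw [ENNReal.ofReal_mul (hγ t ht)]; ring
    _ ≤ _ := by gcongr; exact hle t ht

theorem exists_real (h : NormBound p γ F) :
    ∃ C : ℝ, 0 ≤ C ∧ ∀ t, 1 ≤ t → eLpNorm (F t) p volume ≤ ENNReal.ofReal (C * γ t) := by
  obtain ⟨C, hC, h⟩ := h
  refine ⟨C.toReal, ENNReal.toReal_nonneg, fun t ht => (h t ht).2.trans ?_⟩
  rw [ENNReal.ofReal_mul ENNReal.toReal_nonneg, ENNReal.ofReal_toReal hC]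

end NormBound

theorem norm_apply_le_norm_toLp (v : Fin 3 → ℂ) : ‖WithLp.toLp 2 v‖ ≤ ∑ i, ‖v i‖ := by
  rw [EuclideanSpace.norm_eq]
  refine Real.sqrt_le_iff.mpr ⟨Finset.sum_nonneg fun i _ => norm_nonneg _, ?_⟩
  simp only [Fin.sum_univ_three]
  nlinarith [norm_nonneg (v 0), norm_nonneg (v 1), norm_nonneg (v 2),
    mul_nonneg (norm_nonneg (v 0)) (norm_nonneg (v 1)),
    mul_nonneg (norm_nonneg (v 0)) (norm_nonneg (v 2)),
    mul_nonneg (norm_nonneg (v 1)) (norm_nonneg (v 2))]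

theorem eLpNorm_toLp_le {p : ℝ≥0∞} (hp : 1 ≤ p) {G : Fin 3 → E3 → ℂ}
    (hG : ∀ i, AEStronglyMeasurable (G i)) :
    eLpNorm (fun x => WithLp.toLp 2 fun i => G i x) p volume ≤ ∑ i, eLpNorm (G i) p volume := by
  have h1 : eLpNorm (fun x => WithLp.toLp 2 fun i => G i x) p volume ≤
      eLpNorm (∑ i, fun x => ‖G i x‖) p volume :=
    eLpNorm_mono_real fun x => by
      simpa using norm_apply_le_norm_toLp fun i => G i x
  refine h1.trans ((eLpNorm_sum_le (fun i _ => (hG i).norm) hp).trans_eq ?_)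
  simp only [eLpNorm_norm]

/-! ### Amplitudes -/

theorem exists_log_pow_le (k : ℕ) :
    ∃ K : ℝ, 0 ≤ K ∧ ∀ t : ℝ, 1 ≤ t → |Real.log t| ^ k ≤ K * t ^ (1 / 2 : ℝ) := by
  rcases Nat.eq_zero_or_pos k with rfl | hk
  · exact ⟨1, zero_le_one, fun t ht => by
      simpa using Real.one_le_rpow ht (by norm_num)⟩
  have hk' : (0 : ℝ) < k := by exact_mod_cast hk
  refine ⟨(2 * k) ^ k, by positivity, fun t ht => ?_⟩
  have h0 : 0 ≤ Real.log t := Real.log_nonneg ht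
  have h1 := Real.log_le_rpow_div (x := t) (ε := 1 / (2 * k)) (by linarith) (by positivity)
  rw [abs_of_nonneg h0]
  calc Real.log t ^ k ≤ (t ^ (1 / (2 * k) : ℝ) / (1 / (2 * k))) ^ k := by gcongr
    _ = (2 * k) ^ k * t ^ (1 / 2 : ℝ) := by
        rw [div_eq_mul_inv, mul_pow, ← Real.rpow_natCast (t ^ (1 / (2 * k) : ℝ)),
          ← Real.rpow_mul (by linarith)]
        field_simp

theorem inv_mul_abs_log_le {t : ℝ} (ht : 1 ≤ t) : t⁻¹ * |Real.log t| ≤ 1 := by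
  rw [abs_of_nonneg (Real.log_nonneg ht), inv_mul_le_iff₀ (by linarith), mul_one]
  linarith [Real.log_le_sub_one_of_pos (by linarith : 0 < t)]

namespace NormBound

variable {p : ℝ≥0∞} {γ : ℝ → ℝ} {P : E3 → ℝ} {Q : ℝ → E3 → ℂ}

theorem ansatz (hP : ContDiff ℝ 1 P) (hQ : NormBound p γ Q) {γ' : ℝ → ℝ}
    (hγ : ∀ t, 1 ≤ t → t ^ (-deltaExp p) * γ t ≤ γ' t) :
    NormBound p γ' fun t => ansatz P t (Q t) := by
  obtain ⟨C, hC, h⟩ := hQ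
  refine ⟨C, hC, fun t ht => ?_⟩
  have ht0 : 0 < t := by linarith
  refine ⟨AEStronglyMeasurable.ansatz hP (h t ht).1 ht0, ?_⟩
  rw [eLpNorm_ansatz P _ ht0]
  calc _ ≤ ENNReal.ofReal (t ^ (-deltaExp p)) * (C * ENNReal.ofReal (γ t)) := by
        gcongr; exact (h t ht).2
    _ = C * ENNReal.ofReal (t ^ (-deltaExp p) * γ t) := by
        rw [ENNReal.ofReal_mul (by positivity)]; ring
    _ ≤ _ := by gcongr; exact hγ t ht

theorem gradAmp (hp : 1 ≤ p) (hγ : ∀ t, 1 ≤ t → 0 ≤ γ t) {i : Fin 3} {Q' : ℝ → E3 → ℂ}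
    (h1 : NormBound p γ fun t => coordMul i (Q t)) (h2 : NormBound p γ Q')
    (h3 : NormBound p γ fun t y => partialC P i y * Q t y) :
    NormBound p γ fun t => gradAmp P t i (Q t) (Q' t) := by
  have b1 := h1.smul_bounded hγ (c := fun _ => Complex.I) (K := 1) (fun t _ => by simp)
  have b2 := h2.smul_bounded hγ (c := fun t => ((t⁻¹ : ℝ) : ℂ)) (K := 1) (fun t ht => by
    rw [Complex.norm_real, Real.norm_of_nonneg (by positivity)]
    exact inv_le_one_of_one_le₀ ht)
  have b3 := h3.smul_bounded hγ (c := fun t => ((t⁻¹ : ℝ) : ℂ) * -(Complex.I * Real.log t)) (K := 1)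
    (fun t ht => by
      rw [norm_mul, norm_neg, norm_mul, Complex.norm_I, one_mul, Complex.norm_real,
        Complex.norm_real, Real.norm_of_nonneg (by positivity), Real.norm_eq_abs]
      exact inv_mul_abs_log_le ht)
  refine ((b1.add hp b2).add hp b3).congr fun t _ => Filter.Eventually.of_forall fun y => ?_
  simp only [_root_.gradAmp]
  ring

theorem timeAmp (hp : 1 ≤ p) (hγ : ∀ t, 1 ≤ t → 0 ≤ γ t) {Q' : Fin 3 → ℝ → E3 → ℂ}
    (h0 : NormBound p γ Q) (h1 : ∀ j, NormBound p γ fun t => coordMul j (coordMul j (Q t)))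
    (h2 : ∀ j, NormBound p γ fun t => coordMul j (Q' j t))
    (h3 : NormBound p γ fun t y => (P y : ℂ) * Q t y)
    (h4 : NormBound p γ fun t y => eulerC P y * Q t y) :
    NormBound p γ fun t => timeAmp P t (Q t) fun j => Q' j t := by
  have hinv : ∀ t : ℝ, 1 ≤ t → ‖((t⁻¹ : ℝ) : ℂ)‖ ≤ 1 := fun t ht => by
    rw [Complex.norm_real, Real.norm_of_nonneg (by positivity)]
    exact inv_le_one_of_one_le₀ ht
  have b1 := (NormBound.sum Finset.univ hp fun j _ => h1 j).smul_bounded hγ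
    (c := fun _ => -(Complex.I / 2)) (K := ‖-(Complex.I / 2)‖) (fun t _ => le_rfl)
  have b2 := h0.smul_bounded hγ (c := fun t => -(3 / 2 * ((t⁻¹ : ℝ) : ℂ))) (K := 3 / 2)
    (fun t ht => by
      rw [norm_neg, norm_mul]
      have := hinv t ht
      norm_num at this ⊢
      linarith)
  have b3 := h3.smul_bounded hγ (c := fun t => -(Complex.I * ((t⁻¹ : ℝ) : ℂ))) (K := 1)
    (fun t ht => by rw [norm_neg, norm_mul, Complex.norm_I, one_mul]; exact hinv t ht)
  have b4 := (NormBound.sum Finset.univ hp fun j _ => h2 j).smul_bounded hγ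
    (c := fun t => -((t⁻¹ : ℝ) : ℂ)) (K := 1) (fun t ht => by rw [norm_neg]; exact hinv t ht)
  have b5 := h4.smul_bounded hγ (c := fun t => Complex.I * ((t⁻¹ * Real.log t : ℝ) : ℂ)) (K := 1)
    (fun t ht => by
      rw [norm_mul, Complex.norm_I, one_mul, Complex.norm_real, norm_mul,
        Real.norm_of_nonneg (by positivity : 0 ≤ t⁻¹), Real.norm_eq_abs]
      exact inv_mul_abs_log_le ht)
  exact ((((b1.add hp b2).add hp b3).add hp b4).add hp b5)

end NormBound

/-- Bounds on the amplitude in `L²` and `L^∞` give the decay of all `L^r` norms, `2 ≤ r ≤ ∞`. -/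
theorem exists_eLpNorm_ansatz_le {P : E3 → ℝ} {Q : ℝ → E3 → ℂ} (h2 : NormBound 2 (fun _ => 1) Q)
    (h : NormBound ⊤ (fun _ => 1) Q) : ∃ c : ℝ, 0 ≤ c ∧ ∀ t, 1 ≤ t → ∀ r : ℝ≥0∞, 2 ≤ r →
      eLpNorm (ansatz P t (Q t)) r volume ≤ ENNReal.ofReal (c * t ^ (-deltaExp r)) := by
  obtain ⟨C, hC0, hC⟩ := h2.exists_real
  obtain ⟨D, hD0, hD⟩ := h.exists_real
  refine ⟨max C D, le_max_of_le_left hC0, fun t ht r hr => ?_⟩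
  rw [eLpNorm_ansatz P _ (by linarith), mul_comm, ENNReal.ofReal_mul (le_max_of_le_left hC0)]
  gcongr
  refine (eLpNorm_le_max_two_top hr).trans (max_le ((hC t ht).trans ?_) ((hD t ht).trans ?_))
  · rw [mul_one]; gcongr; exact le_max_left _ _
  · rw [mul_one]; gcongr; exact le_max_right _ _

/-! ### The remainder -/

theorem MemHW.zero_fun {s m : ℕ} {f : E3 → ℂ} (h : MemHW s m f) : MemHW s m fun _ => 0 := by
  simpa using h.const_mul 0

/-- A product of an `H^m` function and a function whose moments have bounded derivatives. -/
theorem BddDerivsW.mul_memH {m : ℕ} : ∀ {s : ℕ} {φ f : E3 → ℂ}, BddDerivsW s m φ → MemH m f →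
    MemHW s m fun x => φ x * f x
  | 0, _, _, hφ, hf => MemH.bdd_mul hφ hf
  | s + 1, φ, f, hφ, hf => ⟨hφ.1.mul_memH hf, fun k => by
      refine (congrArg (MemHW _ _) (funext fun x => ?_)).mpr ((hφ.2 k).mul_memH hf)
      simp only [coordMul]; ring⟩

theorem memHW_lapAmp {s m : ℕ} {P : E3 → ℝ} {PP : Fin 3 → E3 → ℂ} {w : E3 → ℂ}
    {w' w'' : Fin 3 → E3 → ℂ} (hP : ∀ j, BddDerivs m (partialC P j)) (hPP : ∀ j, MemH m (PP j))
    (hb : BddDerivsW s m w) (h0 : MemHW s m w) (h1 : ∀ j, MemHW s m (w' j))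
    (h2 : ∀ j, MemHW s m (w'' j)) : ∀ k, MemHW s m (lapAmp P PP w w' w'' k) := by
  intro k
  fin_cases k
  · exact MemHW.sum Finset.univ (fun i _ => h2 i) h0.zero_fun
  · exact MemHW.sum Finset.univ (fun i _ => (hb.mul_memH (hPP i)).add
      (((h1 i).bdd_mul (hP i)).const_mul 2)) h0.zero_fun
  · exact MemHW.sum Finset.univ (fun i _ => (h0.bdd_mul (hP i)).bdd_mul (hP i)) h0.zero_fun

theorem IsTest.fderiv_apply {ψ : E3 → ℝ} (hψ : IsTest ψ) (v : E3) :
    IsTest fun x => fderiv ℝ ψ x v :=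
  ⟨(hψ.1.fderiv_right (m := ∞) (by simp)).clm_apply contDiff_const, hψ.hasCompactSupport_fderiv_apply v⟩

theorem IsTest.laplacian_eq {ψ : E3 → ℝ} (hψ : IsTest ψ) (x : E3) :
    Δ ψ x = ∑ i, fderiv ℝ (fun y => fderiv ℝ ψ y (basisVec i)) x (basisVec i) := by
  rw [InnerProductSpace.laplacian_eq_iteratedFDeriv_orthonormalBasis ψ
    (EuclideanSpace.basisFun (Fin 3) ℝ)]
  refine Finset.sum_congr rfl fun i _ => ?_
  have h := (hψ.1.fderiv_right (m := ∞) (by simp)).differentiable (by simp) x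
  rw [iteratedFDeriv_two_apply, fderiv_clm_apply h (differentiableAt_const _)]
  simp [basisVec]

/-- Two weak derivatives in the direction `i` for every `i` compute `∫ Δψ f`. -/
theorem integral_laplacian_mul {f : E3 → ℂ} {g h : Fin 3 → E3 → ℂ}
    (h1 : ∀ i, HasWeakPartial i f (g i)) (h2 : ∀ i, HasWeakPartial i (g i) (h i)) {ψ : E3 → ℝ}
    (hψ : IsTest ψ) : ∫ x, ((Δ ψ x : ℝ) : ℂ) * f x = ∑ i, ∫ x, (ψ x : ℂ) * h i x := by
  have e : ∀ x, ((Δ ψ x : ℝ) : ℂ) * f x =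
      ∑ i, ((fderiv ℝ (fun y => fderiv ℝ ψ y (basisVec i)) x (basisVec i) : ℝ) : ℂ) * f x :=
    fun x => by rw [hψ.laplacian_eq, Complex.ofReal_sum, Finset.sum_mul]
  simp only [e]
  rw [integral_finsetSum]
  · refine Finset.sum_congr rfl fun i _ => ?_
    rw [(h1 i).eq _ (hψ.fderiv_apply _), (h2 i).eq ψ hψ, neg_neg]
  · intro i _
    exact (h1 i).left.integrable_ofReal_mul_of_hasCompactSupport
      ((hψ.fderiv_apply _).continuous_fderiv_apply _)
      ((hψ.fderiv_apply _).hasCompactSupport_fderiv_apply _)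

/-- The part of the remainder that does not involve `A₀`. -/
def mainRemainder (P : E3 → ℝ) (PP : Fin 3 → E3 → ℂ) (w : E3 → ℂ) (w' w'' : Fin 3 → E3 → ℂ)
    (t : ℝ) : E3 → ℂ := fun x =>
  (((2 * t ^ 2)⁻¹ : ℝ) : ℂ) * ansatz P t (lapSum P PP w w' w'' t) x

/-- The remainder `R₁`. -/
def remainder (PP : Fin 3 → E3 → ℂ) (w : E3 → ℂ) (w' w'' : Fin 3 → E3 → ℂ) (Ap b : L2C)
    (t : ℝ) : E3 → ℂ := fun x =>
  mainRemainder (tildeA1 w) PP w w' w'' t x + -(A0 Ap b t x * uApprox w t x)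

theorem continuous_ansatz {P : E3 → ℝ} (hP : ContDiff ℝ 1 P) (t : ℝ) {Q : E3 → ℂ}
    (hQ : Continuous Q) : Continuous (ansatz P t Q) := by
  rw [ansatz_eq_carrier_mul]
  exact (contDiff_carrier hP t).continuous.mul (hQ.comp (continuous_const_smul _))

theorem locallyIntegrable_A0 (Ap b : L2C) (t : ℝ) : LocallyIntegrable (A0 Ap b t : E3 → ℂ) :=
  memLp_two_locallyIntegrable (Lp.memLp _)

theorem locallyIntegrable_fin_sum {f : Fin 3 → E3 → ℂ} (h : ∀ i, LocallyIntegrable (f i)) :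
    LocallyIntegrable fun x => ∑ i, f i x := by
  simp only [Fin.sum_univ_three]
  exact ((h 0).add (h 1)).add (h 2)

theorem locallyIntegrable_lapSum {m : ℕ} {P : E3 → ℝ} {PP : Fin 3 → E3 → ℂ}
    (hP : PhaseBounds m P PP) {w : E3 → ℂ} (hw : Continuous w) {w' w'' : Fin 3 → E3 → ℂ}
    (h1 : ∀ i, LocallyIntegrable (w' i)) (h2 : ∀ i, LocallyIntegrable (w'' i)) (t : ℝ) :
    LocallyIntegrable (lapSum P PP w w' w'' t) := by
  have hPc : ∀ j, Continuous (partialC P j) := fun j => (hP.grad j).continuous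
  have hPP : ∀ j, LocallyIntegrable (PP j) := fun j => memLp_two_locallyIntegrable (hP.memH j).memLp
  have h : ∀ k, LocallyIntegrable (lapAmp P PP w w' w'' k) := fun k => by
    fin_cases k
    · exact locallyIntegrable_fin_sum h2
    · exact locallyIntegrable_fin_sum fun i => ((hPP i).continuous_mul hw).add
        (((h1 i).continuous_mul (hPc i)).smul (2 : ℂ))
    · exact locallyIntegrable_fin_sum fun i =>
        ((hw.locallyIntegrable.continuous_mul (hPc i))).continuous_mul (hPc i)
  exact locallyIntegrable_fin_sum fun k => (h k).smul ((-(Complex.I * Real.log t)) ^ (k : ℕ))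

/-- The distributional identity that defines `R₁`. The self-similarity of `A₁` turns `A₁ u_a` into
the ansatz with amplitude `t⁻¹ Ã₁ w`, which the phase term cancels. -/
theorem isRemainder_remainder {m : ℕ} {PP : Fin 3 → E3 → ℂ} {w : E3 → ℂ}
    (hP : PhaseBounds m (tildeA1 w) PP) (hw : Continuous w) {w' w'' : Fin 3 → E3 → ℂ}
    (h1 : ∀ i, HasWeakPartial i w (w' i)) (h2 : ∀ i, HasWeakPartial i (w' i) (w'' i))
    (Ap b : L2C) :
    IsRemainder (uApprox w) (AApprox w Ap b) (remainder PP w w' w'' Ap b) := by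
  intro t ht
  have hu : Continuous (uApprox w t) := continuous_ansatz hP.contDiff t hw
  have hPw : Continuous fun y => ((t⁻¹ * tildeA1 w y : ℝ) : ℂ) * w y :=
    (Complex.continuous_ofReal.comp (continuous_const.mul hP.contDiff.continuous)).mul hw
  have hA1 : ∀ x, (A1 w t x : ℂ) * uApprox w t x =
      ansatz (tildeA1 w) t (fun y => ((t⁻¹ * tildeA1 w y : ℝ) : ℂ) * w y) x := fun x => by
    rw [A1_eq w ht]
    simp only [uApprox_eq_ansatz, ansatz_eq_carrier_mul, dilation]
    ring
  have l0 : LocallyIntegrable fun x => A0 Ap b t x * uApprox w t x := by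
    simpa only [mul_comm] using (locallyIntegrable_A0 Ap b t).continuous_mul hu
  have l1 : LocallyIntegrable fun x => (A1 w t x : ℂ) * uApprox w t x := by
    simp only [hA1]
    exact (continuous_ansatz hP.contDiff t hPw).locallyIntegrable
  have lA : LocallyIntegrable fun x => AApprox w Ap b t x * uApprox w t x := by
    simp only [AApprox, add_mul]
    exact l0.add l1
  have lm : LocallyIntegrable (mainRemainder (tildeA1 w) PP w w' w'' t) :=
    LocallyIntegrable.smul (((locallyIntegrable_lapSum hP hw (fun i => (h1 i).right)
      (fun i => (h2 i).right) t)).ansatz hP.contDiff ht) ((((2 * t ^ 2)⁻¹ : ℝ)) : ℂ)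
  refine ⟨hu.locallyIntegrable, lA, lm.add l0.neg, fun ψ hψ => ?_⟩
  have hT := hasTimeDerivAt_ansatz hP.contDiff h1 ht
  refine ⟨_, hT.2.2 ψ hψ, ?_⟩
  have hg1 := fun i => (h1 i).ansatz hP.contDiff ht
  have hg2 := fun i => (hP.hasWeakPartial_gradAmp hw h1 h2 t i).ansatz hP.contDiff ht
  have hL := integral_laplacian_mul hg1 hg2 hψ
  have hI : ∀ {f : E3 → ℂ}, LocallyIntegrable f → Integrable fun x => (ψ x : ℂ) * f x :=
    fun hf => hf.integrable_ofReal_mul_of_hasCompactSupport hψ.1.continuous hψ.2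
  change _ = _ + 1 / 2 * (∫ x, ((Δ ψ x : ℝ) : ℂ) * ansatz (tildeA1 w) t w x) - _
  have i1 := (hI hT.2.1).const_mul Complex.I
  have i2 := (integrable_finsetSum Finset.univ fun i _ => hI (hg2 i).right).const_mul (1 / 2)
  rw [hL, ← integral_finsetSum _ fun i _ => hI (hg2 i).right, ← integral_const_mul,
    ← integral_const_mul, ← integral_add i1 i2]
  refine Eq.trans ?_ (integral_sub (i1.add i2) (hI lA))
  refine integral_congr_ae (Filter.Eventually.of_forall fun x => ?_)
  have key := I_mul_timeAmp_add_half_sum (tildeA1 w) PP w w' w'' ht (t⁻¹ • x)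
  have hA : AApprox w Ap b t x * uApprox w t x = A0 Ap b t x * uApprox w t x +
      ansatz (tildeA1 w) t (fun y => ((t⁻¹ * tildeA1 w y : ℝ) : ℂ) * w y) x := by
    rw [AApprox, add_mul, hA1]
  simp only [hA, remainder, mainRemainder, ansatz_eq_carrier_mul, dilation, ← Finset.mul_sum]
  linear_combination (-(ψ x : ℂ) * carrier (tildeA1 w) t x) * key

/-! ### The estimates without derivatives -/

theorem deltaExp_two : deltaExp 2 = 0 := by norm_num [deltaExp]

theorem deltaExp_top : deltaExp ⊤ = 3 / 2 := by norm_num [deltaExp]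

theorem inv_sq_mul_sqrt {t : ℝ} (ht : 0 < t) :
    (t ^ 2)⁻¹ * t ^ (1 / 2 : ℝ) = t ^ (-(3 / 2) : ℝ) := by
  rw [← Real.rpow_natCast, ← Real.rpow_neg ht.le, ← Real.rpow_add ht]; norm_num

theorem BddDerivs.memLp_top {m : ℕ} {φ : E3 → ℂ} (h : BddDerivs m φ) : MemLp φ ⊤ volume := by
  obtain ⟨C, hC⟩ := h.bound
  exact memLp_top_of_bound h.continuous.aestronglyMeasurable C (Filter.Eventually.of_forall hC)

namespace NormBound

theorem of_le {p : ℝ≥0∞} {γ : ℝ → ℝ} {F : ℝ → E3 → ℂ} {C : ℝ} (hC : 0 ≤ C)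
    (hF : ∀ t, 1 ≤ t → AEStronglyMeasurable (F t))
    (h : ∀ t, 1 ≤ t → eLpNorm (F t) p volume ≤ ENNReal.ofReal (C * γ t)) : NormBound p γ F :=
  ⟨ENNReal.ofReal C, ENNReal.ofReal_ne_top, fun t ht => ⟨hF t ht, by
    rw [← ENNReal.ofReal_mul hC]; exact h t ht⟩⟩

theorem ansatz_two {P : E3 → ℝ} {Q : ℝ → E3 → ℂ} {γ : ℝ → ℝ} (hP : ContDiff ℝ 1 P)
    (h : NormBound 2 γ Q) : NormBound 2 γ fun t => _root_.ansatz P t (Q t) :=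
  h.ansatz hP fun t _ => by simp [deltaExp_two]

theorem ansatz_top {P : E3 → ℝ} {Q : ℝ → E3 → ℂ} (hP : ContDiff ℝ 1 P)
    (h : NormBound ⊤ (fun _ => 1) Q) :
    NormBound ⊤ (fun t => t ^ (-(3 / 2) : ℝ)) fun t => _root_.ansatz P t (Q t) :=
  h.ansatz hP fun t _ => by simp [deltaExp_top]

/-- The factor `t⁻²` absorbs the logarithms. -/
theorem inv_sq_mul_ansatz {P : E3 → ℝ} {Q : ℝ → E3 → ℂ} (hP : ContDiff ℝ 1 P)
    (h : NormBound 2 (fun t => t ^ (1 / 2 : ℝ)) Q) :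
    NormBound 2 (fun t => t ^ (-(3 / 2) : ℝ))
      fun t x => (((2 * t ^ 2)⁻¹ : ℝ) : ℂ) * _root_.ansatz P t (Q t) x := by
  refine (h.ansatz_two hP).smul (K := 1) (fun t ht => ?_) fun t ht => by positivity
  have ht0 : 0 < t := by linarith
  rw [Complex.norm_real, Real.norm_of_nonneg (by positivity), one_mul, ← inv_sq_mul_sqrt ht0]
  gcongr
  nlinarith [sq_nonneg t]

theorem log_pow_mul {p : ℝ≥0∞} {f : E3 → ℂ} (hf : MemLp f p volume) (k : ℕ) :
    NormBound p (fun t => t ^ (1 / 2 : ℝ))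
      fun t x => (-(Complex.I * Real.log t)) ^ k * f x := by
  obtain ⟨K, _, hK⟩ := exists_log_pow_le k
  refine (NormBound.const hf (γ := fun _ => 1) fun _ _ => le_rfl).smul (K := K) (fun t ht => ?_)
    fun t ht => by positivity
  rw [norm_pow, norm_neg, norm_mul, Complex.norm_I, one_mul, Complex.norm_real, Real.norm_eq_abs,
    mul_one]
  exact hK t ht

theorem log_pow_sum {p : ℝ≥0∞} (hp : 1 ≤ p) {f : Fin 3 → E3 → ℂ} (hf : ∀ k, MemLp (f k) p volume) :
    NormBound p (fun t => t ^ (1 / 2 : ℝ))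
      fun t x => ∑ k : Fin 3, (-(Complex.I * Real.log t)) ^ (k : ℕ) * f k x :=
  NormBound.sum Finset.univ hp fun k _ => log_pow_mul (hf k) k

theorem A0_two (Ap b : L2C) : NormBound 2 (fun _ => 1) fun t => (A0 Ap b t : E3 → ℂ) :=
  NormBound.of_le (C := ‖Ap‖ + ‖b‖) (by positivity) (fun t _ => (Lp.memLp _).1) fun t _ => by
    simpa using eLpNorm_A0_le Ap b t

theorem A1_top {m : ℕ} {w : E3 → ℂ} {PP : Fin 3 → E3 → ℂ} (hP : PhaseBounds m (tildeA1 w) PP) :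
    NormBound ⊤ (fun t => t ^ (-1 : ℝ)) fun t x => (A1 w t x : ℂ) := by
  obtain ⟨C, hC⟩ := hP.bdd
  have hC0 : 0 ≤ C := (abs_nonneg _).trans (hC 0)
  have e : ∀ t : ℝ, 1 ≤ t → (fun x => (A1 w t x : ℂ)) =
      fun x => ((t⁻¹ * tildeA1 w (t⁻¹ • x) : ℝ) : ℂ) := fun t ht => funext fun x => by
    rw [A1_eq w (by linarith)]
  refine NormBound.of_le hC0 (fun t ht => ?_) fun t ht => ?_
  · rw [e t ht]
    exact (Complex.continuous_ofReal.comp (continuous_const.mul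
      (hP.contDiff.continuous.comp (continuous_const_smul _)))).aestronglyMeasurable
  · rw [e t ht, eLpNorm_exponent_top]
    refine eLpNormEssSup_le_of_ae_bound (Filter.Eventually.of_forall fun x => ?_)
    rw [Complex.norm_real, norm_mul, Real.norm_of_nonneg (by positivity), Real.rpow_neg_one,
      mul_comm]
    gcongr
    exact hC _

end NormBound

/-- A bound `C t⁻¹` of the sup norm, in the form of the free wave estimates. -/
theorem normBound_top_of_inv {B : ℝ → L2C} {C : ℝ} (hC : 0 ≤ C)
    (h : ∀ t, 0 < t → eLpNorm (B t) ⊤ volume ≤ ENNReal.ofReal (C * t⁻¹)) :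
    NormBound ⊤ (fun t => t ^ (-1 : ℝ)) fun t => (B t : E3 → ℂ) :=
  NormBound.of_le hC (fun t _ => (Lp.memLp _).1) fun t ht => by
    simpa only [Real.rpow_neg_one] using h t (by linarith)

/-- The bounds on `w` and the phase that give the estimates of `u_a`, `A_a` and `R₁`. -/
structure ProfileBounds (m : ℕ) (PP : Fin 3 → E3 → ℂ) (w : E3 → ℂ) (w' w'' : Fin 3 → E3 → ℂ) :
    Prop where
  phase : PhaseBounds m (tildeA1 w) PP
  bdd : BddDerivs m w
  hasWeakPartial : ∀ i, HasWeakPartial i w (w' i)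
  hasWeakPartial' : ∀ i, HasWeakPartial i (w' i) (w'' i)
  memLp : MemLp w 2 volume
  memLp' : ∀ i, MemLp (w' i) 2 volume
  memH_lapAmp : ∀ k, MemH m (lapAmp (tildeA1 w) PP w w' w'' k)

namespace ProfileBounds

variable {m : ℕ} {PP : Fin 3 → E3 → ℂ} {w : E3 → ℂ} {w' w'' : Fin 3 → E3 → ℂ} {Ap b : L2C}

theorem isRemainder (H : ProfileBounds m PP w w' w'') (Ap b : L2C) :
    IsRemainder (uApprox w) (AApprox w Ap b) (remainder PP w w' w'' Ap b) :=
  isRemainder_remainder H.phase H.bdd.continuous H.hasWeakPartial H.hasWeakPartial' Ap b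

theorem normBound_uApprox (H : ProfileBounds m PP w w' w'') :
    NormBound ⊤ (fun t => t ^ (-(3 / 2) : ℝ)) (uApprox w) :=
  (NormBound.const H.bdd.memLp_top fun _ _ => le_rfl).ansatz_top H.phase.contDiff

theorem normBound_mul_uApprox (H : ProfileBounds m PP w w' w'') {B : ℝ → E3 → ℂ}
    (hB : NormBound 2 (fun _ => 1) B) :
    NormBound 2 (fun t => t ^ (-(3 / 2) : ℝ)) fun t x => B t x * uApprox w t x :=
  (H.normBound_uApprox.mul hB (fun t ht => by positivity) fun t _ => by simp).congr
    fun t _ => Filter.Eventually.of_forall fun x => mul_comm _ _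

theorem basicEstimates (H : ProfileBounds m PP w w' w'') {C : ℝ} (hC : 0 ≤ C)
    (hA : ∀ t, 0 < t → eLpNorm (A0 Ap b t) ⊤ volume ≤ ENNReal.ofReal (C * t⁻¹)) :
    BasicEstimates w (uApprox w) (AApprox w Ap b) (remainder PP w w' w'' Ap b) := by
  refine ⟨fun r hr => ⟨⟨H.bdd.continuous.aestronglyMeasurable, ?_⟩, fun t ht => ?_⟩, ?_, ?_⟩
  · exact (eLpNorm_le_max_two_top hr).trans_lt (max_lt H.memLp.2 H.bdd.memLp_top.2)
  · exact (eLpNorm_ansatz (tildeA1 w) w (by linarith)).le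
  · obtain ⟨a, _, ha⟩ := ((normBound_top_of_inv hC hA).add le_top
      (NormBound.A1_top H.phase)).exists_real
    exact ⟨a, ha⟩
  · have h1 : NormBound 2 (fun t => t ^ (-(3 / 2) : ℝ)) (mainRemainder (tildeA1 w) PP w w' w'') :=
      (NormBound.log_pow_sum one_le_two fun k => (H.memH_lapAmp k).memLp).inv_sq_mul_ansatz
        H.phase.contDiff
    have h2 := (H.normBound_mul_uApprox (NormBound.A0_two Ap b)).smul_bounded
      (fun t ht => by positivity) (c := fun _ => -1) (K := 1) (fun t _ => by simp)
    obtain ⟨a, _, ha⟩ := (h1.add one_le_two h2).exists_real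
    refine ⟨a, fun t ht => ?_⟩
    have e : remainder PP w w' w'' Ap b t = fun x => mainRemainder (tildeA1 w) PP w w' w'' t x +
        -1 * (A0 Ap b t x * uApprox w t x) := funext fun x => by rw [remainder, neg_one_mul]
    rw [e]
    exact ha t ht

end ProfileBounds

/-! ### The estimates of the gradients -/

/-- The gradient of a family of functions with bounded weak partial derivatives. -/
theorem exists_hasWeakGradient_le {p : ℝ≥0∞} (hp : 1 ≤ p) {γ : ℝ → ℝ} (hγ : ∀ t, 1 ≤ t → 0 ≤ γ t)
    {F : ℝ → E3 → ℂ} {G : Fin 3 → ℝ → E3 → ℂ} (hG : ∀ i, NormBound p γ (G i))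
    (hFG : ∀ i t, 1 ≤ t → HasWeakPartial i (F t) (G i t)) :
    ∃ c : ℝ, ∀ t : ℝ, 1 ≤ t → ∃ V, HasWeakGradient (F t) V ∧
      eLpNorm V p volume ≤ ENNReal.ofReal (c * γ t) := by
  choose C hC0 hC using fun i => (hG i).exists_real
  refine ⟨∑ i, C i, fun t ht => ⟨_, hasWeakGradient_of_hasWeakPartial fun i => hFG i t ht, ?_⟩⟩
  refine (eLpNorm_toLp_le hp fun i => (hFG i t ht).right.aestronglyMeasurable).trans ?_
  rw [Finset.sum_mul, ENNReal.ofReal_sum_of_nonneg fun i _ => mul_nonneg (hC0 i) (hγ t ht)]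
  exact Finset.sum_le_sum fun i _ => hC i t ht

theorem hasWeakPartial_ofReal {P : E3 → ℝ} (hP : ContDiff ℝ 1 P) (i : Fin 3) :
    HasWeakPartial i (fun x => (P x : ℂ)) (partialC P i) := by
  have h1 : ContDiff ℝ 1 fun x => (P x : ℂ) := Complex.ofRealCLM.contDiff.comp hP
  refine (HasWeakPartial.of_contDiff h1).congr (ae_eq_refl _)
    (Filter.Eventually.of_forall fun x => ?_)
  have := (Complex.ofRealCLM.hasFDerivAt (x := P x)).comp x
    (hP.differentiable one_ne_zero x).hasFDerivAt
  have e : fderiv ℝ (fun x => (P x : ℂ)) x = _ := this.fderiv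
  simp only [e]
  rfl

theorem hasWeakPartial_A1 {w : E3 → ℂ} (hP : ContDiff ℝ 1 (tildeA1 w)) {t : ℝ} (ht : 0 < t)
    (i : Fin 3) : HasWeakPartial i (fun x => (A1 w t x : ℂ))
      fun x => (((t ^ 2)⁻¹ : ℝ) : ℂ) * partialC (tildeA1 w) i (t⁻¹ • x) := by
  refine (((hasWeakPartial_ofReal hP i).comp_smul ht).const_mul ((t⁻¹ : ℝ) : ℂ)).congr
    (Filter.Eventually.of_forall fun x => ?_) (Filter.Eventually.of_forall fun x => ?_)
  · simp only [A1_eq w ht, dilation]; push_cast; rfl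
  · simp only [dilation]; push_cast; ring

theorem normBound_partial_A1 {m : ℕ} {w : E3 → ℂ} {PP : Fin 3 → E3 → ℂ}
    (hP : PhaseBounds m (tildeA1 w) PP) (i : Fin 3) :
    NormBound ⊤ (fun t => t ^ (-1 : ℝ))
      fun t x => (((t ^ 2)⁻¹ : ℝ) : ℂ) * partialC (tildeA1 w) i (t⁻¹ • x) := by
  have hb := hP.grad i
  obtain ⟨C, hC⟩ := hb.bound
  have h : NormBound ⊤ (fun _ => 1) fun t x => partialC (tildeA1 w) i (t⁻¹ • x) :=
    NormBound.of_le ((norm_nonneg _).trans (hC 0)) (fun t _ =>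
      (hb.continuous.comp (continuous_const_smul _)).aestronglyMeasurable) fun t _ => by
      rw [eLpNorm_exponent_top, mul_one]
      exact eLpNormEssSup_le_of_ae_bound (Filter.Eventually.of_forall fun x => hC _)
  refine h.smul (K := 1) (fun t ht => ?_) fun t ht => by positivity
  rw [Complex.norm_real, Real.norm_of_nonneg (by positivity), Real.rpow_neg_one, one_mul, mul_one]
  exact inv_anti₀ (by linarith) (by nlinarith)

theorem HasWeakPartial.lapSum {P : E3 → ℝ} {PP : Fin 3 → E3 → ℂ} {w : E3 → ℂ}
    {w' w'' : Fin 3 → E3 → ℂ} {i : Fin 3} {L : Fin 3 → E3 → ℂ}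
    (h : ∀ k, HasWeakPartial i (lapAmp P PP w w' w'' k) (L k)) (t : ℝ) :
    HasWeakPartial i (lapSum P PP w w' w'' t)
      fun y => ∑ k : Fin 3, (-(Complex.I * Real.log t)) ^ (k : ℕ) * L k y :=
  HasWeakPartial.sum Finset.univ fun k _ => (h k).const_mul _

/-- The part of the bounds that the gradient estimates use beyond `ProfileBounds 1`: one more power
of `x`. -/
structure WeightedProfileBounds (PP : Fin 3 → E3 → ℂ) (w : E3 → ℂ) (w' w'' : Fin 3 → E3 → ℂ) :
    Prop extends ProfileBounds 1 PP w w' w'' where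
  memLp_top_coordMul : ∀ i, MemLp (coordMul i w) ⊤ volume
  memLp_two_coordMul : ∀ i, MemLp (coordMul i w) 2 volume
  memLp_coordMul_lapAmp : ∀ i k, MemLp (coordMul i (lapAmp (tildeA1 w) PP w w' w'' k)) 2 volume

namespace WeightedProfileBounds

variable {PP : Fin 3 → E3 → ℂ} {w : E3 → ℂ} {w' w'' : Fin 3 → E3 → ℂ} {Ap b : L2C}

theorem memLp_top' (H : WeightedProfileBounds PP w w' w'') (i : Fin 3) :
    MemLp (w' i) ⊤ volume :=
  (H.bdd.2.2 i).memLp_top.ae_eq ((HasWeakPartial.of_contDiff H.bdd.1).unique (H.hasWeakPartial i))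

theorem normBound_gradAmp_two (H : WeightedProfileBounds PP w w' w'') (i : Fin 3) :
    NormBound 2 (fun _ => 1) fun t => gradAmp (tildeA1 w) t i w (w' i) :=
  NormBound.gradAmp one_le_two (fun _ _ => zero_le_one)
    (NormBound.const (H.memLp_two_coordMul i) fun _ _ => le_rfl)
    (NormBound.const (H.memLp' i) fun _ _ => le_rfl)
    (NormBound.const (MemH.bdd_mul (m := 0) (H.phase.grad i).of_succ H.memLp) fun _ _ => le_rfl)

theorem normBound_gradAmp_top (H : WeightedProfileBounds PP w w' w'') (i : Fin 3) :
    NormBound ⊤ (fun _ => 1) fun t => gradAmp (tildeA1 w) t i w (w' i) :=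
  NormBound.gradAmp le_top (fun _ _ => zero_le_one)
    (NormBound.const (H.memLp_top_coordMul i) fun _ _ => le_rfl)
    (NormBound.const (H.memLp_top' i) fun _ _ => le_rfl)
    (NormBound.const ((H.phase.grad i).mul H.bdd).memLp_top fun _ _ => le_rfl)

theorem contDiff_uApprox (H : WeightedProfileBounds PP w w' w'') (t : ℝ) :
    ContDiff ℝ 1 (uApprox w t) := by
  change ContDiff ℝ 1 (ansatz (tildeA1 w) t w)
  rw [ansatz_eq_carrier_mul]
  exact (contDiff_carrier H.phase.contDiff t).mul (H.bdd.1.comp (contDiff_const_smul _))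

theorem fderiv_uApprox_ae (H : WeightedProfileBounds PP w w' w'') (i : Fin 3) {t : ℝ}
    (ht : 0 < t) : (fun x => fderiv ℝ (uApprox w t) x (basisVec i)) =ᵐ[volume]
      ansatz (tildeA1 w) t (gradAmp (tildeA1 w) t i w (w' i)) :=
  (HasWeakPartial.of_contDiff (H.contDiff_uApprox t)).unique
    ((H.hasWeakPartial i).ansatz H.phase.contDiff ht)

theorem coordMul_lapSum (P : E3 → ℝ) (i : Fin 3) (t : ℝ) : coordMul i (lapSum P PP w w' w'' t) =
    fun y => ∑ k : Fin 3, (-(Complex.I * Real.log t)) ^ (k : ℕ) *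
      coordMul i (lapAmp P PP w w' w'' k) y := by
  ext y
  simp only [coordMul, lapSum, Finset.mul_sum, mul_left_comm]

theorem mul_lapSum (P : E3 → ℝ) (φ : E3 → ℂ) (t : ℝ) :
    (fun y => φ y * lapSum P PP w w' w'' t y) =
    fun y => ∑ k : Fin 3, (-(Complex.I * Real.log t)) ^ (k : ℕ) *
      (φ y * lapAmp P PP w w' w'' k y) := by
  ext y
  simp only [lapSum, Finset.mul_sum, mul_left_comm]

theorem exists_partial_mainRemainder (H : WeightedProfileBounds PP w w' w'') (i : Fin 3) :
    ∃ G, NormBound 2 (fun t => t ^ (-(3 / 2) : ℝ)) G ∧ ∀ t, 0 < t →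
      HasWeakPartial i (mainRemainder (tildeA1 w) PP w w' w'' t) (G t) := by
  choose L hL hL2 using fun k => (H.memH_lapAmp k).2 i
  refine ⟨_, NormBound.inv_sq_mul_ansatz H.phase.contDiff (NormBound.gradAmp one_le_two
    (fun t ht => by positivity) (Q := lapSum (tildeA1 w) PP w w' w'')
    (Q' := fun t y => ∑ k : Fin 3, (-(Complex.I * Real.log t)) ^ (k : ℕ) * L k y) ?_ ?_ ?_), fun t ht => (((HasWeakPartial.lapSum hL t).ansatz
      H.phase.contDiff ht).const_mul _)⟩
  · simp only [coordMul_lapSum]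
    exact NormBound.log_pow_sum one_le_two fun k => H.memLp_coordMul_lapAmp i k
  · exact NormBound.log_pow_sum one_le_two fun k => hL2 k
  · exact (NormBound.log_pow_sum one_le_two fun k => MemH.bdd_mul (m := 0)
      (H.phase.grad i).of_succ (H.memH_lapAmp k).memLp).congr fun t _ =>
        Filter.Eventually.of_forall fun y =>
          (congrFun (mul_lapSum (tildeA1 w) (partialC (tildeA1 w) i) t) y).symm

/-- `∂_i (A₀ u_a)`, from the product rule with the `C¹` factor `u_a`. -/
theorem exists_partial_A0_mul (H : WeightedProfileBounds PP w w' w'') (i : Fin 3) {B : ℝ → L2C}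
    {C : ℝ} (hC : 0 ≤ C) (hB : ∀ t, HasWeakPartial i (A0 Ap b t) (B t))
    (hB2 : ∀ t, eLpNorm (B t) 2 volume ≤ ENNReal.ofReal C) :
    ∃ G, NormBound 2 (fun t => t ^ (-(3 / 2) : ℝ)) G ∧ ∀ t, 0 < t →
      HasWeakPartial i (fun x => A0 Ap b t x * uApprox w t x) (G t) := by
  have hBn : NormBound 2 (fun _ => 1) fun t => (B t : E3 → ℂ) :=
    NormBound.of_le hC (fun t _ => (Lp.memLp _).1) fun t _ => by simpa using hB2 t
  have h2 : NormBound 2 (fun t => t ^ (-(3 / 2) : ℝ)) fun t x =>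
      ansatz (tildeA1 w) t (gradAmp (tildeA1 w) t i w (w' i)) x * A0 Ap b t x :=
    ((H.normBound_gradAmp_top i).ansatz_top H.phase.contDiff).mul (NormBound.A0_two Ap b)
      (fun t ht => by positivity) fun t _ => by simp
  refine ⟨_, (H.normBound_mul_uApprox hBn).add one_le_two h2, fun t ht => ?_⟩
  refine ((hB t).contDiff_mul (H.contDiff_uApprox t)).congr
    (Filter.Eventually.of_forall fun x => mul_comm _ _) ?_
  filter_upwards [H.fderiv_uApprox_ae i ht] with x hx
  rw [hx]; ring

theorem gradientEstimates (H : WeightedProfileBounds PP w w' w'') {Adot : 𝓢'(E3, ℂ)}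
    (hA : WaveDataCondition 1 Ap Adot b) (hω : IsOmegaInv Adot b) :
    GradientEstimates (uApprox w) (AApprox w Ap b) (remainder PP w w' w'' Ap b) := by
  choose B C hC0 hB using fun i => hA.exists_A0_partial hω i
  refine ⟨?_, ?_, ?_⟩
  · choose c hc0 hc using fun i =>
      exists_eLpNorm_ansatz_le (P := tildeA1 w) (H.normBound_gradAmp_two i)
        (H.normBound_gradAmp_top i)
    have hW := fun i t (ht : 0 < t) => (H.hasWeakPartial i).ansatz H.phase.contDiff ht
    refine ⟨∑ i, c i, fun t ht => ?_⟩
    have ht0 : 0 < t := by linarith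
    refine ⟨_, hasWeakGradient_of_hasWeakPartial fun i => hW i t ht0, fun r hr => ?_⟩
    refine (eLpNorm_toLp_le (one_le_two.trans hr) fun i =>
      (hW i t ht0).right.aestronglyMeasurable).trans ?_
    rw [Finset.sum_mul, ENNReal.ofReal_sum_of_nonneg fun i _ => mul_nonneg (hc0 i) (by positivity)]
    exact Finset.sum_le_sum fun i _ => hc i t ht r hr
  · refine exists_hasWeakGradient_le le_top (fun t ht => by positivity)
      (G := fun i t x => B i t x + (((t ^ 2)⁻¹ : ℝ) : ℂ) * partialC (tildeA1 w) i (t⁻¹ • x))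
      (fun i => ?_) fun i t ht => ?_
    · exact (normBound_top_of_inv (hC0 i) fun t ht => (hB i t).2.2 ht).add le_top
        (normBound_partial_A1 H.phase i)
    · exact (hB i t).1.add (hasWeakPartial_A1 H.phase.contDiff (by linarith) i)
  · choose G1 hG1 hG1' using fun i => H.exists_partial_mainRemainder i
    choose G2 hG2 hG2' using fun i =>
      H.exists_partial_A0_mul i (hC0 i) (fun t => (hB i t).1) fun t => (hB i t).2.1
    refine exists_hasWeakGradient_le one_le_two (fun t ht => by positivity)
      (G := fun i t x => G1 i t x + -1 * G2 i t x) (fun i => ?_) fun i t ht => ?_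
    · exact (hG1 i).add one_le_two ((hG2 i).smul_bounded (fun t ht => by positivity)
        (c := fun _ => -1) (K := 1) fun t _ => by simp)
    · refine ((hG1' i t (by linarith)).add ((hG2' i t (by linarith)).const_mul (-1))).congr
        (Filter.Eventually.of_forall fun x => ?_) (ae_eq_refl _)
      simp only [remainder, neg_one_mul]

end WeightedProfileBounds

/-! ### Time derivatives in the sense of distributions -/

namespace HasTimeDerivAt

variable {f f₁ f₂ : ℝ → E3 → ℂ} {g g₁ g₂ : E3 → ℂ} {t : ℝ}

theorem add (h₁ : HasTimeDerivAt f₁ g₁ t) (h₂ : HasTimeDerivAt f₂ g₂ t) :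
    HasTimeDerivAt (fun s x => f₁ s x + f₂ s x) (fun x => g₁ x + g₂ x) t := by
  refine ⟨?_, h₁.2.1.add h₂.2.1, fun ψ hψ => ?_⟩
  · filter_upwards [h₁.1, h₂.1] with s hs₁ hs₂ using hs₁.add hs₂
  have hI : ∀ {f : E3 → ℂ}, LocallyIntegrable f → Integrable fun x => (ψ x : ℂ) * f x :=
    fun hf => hf.integrable_ofReal_mul_of_hasCompactSupport hψ.1.continuous hψ.2
  have e : ∫ x, (ψ x : ℂ) * (g₁ x + g₂ x) = (∫ x, (ψ x : ℂ) * g₁ x) + ∫ x, (ψ x : ℂ) * g₂ x := by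
    simp only [mul_add]
    exact integral_add (hI h₁.2.1) (hI h₂.2.1)
  rw [e]
  refine ((h₁.2.2 ψ hψ).add (h₂.2.2 ψ hψ)).congr_of_eventuallyEq ?_
  filter_upwards [h₁.1, h₂.1] with s hs₁ hs₂
  simp only [mul_add]
  exact integral_add (hI hs₁) (hI hs₂)

theorem smul (h : HasTimeDerivAt f g t) {c : ℝ → ℂ} {c' : ℂ} (hc : HasDerivAt c c' t) :
    HasTimeDerivAt (fun s x => c s * f s x) (fun x => c' * f t x + c t * g x) t := by
  have hft := h.1.self_of_nhds
  refine ⟨?_, (hft.smul c').add (h.2.1.smul (c t)), fun ψ hψ => ?_⟩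
  · filter_upwards [h.1] with s hs using hs.smul (c s)
  have hI : ∀ {f : E3 → ℂ}, LocallyIntegrable f → Integrable fun x => (ψ x : ℂ) * f x :=
    fun hf => hf.integrable_ofReal_mul_of_hasCompactSupport hψ.1.continuous hψ.2
  have hm : ∀ (c : ℂ) (f : E3 → ℂ), ∫ x, (ψ x : ℂ) * (c * f x) = c * ∫ x, (ψ x : ℂ) * f x :=
    fun c f => by rw [← integral_const_mul]; simp only [mul_left_comm]
  have e : ∫ x, (ψ x : ℂ) * (c' * f t x + c t * g x) =
      c' * (∫ x, (ψ x : ℂ) * f t x) + c t * ∫ x, (ψ x : ℂ) * g x := by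
    rw [← hm, ← hm]
    simp only [mul_add]
    exact integral_add (hI (hft.smul c')) (hI (h.2.1.smul (c t)))
  rw [e]
  simp only [hm]
  exact hc.mul (h.2.2 ψ hψ)

theorem congr {f' : ℝ → E3 → ℂ} {g' : E3 → ℂ} (h : HasTimeDerivAt f g t)
    (hf : ∀ᶠ s in 𝓝 t, f s =ᵐ[volume] f' s) (hg : g =ᵐ[volume] g') : HasTimeDerivAt f' g' t := by
  have hi : ∀ (ψ : E3 → ℝ) {f f' : E3 → ℂ}, f =ᵐ[volume] f' →
      ∫ x, (ψ x : ℂ) * f x = ∫ x, (ψ x : ℂ) * f' x := fun ψ f f' h =>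
    integral_congr_ae (h.mono fun x hx => by simp only [hx])
  refine ⟨?_, (locallyIntegrable_congr hg).mp h.2.1, fun ψ hψ => ?_⟩
  · filter_upwards [h.1, hf] with s hs hs' using (locallyIntegrable_congr hs').mp hs
  · rw [← hi ψ hg]
    refine (h.2.2 ψ hψ).congr_of_eventuallyEq ?_
    filter_upwards [hf] with s hs using (hi ψ hs).symm

theorem finset_sum {ι : Type*} (S : Finset ι) {f : ι → ℝ → E3 → ℂ} {g : ι → E3 → ℂ}
    (h : ∀ i ∈ S, HasTimeDerivAt (f i) (g i) t) :
    HasTimeDerivAt (fun s x => ∑ i ∈ S, f i s x) (fun x => ∑ i ∈ S, g i x) t := by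
  classical
  induction S using Finset.induction_on with
  | empty =>
    simp only [Finset.sum_empty]
    refine ⟨Filter.Eventually.of_forall fun s => locallyIntegrable_const _,
      locallyIntegrable_const _, fun ψ _ => ?_⟩
    simpa using hasDerivAt_const t (0 : ℂ)
  | insert a S ha ih =>
    simp only [Finset.sum_insert ha]
    exact (h a (by simp)).add (ih fun i hi => h i (by simp [hi]))

end HasTimeDerivAt

/-- `f` is continuously differentiable in time, for positive times, with derivative `f'`. -/
structure HasContDerivs (f f' : ℝ → E3 → ℂ) : Prop where
  hasDerivAt : ∀ s, 0 < s → ∀ x, HasDerivAt (fun s => f s x) (f' s x) s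
  continuousOn : ContinuousOn (fun p : ℝ × E3 => f p.1 p.2) (Set.Ioi 0 ×ˢ Set.univ)
  continuousOn' : ContinuousOn (fun p : ℝ × E3 => f' p.1 p.2) (Set.Ioi 0 ×ˢ Set.univ)

theorem continuous_slice {f : ℝ → E3 → ℂ}
    (h : ContinuousOn (fun p : ℝ × E3 => f p.1 p.2) (Set.Ioi 0 ×ˢ Set.univ)) {s : ℝ} (hs : 0 < s) :
    Continuous (f s) :=
  continuousOn_univ.mp (h.comp (f := fun y : E3 => (s, y)) (s := Set.univ) (by fun_prop)
    fun _ _ => ⟨hs, trivial⟩)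

namespace HasContDerivs

variable {f f' : ℝ → E3 → ℂ}

theorem hasDerivAt_integral (h : HasContDerivs f f') {Q : E3 → ℂ} (hQ : LocallyIntegrable Q)
    {ψ : E3 → ℝ} (hψ : IsTest ψ) {t : ℝ} (ht : 0 < t) :
    HasDerivAt (fun s => ∫ x, ((ψ x : ℂ) * f s x) * Q x) (∫ x, ((ψ x : ℂ) * f' t x) * Q x) t := by
  obtain ⟨ρ, hρ⟩ := hψ.exists_radius
  have hpos : ∀ s ∈ Set.Icc (t - t / 2) (t + t / 2), 0 < s := fun s hs => by linarith [hs.1]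
  have hψc : Continuous fun x => (ψ x : ℂ) := Complex.continuous_ofReal.comp hψ.1.continuous
  refine hasDerivAt_integral_kernel_mul (k := fun s x => (ψ x : ℂ) * f s x)
    (k' := fun s x => (ψ x : ℂ) * f' s x) hQ (ε := t / 2) (ρ := ρ) (by linarith)
    (fun s hs y => (h.hasDerivAt s (hpos s hs) y).const_mul _)
    (fun s hs => hψc.mul (continuous_slice h.continuousOn (hpos s hs)))
    ((hψc.comp continuous_snd).continuousOn.mul
      (h.continuousOn'.mono (Set.prod_mono_left fun s hs => hpos s hs)))
    (fun s _ y hy => by simp [(hρ y hy).1]) (fun s _ y hy => by simp [(hρ y hy).1])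

theorem hasTimeDerivAt (h : HasContDerivs f f') {t : ℝ} (ht : 0 < t) :
    HasTimeDerivAt f (f' t) t := by
  refine ⟨?_, (continuous_slice h.continuousOn' ht).locallyIntegrable, fun ψ hψ => ?_⟩
  · filter_upwards [lt_mem_nhds ht] with s hs
    exact (continuous_slice h.continuousOn hs).locallyIntegrable
  · simpa using h.hasDerivAt_integral (Q := fun _ => 1) (locallyIntegrable_const _) hψ ht

end HasContDerivs

theorem norm_integral_mul_Lp_le {K : E3 → ℂ} (hK : MemLp K 2 volume) (q : L2C) :
    ‖∫ x, K x * q x‖ ≤ (eLpNorm K 2 volume).toReal * ‖q‖ := by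
  have hc : MemLp (fun x => (starRingEnd ℂ) (K x)) 2 volume := hK.star
  have e : ∫ x, K x * q x = inner ℂ (hc.toLp _) q := by
    rw [L2.inner_def]
    refine integral_congr_ae ?_
    filter_upwards [hc.coeFn_toLp] with x hx
    rw [hx, RCLike.inner_apply, Complex.conj_conj, mul_comm]
  rw [e]
  refine (norm_inner_le_norm _ _).trans_eq ?_
  rw [Lp.norm_toLp]
  congr 2
  exact eLpNorm_congr_norm_ae (Filter.Eventually.of_forall fun x => by simp)

/-- Product rule for a curve that is differentiable in `L²` and a factor that is `C¹` in time. -/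
theorem HasContDerivs.hasTimeDerivAt_mul {f f' : ℝ → E3 → ℂ} (h : HasContDerivs f f')
    {A : ℝ → L2C} {B : L2C} {t : ℝ} (ht : 0 < t) (hA : HasDerivAt A B t) :
    HasTimeDerivAt (fun s x => A s x * f s x) (fun x => B x * f t x + A t x * f' t x) t := by
  have hl : ∀ q : L2C, LocallyIntegrable (q : E3 → ℂ) := fun q =>
    memLp_two_locallyIntegrable (Lp.memLp q)
  have hm : ∀ (q : L2C) {F : E3 → ℂ}, Continuous F → LocallyIntegrable fun x => q x * F x :=
    fun q F hF => by simpa only [mul_comm] using (hl q).continuous_mul hF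
  have hfc : ∀ s, 0 < s → Continuous (f s) := fun s hs => continuous_slice h.continuousOn hs
  have hf'c := continuous_slice h.continuousOn' ht
  refine ⟨?_, (hm B (hfc t ht)).add (hm (A t) hf'c), fun ψ hψ => ?_⟩
  · filter_upwards [lt_mem_nhds ht] with s hs using hm (A s) (hfc s hs)
  obtain ⟨ρ, hρ⟩ := hψ.exists_radius
  have hψc : Continuous fun x => (ψ x : ℂ) := Complex.continuous_ofReal.comp hψ.1.continuous
  set K : ℝ → E3 → ℂ := fun s x => (ψ x : ℂ) * f s x with hKdef
  have hnhds : Set.Icc (t - t / 2) (t + t / 2) ∈ 𝓝 t := Icc_mem_nhds (by linarith) (by linarith)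
  have hpos : ∀ s ∈ Set.Icc (t - t / 2) (t + t / 2), 0 < s := fun s hs => by linarith [hs.1]
  obtain ⟨C, hC⟩ := (isCompact_Icc.prod (isCompact_closedBall (0 : E3) ρ)).exists_bound_of_continuousOn
    (((hψc.comp continuous_snd).continuousOn.mul h.continuousOn).mono
      fun p hp => ⟨hpos p.1 hp.1, trivial⟩)
  have hbd : MemLp ((Metric.closedBall (0 : E3) ρ).indicator fun _ => C) 2 volume :=
    memLp_indicator_const 2 Metric.isClosed_closedBall.measurableSet C
      (Or.inr (measure_closedBall_lt_top).ne)
  have hKle : ∀ s ∈ Set.Icc (t - t / 2) (t + t / 2), ∀ x,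
      ‖K s x‖ ≤ (Metric.closedBall (0 : E3) ρ).indicator (fun _ => C) x := fun s hs x => by
    by_cases hx : ‖x‖ ≤ ρ
    · rw [Set.indicator_of_mem (by simpa using hx)]
      exact hC (s, x) ⟨hs, by simpa using hx⟩
    · rw [Set.indicator_of_notMem (by simpa using hx), hKdef]
      simp [(hρ x (not_le.mp hx)).1]
  have hKm : ∀ s ∈ Set.Icc (t - t / 2) (t + t / 2), MemLp (K s) 2 volume := fun s hs =>
    hbd.mono' (hψc.mul (hfc s (hpos s hs))).aestronglyMeasurable
      (Filter.Eventually.of_forall (hKle s hs))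
  set M := (eLpNorm ((Metric.closedBall (0 : E3) ρ).indicator fun _ => C) 2 volume).toReal with hM
  have hbound : ∀ s ∈ Set.Icc (t - t / 2) (t + t / 2), ∀ q : L2C,
      ‖∫ x, K s x * q x‖ ≤ M * ‖q‖ := fun s hs q => by
    refine (norm_integral_mul_Lp_le (hKm s hs) q).trans ?_
    gcongr
    refine ENNReal.toReal_mono hbd.2.ne (eLpNorm_mono_real (hKle s hs))
  have hint : ∀ s ∈ Set.Icc (t - t / 2) (t + t / 2), ∀ q : L2C,
      Integrable fun x => K s x * q x := fun s hs q => (hKm s hs).integrable_mul (Lp.memLp q)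
  have htm : t ∈ Set.Icc (t - t / 2) (t + t / 2) := mem_of_mem_nhds hnhds
  -- the error of the linear approximation of `A` is negligible
  have hr : HasDerivAt (fun s => ∫ x, K s x * (A s - A t - (s - t) • B : L2C) x) 0 t := by
    rw [hasDerivAt_iff_isLittleO] at hA ⊢
    have h1 : (fun s => ∫ x, K s x * (A s - A t - (s - t) • B : L2C) x) =O[𝓝 t]
        fun s => A s - A t - (s - t) • B := by
      refine Asymptotics.IsBigO.of_bound M ?_
      filter_upwards [hnhds] with s hs using hbound s hs _
    have h2 : ∫ x, K t x * (A t - A t - (t - t) • B : L2C) x = 0 := by simp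
    simp only [h2, sub_zero, smul_zero]
    exact h1.trans_isLittleO hA
  have h1 := h.hasDerivAt_integral (hl (A t)) hψ ht
  have h2 := h.hasDerivAt_integral (hl B) hψ ht
  have h3 : HasDerivAt (fun s : ℝ => ((s - t : ℝ) : ℂ)) 1 t := by
    simpa using ((hasDerivAt_id t).sub_const t).ofReal_comp
  have h4 := (h1.add (h3.mul h2)).add hr
  have e : ∫ x, (ψ x : ℂ) * (B x * f t x + A t x * f' t x) =
      (∫ x, ((ψ x : ℂ) * f' t x) * A t x) + ∫ x, K t x * B x := by
    have i1 : Integrable fun x => ((ψ x : ℂ) * f' t x) * A t x := by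
      have := (hm (A t) hf'c).integrable_ofReal_mul_of_hasCompactSupport hψ.1.continuous hψ.2
      exact this.congr (Filter.Eventually.of_forall fun x => by simp only; ring)
    rw [← integral_add i1 (hint t htm B)]
    exact integral_congr_ae (Filter.Eventually.of_forall fun x => by simp only [hKdef]; ring)
  rw [e]
  refine (h4.congr_deriv (by simp [hKdef])).congr_of_eventuallyEq ?_
  filter_upwards [hnhds] with s hs
  have e2 : ∀ᵐ x, (ψ x : ℂ) * (A s x * f s x) = K s x * A t x +
      ((s - t : ℝ) : ℂ) * (K s x * B x) + K s x * (A s - A t - (s - t) • B : L2C) x := by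
    filter_upwards [Lp.coeFn_sub (A s - A t) ((s - t) • B), Lp.coeFn_sub (A s) (A t),
      Lp.coeFn_smul (s - t) B] with x hx1 hx2 hx3
    rw [hx1, Pi.sub_apply, hx2, hx3, Pi.sub_apply, Pi.smul_apply, Complex.real_smul]
    simp only [hKdef]
    ring
  have i1 : Integrable fun x => K s x * A t x + ((s - t : ℝ) : ℂ) * (K s x * B x) :=
    (hint s hs _).add ((hint s hs _).const_mul _)
  rw [integral_congr_ae e2, integral_add i1 (hint s hs _),
    integral_add (hint s hs _) ((hint s hs _).const_mul _), integral_const_mul]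
  rfl

/-! ### The estimates of the time derivatives -/

theorem hasDerivAt_comp_inv_smul {V : Type*} [NormedAddCommGroup V] [NormedSpace ℝ V] {F : E3 → V}
    (hF : Differentiable ℝ F) {s : ℝ} (hs : 0 < s) (x : E3) :
    HasDerivAt (fun s : ℝ => F (s⁻¹ • x)) (-(s⁻¹ • fderiv ℝ F (s⁻¹ • x) (s⁻¹ • x))) s := by
  have h := ((hF (s⁻¹ • x)).hasFDerivAt).comp_hasDerivAt s ((hasDerivAt_inv hs.ne').smul_const x)
  refine h.congr_deriv ?_
  have e : -(s ^ 2)⁻¹ • x = -(s⁻¹ • (s⁻¹ • x)) := by rw [smul_smul, ← neg_smul]; congr 1; ring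
  rw [e, map_neg, map_smul]

theorem hasDerivAt_carrier {P : E3 → ℝ} (hP : ContDiff ℝ 1 P) {s : ℝ} (hs : 0 < s) (x : E3) :
    HasDerivAt (fun s => carrier P s x) (carrier P s x *
      (-(Complex.I / 2) * ((‖s⁻¹ • x‖ ^ 2 : ℝ) : ℂ) - 3 / 2 * (s⁻¹ : ℝ) -
        Complex.I * (s⁻¹ : ℝ) * P (s⁻¹ • x) +
        Complex.I * ((s⁻¹ * Real.log s : ℝ) : ℂ) * eulerC P (s⁻¹ • x))) s := by
  have hs' : (s : ℂ) ≠ 0 := by exact_mod_cast hs.ne'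
  have h1 : HasDerivAt (fun s : ℝ => Complex.I * ((‖x‖ ^ 2 / (2 * s) : ℝ) : ℂ))
      (-(Complex.I / 2) * ((‖s⁻¹ • x‖ ^ 2 : ℝ) : ℂ)) s := by
    have h := (((hasDerivAt_inv hs.ne').const_mul (‖x‖ ^ 2 / 2)).ofReal_comp).const_mul Complex.I
    have e : (fun s : ℝ => Complex.I * ((‖x‖ ^ 2 / (2 * s) : ℝ) : ℂ)) =
        fun s : ℝ => Complex.I * ((‖x‖ ^ 2 / 2 * s⁻¹ : ℝ) : ℂ) := by
      ext s; congr 2; rw [div_mul_eq_div_div, div_eq_mul_inv _ s]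
    rw [e]
    refine h.congr_deriv ?_
    rw [norm_smul, mul_pow, norm_inv, Real.norm_of_nonneg hs.le]
    push_cast
    field_simp
  have h2 : HasDerivAt (fun s : ℝ => -(Complex.I * ((Real.log s * P (s⁻¹ • x) : ℝ) : ℂ)))
      (-(Complex.I * (s⁻¹ : ℝ) * P (s⁻¹ • x)) +
        Complex.I * ((s⁻¹ * Real.log s : ℝ) : ℂ) * eulerC P (s⁻¹ • x)) s := by
    have h := ((((Real.hasDerivAt_log hs.ne').mul
      (hasDerivAt_comp_inv_smul (hP.differentiable one_ne_zero) hs x)).ofReal_comp).const_mul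
        Complex.I).neg
    refine h.congr_deriv ?_
    simp only [eulerC, smul_eq_mul]
    push_cast
    ring
  have h3 := h1.cexp.mul ((hasDerivAt_I_mul_cpow hs).mul h2.cexp)
  refine h3.congr_deriv ?_
  rw [carrier]
  simp only [Pi.mul_apply]
  ring

theorem continuousOn_carrier {P : E3 → ℝ} (hP : Continuous P) :
    ContinuousOn (fun p : ℝ × E3 => carrier P p.1 p.2) (Set.Ioi 0 ×ˢ Set.univ) := by
  have hinv : ContinuousOn (fun p : ℝ × E3 => (p.1, p.1⁻¹ • p.2)) (Set.Ioi 0 ×ˢ Set.univ) :=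
    continuousOn_fst.prodMk
      ((ContinuousOn.inv₀ continuousOn_fst fun p hp => (ne_of_gt hp.1)).smul continuousOn_snd)
  refine ((continuousOn_scaledCarrier hP).comp hinv fun _ hp => ⟨hp.1, trivial⟩).congr
    fun p hp => ?_
  have := carrier_smul P hp.1 (p.1⁻¹ • p.2)
  rwa [smul_inv_smul₀ (ne_of_gt hp.1)] at this

theorem continuousOn_comp_inv_smul {V : Type*} [TopologicalSpace V] {F : E3 → V}
    (hF : Continuous F) :
    ContinuousOn (fun p : ℝ × E3 => F (p.1⁻¹ • p.2)) (Set.Ioi 0 ×ˢ Set.univ) :=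
  hF.comp_continuousOn
    ((ContinuousOn.inv₀ continuousOn_fst fun _ hp => (ne_of_gt hp.1)).smul continuousOn_snd)

theorem HasContDerivs.continuous_deriv {f f' : ℝ → E3 → ℂ} (h : HasContDerivs f f') {s : ℝ}
    (hs : 0 < s) : Continuous (f' s) := continuous_slice h.continuousOn' hs

/-- For a `C¹` amplitude the time derivative of the ansatz is a classical one. -/
theorem hasContDerivs_ansatz {P : E3 → ℝ} (hP : ContDiff ℝ 1 P) {Q : E3 → ℂ} (hQ : ContDiff ℝ 1 Q) :
    HasContDerivs (fun s => ansatz P s Q)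
      (fun s => ansatz P s (timeAmp P s Q fun j y => fderiv ℝ Q y (basisVec j))) := by
  have hE : Continuous (eulerC P) := Complex.continuous_ofReal.comp
    ((hP.continuous_fderiv one_ne_zero).clm_apply continuous_id)
  have hPc : Continuous fun y => (P y : ℂ) := Complex.continuous_ofReal.comp hP.continuous
  have hQc := hQ.continuous
  have hQd : ∀ j, Continuous fun y => fderiv ℝ Q y (basisVec j) := fun j =>
    (hQ.continuous_fderiv one_ne_zero).clm_apply continuous_const
  refine ⟨fun s hs x => ?_, ?_, ?_⟩
  · simp only [ansatz_eq_carrier_mul, dilation]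
    refine ((hasDerivAt_carrier hP hs x).mul
      (hasDerivAt_comp_inv_smul (hQ.differentiable one_ne_zero) hs x)).congr_deriv ?_
    set y := s⁻¹ • x with hy
    have h1 : fderiv ℝ Q y y = ∑ j, (y j : ℂ) * fderiv ℝ Q y (basisVec j) :=
      (congrArg _ (eq_sum_basisVec y)).trans
        (by simp only [map_sum, map_smul, Complex.real_smul])
    have h2 : ‖y‖ ^ 2 = y 0 ^ 2 + y 1 ^ 2 + y 2 ^ 2 := by
      rw [EuclideanSpace.norm_sq_eq, Fin.sum_univ_three]; simp
    rw [h1, h2, Complex.real_smul]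
    simp only [timeAmp, coordMul, Fin.sum_univ_three]
    push_cast
    ring
  · simp only [ansatz_eq_carrier_mul, dilation]
    exact (continuousOn_carrier hP.continuous).mul (continuousOn_comp_inv_smul hQc)
  · simp only [ansatz_eq_carrier_mul, dilation, timeAmp]
    refine (continuousOn_carrier hP.continuous).mul ?_
    have hinv : ContinuousOn (fun p : ℝ × E3 => ((p.1⁻¹ : ℝ) : ℂ)) (Set.Ioi 0 ×ˢ Set.univ) :=
      Complex.continuous_ofReal.comp_continuousOn
        (ContinuousOn.inv₀ continuousOn_fst fun p hp => (ne_of_gt hp.1))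
    have hlog : ContinuousOn (fun p : ℝ × E3 => ((p.1⁻¹ * Real.log p.1 : ℝ) : ℂ))
        (Set.Ioi 0 ×ˢ Set.univ) :=
      Complex.continuous_ofReal.comp_continuousOn
        ((ContinuousOn.inv₀ continuousOn_fst fun p hp => (ne_of_gt hp.1)).mul
          (ContinuousOn.log continuousOn_fst fun p hp => (ne_of_gt hp.1)))
    have hc : ∀ (k : Fin 3) {f : E3 → ℂ}, Continuous f → Continuous (coordMul k f) :=
      fun k f hf => (contDiff_coord k).continuous.mul hf
    have c1 := continuousOn_comp_inv_smul
      (continuous_finsetSum Finset.univ fun j _ => hc j (hc j hQc))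
    have c2 := continuousOn_comp_inv_smul hQc
    have c3 := continuousOn_comp_inv_smul (hPc.mul hQc)
    have c4 := continuousOn_comp_inv_smul
      (continuous_finsetSum Finset.univ fun j _ => hc j (hQd j))
    have c5 := continuousOn_comp_inv_smul (hE.mul hQc)
    exact ((((continuousOn_const.mul c1).add ((continuousOn_const.mul hinv).neg.mul c2)).add
      ((continuousOn_const.mul hinv).neg.mul c3)).add (hinv.neg.mul c4)).add
      ((continuousOn_const.mul hlog).mul c5)

theorem hasContDerivs_inv_mul_dilation {P : E3 → ℝ} (hP : ContDiff ℝ 1 P) :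
    HasContDerivs (fun s x => ((s⁻¹ * P (s⁻¹ • x) : ℝ) : ℂ))
      (fun s x => ((-(s ^ 2)⁻¹ * (P (s⁻¹ • x) + fderiv ℝ P (s⁻¹ • x) (s⁻¹ • x)) : ℝ) : ℂ)) := by
  have hinv : ContinuousOn (fun p : ℝ × E3 => p.1⁻¹) (Set.Ioi 0 ×ˢ Set.univ) :=
    ContinuousOn.inv₀ continuousOn_fst fun p hp => (ne_of_gt hp.1)
  have hE : Continuous fun y => P y + fderiv ℝ P y y := hP.continuous.add
    ((hP.continuous_fderiv one_ne_zero).clm_apply continuous_id)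
  refine ⟨fun s hs x => ?_, ?_, ?_⟩
  · refine HasDerivAt.ofReal_comp (((hasDerivAt_inv hs.ne').mul
      (hasDerivAt_comp_inv_smul (hP.differentiable one_ne_zero) hs x)).congr_deriv ?_)
    rw [smul_eq_mul]
    ring
  · exact Complex.continuous_ofReal.comp_continuousOn
      (hinv.mul (continuousOn_comp_inv_smul hP.continuous))
  · refine Complex.continuous_ofReal.comp_continuousOn
      (ContinuousOn.mul ?_ (continuousOn_comp_inv_smul hE))
    exact (ContinuousOn.inv₀ (by fun_prop) fun p hp => (pow_pos hp.1 2).ne').neg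

/-- The time derivative of a curve that is differentiable in `L²`. -/
theorem hasTimeDerivAt_of_hasDerivAt {A : ℝ → L2C} {B : L2C} {t : ℝ} (ht : 0 < t)
    (hA : HasDerivAt A B t) : HasTimeDerivAt (fun s => (A s : E3 → ℂ)) B t := by
  have h : HasContDerivs (fun _ _ => (1 : ℂ)) fun _ _ => 0 :=
    ⟨fun s _ _ => hasDerivAt_const s 1, continuousOn_const, continuousOn_const⟩
  simpa using h.hasTimeDerivAt_mul ht hA

/-- The part of the bounds that the estimates of the time derivatives use beyond
`WeightedProfileBounds`: two powers of `x`. -/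
structure TimeProfileBounds (PP : Fin 3 → E3 → ℂ) (w : E3 → ℂ) (w' w'' : Fin 3 → E3 → ℂ) :
    Prop extends WeightedProfileBounds PP w w' w'' where
  memLp_two_coordMul_coordMul : ∀ i, MemLp (coordMul i (coordMul i w)) 2 volume
  memLp_top_coordMul_coordMul : ∀ i, MemLp (coordMul i (coordMul i w)) ⊤ volume
  memLp_two_coordMul' : ∀ i, MemLp (coordMul i (w' i)) 2 volume
  bddDerivs_coordMul : ∀ i, BddDerivs 1 (coordMul i w)
  memHW_one_lapAmp : ∀ k, MemHW 1 1 (lapAmp (tildeA1 w) PP w w' w'' k)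
  memHW_two_lapAmp : ∀ k, MemHW 2 0 (lapAmp (tildeA1 w) PP w w' w'' k)

namespace TimeProfileBounds

variable {PP : Fin 3 → E3 → ℂ} {w : E3 → ℂ} {w' w'' : Fin 3 → E3 → ℂ} {Ap b : L2C}

theorem memLp_top_coordMul' (H : TimeProfileBounds PP w w' w'') (i : Fin 3) :
    MemLp (coordMul i (w' i)) ⊤ volume := by
  have h1 := (HasWeakPartial.of_contDiff (H.bddDerivs_coordMul i).1).unique
    ((H.hasWeakPartial i).coordMul i)
  refine (((H.bddDerivs_coordMul i).2.2 i).memLp_top.sub H.bdd.memLp_top).ae_eq ?_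
  filter_upwards [h1] with x hx
  rw [Pi.sub_apply, hx]
  simp

theorem bddDerivs_phase (H : TimeProfileBounds PP w w' w'') :
    BddDerivs 0 fun y => (tildeA1 w y : ℂ) := by
  obtain ⟨C, hC⟩ := H.phase.bdd
  exact ⟨Complex.continuous_ofReal.comp H.phase.contDiff.continuous, C, fun x => by
    rw [Complex.norm_real]; exact hC x⟩

theorem bddDerivs_eulerC (H : TimeProfileBounds PP w w' w'') :
    BddDerivs 0 (eulerC (tildeA1 w)) := by
  obtain ⟨C, hC⟩ := H.phase.euler
  exact ⟨Complex.continuous_ofReal.comp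
    ((H.phase.contDiff.continuous_fderiv one_ne_zero).clm_apply continuous_id), C, fun x => by
    rw [eulerC, Complex.norm_real]; exact hC x⟩

theorem normBound_timeAmp_two (H : TimeProfileBounds PP w w' w'') {Q : E3 → ℂ}
    {Q' : Fin 3 → E3 → ℂ} (h0 : MemLp Q 2 volume)
    (h1 : ∀ j, MemLp (coordMul j (coordMul j Q)) 2 volume)
    (h2 : ∀ j, MemLp (coordMul j (Q' j)) 2 volume) :
    NormBound 2 (fun _ => 1) fun t => timeAmp (tildeA1 w) t Q Q' := by
  refine NormBound.timeAmp (Q := fun _ => Q) (Q' := fun j _ => Q' j) one_le_two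
    (fun _ _ => zero_le_one) (NormBound.const h0 fun _ _ => le_rfl)
    (fun j => NormBound.const (h1 j) fun _ _ => le_rfl)
    (fun j => NormBound.const (h2 j) fun _ _ => le_rfl)
    (NormBound.const (MemH.bdd_mul (m := 0) H.bddDerivs_phase h0) fun _ _ => le_rfl)
    (NormBound.const (MemH.bdd_mul (m := 0) H.bddDerivs_eulerC h0) fun _ _ => le_rfl)

theorem normBound_timeAmp_top (H : TimeProfileBounds PP w w' w'') :
    NormBound ⊤ (fun _ => 1) fun t => timeAmp (tildeA1 w) t w w' := by
  have hw := H.bdd.of_succ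
  exact NormBound.timeAmp (Q := fun _ => w) (Q' := fun j _ => w' j) le_top
    (fun _ _ => zero_le_one) (NormBound.const hw.memLp_top fun _ _ => le_rfl)
    (fun j => NormBound.const (H.memLp_top_coordMul_coordMul j) fun _ _ => le_rfl)
    (fun j => NormBound.const (H.memLp_top_coordMul' j) fun _ _ => le_rfl)
    (NormBound.const (H.bddDerivs_phase.mul hw).memLp_top fun _ _ => le_rfl)
    (NormBound.const (H.bddDerivs_eulerC.mul hw).memLp_top fun _ _ => le_rfl)

theorem timeDeriv_uApprox (H : TimeProfileBounds PP w w' w'') : ∃ c : ℝ, ∀ t : ℝ, 1 ≤ t →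
    ∃ g, HasTimeDerivAt (uApprox w) g t ∧ ∀ r : ℝ≥0∞, 2 ≤ r →
      eLpNorm g r volume ≤ ENNReal.ofReal (c * t ^ (-deltaExp r)) := by
  obtain ⟨c, _, hc⟩ := exists_eLpNorm_ansatz_le (P := tildeA1 w)
    (H.normBound_timeAmp_two H.memLp H.memLp_two_coordMul_coordMul H.memLp_two_coordMul')
    H.normBound_timeAmp_top
  exact ⟨c, fun t ht => ⟨_, hasTimeDerivAt_ansatz H.phase.contDiff H.hasWeakPartial (by linarith),
    hc t ht⟩⟩

theorem timeDeriv_AApprox (H : TimeProfileBounds PP w w' w'') {B : ℝ → L2C} {C : ℝ} (hC : 0 ≤ C)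
    (hB : ∀ t, HasDerivAt (A0 Ap b) (B t) t)
    (hB' : ∀ t, 0 < t → eLpNorm (B t) ⊤ volume ≤ ENNReal.ofReal (C * t⁻¹)) :
    ∃ a : ℝ, ∀ t : ℝ, 1 ≤ t → ∃ g, HasTimeDerivAt (AApprox w Ap b) g t ∧
      eLpNorm g ⊤ volume ≤ ENNReal.ofReal (a * t ^ (-1 : ℝ)) := by
  obtain ⟨K, hK⟩ := H.phase.bdd
  obtain ⟨D, hD⟩ := H.phase.euler
  have hPD := hasContDerivs_inv_mul_dilation H.phase.contDiff
  have hKD : 0 ≤ K + D := add_nonneg ((abs_nonneg _).trans (hK 0)) ((abs_nonneg _).trans (hD 0))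
  have hb : NormBound ⊤ (fun t => t ^ (-1 : ℝ)) fun s x => ((-(s ^ 2)⁻¹ * (tildeA1 w (s⁻¹ • x) +
      fderiv ℝ (tildeA1 w) (s⁻¹ • x) (s⁻¹ • x)) : ℝ) : ℂ) := by
    refine NormBound.of_le hKD (fun t ht => ?_) fun t ht => ?_
    · exact (hPD.continuous_deriv (by linarith : 0 < t)).aestronglyMeasurable
    rw [eLpNorm_exponent_top]
    refine eLpNormEssSup_le_of_ae_bound (Filter.Eventually.of_forall fun x => ?_)
    rw [Complex.norm_real, norm_mul, norm_neg, Real.norm_of_nonneg (by positivity),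
      Real.rpow_neg_one, mul_comm]
    refine mul_le_mul ((abs_add_le _ _).trans (add_le_add (hK _) (hD _)))
      (inv_anti₀ (by linarith) (by nlinarith)) (by positivity) hKD
  obtain ⟨a, _, ha⟩ := ((normBound_top_of_inv hC hB').add le_top hb).exists_real
  refine ⟨a, fun t ht => ⟨_, ?_, ha t ht⟩⟩
  have ht0 : 0 < t := by linarith
  refine ((hasTimeDerivAt_of_hasDerivAt ht0 (hB t)).add (hPD.hasTimeDerivAt ht0)).congr ?_
    (ae_eq_refl _)
  filter_upwards [lt_mem_nhds ht0] with s hs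
  exact Filter.Eventually.of_forall fun x => by simp only [AApprox, A1_eq w hs]

end TimeProfileBounds

/-! ### The time derivative of the remainder -/

/-- The coefficient `(2 t²)⁻¹ (-i ln t)^k` of the main part of the remainder. -/
def remCoeff (k : ℕ) (t : ℝ) : ℂ := (((2 * t ^ 2)⁻¹ : ℝ) : ℂ) * (-(Complex.I * Real.log t)) ^ k

/-- The derivative of `remCoeff k`. -/
def remCoeffDeriv (k : ℕ) (t : ℝ) : ℂ :=
  -(((t ^ 3)⁻¹ : ℝ) : ℂ) * (-(Complex.I * Real.log t)) ^ k +
    (((2 * t ^ 2)⁻¹ : ℝ) : ℂ) *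
      (k * (-(Complex.I * Real.log t)) ^ (k - 1) * -(Complex.I * ((t⁻¹ : ℝ) : ℂ)))

theorem hasDerivAt_remCoeff (k : ℕ) {t : ℝ} (ht : 0 < t) :
    HasDerivAt (remCoeff k) (remCoeffDeriv k t) t := by
  have h1 : HasDerivAt (fun t : ℝ => (2 * t ^ 2)⁻¹) (-(t ^ 3)⁻¹) t := by
    refine (((hasDerivAt_pow 2 t).const_mul 2).inv (by positivity)).congr_deriv ?_
    simp only [Nat.cast_ofNat, Nat.add_one_sub_one, pow_one]
    field_simp
  have h2 : HasDerivAt (fun t : ℝ => -(Complex.I * (Real.log t : ℂ)))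
      (-(Complex.I * ((t⁻¹ : ℝ) : ℂ))) t :=
    (((Real.hasDerivAt_log ht.ne').ofReal_comp).const_mul Complex.I).neg
  refine (h1.ofReal_comp.mul (h2.pow k)).congr_deriv ?_
  rw [remCoeffDeriv, Complex.ofReal_neg]
  rfl

theorem norm_neg_I_mul_log_pow (t : ℝ) (k : ℕ) :
    ‖(-(Complex.I * (Real.log t : ℂ))) ^ k‖ = |Real.log t| ^ k := by
  rw [norm_pow, norm_neg, norm_mul, Complex.norm_I, one_mul, Complex.norm_real, Real.norm_eq_abs]

theorem exists_norm_remCoeff_le (k : ℕ) :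
    ∃ K : ℝ, ∀ t : ℝ, 1 ≤ t → ‖remCoeff k t‖ * 1 ≤ K * t ^ (-(3 / 2) : ℝ) := by
  obtain ⟨K, _, hK⟩ := exists_log_pow_le k
  refine ⟨K, fun t ht => ?_⟩
  rw [mul_one, remCoeff, norm_mul, norm_neg_I_mul_log_pow, Complex.norm_real,
    Real.norm_of_nonneg (by positivity), ← inv_sq_mul_sqrt (by linarith), mul_left_comm]
  exact mul_le_mul (inv_anti₀ (by positivity) (by nlinarith [sq_nonneg t])) (hK t ht)
    (by positivity) (by positivity)

theorem exists_norm_remCoeffDeriv_le (k : ℕ) :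
    ∃ K : ℝ, ∀ t : ℝ, 1 ≤ t → ‖remCoeffDeriv k t‖ * 1 ≤ K * t ^ (-(3 / 2) : ℝ) := by
  obtain ⟨K, _, hK⟩ := exists_log_pow_le k
  obtain ⟨L, _, hL⟩ := exists_log_pow_le (k - 1)
  refine ⟨K + k * L, fun t ht => ?_⟩
  have ht0 : 0 < t := by linarith
  rw [mul_one, remCoeffDeriv, ← inv_sq_mul_sqrt ht0]
  refine (norm_add_le _ _).trans ?_
  simp only [norm_mul, norm_neg, norm_neg_I_mul_log_pow, Complex.norm_real, Complex.norm_I,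
    Complex.norm_natCast, one_mul]
  rw [Real.norm_of_nonneg (by positivity : 0 ≤ (t ^ 3)⁻¹),
    Real.norm_of_nonneg (by positivity : 0 ≤ (2 * t ^ 2)⁻¹),
    Real.norm_of_nonneg (by positivity : 0 ≤ t⁻¹)]
  have h1 : (t ^ 3)⁻¹ ≤ (t ^ 2)⁻¹ :=
    inv_anti₀ (by positivity) (pow_le_pow_right₀ ht (by norm_num))
  have h2 : (2 * t ^ 2)⁻¹ ≤ (t ^ 2)⁻¹ := inv_anti₀ (by positivity) (by nlinarith [sq_nonneg t])
  have h3 : t⁻¹ ≤ 1 := inv_le_one_of_one_le₀ ht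
  calc _ ≤ (t ^ 2)⁻¹ * (K * t ^ (1 / 2 : ℝ)) +
        (t ^ 2)⁻¹ * (k * (L * t ^ (1 / 2 : ℝ)) * 1) := by
        gcongr
        · exact hK t ht
        · exact hL t ht
    _ = _ := by ring

namespace TimeProfileBounds

variable {PP : Fin 3 → E3 → ℂ} {w : E3 → ℂ} {w' w'' : Fin 3 → E3 → ℂ} {Ap b : L2C}

theorem mainRemainder_eq_sum (P : E3 → ℝ) (t : ℝ) (x : E3) :
    mainRemainder P PP w w' w'' t x =
      ∑ k : Fin 3, remCoeff k t * ansatz P t (lapAmp P PP w w' w'' k) x := by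
  simp only [mainRemainder, ansatz_eq_carrier_mul, dilation, lapSum, Finset.mul_sum, remCoeff]
  refine Finset.sum_congr rfl fun k _ => ?_
  ring

theorem exists_timeDeriv_mainRemainder (H : TimeProfileBounds PP w w' w'') :
    ∃ G, NormBound 2 (fun t => t ^ (-(3 / 2) : ℝ)) G ∧ ∀ t, 0 < t →
      HasTimeDerivAt (mainRemainder (tildeA1 w) PP w w' w'') (G t) t := by
  choose L hL _ using fun k => (H.memH_lapAmp k).2
  have hL2 : ∀ k j, MemLp (coordMul j (L k j)) 2 volume := fun k j =>
    ((H.memHW_one_lapAmp k).partial_mem (hL k j)).2 j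
  refine ⟨fun t x => ∑ k : Fin 3, (remCoeffDeriv k t *
    ansatz (tildeA1 w) t (lapAmp (tildeA1 w) PP w w' w'' k) x + remCoeff k t *
      ansatz (tildeA1 w) t (timeAmp (tildeA1 w) t (lapAmp (tildeA1 w) PP w w' w'' k) (L k)) x),
    ?_, fun t ht => ?_⟩
  · refine NormBound.sum Finset.univ one_le_two fun k _ => ?_
    obtain ⟨K, hK⟩ := exists_norm_remCoeff_le k
    obtain ⟨K', hK'⟩ := exists_norm_remCoeffDeriv_le k
    have h1 := (NormBound.const (γ := fun _ => 1) (H.memH_lapAmp k).memLp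
      fun _ _ => le_rfl).ansatz_two H.phase.contDiff
    have h2 := (H.normBound_timeAmp_two (H.memH_lapAmp k).memLp
      (fun j => ((H.memHW_two_lapAmp k).2 j).2 j) (hL2 k)).ansatz_two H.phase.contDiff
    exact (h1.smul hK' fun t ht => by positivity).add one_le_two
      (h2.smul hK fun t ht => by positivity)
  · refine (HasTimeDerivAt.finset_sum Finset.univ fun k _ =>
      (hasTimeDerivAt_ansatz H.phase.contDiff (hL k) ht).smul (hasDerivAt_remCoeff k ht)).congr
        (Filter.Eventually.of_forall fun s => Filter.Eventually.of_forall fun x => ?_)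
        (ae_eq_refl _)
    exact (mainRemainder_eq_sum _ _ _).symm

theorem timeDeriv_remainder (H : TimeProfileBounds PP w w' w'') {B : ℝ → L2C} {C : ℝ} (hC : 0 ≤ C)
    (hB : ∀ t, HasDerivAt (A0 Ap b) (B t) t)
    (hB2 : ∀ t, eLpNorm (B t) 2 volume ≤ ENNReal.ofReal C) :
    ∃ a : ℝ, ∀ t : ℝ, 1 ≤ t → ∃ g, HasTimeDerivAt (remainder PP w w' w'' Ap b) g t ∧
      eLpNorm g 2 volume ≤ ENNReal.ofReal (a * t ^ (-(3 / 2) : ℝ)) := by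
  obtain ⟨G, hG, hG'⟩ := H.exists_timeDeriv_mainRemainder
  have hu := hasContDerivs_ansatz H.phase.contDiff H.bdd.1
  have hBn : NormBound 2 (fun _ => 1) fun t => (B t : E3 → ℂ) :=
    NormBound.of_le hC (fun t _ => (Lp.memLp _).1) fun t _ => by simpa using hB2 t
  have hn1 := H.normBound_mul_uApprox hBn
  -- the classical and the weak derivative of `u_a` agree almost everywhere
  have hae : ∀ t, 0 < t → ansatz (tildeA1 w) t (timeAmp (tildeA1 w) t w w') =ᵐ[volume]
      ansatz (tildeA1 w) t (timeAmp (tildeA1 w) t w fun j y => fderiv ℝ w y (basisVec j)) :=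
    fun t ht => by
      have h1 : ∀ᵐ y, ∀ j, w' j y = fderiv ℝ w y (basisVec j) := ae_all_iff.mpr fun j =>
        (H.hasWeakPartial j).unique (HasWeakPartial.of_contDiff H.bdd.1)
      filter_upwards [ae_comp_smul h1 (inv_pos.mpr ht).ne'] with x hx
      simp only [ansatz_eq_carrier_mul, dilation, timeAmp, coordMul, hx]
  have hn2 : NormBound 2 (fun t => t ^ (-(3 / 2) : ℝ)) fun t x =>
      A0 Ap b t x * ansatz (tildeA1 w) t (timeAmp (tildeA1 w) t w
        fun j y => fderiv ℝ w y (basisVec j)) x :=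
    ((H.normBound_timeAmp_top.ansatz_top H.phase.contDiff).mul (NormBound.A0_two Ap b)
      (γ'' := fun t => t ^ (-(3 / 2) : ℝ)) (fun t ht => by positivity) fun t _ => by simp).congr
      fun t ht => (hae t (by linarith)).mono fun x hx => by simp only [hx, mul_comm]
  obtain ⟨a, _, ha⟩ := (hG.add one_le_two ((hn1.add one_le_two hn2).smul_bounded
    (fun t ht => by positivity) (c := fun _ => -1) (K := 1) fun t _ => by simp)).exists_real
  refine ⟨a, fun t ht => ⟨_, ?_, ha t ht⟩⟩
  have ht0 : 0 < t := by linarith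
  have hprod := (hu.hasTimeDerivAt_mul ht0 (hB t)).smul (c := fun _ => -1) (hasDerivAt_const t _)
  refine ((hG' t ht0).add hprod).congr (Filter.Eventually.of_forall fun s =>
    Filter.Eventually.of_forall fun x => ?_) (Filter.Eventually.of_forall fun x => ?_)
  · simp only [remainder, neg_one_mul, uApprox_eq_ansatz]
  · simp only [uApprox_eq_ansatz]; ring

theorem timeDerivEstimates (H : TimeProfileBounds PP w w' w'') {Adot : 𝓢'(E3, ℂ)}
    (hA : WaveDataCondition 1 Ap Adot b) (hω : IsOmegaInv Adot b) :
    TimeDerivEstimates (uApprox w) (AApprox w Ap b) (remainder PP w w' w'' Ap b) := by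
  obtain ⟨B, C, hC, hB⟩ := hA.exists_A0_deriv hω
  exact ⟨H.timeDeriv_uApprox, H.timeDeriv_AApprox hC (fun t => (hB t).1) fun t => (hB t).2.2,
    H.timeDeriv_remainder hC (fun t => (hB t).1) fun t => (hB t).2.1⟩

end TimeProfileBounds

/-! ### The bounds on the profile -/

section

variable {PP : Fin 3 → E3 → ℂ} {w : E3 → ℂ} {w' w'' : Fin 3 → E3 → ℂ}

theorem MemH.exists_partials {w : E3 → ℂ} (h : MemH 2 w) : ∃ w' w'' : Fin 3 → E3 → ℂ,
    (∀ i, HasWeakPartial i w (w' i)) ∧ ∀ i, HasWeakPartial i (w' i) (w'' i) := by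
  choose w' h1 h1' using h.2
  choose w'' h2 _ using fun i => (h1' i).2 i
  exact ⟨w', w'', h1, h2⟩

theorem profileBounds_of_memH {m : ℕ} (hm : m ≤ 1) (hP : PhaseBounds m (tildeA1 w) PP)
    (hb : BddDerivs m w) (hw : MemH (m + 2) w) (h1 : ∀ i, HasWeakPartial i w (w' i))
    (h2 : ∀ i, HasWeakPartial i (w' i) (w'' i)) : ProfileBounds m PP w w' w'' where
  phase := hP
  bdd := hb
  hasWeakPartial := h1
  hasWeakPartial' := h2
  memLp := hw.memLp
  memLp' i := (hw.partial_mem (h1 i)).memLp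
  memH_lapAmp := memHW_lapAmp (s := 0) hP.grad (fun j => (hP.memH j).mono hm) hb
    (hw.mono (by omega)) (fun i => (hw.partial_mem (h1 i)).of_succ)
    fun i => (hw.partial_mem (h1 i)).partial_mem (h2 i)

theorem weightedProfileBounds_of_memHW (hP : PhaseBounds 1 (tildeA1 w) PP) (hb : BddDerivs 1 w)
    (hbw : BddDerivsW 1 0 w) (hw : MemH 3 w) (hw2 : MemHW 1 2 w)
    (h1 : ∀ i, HasWeakPartial i w (w' i)) (h2 : ∀ i, HasWeakPartial i (w' i) (w'' i)) :
    WeightedProfileBounds PP w w' w'' where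
  toProfileBounds := profileBounds_of_memH le_rfl hP hb hw h1 h2
  memLp_top_coordMul i := (hbw.2 i).bddDerivs.memLp_top
  memLp_two_coordMul i := (hw2.2 i).memH.memLp
  memLp_coordMul_lapAmp i k := ((memHW_lapAmp (s := 1) (m := 0) (fun j => (hP.grad j).of_succ)
    (fun j => (hP.memH j).memLp) hbw hw2.of_succ_right.of_succ_right
    (fun i => (hw2.partial_mem (h1 i)).of_succ_right)
    (fun i => (hw2.partial_mem (h1 i)).partial_mem (h2 i)) k).2 i).memH.memLp

theorem timeProfileBounds_of_memHW (hP : PhaseBounds 1 (tildeA1 w) PP) (hb1 : BddDerivsW 1 1 w)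
    (hb2 : BddDerivsW 2 0 w) (hw1 : MemHW 1 3 w) (hw2 : MemHW 2 2 w)
    (h1 : ∀ i, HasWeakPartial i w (w' i)) (h2 : ∀ i, HasWeakPartial i (w' i) (w'' i)) :
    TimeProfileBounds PP w w' w'' where
  toWeightedProfileBounds := weightedProfileBounds_of_memHW hP hb1.bddDerivs hb2.1 hw1.memH hw2.1
    h1 h2
  memLp_two_coordMul_coordMul i := ((hw2.2 i).2 i).memH.memLp
  memLp_top_coordMul_coordMul i := ((hb2.2 i).2 i).bddDerivs.memLp_top
  memLp_two_coordMul' i := ((hw1.partial_mem (h1 i)).2 i).memH.memLp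
  bddDerivs_coordMul i := (hb1.2 i).bddDerivs
  memHW_one_lapAmp := memHW_lapAmp hP.grad hP.memH hb1 hw1.of_succ_right.of_succ_right
    (fun i => (hw1.partial_mem (h1 i)).of_succ_right)
    fun i => (hw1.partial_mem (h1 i)).partial_mem (h2 i)
  memHW_two_lapAmp := memHW_lapAmp (fun j => (hP.grad j).of_succ) (fun j => (hP.memH j).memLp) hb2
    hw2.of_succ_right.of_succ_right (fun i => (hw2.partial_mem (h1 i)).of_succ_right)
    fun i => (hw2.partial_mem (h1 i)).partial_mem (h2 i)

end

/-! ### Independence of the representative of `F u` -/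

theorem sinOverOmega_congr {g g' : E3 → ℝ} (h : g =ᵐ[volume] g') (s : ℝ) :
    sinOverOmega s g = sinOverOmega s g' := by
  have e : 𝓕 (fun y : E3 => (g y : ℂ)) = 𝓕 fun y : E3 => (g' y : ℂ) := by
    ext ξ
    simp only [Real.fourier_eq]
    exact integral_congr_ae (h.mono fun x hx => by simp only [hx])
  ext x
  simp only [sinOverOmega, e]

section

variable {v w : E3 → ℂ}

theorem tildeA1_congr (h : v =ᵐ[volume] w) : tildeA1 v = tildeA1 w := by
  ext x
  rw [tildeA1, tildeA1]
  congr 1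
  refine setIntegral_congr_fun measurableSet_Ioi fun ν hν => ?_
  have hν0 : (0 : ℝ) < ν := zero_lt_one.trans hν
  have e : dilation ν (fun y => ‖v y‖ ^ 2) =ᵐ[volume] dilation ν fun y => ‖w y‖ ^ 2 :=
    (ae_comp_smul h (inv_pos.mpr hν0).ne').mono fun x hx => by simp only [dilation, hx]
  simp only [sinOverOmega_congr e]

theorem uApprox_congr (h : v =ᵐ[volume] w) {t : ℝ} (ht : 0 < t) :
    uApprox v t =ᵐ[volume] uApprox w t :=
  (ae_comp_smul h (inv_pos.mpr ht).ne').mono fun x hx => by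
    simp only [uApprox_eq_ansatz, ansatz_eq_carrier_mul, dilation, hx, tildeA1_congr h]

theorem AApprox_congr (h : v =ᵐ[volume] w) (Ap b : L2C) {t : ℝ} (ht : 0 < t) :
    AApprox v Ap b t = AApprox w Ap b t := by
  ext x
  rw [AApprox, AApprox, A1_eq v ht, A1_eq w ht, tildeA1_congr h]

end

section

variable {u u' A A' R : ℝ → E3 → ℂ}

theorem IsRemainder.congr (h : IsRemainder u A R) (hu : ∀ t, 0 < t → u t =ᵐ[volume] u' t)
    (hA : ∀ t, 0 < t → A t = A' t) : IsRemainder u' A' R := by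
  intro t ht
  obtain ⟨h1, h2, h3, h4⟩ := h t ht
  have e : (fun x => A t x * u t x) =ᵐ[volume] fun x => A' t x * u' t x :=
    (hu t ht).mono fun x hx => by simp only [hx, hA t ht]
  refine ⟨(locallyIntegrable_congr (hu t ht)).mp h1, (locallyIntegrable_congr e).mp h2, h3,
    fun ψ hψ => ?_⟩
  obtain ⟨d, hd, hd'⟩ := h4 ψ hψ
  refine ⟨d, hd.congr_of_eventuallyEq ?_, hd'.trans ?_⟩
  · filter_upwards [lt_mem_nhds ht] with s hs
    exact integral_congr_ae ((hu s hs).mono fun x hx => by simp only [hx])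
  · have e1 : ∫ x, ((Δ ψ x : ℝ) : ℂ) * u t x = ∫ x, ((Δ ψ x : ℝ) : ℂ) * u' t x :=
      integral_congr_ae ((hu t ht).mono fun x hx => by simp only [hx])
    have e2 : ∫ x, (ψ x : ℂ) * (A t x * u t x) = ∫ x, (ψ x : ℂ) * (A' t x * u' t x) :=
      integral_congr_ae (e.mono fun x hx => by
        beta_reduce at hx
        simp only [hx])
    rw [e1, e2]

theorem BasicEstimates.congr {w w' : E3 → ℂ} (h : BasicEstimates w u A R) (hw : w =ᵐ[volume] w')
    (hu : ∀ t, 0 < t → u t =ᵐ[volume] u' t) (hA : ∀ t, 0 < t → A t = A' t) :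
    BasicEstimates w' u' A' R := by
  obtain ⟨h1, ⟨a, ha⟩, h3⟩ := h
  refine ⟨fun r hr => ⟨(h1 r hr).1.ae_eq hw, fun t ht => ?_⟩, ⟨a, fun t ht => ?_⟩, h3⟩
  · rw [← eLpNorm_congr_ae (hu t (by linarith)), ← eLpNorm_congr_ae hw]
    exact (h1 r hr).2 t ht
  · rw [← hA t (by linarith)]
    exact ha t ht

theorem HasWeakGradient.congr {f f' : E3 → ℂ} {G : E3 → EuclideanSpace ℂ (Fin 3)}
    (h : HasWeakGradient f G) (hf : f =ᵐ[volume] f') : HasWeakGradient f' G := by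
  refine ⟨(locallyIntegrable_congr hf).mp h.1, h.2.1, fun ψ hψ i => ?_⟩
  rw [← h.2.2 ψ hψ i]
  exact integral_congr_ae (hf.mono fun x hx => by simp only [hx])

theorem GradientEstimates.congr (h : GradientEstimates u A R)
    (hu : ∀ t, 0 < t → u t =ᵐ[volume] u' t) (hA : ∀ t, 0 < t → A t = A' t) :
    GradientEstimates u' A' R := by
  obtain ⟨⟨c, hc⟩, ⟨a, ha⟩, h3⟩ := h
  refine ⟨⟨c, fun t ht => ?_⟩, ⟨a, fun t ht => ?_⟩, h3⟩
  · obtain ⟨G, hG, hG'⟩ := hc t ht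
    exact ⟨G, hG.congr (hu t (by linarith)), hG'⟩
  · rw [← hA t (by linarith)]
    exact ha t ht

theorem TimeDerivEstimates.congr (h : TimeDerivEstimates u A R)
    (hu : ∀ t, 0 < t → u t =ᵐ[volume] u' t) (hA : ∀ t, 0 < t → A t = A' t) :
    TimeDerivEstimates u' A' R := by
  obtain ⟨⟨c, hc⟩, ⟨a, ha⟩, h3⟩ := h
  refine ⟨⟨c, fun t ht => ?_⟩, ⟨a, fun t ht => ?_⟩, h3⟩
  · obtain ⟨g, hg, hg'⟩ := hc t ht
    refine ⟨g, hg.congr ?_ (ae_eq_refl _), hg'⟩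
    filter_upwards [lt_mem_nhds (by linarith : 0 < t)] with s hs using hu s hs
  · obtain ⟨g, hg, hg'⟩ := ha t ht
    refine ⟨g, hg.congr ?_ (ae_eq_refl _), hg'⟩
    filter_upwards [lt_mem_nhds (by linarith : 0 < t)] with s hs
    rw [hA s hs]

end

end

theorem proposition3p1 (uPlus APlus : L2C) (AdotPlus : 𝓢'(E3, ℂ))
    (omegaInvAdot : L2C) (hω : IsOmegaInv AdotPlus omegaInvAdot) :
    (MemWeightedSobolev 0 2 (uPlus : 𝓢'(E3, ℂ)) →
      WaveDataCondition 0 APlus AdotPlus omegaInvAdot →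
      ∃ R₁ : ℝ → E3 → ℂ,
        IsRemainder (uApprox (unitaryFourier uPlus))
          (AApprox (unitaryFourier uPlus) APlus omegaInvAdot) R₁ ∧
        BasicEstimates (unitaryFourier uPlus) (uApprox (unitaryFourier uPlus))
          (AApprox (unitaryFourier uPlus) APlus omegaInvAdot) R₁) ∧
    (MemWeightedSobolev 0 3 (uPlus : 𝓢'(E3, ℂ)) → MemWeightedSobolev 1 2 (uPlus : 𝓢'(E3, ℂ)) →
      WaveDataCondition 1 APlus AdotPlus omegaInvAdot →
      ∃ R₁ : ℝ → E3 → ℂ,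
        IsRemainder (uApprox (unitaryFourier uPlus))
          (AApprox (unitaryFourier uPlus) APlus omegaInvAdot) R₁ ∧
        BasicEstimates (unitaryFourier uPlus) (uApprox (unitaryFourier uPlus))
          (AApprox (unitaryFourier uPlus) APlus omegaInvAdot) R₁ ∧
        GradientEstimates (uApprox (unitaryFourier uPlus))
          (AApprox (unitaryFourier uPlus) APlus omegaInvAdot) R₁) ∧
    (MemWeightedSobolev 1 3 (uPlus : 𝓢'(E3, ℂ)) → MemWeightedSobolev 2 2 (uPlus : 𝓢'(E3, ℂ)) →
      WaveDataCondition 1 APlus AdotPlus omegaInvAdot →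
      ∃ R₁ : ℝ → E3 → ℂ,
        IsRemainder (uApprox (unitaryFourier uPlus))
          (AApprox (unitaryFourier uPlus) APlus omegaInvAdot) R₁ ∧
        BasicEstimates (unitaryFourier uPlus) (uApprox (unitaryFourier uPlus))
          (AApprox (unitaryFourier uPlus) APlus omegaInvAdot) R₁ ∧
        GradientEstimates (uApprox (unitaryFourier uPlus))
          (AApprox (unitaryFourier uPlus) APlus omegaInvAdot) R₁ ∧
        TimeDerivEstimates (uApprox (unitaryFourier uPlus))
          (AApprox (unitaryFourier uPlus) APlus omegaInvAdot) R₁) := by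
  have hu : ∀ {w : E3 → ℂ}, unitaryFourier uPlus =ᵐ[volume] w → ∀ t, 0 < t →
      uApprox w t =ᵐ[volume] uApprox (unitaryFourier uPlus) t :=
    fun h t ht => uApprox_congr h.symm ht
  have hA : ∀ {w : E3 → ℂ}, unitaryFourier uPlus =ᵐ[volume] w → ∀ t, 0 < t →
      AApprox w APlus omegaInvAdot t = AApprox (unitaryFourier uPlus) APlus omegaInvAdot t :=
    fun h t ht => AApprox_congr h.symm _ _ ht
  refine ⟨fun h1 hW => ?_, fun h1 h2 hW => ?_, fun h1 h2 hW => ?_⟩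
  · obtain ⟨w, hw, hS, hb, hH⟩ := h1.exists_profile
    obtain ⟨PP, hP⟩ := hS.phaseBounds (m := 0) (by norm_num) le_rfl
    obtain ⟨w', w'', d1, d2⟩ := hH.exists_partials
    obtain ⟨C, hC, hC'⟩ := hW.exists_A0_bound hω
    have H := profileBounds_of_memH (by norm_num) hP hb hH d1 d2
    exact ⟨_, (H.isRemainder APlus omegaInvAdot).congr (hu hw) (hA hw),
      (H.basicEstimates hC hC').congr hw.symm (hu hw) (hA hw)⟩
  · obtain ⟨w, hw, hS, hb, hbw, hH, hHW⟩ := h1.exists_gradient_profile h2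
    obtain ⟨PP, hP⟩ := hS.phaseBounds (m := 1) le_rfl le_rfl
    obtain ⟨w', w'', d1, d2⟩ := hH.of_succ.exists_partials
    obtain ⟨C, hC, hC'⟩ := hW.exists_A0_bound hω
    have H := weightedProfileBounds_of_memHW hP hb hbw hH hHW d1 d2
    exact ⟨_, (H.isRemainder APlus omegaInvAdot).congr (hu hw) (hA hw),
      (H.basicEstimates hC hC').congr hw.symm (hu hw) (hA hw),
      (H.gradientEstimates hW hω).congr (hu hw) (hA hw)⟩
  · obtain ⟨w, hw, hS, hb1, hb2, hH1, hH2⟩ := h1.exists_timeDeriv_profile h2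
    obtain ⟨PP, hP⟩ := hS.phaseBounds (m := 1) le_rfl le_rfl
    obtain ⟨w', w'', d1, d2⟩ := hH2.memH.exists_partials
    obtain ⟨C, hC, hC'⟩ := hW.exists_A0_bound hω
    have H := timeProfileBounds_of_memHW hP hb1 hb2 hH1 hH2 d1 d2
    exact ⟨_, (H.isRemainder APlus omegaInvAdot).congr (hu hw) (hA hw),
      (H.basicEstimates hC hC').congr hw.symm (hu hw) (hA hw),
      (H.gradientEstimates hW hω).congr (hu hw) (hA hw),
      (H.timeDerivEstimates hW hω).congr (hu hw) (hA hw)⟩
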